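/- **Setting.** Let $n\in\{1,2,3\}$, $p\in(n,\infty)$, $T>0$, and let $\Omega\subseteq\mathbb R^n$ be a bounded Lipschitz domain with outer unit normal $\nu$. Let $\Gamma_D,\Gamma_N\subseteq\partial\Omega$ be non-empty, disjoint, relatively open in $\partial\Omega$, with finitely many path-connected components, with $\overline{\Gamma_D}\cup\overline{\Gamma_N}=\partial\Omega$, and such that the interface $\partial\Omega\setminus(\Gamma_D\cup\Gamma_N)$ has surface measure zero. Let $f\in C^1([0,1];[0,\infty))$, let $h\in C^1([0,1];\mathbb R)$ with $h\ge\eta$ for a constant $\eta>0$ and $h'\ge 0$, and let $\mathbf C$ be a constant fourth-order tensor with $\mathbf C_{ijlk}=\mathbf C_{jilk}=\mathbf C_{lkij}$ and $e:\mathbf C e\ge c_0|e|^2$ for all symmetric $e\in\mathbb R^{n\times n}$ and a constant $c_0>0$. Put $W(e,z)=\frac12h(z)\,\mathbf Ce:e$, so that $W_{,e}(e,z)=h(z)\mathbf Ce$ and $W_{,z}(e,z)=\frac12h'(z)\,\mathbf Ce:e$; $\varepsilon(u)=\frac12(\nabla u+(\nabla u)^{\mathrm T})$; $\Delta_pz=\mathrm{div}(|\nabla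 z|^{p-2}\nabla z)$. Let $\partial I_{[0,\infty)}(z)$ be $\{0\}$ if $z>0$, $(-\infty,0]$ if $z=0$, $\emptyset$ if $z<0$, and let $\partial I_{(-\infty,0]}(y)$ be $\{0\}$ if $y<0$, $[0,\infty)$ if $y=0$, $\emptyset$ if $y>0$. Boundary values are taken in the sense of traces, and $H^1_{\Gamma_D}(\Omega;\mathbb R^n)$ is the space of $\zeta\in H^1(\Omega;\mathbb R^n)$ with $\zeta=0$ on $\Gamma_D$. Values at single times are those of the representatives that are continuous in time. **Statement.** Let data $u^0\in H^1(\Omega;\mathbb R^n)$, $v^0\in L^2(\Omega;\mathbb R^n)$, $z^0\in W^{1,p}(\Omega)$ with $0\le z^0\le1$ a.e. in $\Omega$, $\ell\in L^2(0,T;L^2(\Omega;\mathbb R^n))$, $b\in H^1(0,T;H^1(\Omega;\mathbb R^n))\cap H^2(0,T;L^2(\Omega;\mathbb R^n))$ and functions $$u\in L^2(0,T;H^2(\Omega;\mathbb R^n))\cap H^1(0,T;H^1(\Omega;\mathbb R^n))\cap H^2(0,T;L^2(\Omega;\mathbb R^n)),$$ $$z\in L^p(0,T;W^{2,p}(\Omega))\cap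 W^{1,p}(0,T;W^{1,p}(\Omega)),\qquad \xi,\varphi\in L^2(0,T;L^2(\Omega))$$ be given. Then the following are equivalent. (i) $(u,z,\xi,\varphi)$ satisfies a.e. in $\Omega\times(0,T)$ $$\partial_{tt}u-\mathrm{div}\,W_{,e}(\varepsilon(u),z)=\ell,\qquad \partial_tz-\Delta_pz+W_{,z}(\varepsilon(u),z)+f'(z)+\xi+\varphi=0,$$ $$\xi\in\partial I_{[0,\infty)}(z),\qquad \varphi\in\partial I_{(-\infty,0]}(\partial_tz)$$ (the divergences being weak divergences in $\Omega$ that are functions), together with $u=b$ on $\Gamma_D\times(0,T)$, $W_{,e}(\varepsilon(u),z)\cdot\nu=0$ on $\Gamma_N\times(0,T)$, $\nabla z\cdot\nu=0$ on $\partial\Omega\times(0,T)$, and $u(0)=u^0$, $\partial_tu(0)=v^0$, $z(0)=z^0$ in $\Omega$. (ii) $(u,z,\xi,\varphi)$ satisfies all of the following: - $u(0)=u^0$, $\partial_tu(0)=v^0$, $z(0)=z^0$, and $u=b$ on $\Gamma_D\times(0,T)$; - for all $\zeta\in H^1_{\Gamma_D}(\Omega;\mathbb R^n)$ and a.e. $t\in(0,T)$: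 $\int_\Omega\partial_{tt}u\cdot\zeta\,dx+\int_\Omega W_{,e}(\varepsilon(u),z):\varepsilon(\zeta)\,dx=\int_\Omega\ell\cdot\zeta\,dx$; - for all $\zeta\in W^{1,p}(\Omega)$ and a.e. $t\in(0,T)$: $0=\int_\Omega\big((\partial_tz)\zeta+|\nabla z|^{p-2}\nabla z\cdot\nabla\zeta+W_{,z}(\varepsilon(u),z)\zeta+f'(z)\zeta\big)dx+\int_\Omega\xi\zeta\,dx+\int_\Omega\varphi\zeta\,dx$; - for all $\zeta\in W^{1,p}(\Omega)$ with $\zeta\le0$ a.e. and a.e. $t\in(0,T)$: $\int_\Omega\varphi(t)\zeta\,dx\le0$; and $\partial_tz\le0$ a.e. in $\Omega\times(0,T)$; - for all $\zeta\in W^{1,p}(\Omega)$ with $\zeta\ge0$ a.e. and a.e. $t\in(0,T)$: $\int_\Omega\xi(t)(\zeta-z(t))\,dx\le0$; and $z\ge0$ a.e. in $\Omega\times(0,T)$; - for a.e. $t\in(0,T)$, $\mathcal D(0,t)<\infty$ and $\mathcal F(t)+\mathcal K(t)+\mathcal D(0,t)=\mathcal F(0)+\mathcal K(0)+\mathcal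 W_{ext}(0,t)$, where $$\mathcal F(t)=\int_\Omega\Big(\tfrac1p|\nabla z(t)|^p+W(\varepsilon(u(t)),z(t))+f(z(t))\Big)dx,\quad \mathcal K(t)=\int_\Omega\tfrac12|\partial_tu(t)|^2dx,\quad \mathcal D(0,t)=\int_0^t\!\!\int_\Omega|\partial_tz|^2\,dx\,ds,$$ $$\mathcal W_{ext}(0,t)=\int_0^t\!\!\int_\Omega W_{,e}(\varepsilon(u),z):\varepsilon(\partial_tb)\,dx\,ds-\int_0^t\!\!\int_\Omega\partial_tu\cdot\partial_{tt}b\,dx\,ds+\int_\Omega\partial_tu(t)\cdot\partial_tb(t)\,dx-\int_\Omega\partial_tu(0)\cdot\partial_tb(0)\,dx+\int_0^t\!\!\int_\Omega\ell\cdot\partial_t(u-b)\,dx\,ds.$$ -/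

import Mathlib

open MeasureTheory Set Filter Topology
open scoped ContDiff NNReal ENNReal

noncomputable section

namespace Damage

/-- The Euclidean space of dimension `n`. -/
abbrev E (n : ℕ) : Type := EuclideanSpace ℝ (Fin n)

variable {n : ℕ}

/-! ### Domains, boundary parts, normals -/

/-- `Ω` is a bounded Lipschitz domain: open, connected (and nonempty), bounded, and near each boundary
point it is the strict epigraph, in some direction `e`, of a Lipschitz function of the component
orthogonal to `e`. -/
structure IsLipschitzDomain (Ω : Set (E n)) : Prop where
  isOpen : IsOpen Ω
  isConnected : IsConnected Ω
  isBounded : Bornology.IsBounded Ω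
  graph : ∀ x ∈ frontier Ω, ∃ (e : E n) (γ : E n → ℝ) (K : ℝ≥0) (r : ℝ),
    ‖e‖ = 1 ∧ LipschitzWith K γ ∧ 0 < r ∧
      ∀ y ∈ Metric.ball x r, (y ∈ Ω ↔ γ (y - inner ℝ e y • e) < inner ℝ e y)

/-- Surface measure (Hausdorff measure of dimension `n - 1`, up to a positive constant factor)
restricted to a set `Γ`. -/
def surf (Γ : Set (E n)) : Measure (E n) := (Measure.hausdorffMeasure ((n : ℝ) - 1)).restrict Γ

/-- Dirichlet part and Neumann part of the boundary. -/
structure IsBoundarySplit (Ω ΓD ΓN : Set (E n)) : Prop where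
  nonempty_D : ΓD.Nonempty
  nonempty_N : ΓN.Nonempty
  relOpen_D : ∃ U : Set (E n), IsOpen U ∧ ΓD = U ∩ frontier Ω
  relOpen_N : ∃ U : Set (E n), IsOpen U ∧ ΓN = U ∩ frontier Ω
  components_D : Finite (ZerothHomotopy ΓD)
  components_N : Finite (ZerothHomotopy ΓN)
  disjoint : Disjoint ΓD ΓN
  cover : closure ΓD ∪ closure ΓN = frontier Ω
  interface_null : surf (frontier Ω \ (ΓD ∪ ΓN)) univ = 0

/-- `ν` is the outer unit normal to `Ω` at `x`: seen from `x`, the set `Ω` is asymptotically the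
half space `{y | ⟪y - x, ν⟫ < 0}`.  Such a `ν` is unique, and it is
`(∇γ, -1) / √(1 + |∇γ|²)` at a point where the boundary is the graph of a differentiable `γ` with
`Ω` above it. -/
def IsOuterNormal (Ω : Set (E n)) (x ν : E n) : Prop :=
  ‖ν‖ = 1 ∧ ∀ ε > (0 : ℝ), ∀ᶠ y in 𝓝 x,
    (inner ℝ (y - x) ν < -(ε * ‖y - x‖) → y ∈ Ω) ∧ (ε * ‖y - x‖ < inner ℝ (y - x) ν → y ∉ Ω)

/-! ### Weak derivatives and Sobolev functions on `Ω` -/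

/-- Test functions: smooth with compact support in `U`. -/
def IsTest {V : Type*} [NormedAddCommGroup V] [NormedSpace ℝ V] (U : Set V) (φ : V → ℝ) : Prop :=
  ContDiff ℝ ∞ φ ∧ HasCompactSupport φ ∧ tsupport φ ⊆ U

variable {F : Type*} [NormedAddCommGroup F] [NormedSpace ℝ F]

/-- `g` is the weak partial derivative `∂_i w` in `Ω`. -/
def IsWeakPartial (Ω : Set (E n)) (i : Fin n) (w g : E n → F) : Prop :=
  LocallyIntegrableOn w Ω ∧ LocallyIntegrableOn g Ω ∧
    ∀ φ : E n → ℝ, IsTest Ω φ →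
      ∫ x in Ω, fderiv ℝ φ x (EuclideanSpace.single i 1) • w x = -∫ x in Ω, φ x • g x

/-- `d` is the weak divergence of the vector field `V` in `Ω`. -/
def IsWeakDiv (Ω : Set (E n)) (V : E n → E n) (d : E n → ℝ) : Prop :=
  LocallyIntegrableOn V Ω ∧ LocallyIntegrableOn d Ω ∧
    ∀ φ : E n → ℝ, IsTest Ω φ → ∫ x in Ω, fderiv ℝ φ x (V x) = -∫ x in Ω, φ x * d x

/-- `w ∈ W^{1,q}(Ω)` with weak partial derivatives `D i = ∂_i w`. -/
def IsSobolev (Ω : Set (E n)) (q : ℝ≥0∞) (w : E n → F) (D : Fin n → E n → F) : Prop :=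
  MemLp w q (volume.restrict Ω) ∧
    ∀ i, MemLp (D i) q (volume.restrict Ω) ∧ IsWeakPartial Ω i w (D i)

/-- `w ∈ W^{1,q}(Ω)`. -/
def MemW1 (Ω : Set (E n)) (q : ℝ≥0∞) (w : E n → F) : Prop :=
  ∃ D : Fin n → E n → F, IsSobolev Ω q w D

/-- `g ∈ L^q(∂Ω)` is the trace of `w ∈ W^{1,q}(Ω)`: functions that are smooth up to the boundary
approximate `w` in `W^{1,q}(Ω)` and their boundary values approximate `g` in `L^q(∂Ω)`. -/
def HasTrace (Ω : Set (E n)) (q : ℝ≥0∞) (w g : E n → F) : Prop :=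
  MemLp g q (surf (frontier Ω)) ∧
  ∃ D : Fin n → E n → F, IsSobolev Ω q w D ∧
  ∃ s : ℕ → E n → F, (∀ k, ContDiff ℝ ∞ (s k)) ∧
    Tendsto (fun k => eLpNorm (fun x => s k x - w x) q (volume.restrict Ω)) atTop (𝓝 0) ∧
    (∀ i, Tendsto (fun k => eLpNorm
        (fun x => fderiv ℝ (s k) x (EuclideanSpace.single i 1) - D i x) q (volume.restrict Ω))
      atTop (𝓝 0)) ∧
    Tendsto (fun k => eLpNorm (fun x => s k x - g x) q (surf (frontier Ω))) atTop (𝓝 0)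

/-- `w ∈ H¹(Ω)` vanishes on `Γ ⊆ ∂Ω` in the sense of traces. -/
def VanishesOn (Ω Γ : Set (E n)) (w : E n → F) : Prop :=
  ∃ g : E n → F, HasTrace Ω 2 w g ∧ ∀ᵐ x ∂(surf Γ), g x = 0

/-! ### Time-dependent functions -/

/-- The product of the Lebesgue measures on `(0,t)` and on `Ω`. -/
def cyl (Ω : Set (E n)) (t : ℝ) : Measure (ℝ × E n) :=
  (volume.restrict (Ioo 0 t)).prod (volume.restrict Ω)

/-- `w ∈ L^q(0,T;L^q(Ω))`, as a space-time function. -/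
def MemLpT (Ω : Set (E n)) (T : ℝ) (q : ℝ≥0∞) (w : ℝ → E n → F) : Prop :=
  MemLp (fun y : ℝ × E n => w y.1 y.2) q (cyl Ω T)

/-- `wt` is the weak derivative of `w` in time on `(0,T)`: `∫ φ' w dt = - ∫ φ wt dt`, as functions
on `Ω`, for all test functions `φ` on `(0,T)`. -/
def IsTimeDeriv (Ω : Set (E n)) (T : ℝ) (w wt : ℝ → E n → F) : Prop :=
  ∀ φ : ℝ → ℝ, IsTest (Ioo 0 T) φ → ∀ᵐ x ∂(volume.restrict Ω),
    ∫ t in Ioo 0 T, deriv φ t • w t x = -∫ t in Ioo 0 T, φ t • wt t x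

/-- `w ∈ C([0,T];L^q(Ω))`. -/
def ContinuousInLp (Ω : Set (E n)) (T : ℝ) (q : ℝ≥0∞) (w : ℝ → E n → F) : Prop :=
  ∀ t ∈ Icc 0 T, MemLp (w t) q (volume.restrict Ω) ∧
    Tendsto (fun s => eLpNorm (fun x => w s x - w t x) q (volume.restrict Ω))
      (𝓝[Icc 0 T] t) (𝓝 0)

/-- An element of `W^{1,q}(0,T;W^{1,q}(Ω))`, `q < ∞`, together with its weak derivatives:
`dx i = ∂_i`, `dt = ∂_t`, `dtdx i = ∂_i ∂_t`.  The element is given by its representative that is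
continuous in time, so that its values at single times, such as `t = 0`, have a meaning. -/
structure Curve (Ω : Set (E n)) (T : ℝ) (q : ℝ≥0∞) (F : Type*)
    [NormedAddCommGroup F] [NormedSpace ℝ F] where
  val : ℝ → E n → F
  dx : Fin n → ℝ → E n → F
  dt : ℝ → E n → F
  dtdx : Fin n → ℝ → E n → F
  continuous_val : ContinuousInLp Ω T q val
  sobolev_val : ∀ t ∈ Icc 0 T, IsSobolev Ω q (val t) (fun i => dx i t)
  memLp_val : MemLpT Ω T q val
  memLp_dx : ∀ i, MemLpT Ω T q (dx i)
  memLp_dt : MemLpT Ω T q dt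
  memLp_dtdx : ∀ i, MemLpT Ω T q (dtdx i)
  timeDeriv_val : IsTimeDeriv Ω T val dt
  sobolev_dt : ∀ᵐ t ∂(volume.restrict (Ioo 0 T)), IsSobolev Ω q (dt t) (fun i => dtdx i t)

/-- `dxx i j = ∂_j ∂_i w` are second weak derivatives in `L^q(0,T;L^q(Ω))`; with a `Curve` as `w`,
this says `w ∈ L^q(0,T;W^{2,q}(Ω))`. -/
def IsSecondSpace (Ω : Set (E n)) (T : ℝ) (q : ℝ≥0∞) (dx : Fin n → ℝ → E n → F)
    (dxx : Fin n → Fin n → ℝ → E n → F) : Prop :=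
  (∀ i j, MemLpT Ω T q (dxx i j)) ∧
    ∀ᵐ t ∂(volume.restrict (Ioo 0 T)), ∀ i j, IsWeakPartial Ω j (dx i t) (dxx i j t)

/-- `dtt` is the time derivative of `dt`, both are in `L^q(0,T;L^q(Ω))`, and `dt` is the
representative that is continuous in time; with a `Curve` as `w`, this says
`w ∈ W^{2,q}(0,T;L^q(Ω))`. -/
def IsSecondTime (Ω : Set (E n)) (T : ℝ) (q : ℝ≥0∞) (dt dtt : ℝ → E n → F) : Prop :=
  ContinuousInLp Ω T q dt ∧ MemLpT Ω T q dtt ∧ IsTimeDeriv Ω T dt dtt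

/-- Elements of `H¹(0,T;H¹(Ω;ℝⁿ)) ∩ H²(0,T;L²(Ω;ℝⁿ))` (Dirichlet data). -/
structure DirichletDatum (Ω : Set (E n)) (T : ℝ) extends Curve Ω T 2 (E n) where
  dtt : ℝ → E n → E n
  second_time : IsSecondTime Ω T 2 dt dtt

/-- Elements of `L²(0,T;H²(Ω;ℝⁿ)) ∩ H¹(0,T;H¹(Ω;ℝⁿ)) ∩ H²(0,T;L²(Ω;ℝⁿ))` (displacements). -/
structure Displacement (Ω : Set (E n)) (T : ℝ) extends Curve Ω T 2 (E n) where
  dxx : Fin n → Fin n → ℝ → E n → E n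
  dtt : ℝ → E n → E n
  second_space : IsSecondSpace Ω T 2 dx dxx
  second_time : IsSecondTime Ω T 2 dt dtt

/-- Elements of `L^p(0,T;W^{2,p}(Ω)) ∩ W^{1,p}(0,T;W^{1,p}(Ω))` (damage variables). -/
structure DamageVar (Ω : Set (E n)) (T p : ℝ) extends Curve Ω T (ENNReal.ofReal p) ℝ where
  dxx : Fin n → Fin n → ℝ → E n → ℝ
  second_space : IsSecondSpace Ω T (ENNReal.ofReal p) dx dxx

/-! ### The elastic energy density -/

/-- Fourth-order tensors. -/
abbrev Tensor4 (n : ℕ) : Type := Fin n → Fin n → Fin n → Fin n → ℝ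

/-- `a : b = ∑ a_ij b_ij`. -/
def ddot (a b : Matrix (Fin n) (Fin n) ℝ) : ℝ := ∑ i, ∑ j, a i j * b i j

/-- `(C e)_ij = ∑ C_ijlk e_lk`. -/
def Tensor4.app (C : Tensor4 n) (e : Matrix (Fin n) (Fin n) ℝ) : Matrix (Fin n) (Fin n) ℝ :=
  Matrix.of fun i j => ∑ l, ∑ k, C i j l k * e l k

/-- Symmetry and coercivity (with some constant) of the stiffness tensor. -/
structure IsStiffness (C : Tensor4 n) : Prop where
  minor_symm : ∀ i j l k, C i j l k = C j i l k
  major_symm : ∀ i j l k, C i j l k = C l k i j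
  coercive : ∃ c₀ > (0 : ℝ), ∀ e : Matrix (Fin n) (Fin n) ℝ, e.IsSymm →
    c₀ * ddot e e ≤ ddot e (C.app e)

/-- `W(e,z) = ½ h(z) C e : e`. -/
def energyDensity (C : Tensor4 n) (h : ℝ → ℝ) (e : Matrix (Fin n) (Fin n) ℝ) (z : ℝ) : ℝ :=
  1 / 2 * h z * ddot (C.app e) e

/-- The partial derivative `W_{,e}(e,z) = h(z) C e` (by the major symmetry of `C`). -/
def energyDensity_e (C : Tensor4 n) (h : ℝ → ℝ) (e : Matrix (Fin n) (Fin n) ℝ) (z : ℝ) :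
    Matrix (Fin n) (Fin n) ℝ := h z • C.app e

/-- The partial derivative `W_{,z}` of `W` for `z` in `[0,1]`. -/
def energyDensity_z (C : Tensor4 n) (h : ℝ → ℝ) (e : Matrix (Fin n) (Fin n) ℝ) (z : ℝ) : ℝ :=
  1 / 2 * derivWithin h (Icc 0 1) z * ddot (C.app e) e

/-- The symmetrized gradient, where `D j` is the `j`-th partial derivative of a vector field. -/
def strain (D : Fin n → E n) : Matrix (Fin n) (Fin n) ℝ :=
  Matrix.of fun i j => (D j i + D i j) / 2

/-- The gradient vector with components `D j`. -/
def gradVec (D : Fin n → ℝ) : E n := WithLp.toLp 2 D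

/-- `|a|^{p-2} a`. -/
def pFlux (p : ℝ) (a : E n) : E n := ‖a‖ ^ (p - 2) • a

/-- The subdifferential of the indicator function of `[0,∞)` at `z`. -/
def subdiffNonneg (z : ℝ) : Set ℝ := {ξ | (0 < z ∧ ξ = 0) ∨ (z = 0 ∧ ξ ≤ 0)}

/-- The subdifferential of the indicator function of `(-∞,0]` at `y`. -/
def subdiffNonpos (y : ℝ) : Set ℝ := {φ | (y < 0 ∧ φ = 0) ∨ (y = 0 ∧ 0 ≤ φ)}

/-! ### Quantities along `(u, z)` -/

variable {Ω : Set (E n)} {T p : ℝ}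

/-- The linearized strain `ε(w)` of a time-dependent vector field. -/
def Curve.eps (w : Curve Ω T 2 (E n)) (t : ℝ) (x : E n) : Matrix (Fin n) (Fin n) ℝ :=
  strain fun j => w.dx j t x

/-- The strain rate `ε(∂_t w)`. -/
def Curve.epsDt (w : Curve Ω T 2 (E n)) (t : ℝ) (x : E n) : Matrix (Fin n) (Fin n) ℝ :=
  strain fun j => w.dtdx j t x

/-- The gradient `∇z`. -/
def DamageVar.grad (z : DamageVar Ω T p) (t : ℝ) (x : E n) : E n := gradVec fun j => z.dx j t x

/-- The stress `W_{,e}(ε(u), z)`. -/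
def stress (C : Tensor4 n) (h : ℝ → ℝ) (u : Displacement Ω T) (z : DamageVar Ω T p)
    (t : ℝ) (x : E n) : Matrix (Fin n) (Fin n) ℝ :=
  energyDensity_e C h (u.eps t x) (z.val t x)

/-- The free energy `𝓕(t)`. -/
def freeEnergy (C : Tensor4 n) (h f : ℝ → ℝ) (u : Displacement Ω T) (z : DamageVar Ω T p)
    (t : ℝ) : ℝ :=
  ∫ x in Ω, (1 / p * ‖z.grad t x‖ ^ p + energyDensity C h (u.eps t x) (z.val t x)
    + f (z.val t x))

/-- The kinetic energy `𝓚(t)`. -/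
def kineticEnergy (u : Displacement Ω T) (t : ℝ) : ℝ := ∫ x in Ω, 1 / 2 * ‖u.dt t x‖ ^ 2

/-- The dissipated energy `𝓓(0,t)`. -/
def dissipated (z : DamageVar Ω T p) (t : ℝ) : ℝ := ∫ s in (0 : ℝ)..t, ∫ x in Ω, |z.dt s x| ^ 2

/-- The external work `𝓦_ext(0,t)`. -/
def externalWork (C : Tensor4 n) (h : ℝ → ℝ) (ℓ : ℝ → E n → E n) (b : DirichletDatum Ω T)
    (u : Displacement Ω T) (z : DamageVar Ω T p) (t : ℝ) : ℝ :=
  (∫ s in (0 : ℝ)..t, ∫ x in Ω, ddot (stress C h u z s x) (b.epsDt s x))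
    - (∫ s in (0 : ℝ)..t, ∫ x in Ω, inner ℝ (u.dt s x) (b.dtt s x))
    + (∫ x in Ω, inner ℝ (u.dt t x) (b.dt t x))
    - (∫ x in Ω, inner ℝ (u.dt 0 x) (b.dt 0 x))
    + ∫ s in (0 : ℝ)..t, ∫ x in Ω, inner ℝ (ℓ s x) (u.dt s x - b.dt s x)

/-! ### The two notions of solution -/

/-- Initial conditions, and the Dirichlet condition on `Γ_D × (0,T)` in the sense of traces. -/
structure InitialDirichlet (ΓD : Set (E n)) (u0 v0 : E n → E n) (z0 : E n → ℝ)
    (b : DirichletDatum Ω T) (u : Displacement Ω T) (z : DamageVar Ω T p) : Prop where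
  init_u : ∀ᵐ x ∂(volume.restrict Ω), u.val 0 x = u0 x
  init_ut : ∀ᵐ x ∂(volume.restrict Ω), u.dt 0 x = v0 x
  init_z : ∀ᵐ x ∂(volume.restrict Ω), z.val 0 x = z0 x
  dirichlet : ∀ᵐ t ∂(volume.restrict (Ioo 0 T)),
    VanishesOn Ω ΓD (fun x => u.val t x - b.val t x)

/-- `(u, z, ξ, φ)` solves the PDE system with its inclusions and its initial and boundary
conditions almost everywhere. -/
structure IsStrongSolution (ΓD ΓN : Set (E n)) (C : Tensor4 n) (h f : ℝ → ℝ)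
    (u0 v0 : E n → E n) (z0 : E n → ℝ) (ℓ : ℝ → E n → E n) (b : DirichletDatum Ω T)
    (u : Displacement Ω T) (z : DamageVar Ω T p) (ξ φ : ℝ → E n → ℝ) : Prop where
  init_dirichlet : InitialDirichlet ΓD u0 v0 z0 b u z
  /-- `u_tt - div W_{,e}(ε(u),z) = ℓ` -/
  force : ∀ᵐ t ∂(volume.restrict (Ioo 0 T)), ∃ d : E n → E n,
    (∀ i, IsWeakDiv Ω (fun x => gradVec (stress C h u z t x i)) (fun x => d x i)) ∧
    ∀ᵐ x ∂(volume.restrict Ω), u.dtt t x - d x = ℓ t x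
  /-- `z_t - Δ_p z + W_{,z}(ε(u),z) + f'(z) + ξ + φ = 0` -/
  damage : ∀ᵐ t ∂(volume.restrict (Ioo 0 T)), ∃ d : E n → ℝ,
    IsWeakDiv Ω (fun x => pFlux p (z.grad t x)) d ∧
    ∀ᵐ x ∂(volume.restrict Ω), z.dt t x - d x + energyDensity_z C h (u.eps t x) (z.val t x)
      + derivWithin f (Icc 0 1) (z.val t x) + ξ t x + φ t x = 0
  incl_ξ : ∀ᵐ y ∂(cyl Ω T), ξ y.1 y.2 ∈ subdiffNonneg (z.val y.1 y.2)
  incl_φ : ∀ᵐ y ∂(cyl Ω T), φ y.1 y.2 ∈ subdiffNonpos (z.dt y.1 y.2)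
  /-- `W_{,e}(ε(u),z) · ν = 0` on `Γ_N × (0,T)` -/
  neumann_u : ∀ᵐ t ∂(volume.restrict (Ioo 0 T)), ∃ g : Fin n → Fin n → E n → ℝ,
    (∀ i j, HasTrace Ω 2 (fun x => stress C h u z t x i j) (g i j)) ∧
    ∀ᵐ x ∂(surf ΓN), ∃ ν, IsOuterNormal Ω x ν ∧ ∀ i, ∑ j, g i j x * ν j = 0
  /-- `∇z · ν = 0` on `∂Ω × (0,T)` -/
  neumann_z : ∀ᵐ t ∂(volume.restrict (Ioo 0 T)), ∃ g : Fin n → E n → ℝ,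
    (∀ j, HasTrace Ω (ENNReal.ofReal p) (z.dx j t) (g j)) ∧
    ∀ᵐ x ∂(surf (frontier Ω)), ∃ ν, IsOuterNormal Ω x ν ∧ ∑ j, g j x * ν j = 0

/-- `(u, z, ξ, φ)` satisfies the weak formulation.  The dual pairings with `∂_tt u`, `ξ` and `φ`,
which are functions in `L²(Ω)`, are integrals over `Ω`. -/
structure IsWeakSolution (ΓD : Set (E n)) (C : Tensor4 n) (h f : ℝ → ℝ)
    (u0 v0 : E n → E n) (z0 : E n → ℝ) (ℓ : ℝ → E n → E n) (b : DirichletDatum Ω T)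
    (u : Displacement Ω T) (z : DamageVar Ω T p) (ξ φ : ℝ → E n → ℝ) : Prop where
  init_dirichlet : InitialDirichlet ΓD u0 v0 z0 b u z
  force : ∀ (ζ : E n → E n) (Dζ : Fin n → E n → E n), IsSobolev Ω 2 ζ Dζ → VanishesOn Ω ΓD ζ →
    ∀ᵐ t ∂(volume.restrict (Ioo 0 T)),
      (∫ x in Ω, inner ℝ (u.dtt t x) (ζ x))
        + (∫ x in Ω, ddot (stress C h u z t x) (strain fun j => Dζ j x))
        = ∫ x in Ω, inner ℝ (ℓ t x) (ζ x)
  damage : ∀ (ζ : E n → ℝ) (Dζ : Fin n → E n → ℝ), IsSobolev Ω (ENNReal.ofReal p) ζ Dζ →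
    ∀ᵐ t ∂(volume.restrict (Ioo 0 T)),
      0 = (∫ x in Ω, (z.dt t x * ζ x
            + inner ℝ (pFlux p (z.grad t x)) (gradVec fun j => Dζ j x)
            + energyDensity_z C h (u.eps t x) (z.val t x) * ζ x
            + derivWithin f (Icc 0 1) (z.val t x) * ζ x))
          + (∫ x in Ω, ξ t x * ζ x) + ∫ x in Ω, φ t x * ζ x
  ineq_φ : ∀ ζ : E n → ℝ, MemW1 Ω (ENNReal.ofReal p) ζ → (∀ᵐ x ∂(volume.restrict Ω), ζ x ≤ 0) →
    ∀ᵐ t ∂(volume.restrict (Ioo 0 T)), ∫ x in Ω, φ t x * ζ x ≤ 0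
  dt_nonpos : ∀ᵐ y ∂(cyl Ω T), z.dt y.1 y.2 ≤ 0
  ineq_ξ : ∀ ζ : E n → ℝ, MemW1 Ω (ENNReal.ofReal p) ζ → (∀ᵐ x ∂(volume.restrict Ω), 0 ≤ ζ x) →
    ∀ᵐ t ∂(volume.restrict (Ioo 0 T)), ∫ x in Ω, ξ t x * (ζ x - z.val t x) ≤ 0
  nonneg : ∀ᵐ y ∂(cyl Ω T), 0 ≤ z.val y.1 y.2
  /-- The energy-dissipation balance, an identity between finite quantities. -/
  balance : ∀ᵐ t ∂(volume.restrict (Ioo 0 T)),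
    Integrable (fun y : ℝ × E n => |z.dt y.1 y.2| ^ 2) (cyl Ω t) ∧
    freeEnergy C h f u z t + kineticEnergy u t + dissipated z t
      = freeEnergy C h f u z 0 + kineticEnergy u 0 + externalWork C h ℓ b u z t

end Damage

end

/-! At a fixed time, the differential equations with their Neumann conditions and the weak equations
are equivalent by Green's formula. The regularity makes this legitimate: `ε(u)` is in `H¹` and `∇z`
is in `W^{1,p}` with `p > n`, hence bounded, so the stress has traces and the flux `|∇z|^{p-2}∇z` is
continuous up to the boundary (`momentum_weak_of_strong`, `momentum_strong_of_weak`,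
`DamageRegularAt.weak_of_strong`, `DamageRegularAt.strong_of_weak`). The inclusion for `ξ` is its
variational inequality, since the latter says `ξ ≤ 0` and `ξ z = 0` (`ae_cyl_xi_nonpos`).

The inclusion for `φ` is different. The weak formulation gives only `φ ≥ 0` and `∂_t z ≤ 0`; the
missing complementarity `φ ∂_t z = 0` is encoded in the energy balance. If the momentum balance is
tested with `∂_t (u - b)` and the damage equation with `∂_t z`, the chain rule in time gives, for
both notions of solution, `𝓕(t) + 𝓚(t) + ∫∫ (|∂_t z|² + φ ∂_t z) = 𝓕(0) + 𝓚(0) + 𝓦_ext(0,t)`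
(`energy_relation`). The term `ξ ∂_t z` is absent because a nonnegative function has zero time
derivative almost everywhere on its zero set (`DamageVar.mul_dt_eq_zero`). Thus the energy balance
amounts to `∫∫ φ ∂_t z = 0`, and as this integrand has a sign, to `φ ∂_t z = 0` almost everywhere
(`balance_of_relation`, `mul_dt_eq_zero_of_balance`).

The test with the rates needs care. The coefficients are given on `[0,1]` only, so `0 ≤ z ≤ 1` is
deduced first, from monotonicity in time (`DamageVar.ae_mem_Icc`). In `h'(z) C ε(u) : ε(u) ∂_t z`
the factor `C ε(u) : ε(u)` is just integrable in space, but dominated uniformly in time, and `∂_t z`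
is bounded in space for almost every time because `p > n` (`Curve.integrable_mul_dt`). The exponent
may be below 2, so finiteness of the dissipation is a conclusion of the relation. Finally, the weak
equations hold off a null set of times that depends on the test function; separability removes this
dependence (`ae_forall_of_forall_ae`), and then the test function may depend on the time.

The analysis on Lipschitz domains is built up from graph charts: a boundary measure with a
Gauss-Green formula (`exists_boundaryMeasure`), traces, one-sided mollification along interior cones
(`exists_mollifier`), Morrey's inequality (`exists_sup_bound`), and a Gauss-Green formula for
continuous fields whose divergence is only integrable (`BoundaryMeasure.integral_flux`), as is the
case for the flux of the `p`-Laplacian. -/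

open MeasureTheory Set Filter Topology
open scoped ContDiff NNReal ENNReal

noncomputable section

namespace Damage

variable {n : ℕ}

/-! ### Weak derivatives: uniqueness, Leibniz rule, stability under limits. -/

section WeakDerivatives

variable {F G : Type*} [NormedAddCommGroup F] [NormedSpace ℝ F] [NormedAddCommGroup G]
  [NormedSpace ℝ G] {Ω : Set (E n)} {i : Fin n}

/-- The `i`-th standard unit vector. -/
abbrev unitVec (i : Fin n) : E n := EuclideanSpace.single i 1

/-- The compact support of `φ` lies inside `Ω`, so local integrability of `w` on `Ω` is enough, with
no condition near the boundary. -/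
theorem IsTest.integrableOn_smul {φ : E n → ℝ} (hφ : IsTest Ω φ) {w : E n → F}
    (hw : LocallyIntegrableOn w Ω) : IntegrableOn (fun x => φ x • w x) Ω := by
  have h1 : IntegrableOn w (tsupport φ) := hw.integrableOn_compact_subset hφ.2.2 hφ.2.1
  have h2 : IntegrableOn (fun x => φ x • w x) (tsupport φ) :=
    h1.continuousOn_smul hφ.1.continuous.continuousOn hφ.2.1
  have h3 : Integrable (fun x => φ x • w x) := by
    rw [← integrableOn_iff_integrable_of_support_subset (s := tsupport φ)]
    · exact h2
    · intro x hx
      apply subset_tsupport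
      intro h0
      simp [h0] at hx
  exact h3.integrableOn

theorem IsTest.fderiv {φ : E n → ℝ} (hφ : IsTest Ω φ) (v : E n) :
    IsTest Ω (fun x => fderiv ℝ φ x v) := by
  refine ⟨?_, ?_, ?_⟩
  · exact (hφ.1.fderiv_right (m := ∞) (by simp)).clm_apply contDiff_const
  · exact hφ.2.1.fderiv_apply ℝ v
  · exact (tsupport_fderiv_apply_subset ℝ v).trans hφ.2.2

theorem IsTest.mul_left {φ χ : E n → ℝ} (hφ : IsTest Ω φ) (hχ : ContDiff ℝ ∞ χ) :
    IsTest Ω (fun x => χ x * φ x) :=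
  ⟨hχ.mul hφ.1, hφ.2.1.mul_left, (tsupport_mul_subset_right).trans hφ.2.2⟩

/-- The fundamental lemma of the calculus of variations, which makes weak derivatives and weak
divergences unique. -/
theorem ae_eq_of_integral_test {w w' : E n → F} (hΩ : IsOpen Ω) [CompleteSpace F]
    (hw : LocallyIntegrableOn w Ω) (hw' : LocallyIntegrableOn w' Ω)
    (h : ∀ φ : E n → ℝ, IsTest Ω φ → ∫ x in Ω, φ x • w x = ∫ x in Ω, φ x • w' x) :
    w =ᵐ[volume.restrict Ω] w' := by
  have := hΩ.ae_eq_zero_of_integral_contDiff_smul_eq_zero (hw.sub hw') (fun g g1 g2 g3 => by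
    have hg : IsTest Ω g := ⟨g1, g2, g3⟩
    have := h g hg
    have e : ∫ x, g x • (w - w') x = ∫ x in Ω, g x • (w - w') x := by
      rw [setIntegral_eq_integral_of_forall_compl_eq_zero]
      intro x hx
      have : g x = 0 := image_eq_zero_of_notMem_tsupport fun h => hx (g3 h)
      simp [this]
    rw [e]
    simp only [Pi.sub_apply, smul_sub]
    rw [integral_sub (hg.integrableOn_smul hw) (hg.integrableOn_smul hw'), this, sub_self])
  rw [EventuallyEq, ae_restrict_iff' hΩ.measurableSet]
  filter_upwards [this] with x hx hxΩ
  exact sub_eq_zero.1 (hx hxΩ)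

/-- Traces carry their derivatives inside an existential; uniqueness allows these to be exchanged
for the derivatives at hand. -/
theorem IsWeakPartial.ae_unique [CompleteSpace F] (hΩ : IsOpen Ω) {w w' g g' : E n → F}
    (h : IsWeakPartial Ω i w g)
    (h' : IsWeakPartial Ω i w' g') (hw : w =ᵐ[volume.restrict Ω] w') :
    g =ᵐ[volume.restrict Ω] g' := by
  refine ae_eq_of_integral_test hΩ h.2.1 h'.2.1 fun φ hφ => ?_
  rw [← neg_inj, ← h.2.2 φ hφ, ← h'.2.2 φ hφ]
  refine integral_congr_ae ?_
  filter_upwards [hw] with x hx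
  rw [hx]

theorem IsWeakDiv.ae_unique (hΩ : IsOpen Ω) {V V' : E n → E n} {d d' : E n → ℝ}
    (h : IsWeakDiv Ω V d) (h' : IsWeakDiv Ω V' d') (hV : V =ᵐ[volume.restrict Ω] V') :
    d =ᵐ[volume.restrict Ω] d' := by
  refine ae_eq_of_integral_test hΩ h.2.1 h'.2.1 fun φ hφ => ?_
  simp only [smul_eq_mul]
  rw [← neg_inj, ← h.2.2 φ hφ, ← h'.2.2 φ hφ]
  refine integral_congr_ae ?_
  filter_upwards [hV] with x hx
  rw [hx]

theorem IsWeakPartial.isWeakDiv {w g : E n → ℝ} (h : IsWeakPartial Ω i w g) :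
    IsWeakDiv Ω (fun x => w x • unitVec i) g := by
  refine ⟨?_, h.2.1, fun φ hφ => ?_⟩
  · exact fun x hx => (h.1 x hx).imp fun s hs => ⟨hs.1, hs.2.smul_const _⟩
  · have := h.2.2 φ hφ
    simp only [smul_eq_mul] at this
    rw [← this]
    simp [mul_comm]

theorem locallyIntegrableOn_contDiff_mul {w : E n → F} (hΩ : IsOpen Ω)
    (hw : LocallyIntegrableOn w Ω)
    {χ : E n → ℝ} (hχ : Continuous χ) : LocallyIntegrableOn (fun x => χ x • w x) Ω :=
  hw.continuousOn_smul hΩ.isLocallyClosed hχ.continuousOn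

/-- The weak formula for `w` is applied to `χ φ`, which is again a test function because `χ` is
smooth. -/
theorem IsWeakPartial.smooth_smul (hΩ : IsOpen Ω) {w g : E n → F} (h : IsWeakPartial Ω i w g)
    {χ : E n → ℝ} (hχ : ContDiff ℝ ∞ χ) :
    IsWeakPartial Ω i (fun x => χ x • w x)
      (fun x => χ x • g x + fderiv ℝ χ x (unitVec i) • w x) := by
  have hχ' : Continuous fun x => fderiv ℝ χ x (unitVec i) :=
    (hχ.continuous_fderiv (by simp)).clm_apply continuous_const
  have hχ'' : ContDiff ℝ ∞ fun x => fderiv ℝ χ x (unitVec i) :=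
    (hχ.fderiv_right (m := ∞) (by simp)).clm_apply contDiff_const
  refine ⟨locallyIntegrableOn_contDiff_mul hΩ h.1 hχ.continuous,
    (locallyIntegrableOn_contDiff_mul hΩ h.2.1 hχ.continuous).add
      (locallyIntegrableOn_contDiff_mul hΩ h.1 hχ'), fun φ hφ => ?_⟩
  have h1 := h.2.2 _ (hφ.mul_left hχ)
  have e1 : ∀ x, fderiv ℝ (fun x => χ x * φ x) x (unitVec i) • w x
      = fderiv ℝ φ x (unitVec i) • χ x • w x + (fderiv ℝ χ x (unitVec i) * φ x) • w x := by
    intro x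
    rw [fderiv_fun_mul ((hχ.differentiable (by simp)) x) ((hφ.1.differentiable (by simp)) x)]
    simp only [add_apply, smul_apply, smul_eq_mul]
    rw [add_smul, smul_smul]
    ring_nf
  simp only [e1] at h1
  have i1 : IntegrableOn (fun x => fderiv ℝ φ x (unitVec i) • χ x • w x) Ω :=
    (hφ.fderiv _).integrableOn_smul (locallyIntegrableOn_contDiff_mul hΩ h.1 hχ.continuous)
  have i2 : IntegrableOn (fun x => (fderiv ℝ χ x (unitVec i) * φ x) • w x) Ω :=
    (hφ.mul_left hχ'').integrableOn_smul h.1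
  have i3 : IntegrableOn (fun x => (χ x * φ x) • g x) Ω :=
    (hφ.mul_left hχ).integrableOn_smul h.2.1
  rw [integral_add i1 i2] at h1
  have e2 : ∀ x, φ x • (χ x • g x + fderiv ℝ χ x (unitVec i) • w x)
      = (χ x * φ x) • g x + (fderiv ℝ χ x (unitVec i) * φ x) • w x := by
    intro x
    rw [smul_add, smul_smul, smul_smul]
    ring_nf
  simp only [e2]
  rw [integral_add i3 i2, eq_sub_of_add_eq h1]
  abel

/-- Integration by parts against the constant function one. -/
theorem integral_fderiv_eq_zero_of_hasCompactSupport {w : E n → F} (hw : ContDiff ℝ 1 w)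
    (hc : HasCompactSupport w) (v : E n) : ∫ x, fderiv ℝ w x v = 0 := by
  have h := integral_smul_fderiv_eq_neg_fderiv_smul_of_integrable (𝕜 := ℝ) (μ := volume)
    (f := fun _ : E n => (1 : ℝ)) (g := w) (v := v)
    (by simp) (by
      simp only [one_smul]
      exact ((hw.continuous_fderiv (by simp)).clm_apply
        continuous_const).integrable_of_hasCompactSupport (hc.fderiv_apply ℝ v))
    (by simpa using hw.continuous.integrable_of_hasCompactSupport hc)
    (by simp) (fun x _ => (hw.differentiable (by simp)) x)
  simpa using h

/-- The product `φ w` has compact support, so its derivative integrates to zero; all integrals over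
`Ω` are integrals over the whole space because `φ` is supported in `Ω`. -/
theorem isWeakPartial_of_contDiff {w : E n → F} (hw : ContDiff ℝ 1 w) :
    IsWeakPartial Ω i w (fun x => fderiv ℝ w x (unitVec i)) := by
  have hc : Continuous fun x => fderiv ℝ w x (unitVec i) :=
    (hw.continuous_fderiv (by simp)).clm_apply continuous_const
  refine ⟨hw.continuous.locallyIntegrable.locallyIntegrableOn _,
    hc.locallyIntegrable.locallyIntegrableOn _, fun φ hφ => ?_⟩
  have key := integral_fderiv_eq_zero_of_hasCompactSupport (w := fun x => φ x • w x)
    ((hφ.1.of_le (by simp)).smul hw) (hφ.2.1.smul_right) (unitVec i)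
  have e : ∀ x, fderiv ℝ (fun x => φ x • w x) x (unitVec i)
      = fderiv ℝ φ x (unitVec i) • w x + φ x • fderiv ℝ w x (unitVec i) := by
    intro x
    rw [fderiv_fun_smul ((hφ.1.differentiable (by simp)) x) ((hw.differentiable (by simp)) x)]
    simp [add_comm]
  simp only [e] at key
  have z1 : ∫ x in Ω, fderiv ℝ φ x (unitVec i) • w x = ∫ x, fderiv ℝ φ x (unitVec i) • w x := by
    rw [setIntegral_eq_integral_of_forall_compl_eq_zero]
    intro x hx
    have : fderiv ℝ φ x (unitVec i) = 0 :=
      image_eq_zero_of_notMem_tsupport (f := fun x => fderiv ℝ φ x (unitVec i))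
        fun h => hx ((hφ.fderiv (unitVec i)).2.2 h)
    simp [this]
  have z2 : ∫ x in Ω, φ x • fderiv ℝ w x (unitVec i) = ∫ x, φ x • fderiv ℝ w x (unitVec i) := by
    rw [setIntegral_eq_integral_of_forall_compl_eq_zero]
    intro x hx
    have : φ x = 0 := image_eq_zero_of_notMem_tsupport fun h => hx (hφ.2.2 h)
    simp [this]
  change ∫ x in Ω, fderiv ℝ φ x (unitVec i) • w x = _
  rw [z1, z2, eq_neg_iff_add_eq_zero, ← integral_add, key]
  · exact ((hφ.fderiv (unitVec i)).1.continuous.smul hw.continuous).integrable_of_hasCompactSupport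
      (hφ.fderiv (unitVec i)).2.1.smul_right
  · exact (hφ.1.continuous.smul hc).integrable_of_hasCompactSupport hφ.2.1.smul_right

theorem tendsto_integral_smul_of_L1 {α : Type*} [MeasurableSpace α] {μ : Measure α}
    {a : α → ℝ} {w : ℕ → α → F} {w' : α → F} (ha : AEStronglyMeasurable a μ)
    {c : ℝ} (hac : ∀ x, |a x| ≤ c) (hw : ∀ k, Integrable (w k) μ) (hw' : Integrable w' μ)
    (h : Tendsto (fun k => eLpNorm (fun x => w k x - w' x) 1 μ) atTop (𝓝 0)) :
    Tendsto (fun k => ∫ x, a x • w k x ∂μ) atTop (𝓝 (∫ x, a x • w' x ∂μ)) := by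
  refine tendsto_integral_of_L1' _ (hw'.bdd_smul c ha (ae_of_all _ fun x => hac x)).1
    (Eventually.of_forall fun k => (hw k).bdd_smul c ha (ae_of_all _ fun x => hac x)) ?_
  have : Tendsto (fun k => ENNReal.ofReal c * eLpNorm (fun x => w k x - w' x) 1 μ) atTop (𝓝 0) := by
    simpa using ENNReal.Tendsto.const_mul h (Or.inr (by simp))
  refine tendsto_of_tendsto_of_tendsto_of_le_of_le tendsto_const_nhds this (fun _ => zero_le) ?_
  intro k
  refine eLpNorm_le_mul_eLpNorm_of_ae_le_mul (ae_of_all _ fun x => ?_) 1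
  change ‖a x • w k x - a x • w' x‖ ≤ _
  rw [← smul_sub, norm_smul]
  exact mul_le_mul_of_nonneg_right (hac x) (norm_nonneg _)

/-- The defining identity tests against bounded functions, so it survives convergence in `L¹`. The
product and chain rules in Sobolev spaces are limits of smooth ones in this sense. -/
theorem IsWeakPartial.of_tendsto {w g : ℕ → E n → F} {w' g' : E n → F}
    (h : ∀ k, IsWeakPartial Ω i (w k) (g k))
    (hw : ∀ k, IntegrableOn (w k) Ω) (hw' : IntegrableOn w' Ω)
    (hg : ∀ k, IntegrableOn (g k) Ω) (hg' : IntegrableOn g' Ω)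
    (h1 : Tendsto (fun k => eLpNorm (fun x => w k x - w' x) 1 (volume.restrict Ω)) atTop (𝓝 0))
    (h2 : Tendsto (fun k => eLpNorm (fun x => g k x - g' x) 1 (volume.restrict Ω)) atTop (𝓝 0)) :
    IsWeakPartial Ω i w' g' := by
  refine ⟨hw'.locallyIntegrableOn, hg'.locallyIntegrableOn, fun φ hφ => ?_⟩
  obtain ⟨c1, hc1⟩ := hφ.2.1.exists_bound_of_continuous hφ.1.continuous
  obtain ⟨c2, hc2⟩ := (hφ.fderiv (unitVec i)).2.1.exists_bound_of_continuous
    (hφ.fderiv (unitVec i)).1.continuous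
  have t1 := tendsto_integral_smul_of_L1 (a := fun x => fderiv ℝ φ x (unitVec i))
    (hφ.fderiv (unitVec i)).1.continuous.aestronglyMeasurable hc2 hw hw' h1
  have t2 := (tendsto_integral_smul_of_L1 (a := φ)
    hφ.1.continuous.aestronglyMeasurable hc1 hg hg' h2).neg
  refine tendsto_nhds_unique t1 (t2.congr fun k => ?_)
  exact ((h k).2.2 φ hφ).symm

theorem IsWeakPartial.clm_comp [CompleteSpace F] [CompleteSpace G] (L : F →L[ℝ] G)
    {w g : E n → F} (h : IsWeakPartial Ω i w g) :
    IsWeakPartial Ω i (fun x => L (w x)) (fun x => L (g x)) := by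
  refine ⟨fun x hx => (h.1 x hx).imp fun s hs => ⟨hs.1, L.integrable_comp hs.2⟩,
    fun x hx => (h.2.1 x hx).imp fun s hs => ⟨hs.1, L.integrable_comp hs.2⟩, fun φ hφ => ?_⟩
  have := congrArg L (h.2.2 φ hφ)
  rw [map_neg, ← L.integral_comp_comm ((hφ.fderiv _).integrableOn_smul h.1),
    ← L.integral_comp_comm (hφ.integrableOn_smul h.2.1)] at this
  simpa using this

theorem IsWeakPartial.add {w w' g g' : E n → F} (h : IsWeakPartial Ω i w g)
    (h' : IsWeakPartial Ω i w' g') :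
    IsWeakPartial Ω i (fun x => w x + w' x) (fun x => g x + g' x) := by
  refine ⟨h.1.add h'.1, h.2.1.add h'.2.1, fun φ hφ => ?_⟩
  simp only [smul_add]
  rw [integral_add ((hφ.fderiv _).integrableOn_smul h.1) ((hφ.fderiv _).integrableOn_smul h'.1),
    integral_add (hφ.integrableOn_smul h.2.1) (hφ.integrableOn_smul h'.2.1), h.2.2 φ hφ,
    h'.2.2 φ hφ]
  abel

theorem IsWeakPartial.congr {w w' g g' : E n → F} (h : IsWeakPartial Ω i w g)
    (hw : w =ᵐ[volume.restrict Ω] w') (hg : g =ᵐ[volume.restrict Ω] g') :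
    IsWeakPartial Ω i w' g' := by
  have aux : ∀ {a b : E n → F}, a =ᵐ[volume.restrict Ω] b → LocallyIntegrableOn a Ω →
      LocallyIntegrableOn b Ω := by
    intro a b hab ha x hx
    obtain ⟨s, hs, hi⟩ := ha x hx
    -- The two functions agree almost everywhere in `Ω` only, so the neighbourhood is cut down to
    -- `Ω`.
    refine ⟨s ∩ Ω, inter_mem hs self_mem_nhdsWithin, ?_⟩
    refine (hi.mono_set inter_subset_left).congr ?_
    exact ae_restrict_of_ae_restrict_of_subset inter_subset_right hab
  refine ⟨aux hw h.1, aux hg h.2.1, fun φ hφ => ?_⟩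
  have e1 : ∫ x in Ω, fderiv ℝ φ x (EuclideanSpace.single i 1) • w x
      = ∫ x in Ω, fderiv ℝ φ x (EuclideanSpace.single i 1) • w' x :=
    integral_congr_ae (hw.mono fun x hx => by simp only [hx])
  have e2 : ∫ x in Ω, φ x • g x = ∫ x in Ω, φ x • g' x :=
    integral_congr_ae (hg.mono fun x hx => by simp only [hx])
  rw [← e1, ← e2]
  exact h.2.2 φ hφ

theorem IsSobolev.clm_comp [CompleteSpace F] [CompleteSpace G] (L : F →L[ℝ] G) {q : ℝ≥0∞}
    {w : E n → F} {D : Fin n → E n → F} (h : IsSobolev Ω q w D) :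
    IsSobolev Ω q (fun x => L (w x)) (fun i x => L (D i x)) :=
  ⟨L.comp_memLp' h.1, fun i => ⟨L.comp_memLp' (h.2 i).1, (h.2 i).2.clm_comp L⟩⟩

end WeakDerivatives

/-! ### One real variable: weak derivatives, primitives, absolute continuity. -/

section OneDimensional

variable {F : Type*} [NormedAddCommGroup F] [NormedSpace ℝ F]

/-- Fubini on the triangle `s ≤ t`: integrating `φ'` over `[s, T)` leaves `-φ s`, since `φ` vanishes
at `T`. -/
theorem integral_deriv_smul_primitive [CompleteSpace F] {T : ℝ} {k : ℝ → F}
    (hk : IntegrableOn k (Ioo 0 T)) {φ : ℝ → ℝ} (hφ : IsTest (Ioo 0 T) φ) :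
    ∫ t in Ioo 0 T, deriv φ t • (∫ s in (0 : ℝ)..t, k s) = -∫ t in Ioo 0 T, φ t • k t := by
  set μ : Measure ℝ := volume.restrict (Ioo 0 T)
  have hd : Continuous (deriv φ) := hφ.1.continuous_deriv (by simp)
  obtain ⟨c, hc⟩ := hφ.2.1.deriv.exists_bound_of_continuous hd
  have hint : Integrable (fun y : ℝ × ℝ => deriv φ y.1 • k y.2) (μ.prod μ) := by
    have h1 : Integrable (deriv φ) μ :=
      (hd.integrable_of_hasCompactSupport hφ.2.1.deriv).mono_measure Measure.restrict_le_self
    exact h1.smul_prod hk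
  have hint2 : Integrable
      (fun y : ℝ × ℝ => {y : ℝ × ℝ | y.2 ≤ y.1}.indicator (fun y => deriv φ y.1 • k y.2) y)
      (μ.prod μ) := hint.indicator (measurableSet_le measurable_snd measurable_fst)
  have e1 : ∀ t ∈ Ioo 0 T, deriv φ t • (∫ s in (0 : ℝ)..t, k s)
      = ∫ s, {y : ℝ × ℝ | y.2 ≤ y.1}.indicator (fun y => deriv φ y.1 • k y.2) (t, s) ∂μ := by
    intro t ht
    rw [intervalIntegral.integral_of_le ht.1.le, ← integral_smul]
    have : ∀ s, {y : ℝ × ℝ | y.2 ≤ y.1}.indicator (fun y => deriv φ y.1 • k y.2) (t, s)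
        = (Iic t).indicator (fun s => deriv φ t • k s) s := by
      intro s; simp [indicator]
    simp only [this]
    rw [integral_indicator measurableSet_Iic, Measure.restrict_restrict measurableSet_Iic]
    congr 2
    ext s; simp only [mem_Ioc, mem_inter_iff, mem_Iic, mem_Ioo]
    constructor
    · rintro ⟨h1, h2⟩; exact ⟨h2, h1, h2.trans_lt ht.2⟩
    · rintro ⟨h1, h2, h3⟩; exact ⟨h2, h1⟩
  have e2 : ∀ s ∈ Ioo 0 T, -(φ s • k s)
      = ∫ t, {y : ℝ × ℝ | y.2 ≤ y.1}.indicator (fun y => deriv φ y.1 • k y.2) (t, s) ∂μ := by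
    intro s hs
    have : ∀ t, {y : ℝ × ℝ | y.2 ≤ y.1}.indicator (fun y => deriv φ y.1 • k y.2) (t, s)
        = (Ici s).indicator (fun t => deriv φ t • k s) t := by
      intro t; simp [indicator]
    simp only [this]
    rw [integral_indicator measurableSet_Ici, Measure.restrict_restrict measurableSet_Ici,
      integral_smul_const]
    have h3 : ∫ t in Ici s ∩ Ioo 0 T, deriv φ t = φ T - φ s := by
      have : Ici s ∩ Ioo 0 T = Ico s T := by
        ext t; simp only [mem_inter_iff, mem_Ici, mem_Ioo, mem_Ico]
        constructor
        · rintro ⟨h1, h2, h3⟩; exact ⟨h1, h3⟩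
        · rintro ⟨h1, h2⟩; exact ⟨h1, hs.1.trans_le h1, h2⟩
      rw [this, integral_Ico_eq_integral_Ioc, ← intervalIntegral.integral_of_le hs.2.le,
        intervalIntegral.integral_deriv_eq_sub]
      · exact fun x _ => (hφ.1.differentiable (by simp)) x
      · exact hd.intervalIntegrable _ _
    have hT0 : φ T = 0 := image_eq_zero_of_notMem_tsupport fun h => by
      have := hφ.2.2 h; simp at this
    rw [h3, hT0, zero_sub, neg_smul]
  rw [setIntegral_congr_fun measurableSet_Ioo e1, ← integral_neg,
    setIntegral_congr_fun measurableSet_Ioo e2]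
  exact integral_integral_swap hint2

/-- The du Bois-Reymond argument. A test function minus its integral times a fixed bump `θ` of
integral one is the derivative of a test function, so `r` minus its average `c` against `θ` is
orthogonal to every test function. Continuity turns the resulting almost everywhere identity into
one on all of `[0, T]`. -/
theorem eq_const_of_integral_deriv_smul_eq_zero [CompleteSpace F] {T : ℝ} (hT : 0 < T) {r : ℝ → F}
    (hr : ContinuousOn r (Icc 0 T))
    (h : ∀ φ : ℝ → ℝ, IsTest (Ioo 0 T) φ → ∫ t in Ioo 0 T, deriv φ t • r t = 0) :
    ∀ t ∈ Icc 0 T, r t = r 0 := by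
  have hri : IntegrableOn r (Ioo 0 T) :=
    (hr.integrableOn_compact isCompact_Icc).mono_set Ioo_subset_Icc_self
  -- The outer radius `T / 3` around the midpoint keeps the closed support inside `(0, T)`.
  let B : ContDiffBump (T / 2) := ⟨T / 6, T / 3, by positivity, by linarith⟩
  set θ : ℝ → ℝ := B.normed volume
  have hθt : IsTest (Ioo 0 T) θ := by
    refine ⟨B.contDiff_normed, B.hasCompactSupport_normed, ?_⟩
    rw [B.tsupport_normed_eq, Real.closedBall_eq_Icc]
    refine Icc_subset_Ioo ?_ ?_ <;> simp only [B] <;> linarith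
  have hθ1 : ∫ t, θ t = 1 := B.integral_normed
  have hθs : ∀ {φ : ℝ → ℝ}, IsTest (Ioo 0 T) φ → ∀ s, s ∉ Ioo 0 T → φ s = 0 := fun hφ s hs =>
    image_eq_zero_of_notMem_tsupport fun h => hs (hφ.2.2 h)
  set c : F := ∫ t in Ioo 0 T, θ t • r t
  have key : ∀ ψ : ℝ → ℝ, IsTest (Ioo 0 T) ψ → ∫ t in Ioo 0 T, ψ t • (r t - c) = 0 := by
    intro ψ hψ
    set m := ∫ t, ψ t
    -- Since `g` has integral zero, its primitive vanishes to the right of the support of `g` as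
    -- well as to the left, hence is a test function.
    set g : ℝ → ℝ := fun t => ψ t - m * θ t
    have hg : IsTest (Ioo 0 T) g := by
      refine ⟨hψ.1.sub (contDiff_const.mul hθt.1), hψ.2.1.sub hθt.2.1.mul_left, ?_⟩
      refine (tsupport_sub ψ (fun t => m * θ t)).trans (union_subset hψ.2.2 ?_)
      exact (tsupport_mul_subset_right (f := fun _ => m) (g := θ)).trans hθt.2.2
    have hgc : Continuous g := hg.1.continuous
    have hψi : Integrable ψ := hψ.1.continuous.integrable_of_hasCompactSupport hψ.2.1
    have hθi : Integrable θ := hθt.1.continuous.integrable_of_hasCompactSupport hθt.2.1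
    have hg0 : ∫ t, g t = 0 := by
      simp only [g]
      rw [integral_sub hψi (hθi.const_mul m), integral_const_mul, hθ1, mul_one, sub_self]
    set φ : ℝ → ℝ := fun t => ∫ s in (0 : ℝ)..t, g s
    have hφd : ∀ t, HasDerivAt φ (g t) t := fun t =>
      intervalIntegral.integral_hasDerivAt_right (hgc.intervalIntegrable _ _)
        hgc.stronglyMeasurable.stronglyMeasurableAtFilter hgc.continuousAt
    have hφe : deriv φ = g := funext fun t => (hφd t).deriv
    have hφ : IsTest (Ioo 0 T) φ := by
      have hz : ∀ t, t ∉ Ioo 0 T → g t = 0 := fun t ht => hθs hg t ht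
      obtain ⟨a, b, ha, hb, hab⟩ : ∃ a b, 0 < a ∧ b < T ∧ tsupport g ⊆ Icc a b := by
        rcases (tsupport g).eq_empty_or_nonempty with h0 | h0
        · exact ⟨T / 3, T / 2, by linarith, by linarith, by simp [h0]⟩
        · obtain ⟨a, ha1, ha2⟩ := hg.2.1.isCompact.exists_isLeast h0
          obtain ⟨b, hb1, hb2⟩ := hg.2.1.isCompact.exists_isGreatest h0
          exact ⟨a, b, (hg.2.2 ha1).1, (hg.2.2 hb1).2, fun x hx => ⟨ha2 hx, hb2 hx⟩⟩
      have hgz : ∀ t, t ∉ Icc a b → g t = 0 := fun t ht =>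
        image_eq_zero_of_notMem_tsupport fun h => ht (hab h)
      have hφz : ∀ t, t ∉ Icc a b → φ t = 0 := by
        intro t ht
        simp only [mem_Icc, not_and_or, not_le] at ht
        rcases ht with ht | ht
        · have : EqOn g (fun _ => 0) (uIcc 0 t) := by
            intro s hs
            refine hgz s fun h => ?_
            have := hs.2
            have h2 : max 0 t < a := max_lt ha ht
            exact absurd h.1 (not_le.2 (this.trans_lt h2))
          simp only [φ]
          rw [intervalIntegral.integral_congr this]; simp
        · have h1 : φ t = ∫ s in Iic t, g s := by
            simp only [φ]
            rw [← intervalIntegral.integral_Iic_sub_Iic (hg.1.continuous.integrable_of_hasCompactSupport hg.2.1).integrableOn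
              (hg.1.continuous.integrable_of_hasCompactSupport hg.2.1).integrableOn]
            rw [setIntegral_eq_zero_of_forall_eq_zero (t := Iic (0 : ℝ)), sub_zero]
            intro s hs
            exact hz s fun h => not_le.2 h.1 hs
          rw [h1, setIntegral_eq_integral_of_forall_compl_eq_zero, hg0]
          intro s hs
          exact hgz s fun h => hs (h.2.trans ht.le)
      have hsup : tsupport φ ⊆ Icc a b := by
        refine closure_minimal (fun t ht => ?_) isClosed_Icc
        by_contra h
        exact ht (hφz t h)
      refine ⟨?_, HasCompactSupport.of_support_subset_isCompact isCompact_Icc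
        ((subset_tsupport _).trans hsup), hsup.trans (Icc_subset_Ioo ha hb)⟩
      rw [contDiff_infty_iff_deriv, hφe]
      exact ⟨fun t => (hφd t).differentiableAt, hg.1⟩
    have h1 := h φ hφ
    rw [hφe] at h1
    have i1 : ∀ {χ : ℝ → ℝ}, IsTest (Ioo 0 T) χ → IntegrableOn (fun t => χ t • r t) (Ioo 0 T) := by
      intro χ hχ
      obtain ⟨C, hC⟩ := hχ.2.1.exists_bound_of_continuous hχ.1.continuous
      exact hri.bdd_smul C hχ.1.continuous.aestronglyMeasurable (ae_of_all _ hC)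
    have e : ∀ t, g t • r t = ψ t • r t - m • θ t • r t := by
      intro t; simp only [g, sub_smul, mul_smul]
    simp only [e] at h1
    rw [integral_sub (g := fun t => m • θ t • r t) (i1 hψ) ((i1 hθt).smul m), integral_smul] at h1
    simp only [smul_sub]
    rw [integral_sub (i1 hψ) (hψi.integrableOn.smul_const c), integral_smul_const]
    have : ∫ t in Ioo 0 T, ψ t = m := setIntegral_eq_integral_of_forall_compl_eq_zero (hθs hψ)
    rw [this]
    exact h1
  have hae : ∀ᵐ t, t ∈ Ioo 0 T → r t - c = 0 := by
    refine isOpen_Ioo.ae_eq_zero_of_integral_contDiff_smul_eq_zero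
      ((hri.sub (integrableOn_const (by simp))).locallyIntegrableOn) fun g g1 g2 g3 => ?_
    rw [← key g ⟨g1, g2, g3⟩]
    symm
    apply setIntegral_eq_integral_of_forall_compl_eq_zero
    intro s hs
    rw [hθs ⟨g1, g2, g3⟩ s hs, zero_smul]
  have hall : EqOn r (fun _ => c) (Icc 0 T) := by
    have : r =ᵐ[volume.restrict (Icc 0 T)] fun _ => c := by
      rw [restrict_Ioo_eq_restrict_Icc.symm, EventuallyEq, ae_restrict_iff' measurableSet_Ioo]
      filter_upwards [hae] with t ht h
      exact sub_eq_zero.1 (ht h)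
    exact Measure.eqOn_Icc_of_ae_eq volume hT.ne this hr continuousOn_const
  intro t ht
  rw [hall ht, hall (left_mem_Icc.2 hT.le)]

theorem continuousOn_primitive_Icc {T : ℝ} {k : ℝ → F}
    (hk : IntegrableOn k (Ioo 0 T)) : ContinuousOn (fun t => ∫ s in (0 : ℝ)..t, k s) (Icc 0 T) := by
  rcases le_total 0 T with h | h
  · have := intervalIntegral.continuousOn_primitive_interval (μ := volume) (f := k) (a := 0) (b := T)
      (by rwa [uIcc_of_le h, integrableOn_Icc_iff_integrableOn_Ioo])
    rwa [uIcc_of_le h] at this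
  · rcases h.lt_or_eq with h | h
    · simp [Icc_eq_empty (not_le.2 h)]
    · subst h; simp

/-- A continuous function with an integrable weak derivative is the primitive of it. -/
theorem eq_add_integral_of_weak_deriv [CompleteSpace F] {T : ℝ} (hT : 0 < T) {g k : ℝ → F}
    (hg : ContinuousOn g (Icc 0 T)) (hk : IntegrableOn k (Ioo 0 T))
    (h : ∀ φ : ℝ → ℝ, IsTest (Ioo 0 T) φ →
      ∫ t in Ioo 0 T, deriv φ t • g t = -∫ t in Ioo 0 T, φ t • k t) :
    ∀ t ∈ Icc 0 T, g t = g 0 + ∫ s in (0 : ℝ)..t, k s := by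
  have hc := continuousOn_primitive_Icc hk
  have := eq_const_of_integral_deriv_smul_eq_zero hT (hg.sub hc) fun φ hφ => by
    have hd : Continuous (deriv φ) := hφ.1.continuous_deriv (by simp)
    have i : ∀ {f : ℝ → F}, ContinuousOn f (Icc 0 T) →
        IntegrableOn (fun t => deriv φ t • f t) (Ioo 0 T) := fun hf =>
      ((hd.continuousOn.smul hf).integrableOn_compact isCompact_Icc).mono_set Ioo_subset_Icc_self
    simp only [Pi.sub_apply, smul_sub]
    rw [integral_sub (i hg) (i hc), h φ hφ, integral_deriv_smul_primitive hk hφ, sub_self]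
  intro t ht
  have h1 := this t ht
  simp only [Pi.sub_apply, intervalIntegral.integral_same, sub_zero] at h1
  rw [← h1]; abel

theorem ae_hasDerivAt_primitive {T : ℝ} [CompleteSpace F] {k : ℝ → F}
    (hk : IntegrableOn k (Ioo 0 T)) :
    ∀ᵐ t ∂(volume.restrict (Ioo 0 T)), HasDerivAt (fun t => ∫ s in (0 : ℝ)..t, k s) (k t) t := by
  rw [ae_restrict_iff' measurableSet_Ioo]
  rcases le_total 0 T with h | h
  · have h1 : IntervalIntegrable k volume 0 T := by
      rwa [intervalIntegrable_iff_integrableOn_Ioo_of_le h]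
    filter_upwards [h1.ae_hasDerivAt_integral] with t ht h2
    rw [uIcc_of_le h] at ht
    exact ht (Ioo_subset_Icc_self h2) 0 (left_mem_Icc.2 h)
  · exact ae_of_all _ fun t ht => by simp [Ioo_eq_empty (not_lt.2 h)] at ht

/-- Chain rule for absolutely continuous functions. -/
theorem comp_primitive_eq_add_integral [FiniteDimensional ℝ F] {T : ℝ} {Ψ : F → ℝ}
    (hΨ : ContDiff ℝ 1 Ψ) (a₀ : F) {k : ℝ → F} (hk : IntegrableOn k (Ioo 0 T)) {t : ℝ}
    (ht : t ∈ Icc 0 T) :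
    Ψ (a₀ + ∫ s in (0 : ℝ)..t, k s) =
      Ψ a₀ + ∫ s in (0 : ℝ)..t, fderiv ℝ Ψ (a₀ + ∫ r in (0 : ℝ)..s, k r) (k s) := by
  have := FiniteDimensional.complete ℝ F
  have := FiniteDimensional.proper ℝ F
  have hkt : IntegrableOn k (Ioo 0 t) := hk.mono_set (Ioo_subset_Ioo_right ht.2)
  have hki : IntervalIntegrable k volume 0 t := by
    rwa [intervalIntegrable_iff_integrableOn_Ioo_of_le ht.1]
  set a : ℝ → F := fun t => a₀ + ∫ s in (0 : ℝ)..t, k s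
  have hac : ContinuousOn a (Icc 0 t) := continuousOn_const.add (continuousOn_primitive_Icc hkt)
  -- The curve stays in a closed ball, which is compact and convex, so `Ψ` is Lipschitz along it.
  obtain ⟨R, hR⟩ := (isCompact_Icc.image_of_continuousOn hac).isBounded.subset_closedBall 0
  obtain ⟨L, hL⟩ := (isCompact_closedBall (0 : F) R).exists_bound_of_continuousOn
    (hΨ.continuous_fderiv (by simp)).continuousOn
  have hlip : ∀ x ∈ Icc 0 t, ∀ y ∈ Icc 0 t, ‖Ψ (a y) - Ψ (a x)‖ ≤ L * ‖a y - a x‖ :=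
    fun x hx y hy => (convex_closedBall (0 : F) R).norm_image_sub_le_of_norm_fderiv_le (𝕜 := ℝ)
      (fun z _ => (hΨ.differentiable (by simp)) z) hL (hR (mem_image_of_mem a hx))
      (hR (mem_image_of_mem a hy))
  have hL0 : 0 ≤ L := by
    refine (norm_nonneg _).trans (hL (a 0) (hR (mem_image_of_mem a (left_mem_Icc.2 ht.1))))
  have hki0 : ∀ x ∈ Icc 0 t, IntervalIntegrable k volume 0 x := fun x hx => by
    rw [intervalIntegrable_iff_integrableOn_Ioo_of_le hx.1]
    exact hkt.mono_set (Ioo_subset_Ioo_right hx.2)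
  have hdist : ∀ x ∈ Icc 0 t, ∀ y ∈ Icc 0 t,
      dist (Ψ (a x)) (Ψ (a y)) ≤ L * dist (∫ s in (0 : ℝ)..x, ‖k s‖) (∫ s in (0 : ℝ)..y, ‖k s‖) := by
    intro x hx y hy
    rw [dist_comm, dist_eq_norm, dist_comm, dist_eq_norm]
    refine (hlip x hx y hy).trans (mul_le_mul_of_nonneg_left ?_ hL0)
    simp only [a]
    rw [add_sub_add_left_eq_sub, intervalIntegral.integral_interval_sub_left (hki0 y hy) (hki0 x hx),
      intervalIntegral.integral_interval_sub_left (hki0 y hy).norm (hki0 x hx).norm]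
    exact intervalIntegral.norm_integral_le_abs_integral_norm
  have hA : AbsolutelyContinuousOnInterval (fun s => ∫ r in (0 : ℝ)..s, ‖k r‖) 0 t :=
    hki.norm.absolutelyContinuousOnInterval_intervalIntegral (by simp)
  -- Increments of `Ψ ∘ a` are dominated by those of the primitive of `‖k‖`, which is absolutely
  -- continuous. The fundamental theorem of calculus then reduces the claim to the derivative at
  -- almost every time.
  have hAC : AbsolutelyContinuousOnInterval (fun s => Ψ (a s)) 0 t := by
    unfold AbsolutelyContinuousOnInterval at hA ⊢
    have h2 := hA.const_mul L
    rw [mul_zero] at h2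
    refine squeeze_zero' ?_ ?_ h2
    · exact Eventually.of_forall fun E => Finset.sum_nonneg fun i _ => dist_nonneg
    · have : ∀ᶠ E in AbsolutelyContinuousOnInterval.totalLengthFilter ⊓
          𝓟 (AbsolutelyContinuousOnInterval.disjWithin 0 t),
          E ∈ AbsolutelyContinuousOnInterval.disjWithin 0 t :=
        eventually_inf_principal.2 (Eventually.of_forall fun _ h => h)
      filter_upwards [this] with E hE
      rw [Finset.mul_sum]
      refine Finset.sum_le_sum fun i hi => ?_
      have h3 := hE.1 i hi
      rw [uIcc_of_le ht.1] at h3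
      exact hdist _ h3.1 _ h3.2
  have hftc := hAC.integral_deriv_eq_sub
  have h0 : a 0 = a₀ := by simp [a]
  rw [h0] at hftc
  change Ψ (a t) = Ψ a₀ + ∫ s in (0 : ℝ)..t, fderiv ℝ Ψ (a s) (k s)
  rw [eq_add_of_sub_eq' hftc.symm]
  congr 1
  rw [intervalIntegral.integral_of_le ht.1, intervalIntegral.integral_of_le ht.1,
    ← restrict_Ioo_eq_restrict_Ioc]
  refine integral_congr_ae ?_
  filter_upwards [ae_hasDerivAt_primitive hkt] with s hs
  have h1 : HasDerivAt a (k s) s := hs.const_add a₀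
  exact (((hΨ.differentiable (by simp)) (a s)).hasFDerivAt.comp_hasDerivAt s h1).deriv

/-- A nonnegative absolutely continuous function has zero derivative almost everywhere on its
zero set. -/
theorem ae_eq_zero_of_nonneg_primitive {T : ℝ} {a₀ : ℝ} {k : ℝ → ℝ}
    (hk : IntegrableOn k (Ioo 0 T)) (h : ∀ t ∈ Ioo 0 T, 0 ≤ a₀ + ∫ s in (0 : ℝ)..t, k s) :
    ∀ᵐ t ∂(volume.restrict (Ioo 0 T)), a₀ + ∫ s in (0 : ℝ)..t, k s = 0 → k t = 0 := by
  filter_upwards [ae_hasDerivAt_primitive hk, ae_restrict_mem measurableSet_Ioo] with t ht hmem h0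
  have h1 : HasDerivAt (fun t => a₀ + ∫ s in (0 : ℝ)..t, k s) (k t) t := ht.const_add a₀
  -- A zero of a nonnegative function is a minimum, so the derivative vanishes there if it exists.
  refine IsLocalMin.hasDerivAt_eq_zero ?_ h1
  filter_upwards [Ioo_mem_nhds hmem.1 hmem.2] with s hs
  rw [h0]
  exact h s hs

end OneDimensional

/-! ### Null sets of times that do not depend on the test function. -/

section Exchange

/-- A countable dense set of `x` has a common null set of parameters, and closedness of the
condition carries it to all other `x`. -/
theorem ae_forall_of_forall_ae {α X : Type*} [MeasurableSpace α] {ν : Measure α}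
    [TopologicalSpace X] [TopologicalSpace.SeparableSpace X] {P : α → X → Prop}
    (hP : ∀ᵐ t ∂ν, IsClosed {x | P t x}) (h : ∀ x, ∀ᵐ t ∂ν, P t x) : ∀ᵐ t ∂ν, ∀ x, P t x := by
  rcases isEmpty_or_nonempty X with hX | hX
  · exact ae_of_all _ fun t x => (hX.false x).elim
  · filter_upwards [hP, ae_all_iff.2 fun k => h (TopologicalSpace.denseSeq X k)] with t h1 h2 x
    have := (TopologicalSpace.denseRange_denseSeq X).closure_eq
    have h3 : closure (range (TopologicalSpace.denseSeq X)) ⊆ {x | P t x} :=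
      closure_minimal (by rintro _ ⟨k, rfl⟩; exact h2 k) h1
    exact h3 (this ▸ mem_univ x)

theorem MemLp_prod_section {α β F : Type*} [MeasurableSpace α] [MeasurableSpace β]
    [NormedAddCommGroup F] {ν : Measure α} {μ : Measure β} [SFinite ν] [SFinite μ]
    {q : ℝ≥0∞} (hq0 : q ≠ 0) (hq : q ≠ ⊤) {a : α → β → F}
    (ha : MemLp (fun y : α × β => a y.1 y.2) q (ν.prod μ)) : ∀ᵐ t ∂ν, MemLp (a t) q μ := by
  have h1 := ((integrable_norm_rpow_iff ha.1 hq0 hq).2 ha).prod_right_ae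
  filter_upwards [h1, ha.1.prodMk_left] with t h2 h3
  exact (integrable_norm_rpow_iff h3 hq0 hq).1 h2

variable {α V : Type*} [MeasurableSpace α] {μ : Measure α}
  [NormedAddCommGroup V] [InnerProductSpace ℝ V]

theorem integral_inner_eq_inner_toLp {f g : α → V} (hf : MemLp f 2 μ) (hg : MemLp g 2 μ) :
    ∫ x, inner ℝ (f x) (g x) ∂μ = inner ℝ (hf.toLp f) (hg.toLp g) := by
  rw [L2.inner_def]
  refine integral_congr_ae ?_
  filter_upwards [hf.coeFn_toLp, hg.coeFn_toLp] with x h1 h2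
  rw [h1, h2]

theorem MemLp.integrable_inner_two {f g : α → V} (hf : MemLp f 2 μ) (hg : MemLp g 2 μ) :
    Integrable (fun x => inner ℝ (f x) (g x)) μ := by
  refine (L2.integrable_inner (𝕜 := ℝ) (hf.toLp f) (hg.toLp g)).congr ?_
  filter_upwards [hf.coeFn_toLp, hg.coeFn_toLp] with x h1 h2
  rw [h1, h2]

/-- Instance search for the separability of `Lp V 2 μ` asks for this fact. -/
instance fact_two_ne_top : Fact ((2 : ℝ≥0∞) ≠ ⊤) := ⟨by simp⟩

variable [SFinite μ]

theorem integral_inner_primitive [CompleteSpace V] {T : ℝ} {e : α → V} (he : MemLp e 2 μ)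
    {g : ℝ → α → V}
    (hg : MemLp (fun y : ℝ × α => g y.1 y.2) 2 ((volume.restrict (Ioo 0 T)).prod μ)) :
    Integrable (fun y : ℝ × α => inner ℝ (e y.2) (g y.1 y.2)) ((volume.restrict (Ioo 0 T)).prod μ) ∧
    ∀ t ∈ Icc 0 T, ∫ x, inner ℝ (e x) (∫ s in (0 : ℝ)..t, g s x) ∂μ
      = ∫ s in (0 : ℝ)..t, ∫ x, inner ℝ (e x) (g s x) ∂μ := by
  have he2 : MemLp (fun y : ℝ × α => e y.2) 2 ((volume.restrict (Ioo 0 T)).prod μ) :=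
    he.comp_snd _
  have hi : Integrable (fun y : ℝ × α => inner ℝ (e y.2) (g y.1 y.2))
      ((volume.restrict (Ioo 0 T)).prod μ) := MemLp.integrable_inner_two he2 hg
  refine ⟨hi, fun t ht => ?_⟩
  have hsub : (volume.restrict (Ioo 0 t)).prod μ ≤ (volume.restrict (Ioo 0 T)).prod μ :=
    Measure.prod_mono (Measure.restrict_mono (Ioo_subset_Ioo_right ht.2) le_rfl) le_rfl
  have hi' := hi.mono_measure hsub
  have hg' : Integrable (fun y : α × ℝ => inner ℝ (e y.1) (g y.2 y.1))
      (μ.prod (volume.restrict (Ioo 0 t))) := hi'.swap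
  simp only [intervalIntegral.integral_of_le ht.1, ← restrict_Ioo_eq_restrict_Ioc]
  rw [integral_integral_swap hi']
  refine integral_congr_ae ?_
  have hgs : ∀ᵐ x ∂μ, MemLp (fun s => g s x) 2 (volume.restrict (Ioo 0 t)) := by
    have h2 : MemLp (fun y : α × ℝ => g y.2 y.1) 2 (μ.prod (volume.restrict (Ioo 0 t))) :=
      (hg.mono_measure hsub).comp_measurePreserving Measure.measurePreserving_swap
    exact MemLp_prod_section (a := fun x s => g s x) (by simp) (by simp) h2
  filter_upwards [hgs] with x hx
  rw [← integral_inner (hx.integrable (by norm_num)) (e x)]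

variable [IsSeparable μ] [SecondCountableTopology V]

/-- The test functions form a subset of the separable space `Lp V 2 μ`, on which the pairing with `a
t` is continuous for almost every `t`. The bound `c` may depend on time, as it does in the
variational inequality for `ξ`. -/
theorem ae_forall_integral_inner_le {ν : Measure ℝ} [SFinite ν] {a : ℝ → α → V} {c : ℝ → ℝ}
    (ha : MemLp (fun y : ℝ × α => a y.1 y.2) 2 (ν.prod μ)) {S : Set (α → V)}
    (hS : ∀ Z ∈ S, MemLp Z 2 μ) (h : ∀ Z ∈ S, ∀ᵐ t ∂ν, ∫ x, inner ℝ (a t x) (Z x) ∂μ ≤ c t) :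
    ∀ᵐ t ∂ν, ∀ Z ∈ S, ∫ x, inner ℝ (a t x) (Z x) ∂μ ≤ c t := by
  have ha' := MemLp_prod_section (by simp) (by simp) ha
  let X : Set (Lp V 2 μ) := {f | ∃ Z, ∃ hZ : Z ∈ S, f = (hS Z hZ).toLp Z}
  have key : ∀ᵐ t ∂ν, ∀ f : X, ∫ x, inner ℝ (a t x) (f.1 x) ∂μ ≤ c t := by
    refine ae_forall_of_forall_ae ?_ ?_
    · filter_upwards [ha'] with t ht
      have e : ∀ f : X, ∫ x, inner ℝ (a t x) (f.1 x) ∂μ = inner ℝ (ht.toLp (a t)) f.1 := by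
        intro f
        rw [integral_inner_eq_inner_toLp ht (Lp.memLp f.1), Lp.toLp_coeFn]
      simp only [e]
      exact isClosed_le (by fun_prop) continuous_const
    · rintro ⟨_, Z, hZ, rfl⟩
      filter_upwards [h Z hZ] with t ht
      refine (integral_congr_ae ?_).trans_le ht
      filter_upwards [(hS Z hZ).coeFn_toLp] with x hx
      rw [hx]
  filter_upwards [key] with t ht Z hZ
  refine (integral_congr_ae ?_).trans_le (ht ⟨_, Z, hZ, rfl⟩)
  filter_upwards [(hS Z hZ).coeFn_toLp] with x hx
  rw [hx]

theorem ae_eq_zero_of_primitive_eq_zero {F : Type*} [NormedAddCommGroup F] [NormedSpace ℝ F]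
    [CompleteSpace F] {T : ℝ} {k : ℝ → F} (hk : IntegrableOn k (Ioo 0 T))
    (h : ∀ t ∈ Ioo 0 T, ∫ s in (0 : ℝ)..t, k s = 0) :
    ∀ᵐ t ∂(volume.restrict (Ioo 0 T)), k t = 0 := by
  filter_upwards [ae_hasDerivAt_primitive hk, ae_restrict_mem measurableSet_Ioo] with t ht hmem
  have h0 : HasDerivAt (fun t => ∫ s in (0 : ℝ)..t, k s) 0 t := by
    refine (hasDerivAt_const t (0 : F)).congr_of_eventuallyEq ?_
    filter_upwards [Ioo_mem_nhds hmem.1 hmem.2] with s hs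
    exact h s hs
  exact ht.unique h0

/-- If, for almost all `s`, the field `G s` is orthogonal to almost all values of a curve, then for
almost all `s` it is orthogonal to the time derivative of this curve at time `s`. -/
theorem ae_integral_inner_deriv_eq_zero [CompleteSpace V] {T : ℝ} (hT : 0 < T)
    {w g G : ℝ → α → V}
    (hg : MemLp (fun y : ℝ × α => g y.1 y.2) 2 ((volume.restrict (Ioo 0 T)).prod μ))
    (hG : MemLp (fun y : ℝ × α => G y.1 y.2) 2 ((volume.restrict (Ioo 0 T)).prod μ))
    (hw0 : MemLp (w 0) 2 μ)
    (hw : ∀ t ∈ Icc 0 T, ∀ᵐ x ∂μ, w t x = w 0 x + ∫ s in (0 : ℝ)..t, g s x)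
    (hgi : ∀ t ∈ Icc 0 T, MemLp (fun x => ∫ s in (0 : ℝ)..t, g s x) 2 μ)
    (h : ∀ᵐ s ∂(volume.restrict (Ioo 0 T)), ∀ᵐ t ∂(volume.restrict (Ioo 0 T)),
      ∫ x, inner ℝ (G s x) (w t x) ∂μ = 0) :
    ∀ᵐ s ∂(volume.restrict (Ioo 0 T)), ∫ x, inner ℝ (G s x) (g s x) ∂μ = 0 := by
  have hg' := MemLp_prod_section (by simp) (by simp) hg
  have hG' := MemLp_prod_section (by simp) (by simp) hG
  -- For fixed `e` in `S` the function `t ↦ ∫ ⟪e, w t⟫` is absolutely continuous and zero, so its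
  -- derivative `∫ ⟪e, g s⟫` is zero for almost every `s`. Separability makes the null set
  -- independent of `e`, and then `e` may be taken to be `G s` at the same time `s`.
  let S : Set (Lp V 2 μ) :=
    {e | ∀ᵐ t ∂(volume.restrict (Ioo 0 T)), ∫ x, inner ℝ (e x) (w t x) ∂μ = 0}
  have key : ∀ᵐ s ∂(volume.restrict (Ioo 0 T)), ∀ e : S, ∫ x, inner ℝ (e.1 x) (g s x) ∂μ = 0 := by
    refine ae_forall_of_forall_ae ?_ ?_
    · filter_upwards [hg'] with t ht
      have e : ∀ f : S, ∫ x, inner ℝ (f.1 x) (g t x) ∂μ = inner ℝ f.1 (ht.toLp (g t)) := by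
        intro f
        rw [integral_inner_eq_inner_toLp (Lp.memLp f.1) ht, Lp.toLp_coeFn]
      simp only [e]
      exact isClosed_eq (by fun_prop) continuous_const
    · rintro ⟨e, he⟩
      obtain ⟨hi, hs⟩ := integral_inner_primitive (Lp.memLp e) hg
      have hk : IntegrableOn (fun s => ∫ x, inner ℝ (e x) (g s x) ∂μ) (Ioo 0 T) :=
        hi.integral_prod_left
      have hwt : ∀ t ∈ Icc 0 T, ∫ x, inner ℝ (e x) (w t x) ∂μ = ∫ x, inner ℝ (e x) (w 0 x) ∂μ
          + ∫ s in (0 : ℝ)..t, ∫ x, inner ℝ (e x) (g s x) ∂μ := by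
        intro t ht
        rw [← hs t ht, ← integral_add (MemLp.integrable_inner_two (Lp.memLp e) hw0)
          (MemLp.integrable_inner_two (Lp.memLp e) (hgi t ht))]
        refine integral_congr_ae ?_
        filter_upwards [hw t ht] with x hx
        rw [hx, inner_add_right]
      have hcont : ContinuousOn (fun t => ∫ x, inner ℝ (e x) (w 0 x) ∂μ
          + ∫ s in (0 : ℝ)..t, ∫ x, inner ℝ (e x) (g s x) ∂μ) (Icc 0 T) :=
        continuousOn_const.add (continuousOn_primitive_Icc hk)
      have hz : EqOn (fun t => ∫ x, inner ℝ (e x) (w 0 x) ∂μ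
          + ∫ s in (0 : ℝ)..t, ∫ x, inner ℝ (e x) (g s x) ∂μ) (fun _ => (0 : ℝ)) (Icc 0 T) := by
        refine Measure.eqOn_Icc_of_ae_eq volume hT.ne ?_ hcont continuousOn_const
        rw [← restrict_Ioo_eq_restrict_Icc]
        filter_upwards [he, ae_restrict_mem measurableSet_Ioo] with t ht hmem
        rw [← hwt t (Ioo_subset_Icc_self hmem), ht]
      have h0 : ∫ x, inner ℝ (e x) (w 0 x) ∂μ = 0 := by
        have := hz (left_mem_Icc.2 hT.le)
        simpa using this
      refine ae_eq_zero_of_primitive_eq_zero hk fun t ht => ?_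
      have := hz (Ioo_subset_Icc_self ht)
      simpa [h0] using this
  filter_upwards [key, hG', h] with s h1 h2 h3
  have hmem : h2.toLp (G s) ∈ S := by
    filter_upwards [h3] with t ht
    rw [← ht]
    refine integral_congr_ae ?_
    filter_upwards [h2.coeFn_toLp] with x hx
    rw [hx]
  rw [← h1 ⟨_, hmem⟩]
  refine integral_congr_ae ?_
  filter_upwards [h2.coeFn_toLp] with x hx
  rw [hx]

end Exchange

/-! ### Mollification in `L^q` of the whole space. -/

section Mollify

open Convolution ContinuousLinearMap

/-- Mollifications of `a` converge to `a` almost everywhere, and each of their values is an integral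
of `a` against a nonnegative smooth bump. -/
theorem ae_nonneg_of_integral_mul_nonneg {a : E n → ℝ} (ha : Integrable a)
    (h : ∀ χ : E n → ℝ, ContDiff ℝ ∞ χ → HasCompactSupport χ → (∀ x, 0 ≤ χ x) →
      0 ≤ ∫ x, χ x * a x) : ∀ᵐ x, 0 ≤ a x := by
  let B : ℕ → ContDiffBump (0 : E n) := fun k =>
    ⟨1 / (k + 1 : ℝ) / 2, 1 / (k + 1 : ℝ), by positivity, half_lt_self (by positivity)⟩
  have h1 := ContDiffBump.ae_convolution_tendsto_right_of_locallyIntegrable (φ := B) (K := 2)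
    (l := atTop) (μ := volume) tendsto_one_div_add_atTop_nhds_zero_nat
    (Eventually.of_forall fun k => le_of_eq (by simp only [B]; ring)) ha.locallyIntegrable
  filter_upwards [h1] with x hx
  refine ge_of_tendsto' hx fun k => ?_
  rw [convolution_lsmul_swap]
  have := h (fun t => (B k).normed volume (x - t))
    ((B k).contDiff_normed.comp (contDiff_const.sub contDiff_id))
    ((B k).hasCompactSupport_normed.comp_homeomorph (Homeomorph.subLeft x))
    (fun t => (B k).nonneg_normed _)
  simpa using this

/-- Continuity of translations in `L^q`, from the continuity of composition with measure preserving
maps. -/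
theorem tendsto_eLpNorm_translate {F : Type*} [NormedAddCommGroup F] {q : ℝ≥0∞} [Fact (1 ≤ q)]
    (hq : q ≠ ⊤) {f : E n → F} (hf : MemLp f q) :
    Tendsto (fun y : E n => eLpNorm (fun x => f (x - y) - f x) q) (𝓝 0) (𝓝 0) := by
  let g : E n → C(E n, E n) := fun y => ⟨fun x => x - y, by fun_prop⟩
  have hgc : Continuous g := by
    have : Continuous (fun p : E n × E n => p.2 - p.1) := by fun_prop
    exact (ContinuousMap.curry ⟨_, this⟩).continuous
  have hgm : ∀ y, MeasurePreserving (g y) volume volume := fun y => measurePreserving_sub_right _ y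
  have hg0 : g 0 = ContinuousMap.id _ := by ext x; simp [g]
  have t : Tendsto (fun y => Lp.compMeasurePreserving (g y) (hgm y) (hf.toLp f)) (𝓝 0)
      (𝓝 (Lp.compMeasurePreserving (g 0) (hgm 0) (hf.toLp f))) :=
    Filter.Tendsto.compMeasurePreservingLp tendsto_const_nhds (hgc.tendsto 0) hgm (hgm 0) hq
  rw [Lp.tendsto_Lp_iff_tendsto_eLpNorm'] at t
  refine t.congr fun y => eLpNorm_congr_ae ?_
  have e1 : ∀ y, (Lp.compMeasurePreserving (g y) (hgm y) (hf.toLp f) : E n → F) =ᵐ[volume]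
      fun x => f (x - y) := by
    intro y
    refine (Lp.coeFn_compMeasurePreserving _ (hgm y)).trans ?_
    exact (hgm y).quasiMeasurePreserving.ae_eq_comp hf.coeFn_toLp
  filter_upwards [e1 y, e1 0] with x h1 h2
  rw [Pi.sub_apply, h1, h2, sub_zero]

/-- The difference is an average of the functions `f (· - y) - f` with respect to the probability
measure with density `ρ`. Comparing the `L¹` and `L^q` norms for this measure and applying Tonelli
bounds it by the largest of their norms. Kernels need not be centred at zero, which the one-sided
mollification exploits. -/
theorem eLpNorm_convolution_sub_le {q : ℝ≥0∞} [Fact (1 ≤ q)] (hq : q ≠ ⊤) {f : E n → ℝ}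
    (hf : MemLp f q) {ρ : E n → ℝ} (hρ : Continuous ρ) (hc : HasCompactSupport ρ)
    (h0 : ∀ x, 0 ≤ ρ x) (h1 : ∫ x, ρ x = 1) {r : ℝ} (hr : tsupport ρ ⊆ Metric.closedBall 0 r)
    {ε : ℝ≥0∞}
    (hε : ∀ y ∈ Metric.closedBall (0 : E n) r, eLpNorm (fun x => f (x - y) - f x) q ≤ ε) :
    eLpNorm (fun x => (ρ ⋆[lsmul ℝ ℝ, volume] f) x - f x) q ≤ ε := by
  have hq1 : 1 ≤ q := Fact.out
  have hq0 : q ≠ 0 := (one_pos.trans_le hq1).ne'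
  have hqr : 0 < q.toReal := ENNReal.toReal_pos hq0 hq
  -- A strongly measurable version makes `f (x - y)` jointly measurable; convolution and translates
  -- do not see the change.
  wlog hfm : StronglyMeasurable f generalizing f
  · have e : f =ᵐ[volume] hf.1.mk f := hf.1.ae_eq_mk
    have e2 : ∀ y, (fun x => f (x - y) - f x) =ᵐ[volume]
        fun x => hf.1.mk f (x - y) - hf.1.mk f x := by
      intro y
      filter_upwards [e, (measurePreserving_sub_right volume y).quasiMeasurePreserving.ae e]
        with x hx hx'
      rw [hx, hx']
    have := this ((memLp_congr_ae e).1 hf) (fun y hy => by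
      rw [← eLpNorm_congr_ae (e2 y)]; exact hε y hy) hf.1.stronglyMeasurable_mk
    rw [← convolution_congr (lsmul ℝ ℝ) (ae_eq_refl ρ) e] at this
    refine (eLpNorm_congr_ae ?_).trans_le this
    filter_upwards [e] with x hx
    rw [hx]
  have hloc : LocallyIntegrable f := hf.locallyIntegrable hq1
  have hρi : Integrable ρ := hρ.integrable_of_hasCompactSupport hc
  set P : Measure (E n) := volume.withDensity fun y => ENNReal.ofReal (ρ y)
  have hρm : Measurable fun y => ENNReal.ofReal (ρ y) := hρ.measurable.ennreal_ofReal
  have hP : IsProbabilityMeasure P := ⟨by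
    rw [withDensity_apply _ MeasurableSet.univ, Measure.restrict_univ,
      ← ofReal_integral_eq_lintegral_ofReal hρi (ae_of_all _ h0), h1, ENNReal.ofReal_one]⟩
  set k : E n → E n → ℝ := fun x y => f (x - y) - f x
  have hkm : Measurable (Function.uncurry k) := by
    have := hfm.measurable
    fun_prop
  have hpt : ∀ x, ‖(ρ ⋆[lsmul ℝ ℝ, volume] f) x - f x‖ₑ ^ q.toReal
      ≤ ∫⁻ y, ‖k x y‖ₑ ^ q.toReal ∂P := by
    intro x
    have hex : Integrable (fun y => ρ y * f (x - y)) := by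
      have := hc.convolutionExists_left (lsmul ℝ ℝ) hρ hloc x (μ := volume)
      simpa [ConvolutionExistsAt] using this
    have e1 : (ρ ⋆[lsmul ℝ ℝ, volume] f) x - f x = ∫ y, ρ y * k x y := by
      rw [convolution_lsmul]
      simp only [k, mul_sub, smul_eq_mul]
      rw [integral_sub hex (hρi.mul_const _), integral_mul_const, h1, one_mul]
    have e2 : ‖(ρ ⋆[lsmul ℝ ℝ, volume] f) x - f x‖ₑ ≤ ∫⁻ y, ‖k x y‖ₑ ∂P := by
      rw [e1]
      refine (enorm_integral_le_lintegral_enorm _).trans (le_of_eq ?_)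
      rw [lintegral_withDensity_eq_lintegral_mul _ hρm (by
        have : Measurable (k x) := hkm.comp measurable_prodMk_left
        fun_prop)]
      refine lintegral_congr fun y => ?_
      rw [Pi.mul_apply, enorm_mul, Real.enorm_of_nonneg (h0 y)]
    have e3 : eLpNorm (k x) 1 P ≤ eLpNorm (k x) q P :=
      eLpNorm_le_eLpNorm_of_exponent_le hq1 (by
        have : Measurable (k x) := hkm.comp measurable_prodMk_left
        exact this.aestronglyMeasurable)
    rw [eLpNorm_one_eq_lintegral_enorm] at e3
    refine (ENNReal.rpow_le_rpow (e2.trans e3) hqr.le).trans (le_of_eq ?_)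
    rw [eLpNorm_eq_lintegral_rpow_enorm_toReal hq0 hq, ← ENNReal.rpow_mul,
      one_div_mul_cancel hqr.ne', ENNReal.rpow_one]
  rw [eLpNorm_eq_lintegral_rpow_enorm_toReal hq0 hq, one_div, ENNReal.rpow_inv_le_iff hqr]
  calc ∫⁻ x, ‖(ρ ⋆[lsmul ℝ ℝ, volume] f) x - f x‖ₑ ^ q.toReal
      ≤ ∫⁻ x, ∫⁻ y, ‖k x y‖ₑ ^ q.toReal ∂P := lintegral_mono hpt
    _ = ∫⁻ y, (∫⁻ x, ‖k x y‖ₑ ^ q.toReal) ∂P := by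
        rw [lintegral_lintegral_swap]
        have : Measurable fun z : E n × E n => ‖Function.uncurry k z‖ₑ ^ q.toReal := by fun_prop
        exact this.aemeasurable
    _ ≤ ∫⁻ y, ε ^ q.toReal ∂P := by
        refine lintegral_mono_ae ?_
        have hsup : ∀ᵐ y ∂P, y ∈ Metric.closedBall (0 : E n) r := by
          rw [ae_withDensity_iff hρm]
          refine ae_of_all _ fun y hy => hr (subset_tsupport _ fun h => hy (by simp [h]))
        filter_upwards [hsup] with y hy
        have := hε y hy
        rwa [eLpNorm_eq_lintegral_rpow_enorm_toReal hq0 hq, one_div,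
          ENNReal.rpow_inv_le_iff hqr] at this
    _ = ε ^ q.toReal := by simp

theorem tendsto_eLpNorm_convolution_sub {q : ℝ≥0∞} [Fact (1 ≤ q)] (hq : q ≠ ⊤) {f : E n → ℝ}
    (hf : MemLp f q) {ρ : ℕ → E n → ℝ} (hρ : ∀ k, Continuous (ρ k))
    (hc : ∀ k, HasCompactSupport (ρ k))
    (h0 : ∀ k x, 0 ≤ ρ k x) (h1 : ∀ k, ∫ x, ρ k x = 1) {r : ℕ → ℝ}
    (hr : ∀ k, tsupport (ρ k) ⊆ Metric.closedBall 0 (r k)) (hr0 : Tendsto r atTop (𝓝 0)) :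
    Tendsto (fun k => eLpNorm (fun x => (ρ k ⋆[lsmul ℝ ℝ, volume] f) x - f x) q) atTop (𝓝 0) := by
  rw [ENNReal.tendsto_nhds_zero]
  intro ε hε
  have h2 := (ENNReal.tendsto_nhds_zero.1 (tendsto_eLpNorm_translate hq hf)) ε hε
  obtain ⟨δ, hδ, hb⟩ := Metric.eventually_nhds_iff_ball.1 h2
  filter_upwards [hr0.eventually (gt_mem_nhds hδ)] with k hk
  exact eLpNorm_convolution_sub_le hq hf (hρ k) (hc k) (h0 k) (h1 k) (hr k) fun y hy =>
    hb y (Metric.closedBall_subset_ball hk hy)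

theorem fderiv_convolution_apply {f ρ : E n → ℝ} (hf : LocallyIntegrable f)
    (hρ : ContDiff ℝ ∞ ρ) (hc : HasCompactSupport ρ) (x v : E n) :
    fderiv ℝ (ρ ⋆[lsmul ℝ ℝ, volume] f) x v = ∫ y, fderiv ℝ ρ (x - y) v * f y := by
  have h := hc.hasFDerivAt_convolution_left (lsmul ℝ ℝ) (hρ.of_le (by simp)) hf x (μ := volume)
  have hex : ConvolutionExistsAt (fderiv ℝ ρ) f x (precompL (E n) (lsmul ℝ ℝ)) volume :=
    (hc.fderiv ℝ).convolutionExists_left _ (hρ.continuous_fderiv (by simp)) hf x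
  rw [h.fderiv, convolution_eq_swap, integral_apply hex.integrable_swap]
  rfl

end Mollify

/-! ### Geometry of Lipschitz domains: interior cones and coordinates along a direction. -/

section Geometry

/-- Uniform interior cone condition for the points of `closure Ω` near `x₀`. -/
structure HasCone (Ω : Set (E n)) (x₀ : E n) (ρ : ℝ) (v₀ : E n) (c : ℝ) : Prop where
  radius_pos : 0 < ρ
  aperture_pos : 0 < c
  mem : ∀ x ∈ closure Ω, x ∈ Metric.ball x₀ ρ → ∀ τ ∈ Ioc (0 : ℝ) 1, ∀ v ∈ Metric.closedBall v₀ c,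
    x + τ • v ∈ Ω

/-- Projection to the orthogonal complement of the line spanned by a unit vector. -/
def perp (e y : E n) : E n := y - (inner ℝ e y : ℝ) • e

theorem perp_add (e x y : E n) : perp e (x + y) = perp e x + perp e y := by
  simp only [perp, inner_add_right, add_smul]; abel

theorem perp_smul (e : E n) (a : ℝ) (y : E n) : perp e (a • y) = a • perp e y := by
  simp only [perp, inner_smul_right, smul_sub, smul_smul]

theorem inner_perp {e : E n} (he : ‖e‖ = 1) (y : E n) : inner ℝ e (perp e y) = (0 : ℝ) := by
  simp [perp, inner_sub_right, inner_smul_right, he]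

theorem perp_self {e : E n} (he : ‖e‖ = 1) : perp e e = 0 := by
  simp [perp, he]

theorem norm_perp_le {e : E n} (he : ‖e‖ = 1) (y : E n) : ‖perp e y‖ ≤ ‖y‖ := by
  have h : ‖y‖ ^ 2 = ‖perp e y‖ ^ 2 + (inner ℝ e y : ℝ) ^ 2 := by
    have hy : y = perp e y + (inner ℝ e y : ℝ) • e := by simp [perp]
    conv_lhs => rw [hy]
    rw [norm_add_sq_real, inner_smul_right, real_inner_comm e (perp e y), inner_perp he, norm_smul, he]
    simp
  nlinarith [sq_nonneg (inner ℝ e y : ℝ), norm_nonneg y, norm_nonneg (perp e y)]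

theorem continuous_perp (e : E n) : Continuous (perp e) := by unfold perp; fun_prop

theorem le_inner_of_mem_closure {Ω : Set (E n)} {e x₀ : E n} {γ : E n → ℝ} {r : ℝ}
    (hγ : Continuous γ)
    (hg : ∀ y ∈ Metric.ball x₀ r, (y ∈ Ω ↔ γ (perp e y) < inner ℝ e y)) {x : E n}
    (hx : x ∈ closure Ω) (hxb : x ∈ Metric.ball x₀ r) : γ (perp e x) ≤ inner ℝ e x := by
  have h1 : x ∈ closure (Metric.ball x₀ r ∩ Ω) := Metric.isOpen_ball.inter_closure ⟨hxb, hx⟩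
  have hc : IsClosed {y : E n | γ (perp e y) ≤ inner ℝ e y} :=
    isClosed_le (hγ.comp (continuous_perp e)) (by fun_prop)
  exact closure_minimal (fun y hy => ((hg y hy.1).1 hy.2).le) hc h1

/-- Near an interior point a small ball of directions suffices. Near a boundary point the cone is
built around the graph direction `e`: moving by `τ • ((r / 4) • e + u)` raises the height along `e`
by at least `τ * (r / 4 - c)`, and the graph by at most `K * τ * c`. -/
theorem exists_cone {Ω : Set (E n)} (hΩ : IsLipschitzDomain Ω) {x₀ : E n} (hx₀ : x₀ ∈ closure Ω) :
    ∃ ρ v₀ c, HasCone Ω x₀ ρ v₀ c := by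
  by_cases hin : x₀ ∈ Ω
  · obtain ⟨ε, hε, hb⟩ := Metric.isOpen_iff.1 hΩ.isOpen x₀ hin
    refine ⟨ε / 2, 0, ε / 3, by positivity, by positivity, fun x _ hx τ hτ v hv => hb ?_⟩
    rw [mem_closedBall_zero_iff] at hv
    rw [Metric.mem_ball, dist_eq_norm] at hx ⊢
    calc ‖x + τ • v - x₀‖ = ‖(x - x₀) + τ • v‖ := by congr 1; abel
      _ ≤ ‖x - x₀‖ + ‖τ • v‖ := norm_add_le _ _
      _ < ε := by
        rw [norm_smul, Real.norm_of_nonneg hτ.1.le]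
        nlinarith [mul_le_mul hτ.2 hv (norm_nonneg _) zero_le_one]
  · have hfr : x₀ ∈ frontier Ω := by rw [hΩ.isOpen.frontier_eq]; exact ⟨hx₀, hin⟩
    obtain ⟨e, γ, K, r, he, hγ, hr, hg⟩ := hΩ.graph x₀ hfr
    -- With `c * (K + 2) = r / 4` the gain `r / 4 - c = (K + 1) * c` exceeds the rise `K * c` of the
    -- graph.
    set c : ℝ := r / 4 / (K + 2)
    have hK : (0 : ℝ) ≤ K := K.2
    have hc : 0 < c := by positivity
    have hcK : c * (K + 2) = r / 4 := div_mul_cancel₀ _ (by positivity)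
    refine ⟨r / 2, (r / 4) • e, c, by positivity, hc, fun x hxc hx τ hτ v hv => ?_⟩
    obtain ⟨u, hu, rfl⟩ : ∃ u, ‖u‖ ≤ c ∧ v = (r / 4) • e + u :=
      ⟨v - (r / 4) • e, by rwa [Metric.mem_closedBall, dist_eq_norm] at hv, by abel⟩
    have hxr : x ∈ Metric.ball x₀ r := Metric.ball_subset_ball (by linarith) hx
    have h1 : ‖(r / 4) • e + u‖ ≤ r / 4 + c := by
      refine (norm_add_le _ _).trans ?_
      rw [norm_smul, he, Real.norm_of_nonneg (by positivity)]
      linarith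
    have hmem : x + τ • ((r / 4) • e + u) ∈ Metric.ball x₀ r := by
      rw [Metric.mem_ball, dist_eq_norm] at hx ⊢
      calc ‖x + τ • ((r / 4) • e + u) - x₀‖ = ‖(x - x₀) + τ • ((r / 4) • e + u)‖ := by
            congr 1; abel
        _ ≤ ‖x - x₀‖ + ‖τ • ((r / 4) • e + u)‖ := norm_add_le _ _
        _ < r := by
          rw [norm_smul, Real.norm_of_nonneg hτ.1.le]
          have : τ * ‖(r / 4) • e + u‖ ≤ 1 * (r / 4 + c) :=
            mul_le_mul hτ.2 h1 (norm_nonneg _) zero_le_one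
          nlinarith
    have h0 := le_inner_of_mem_closure hγ.continuous hg hxc hxr
    refine (hg _ hmem).2 ?_
    change γ (perp e (x + τ • ((r / 4) • e + u))) < _
    have e1 : perp e (x + τ • ((r / 4) • e + u)) = perp e x + τ • perp e u := by
      rw [perp_add, perp_smul, perp_add, perp_smul, perp_self he, smul_zero, zero_add]
    have e2 : γ (perp e x + τ • perp e u) ≤ γ (perp e x) + K * (τ * c) := by
      have := hγ.dist_le_mul (perp e x + τ • perp e u) (perp e x)
      rw [Real.dist_eq, dist_eq_norm, add_sub_cancel_left, norm_smul,
        Real.norm_of_nonneg hτ.1.le] at this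
      have h2 := (abs_le.1 this).2
      have h3 : τ * ‖perp e u‖ ≤ τ * c :=
        mul_le_mul_of_nonneg_left ((norm_perp_le he u).trans hu) hτ.1.le
      nlinarith [mul_le_mul_of_nonneg_left h3 hK]
    have e3 : inner ℝ e (x + τ • ((r / 4) • e + u)) ≥ inner ℝ e x + τ * (r / 4 - c) := by
      rw [inner_add_right, inner_smul_right, inner_add_right, inner_smul_right,
        real_inner_self_eq_norm_sq, he]
      have : -c ≤ inner ℝ e u := by
        have := abs_real_inner_le_norm e u
        rw [he, one_mul] at this
        linarith [(abs_le.1 (this.trans hu)).1]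
      nlinarith [mul_le_mul_of_nonneg_left this hτ.1.le]
    rw [e1]
    nlinarith [mul_pos hτ.1 hc]

/-! ### Integration along lines in a fixed direction -/

variable {e : E n}

/-- The hyperplane orthogonal to `e`. -/
abbrev Hyper (e : E n) : Submodule ℝ (E n) := (ℝ ∙ e)ᗮ

theorem inner_coe_hyper (y : Hyper e) : inner ℝ e (y : E n) = (0 : ℝ) :=
  Submodule.mem_orthogonal_singleton_iff_inner_right.1 y.2

/-- Coordinates along `e` and the hyperplane orthogonal to it. -/
def lineMap (e : E n) (q : Hyper e × ℝ) : E n := (q.1 : E n) + q.2 • e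

/-- The map is the inverse of the orthogonal decomposition along `e`, after `ℝ ∙ e` is identified
with the real line; each factor preserves volume. -/
theorem measurePreserving_lineMap (he : ‖e‖ = 1) :
    MeasurePreserving (lineMap e) (volume.prod volume) volume := by
  have h1 : MeasurePreserving (Prod.swap : Hyper e × ℝ → ℝ × Hyper e) (volume.prod volume)
      (volume.prod volume) := Measure.measurePreserving_swap
  let I : ℝ ≃ₗᵢ[ℝ] (ℝ ∙ e : Submodule ℝ (E n)) :=
    LinearIsometryEquiv.toSpanUnitSingleton (𝕜 := ℝ) e he
  have h2 : MeasurePreserving (Prod.map I (id : Hyper e → Hyper e))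
      (volume.prod volume) (volume.prod volume) :=
    I.measurePreserving.prod (MeasurePreserving.id _)
  have h3 : MeasurePreserving (WithLp.toLp 2 : (ℝ ∙ e) × Hyper e → WithLp 2 ((ℝ ∙ e) × Hyper e))
      (volume.prod volume) volume := WithLp.volume_preserving_toLp (ℝ ∙ e) (Hyper e)
  have h4 := (ℝ ∙ e).orthogonalDecomposition.symm.measurePreserving
  have e1 : lineMap e = (ℝ ∙ e).orthogonalDecomposition.symm ∘ WithLp.toLp 2 ∘
      Prod.map I id ∘ Prod.swap := by
    funext q
    have hI : ((I q.2 : (ℝ ∙ e : Submodule ℝ (E n))) : E n) = q.2 • e := rfl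
    have h5 : (ℝ ∙ e).orthogonalDecomposition.symm (WithLp.toLp 2 (I q.2, q.1))
        = (I q.2 : E n) + q.1 := rfl
    change _ = (ℝ ∙ e).orthogonalDecomposition.symm (WithLp.toLp 2 (I q.2, q.1))
    rw [h5, hI, lineMap, add_comm]
  rw [e1]
  exact h4.comp (h3.comp (h2.comp h1))

theorem continuous_lineMap : Continuous (lineMap e) := by unfold lineMap; fun_prop

theorem measurableEmbedding_lineMap (he : ‖e‖ = 1) : MeasurableEmbedding (lineMap e) := by
  refine (continuous_lineMap (e := e)).measurableEmbedding ?_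
  intro p q h
  simp only [lineMap] at h
  have h1 := congrArg (fun z => (inner ℝ e z : ℝ)) h
  simp only [inner_add_right, inner_coe_hyper, inner_smul_right, real_inner_self_eq_norm_sq,
    he] at h1
  have h2 : p.2 = q.2 := by linarith
  rw [h2] at h
  exact Prod.ext (Subtype.ext (add_right_cancel h)) h2

theorem perp_lineMap (he : ‖e‖ = 1) (q : Hyper e × ℝ) : perp e (lineMap e q) = q.1 := by
  simp [perp, lineMap, inner_add_right, inner_coe_hyper, inner_smul_right,
    he]

theorem inner_lineMap (he : ‖e‖ = 1) (q : Hyper e × ℝ) : inner ℝ e (lineMap e q) = q.2 := by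
  simp [lineMap, inner_add_right, inner_coe_hyper, inner_smul_right,
    he]

/-- Projection to the hyperplane orthogonal to `e`. -/
def toHyper (he : ‖e‖ = 1) (y : E n) : Hyper e :=
  ⟨perp e y, Submodule.mem_orthogonal_singleton_iff_inner_right.2 (inner_perp he y)⟩

theorem toHyper_lineMap (he : ‖e‖ = 1) (q : Hyper e × ℝ) : toHyper he (lineMap e q) = q.1 :=
  Subtype.ext (perp_lineMap he q)

theorem norm_coe_hyper_le (he : ‖e‖ = 1) (q : Hyper e × ℝ) : ‖q.1‖ ≤ ‖lineMap e q‖ := by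
  have := norm_perp_le he (lineMap e q)
  rwa [perp_lineMap he] at this

/-- Differentiation under the integral: for `|h| < 1` the derivatives of the translates are bounded
and vanish outside one ball. Nothing is required of `U`. -/
theorem hasDerivAt_integral_translate {U : Set (E n)} {w : E n → ℝ}
    (hw : ContDiff ℝ 1 w) (hc : HasCompactSupport w) (v : E n) :
    HasDerivAt (fun h : ℝ => ∫ z in U, w (z + h • v)) (∫ z in U, fderiv ℝ w z v) 0 := by
  have hd : Continuous fun z => fderiv ℝ w z v :=
    (hw.continuous_fderiv (by simp)).clm_apply continuous_const
  have hdc : HasCompactSupport fun z => fderiv ℝ w z v := hc.fderiv_apply ℝ v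
  obtain ⟨M, hM⟩ := hdc.exists_bound_of_continuous hd
  obtain ⟨R, hR⟩ := hc.isCompact.isBounded.subset_closedBall 0
  have hderiv : ∀ z h, HasDerivAt (fun h : ℝ => w (z + h • v)) (fderiv ℝ w (z + h • v) v) h := by
    intro z h
    have h1 : HasDerivAt (fun h : ℝ => z + h • v) v h := by
      simpa using ((hasDerivAt_id h).smul_const v).const_add z
    exact ((hw.differentiable (by simp)) (z + h • v)).hasFDerivAt.comp_hasDerivAt h h1
  have := (hasDerivAt_integral_of_dominated_loc_of_deriv_le (μ := volume.restrict U)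
    (F := fun h z => w (z + h • v)) (F' := fun h z => fderiv ℝ w (z + h • v) v) (x₀ := (0 : ℝ))
    (s := Metric.ball 0 1) (bound := (Metric.closedBall 0 (R + ‖v‖)).indicator fun _ => M)
    (Metric.ball_mem_nhds _ one_pos)
    (Eventually.of_forall fun h => (hw.continuous.comp (by fun_prop)).aestronglyMeasurable)
    ?_ ?_ ?_ ?_ (ae_of_all _ fun z h _ => hderiv z h)).2
  · simpa using this
  · simpa using (hw.continuous.integrable_of_hasCompactSupport hc).restrict
  · simpa using hd.aestronglyMeasurable
  · refine ae_of_all _ fun z h hh => ?_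
    by_cases hz : z ∈ Metric.closedBall (0 : E n) (R + ‖v‖)
    · rw [indicator_of_mem hz]; exact hM _
    · rw [indicator_of_notMem hz]
      have : z + h • v ∉ tsupport fun z => fderiv ℝ w z v := by
        intro hmem
        have h1 := hR (tsupport_fderiv_apply_subset ℝ v hmem)
        rw [mem_closedBall_zero_iff] at h1 hz
        apply hz
        rw [mem_ball_zero_iff, Real.norm_eq_abs] at hh
        calc ‖z‖ = ‖(z + h • v) - h • v‖ := by congr 1; abel
          _ ≤ ‖z + h • v‖ + ‖h • v‖ := norm_sub_le _ _
          _ ≤ R + ‖v‖ := by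
            rw [norm_smul, Real.norm_eq_abs]
            nlinarith [norm_nonneg v]
      rw [show fderiv ℝ w (z + h • v) v = 0 from
          image_eq_zero_of_notMem_tsupport (f := fun z => fderiv ℝ w z v) this, norm_zero]
  · refine Integrable.integrableOn ?_
    rw [integrable_indicator_iff Metric.isClosed_closedBall.measurableSet]
    exact integrableOn_const (measure_closedBall_lt_top.ne)

theorem hasDerivAt_integral_Ioi {g : ℝ → ℝ} (hg : Continuous g) (hi : Integrable g) (τ : ℝ) :
    HasDerivAt (fun τ => ∫ s in Ioi τ, g s) (-g τ) τ := by
  have e : (fun τ => ∫ s in Ioi τ, g s) = fun τ => (∫ s in Ioi (0 : ℝ), g s) - ∫ s in (0 : ℝ)..τ, g s := by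
    ext τ
    rw [← intervalIntegral.integral_Ioi_sub_Ioi' hi.integrableOn hi.integrableOn]
    ring
  rw [e]
  have := (intervalIntegral.integral_hasDerivAt_right (hi.intervalIntegrable (a := 0) (b := τ))
    hg.stronglyMeasurable.stronglyMeasurableAtFilter hg.continuousAt).const_sub
      (∫ s in Ioi (0 : ℝ), g s)
  exact this

end Geometry

/-! ### The Gauss-Green formula over a Lipschitz epigraph, and its normal. -/

section LocalBoundary

/-- `m` is a measure on the boundary of `Ω`, comparable with the surface measure in `B`, and `N` is an
outer normal field, such that the Gauss-Green formula holds for functions supported in `B`. -/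
structure BoundaryMeasure (Ω B : Set (E n)) (m : Measure (E n)) (N : E n → E n) : Prop where
  finite : IsFiniteMeasure m
  le_surf : ∃ C : ℝ≥0, m ≤ C • surf (frontier Ω)
  surf_le : ∃ C : ℝ≥0, (surf (frontier Ω)).restrict B ≤ C • m
  measurable : AEStronglyMeasurable N m
  normal : ∀ᵐ x ∂m, IsOuterNormal Ω x (N x)
  gauss_green : ∀ w : E n → ℝ, ContDiff ℝ 1 w → HasCompactSupport w → tsupport w ⊆ B → ∀ v : E n,
    ∫ x in Ω, fderiv ℝ w x v = ∫ x, w x * inner ℝ (N x) v ∂m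

variable {e : E n}

/-- Both sides are the derivative at `h = 0` of `∫ z in U, w (z + h • v)`. Differentiating `w` gives
the left side. Moving the set instead of the function gives integrals over epigraphs of `τ h`, and
differentiating the lower limit on each line along `e` gives the right side; the derivative of the
graph function exists almost everywhere by Rademacher's theorem. -/
theorem integral_fderiv_epigraph (he : ‖e‖ = 1) {γ : E n → ℝ} {K : ℝ≥0} (hγ : LipschitzWith K γ)
    {w : E n → ℝ} (hw : ContDiff ℝ 1 w) (hc : HasCompactSupport w) (v : E n) :
    ∫ z in {z | γ (perp e z) < inner ℝ e z}, fderiv ℝ w z v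
      = ∫ y : Hyper e, w (lineMap e (y, γ y))
          * (fderiv ℝ (fun y : Hyper e => γ y) y (toHyper he v) - inner ℝ e v) := by
  set U : Set (E n) := {z | γ (perp e z) < inner ℝ e z}
  have hU : MeasurableSet U :=
    measurableSet_lt (hγ.continuous.measurable.comp (continuous_perp e).measurable)
      (by fun_prop)
  set Γ : Hyper e → ℝ := fun y => γ y
  have hΓ : LipschitzWith K Γ := LipschitzWith.of_dist_le_mul fun a b => hγ.dist_le_mul a b
  obtain ⟨M, hM⟩ := hc.exists_bound_of_continuous hw.continuous
  have hM0 : 0 ≤ M := (norm_nonneg _).trans (hM 0)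
  obtain ⟨R, hR⟩ := hc.isCompact.isBounded.subset_closedBall 0
  have hwi : Integrable w := hw.continuous.integrable_of_hasCompactSupport hc
  have hmp := measurePreserving_lineMap he
  have hme := measurableEmbedding_lineMap he
  have hwz : ∀ y : Hyper e, y ∉ Metric.closedBall (0 : Hyper e) R → ∀ s, w (lineMap e (y, s)) = 0 := by
    intro y hy s
    refine image_eq_zero_of_notMem_tsupport fun h => hy ?_
    have := hR h
    rw [mem_closedBall_zero_iff] at this ⊢
    exact (norm_coe_hyper_le he (y, s)).trans this
  have hline : ∀ y : Hyper e, Integrable fun s => w (lineMap e (y, s)) := by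
    intro y
    refine Continuous.integrable_of_hasCompactSupport
      (hw.continuous.comp (continuous_lineMap.comp (by fun_prop))) ?_
    refine HasCompactSupport.of_support_subset_isCompact (isCompact_closedBall (0 : ℝ) R)
      fun s hs => ?_
    have h1 := hR (subset_tsupport _ hs)
    rw [mem_closedBall_zero_iff] at h1 ⊢
    have h2 := abs_real_inner_le_norm e (lineMap e (y, s))
    rw [inner_lineMap he, he, one_mul] at h2
    exact h2.trans h1
  -- The graph function of `U` translated by `h • v`.
  set τ : ℝ → Hyper e → ℝ := fun h y => γ (y - h • perp e v) + h * inner ℝ e v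
  have hτc : ∀ h, Continuous (τ h) := fun h =>
    (hγ.continuous.comp (by fun_prop)).add continuous_const
  have hJ : ∀ h : ℝ, Integrable (fun q : Hyper e × ℝ => (Ioi (τ h q.1)).indicator
        (fun s => w (lineMap e (q.1, s))) q.2) (volume.prod volume) ∧
      ∫ z in U, w (z + h • v) = ∫ y : Hyper e, ∫ s in Ioi (τ h y), w (lineMap e (y, s)) := by
    intro h
    have e1 : ∀ q : Hyper e × ℝ, U.indicator (fun z => w (z + h • v)) (lineMap e q - h • v)
        = (Ioi (τ h q.1)).indicator (fun s => w (lineMap e (q.1, s))) q.2 := by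
      intro q
      have : lineMap e q - h • v ∈ U ↔ q.2 ∈ Ioi (τ h q.1) := by
        simp only [U, mem_ofPred_eq, mem_Ioi, τ]
        have h1 : perp e (lineMap e q - h • v) = q.1 - h • perp e v := by
          rw [sub_eq_add_neg, ← neg_smul, perp_add, perp_smul, perp_lineMap he, neg_smul,
            sub_eq_add_neg]
        rw [h1, inner_sub_right, inner_smul_right, inner_lineMap he, lt_sub_iff_add_lt]
      by_cases hq : q.2 ∈ Ioi (τ h q.1)
      · rw [indicator_of_mem hq, indicator_of_mem (this.2 hq), sub_add_cancel]
      · rw [indicator_of_notMem hq, indicator_of_notMem (fun hh => hq (this.1 hh))]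
    have hi : Integrable (fun z => U.indicator (fun z => w (z + h • v)) (z - h • v)) := by
      refine Integrable.comp_sub_right (f := U.indicator (fun z => w (z + h • v))) ?_ (h • v)
      exact (hwi.comp_add_right (h • v)).indicator hU
    have hi2 : Integrable (fun q : Hyper e × ℝ => (Ioi (τ h q.1)).indicator
        (fun s => w (lineMap e (q.1, s))) q.2) (volume.prod volume) := by
      have := (hmp.integrable_comp_emb hme).2 hi
      refine this.congr (ae_of_all _ fun q => ?_)
      exact e1 q
    refine ⟨hi2, ?_⟩
    rw [← integral_indicator hU, ← integral_sub_right_eq_self _ (h • v), ← hmp.integral_comp hme]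
    simp only [e1]
    rw [integral_prod _ hi2]
    refine integral_congr_ae (ae_of_all _ fun y => ?_)
    simp only
    rw [integral_indicator measurableSet_Ioi]
  have d1 := hasDerivAt_integral_translate (U := U) hw hc v
  simp only [fun h => (hJ h).2] at d1
  refine d1.unique ?_
  have hsec : ∀ h, (fun y : Hyper e => ∫ s in Ioi (τ h y), w (lineMap e (y, s)))
      = fun y => ∫ s, (Ioi (τ h y)).indicator (fun s => w (lineMap e (y, s))) s := by
    intro h; funext y; rw [integral_indicator measurableSet_Ioi]
  have hint : ∀ h, Integrable fun y : Hyper e => ∫ s in Ioi (τ h y), w (lineMap e (y, s)) := by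
    intro h; rw [hsec h]; exact (hJ h).1.integral_prod_left
  have hτ0 : ∀ y, τ 0 y = Γ y := fun y => by simp [τ, Γ]
  have hmeasd : Measurable fun y : Hyper e => fderiv ℝ Γ y (toHyper he v) :=
    measurable_fderiv_apply_const ℝ Γ _
  have hlm : Continuous fun y : Hyper e => lineMap e (y, γ y) :=
    continuous_lineMap.comp (continuous_id.prodMk (hγ.continuous.comp continuous_subtype_val))
  -- Only the variant with a Lipschitz bound applies: `h ↦ τ h y` is known to be Lipschitz, and for
  -- almost every `y` differentiable at `h = 0`, but not nearby.
  refine (hasDerivAt_integral_of_dominated_loc_of_lip (μ := volume)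
    (F := fun h (y : Hyper e) => ∫ s in Ioi (τ h y), w (lineMap e (y, s))) (x₀ := (0 : ℝ))
    (bound := (Metric.closedBall (0 : Hyper e) R).indicator fun _ => M * (K * ‖v‖ + ‖v‖))
    (s := univ) univ_mem (Eventually.of_forall fun h => (hint h).1) (hint 0) ?_ ?_ ?_ ?_).2
  · exact ((hw.continuous.comp hlm).measurable.mul
      (hmeasd.sub_const _)).aestronglyMeasurable
  · refine ae_of_all _ fun y => ?_
    by_cases hy : y ∈ Metric.closedBall (0 : Hyper e) R
    · rw [indicator_of_mem hy]
      refine LipschitzOnWith.of_dist_le_mul fun a _ b _ => ?_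
      have hb : 0 ≤ M * (K * ‖v‖ + ‖v‖) := by positivity
      rw [Real.dist_eq, Real.coe_nnabs, abs_of_nonneg hb,
        intervalIntegral.integral_Ioi_sub_Ioi' (hline y).integrableOn (hline y).integrableOn]
      have h1 : ‖∫ s in τ a y..τ b y, w (lineMap e (y, s))‖ ≤ M * |τ b y - τ a y| :=
        intervalIntegral.norm_integral_le_of_norm_le_const fun s _ => hM _
      rw [Real.norm_eq_abs] at h1
      refine h1.trans ?_
      rw [mul_assoc]
      refine mul_le_mul_of_nonneg_left ?_ hM0
      have h2 : |γ (y - b • perp e v) - γ (y - a • perp e v)| ≤ K * (|b - a| * ‖v‖) := by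
        have := hγ.dist_le_mul (y - b • perp e v) (y - a • perp e v)
        rw [Real.dist_eq, dist_eq_norm] at this
        refine this.trans (mul_le_mul_of_nonneg_left ?_ K.2)
        have e2 : (y : E n) - b • perp e v - (y - a • perp e v) = (a - b) • perp e v := by
          rw [sub_smul]; abel
        rw [e2, norm_smul, Real.norm_eq_abs, abs_sub_comm]
        exact mul_le_mul_of_nonneg_left (norm_perp_le he v) (abs_nonneg _)
      have h3 : |(inner ℝ e v : ℝ)| ≤ ‖v‖ := by
        have := abs_real_inner_le_norm e v
        rwa [he, one_mul] at this
      have e3 : τ b y - τ a y = (γ (y - b • perp e v) - γ (y - a • perp e v))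
          + (b - a) * inner ℝ e v := by simp only [τ]; ring
      rw [e3, dist_comm, Real.dist_eq]
      refine (abs_add_le _ _).trans ?_
      rw [abs_mul]
      nlinarith [abs_nonneg (b - a), mul_le_mul_of_nonneg_left h3 (abs_nonneg (b - a))]
    · rw [indicator_of_notMem hy]
      have : (fun h => ∫ s in Ioi (τ h y), w (lineMap e (y, s))) = fun _ => 0 := by
        funext h
        simp [hwz y hy]
      rw [this]
      exact LipschitzOnWith.of_dist_le_mul fun a _ b _ => by simp
  · rw [integrable_indicator_iff Metric.isClosed_closedBall.measurableSet]
    exact integrableOn_const (measure_closedBall_lt_top.ne)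
  · filter_upwards [hΓ.ae_differentiableAt] with y hy
    have h1 := hasDerivAt_integral_Ioi (hw.continuous.comp (continuous_lineMap.comp
      (continuous_const.prodMk continuous_id))) (hline y) (τ 0 y)
    have h2 : HasDerivAt (fun h => τ h y)
        (-(fderiv ℝ Γ y (toHyper he v)) + inner ℝ e v) 0 := by
      have h3 : HasDerivAt (fun h : ℝ => y - h • toHyper he v) (-toHyper he v) 0 := by
        simpa using ((hasDerivAt_id (0 : ℝ)).smul_const (toHyper he v)).const_sub y
      have h4 : HasFDerivAt Γ (fderiv ℝ Γ y) (y - (0 : ℝ) • toHyper he v) := by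
        simpa using hy.hasFDerivAt
      have h5 := h4.comp_hasDerivAt (0 : ℝ) h3
      have h6 : HasDerivAt (fun h : ℝ => h * inner ℝ e v) (inner ℝ e v) 0 := by
        simpa using (hasDerivAt_id (0 : ℝ)).mul_const (inner ℝ e v : ℝ)
      rw [map_neg] at h5
      exact h5.add h6
    have h7 := h1.comp (0 : ℝ) h2
    refine h7.congr_deriv ?_
    rw [hτ0]
    simp only [Function.comp, id]
    change -w (lineMap e (y, γ y)) * _ = _
    ring

/-- The hyperplane has dimension `n - 1`, where Lebesgue measure is Hausdorff measure up to a
factor; the factor is nonzero because Lebesgue measure is. Its value is irrelevant, as only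
two-sided comparison with `surf` is needed. -/
theorem exists_volume_hyper_eq (he : ‖e‖ = 1) : ∃ c : ℝ≥0, c ≠ 0 ∧
    (volume : Measure (Hyper e)) = c • (Measure.hausdorffMeasure ((n : ℝ) - 1)) := by
  have hne : e ≠ 0 := fun h => by simp [h] at he
  have hd : ((n : ℝ) - 1) = (Module.finrank ℝ (Hyper e) : ℕ) := by
    have h1 := (ℝ ∙ e).finrank_add_finrank_orthogonal
    rw [finrank_span_singleton hne, finrank_euclideanSpace_fin] at h1
    have : (n : ℝ) = 1 + (Module.finrank ℝ (Hyper e) : ℕ) := by exact_mod_cast h1.symm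
    rw [this]; ring
  have h2 := InnerProductSpace.euclideanHausdorffMeasure_eq_volume (V := Hyper e)
  rw [Measure.euclideanHausdorffMeasure_def] at h2
  rw [hd]
  refine ⟨_, ?_, h2.symm⟩
  intro h0
  rw [h0, zero_smul] at h2
  have h3 : (volume : Measure (Hyper e)) univ ≠ 0 := isOpen_univ.measure_ne_zero _ univ_nonempty
  rw [← h2] at h3
  simp at h3

/-- The normal of the graph of `γ` above `y`, not normalized and pointing downwards. -/
def graphNormal (e : E n) (γ : E n → ℝ) (y : Hyper e) : E n :=
  ((InnerProductSpace.toDual ℝ (Hyper e)).symm (fderiv ℝ (fun y : Hyper e => γ y) y) : Hyper e) - e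

/-- This is the factor in `integral_fderiv_epigraph`, which thereby becomes a flux through the
graph. -/
theorem inner_graphNormal (he : ‖e‖ = 1) (γ : E n → ℝ) (y : Hyper e) (v : E n) :
    inner ℝ (graphNormal e γ y) v
      = fderiv ℝ (fun y : Hyper e => γ y) y (toHyper he v) - inner ℝ e v := by
  rw [graphNormal, inner_sub_left]
  congr 1
  rw [← InnerProductSpace.toDual_symm_apply (𝕜 := ℝ) (E := Hyper e)]
  set g := (InnerProductSpace.toDual ℝ (Hyper e)).symm (fderiv ℝ (fun y : Hyper e => γ y) y)
  change inner ℝ (g : E n) v = inner ℝ (g : E n) (perp e v)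
  rw [perp, inner_sub_right, inner_smul_right, real_inner_comm e (g : E n), inner_coe_hyper]
  simp

/-- The component along `e` is `-1`. -/
theorem one_le_norm_graphNormal (he : ‖e‖ = 1) (γ : E n → ℝ) (y : Hyper e) :
    1 ≤ ‖graphNormal e γ y‖ := by
  have h1 := abs_real_inner_le_norm (graphNormal e γ y) e
  rw [inner_graphNormal he, he, mul_one, real_inner_self_eq_norm_sq, he] at h1
  have : toHyper he e = 0 := Subtype.ext (perp_self he)
  rw [this, map_zero] at h1
  simpa using h1

theorem norm_graphNormal_le (he : ‖e‖ = 1) {γ : E n → ℝ} {K : ℝ≥0} (hγ : LipschitzWith K γ)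
    (y : Hyper e) : ‖graphNormal e γ y‖ ≤ K + 1 := by
  have hΓ : LipschitzWith K (fun y : Hyper e => γ y) :=
    LipschitzWith.of_dist_le_mul fun a b => hγ.dist_le_mul a b
  refine (norm_sub_le _ _).trans ?_
  rw [he]
  gcongr
  change ‖(InnerProductSpace.toDual ℝ (Hyper e)).symm (fderiv ℝ (fun y : Hyper e => γ y) y)‖ ≤ _
  rw [LinearIsometryEquiv.norm_map]
  exact norm_fderiv_le_of_lipschitz ℝ hΓ

theorem measurable_graphNormal (γ : E n → ℝ) : Measurable (graphNormal e γ) := by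
  have h1 : Measurable fun y => fderiv ℝ (fun y : Hyper e => γ y) y := measurable_fderiv ℝ _
  have h2 := (InnerProductSpace.toDual ℝ (Hyper e)).symm.continuous.measurable.comp h1
  exact (measurable_subtype_coe.comp h2).sub_const e

/-- By first order expansion of `γ` at `y`, the height of `z` above the graph is `-⟪z - x, N⟫` up to
an error of at most `ε ‖z - x‖`. So the sign of the height is decided once the normalized product
exceeds `ε ‖z - x‖` in absolute value, because `‖N‖ ≥ 1`. -/
theorem isOuterNormal_graph {Ω : Set (E n)} (he : ‖e‖ = 1) {γ : E n → ℝ} {x₀ : E n} {r : ℝ}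
    (hg : ∀ y ∈ Metric.ball x₀ r, (y ∈ Ω ↔ γ (perp e y) < inner ℝ e y)) {y : Hyper e}
    (hy : DifferentiableAt ℝ (fun y : Hyper e => γ y) y)
    (hb : lineMap e (y, γ y) ∈ Metric.ball x₀ r) :
    IsOuterNormal Ω (lineMap e (y, γ y)) (‖graphNormal e γ y‖⁻¹ • graphNormal e γ y) := by
  set N := graphNormal e γ y
  have hN1 : 1 ≤ ‖N‖ := one_le_norm_graphNormal he γ y
  have hN0 : 0 < ‖N‖ := one_pos.trans_le hN1
  refine ⟨by rw [norm_smul, norm_inv, norm_norm, inv_mul_cancel₀ hN0.ne'], fun ε hε => ?_⟩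
  set x := lineMap e (y, γ y)
  have hx : toHyper he x = y := toHyper_lineMap he (y, γ y)
  have hcont : Continuous (toHyper he) :=
    Continuous.subtype_mk (continuous_perp e) _
  have ho := hy.hasFDerivAt.isLittleO.def hε
  have hev : ∀ᶠ z in 𝓝 x, ‖γ (toHyper he z) - γ y - fderiv ℝ (fun y : Hyper e => γ y) y
      (toHyper he z - y)‖ ≤ ε * ‖toHyper he z - y‖ :=
    (hx ▸ hcont.tendsto x : Tendsto (toHyper he) (𝓝 x) (𝓝 y)).eventually ho
  filter_upwards [hev, Metric.isOpen_ball.mem_nhds hb] with z hz hzb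
  have e1 : toHyper he z - y = toHyper he (z - x) := by
    apply Subtype.ext
    conv_lhs => rw [← hx]
    change perp e z - perp e x = perp e (z - x)
    rw [sub_eq_add_neg z x, ← neg_one_smul ℝ x, perp_add, perp_smul]
    simp [sub_eq_add_neg]
  have e2 : ‖toHyper he (z - x)‖ ≤ ‖z - x‖ := norm_perp_le he (z - x)
  have e3 : inner ℝ (z - x) N = fderiv ℝ (fun y : Hyper e => γ y) y (toHyper he (z - x))
      - (inner ℝ e z - γ y) := by
    rw [real_inner_comm, inner_graphNormal he, inner_sub_right, inner_lineMap he]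
  rw [e1, Real.norm_eq_abs] at hz
  have hz' := abs_le.1 (hz.trans (mul_le_mul_of_nonneg_left e2 hε.le))
  have hmem : z ∈ Ω ↔ γ (toHyper he z) < inner ℝ e z := hg z hzb
  have e4 : (inner ℝ (z - x) (‖N‖⁻¹ • N) : ℝ) = ‖N‖⁻¹ * inner ℝ (z - x) N := inner_smul_right _ _ _
  have e5 : (inner ℝ (z - x) N : ℝ) = ‖N‖ * inner ℝ (z - x) (‖N‖⁻¹ • N) := by
    rw [e4, ← mul_assoc, mul_inv_cancel₀ hN0.ne', one_mul]
  have hp : 0 ≤ ε * ‖z - x‖ := by positivity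
  constructor
  · intro h
    rw [hmem]
    nlinarith
  · intro h
    rw [hmem, not_lt]
    nlinarith

end LocalBoundary

/-! ### Local boundary measures in graph charts. -/

section BoundaryMeasure

theorem exists_partition {K : Set (E n)} (hK : IsCompact K) {ρ : E n → ℝ}
    (hρ : ∀ x ∈ K, 0 < ρ x) :
    ∃ (s : Finset (E n)) (χ : E n → E n → ℝ), (∀ i ∈ s, i ∈ K) ∧
      (∀ i ∈ s, ContDiff ℝ ∞ (χ i) ∧ HasCompactSupport (χ i) ∧
        tsupport (χ i) ⊆ Metric.ball i (ρ i) ∧ ∀ x, 0 ≤ χ i x ∧ χ i x ≤ 1) ∧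
      ∀ x ∈ K, ∑ i ∈ s, χ i x = 1 := by
  obtain ⟨t, ht, hcov⟩ := hK.elim_nhds_subcover (fun x => Metric.ball x (ρ x))
    (fun x hx => Metric.ball_mem_nhds x (hρ x hx))
  obtain ⟨f, hf⟩ := SmoothPartitionOfUnity.exists_isSubordinate (modelWithCornersSelf ℝ (E n)) hK.isClosed
    (fun i : t => Metric.ball (i : E n) (ρ i)) (fun i => Metric.isOpen_ball) (by
      intro x hx
      obtain ⟨i, hi, hxi⟩ := mem_iUnion₂.1 (hcov hx)
      exact mem_iUnion.2 ⟨⟨i, hi⟩, hxi⟩)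
  classical
  refine ⟨t, fun i => if h : i ∈ t then f ⟨i, h⟩ else 0, ht, fun i hi => ?_, fun x hx => ?_⟩
  · simp only [hi, dif_pos]
    have h1 : tsupport (f ⟨i, hi⟩) ⊆ Metric.ball i (ρ i) := hf ⟨i, hi⟩
    refine ⟨(f ⟨i, hi⟩).contMDiff.contDiff, ?_, h1, fun x => ⟨f.nonneg _ _, f.le_one _ _⟩⟩
    exact (isCompact_closedBall i (ρ i)).of_isClosed_subset (isClosed_tsupport _)
      (h1.trans Metric.ball_subset_closedBall)
  · have := f.sum_eq_one hx
    rw [finsum_eq_sum_of_fintype] at this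
    rw [← this, ← Finset.sum_coe_sort t]
    refine Finset.sum_congr rfl fun i _ => ?_
    simp

variable {Ω : Set (E n)}

/-- The measure is Lebesgue measure on the hyperplane with the area density `‖g‖`, pushed to the
graph. Since `1 ≤ ‖g‖ ≤ K + 1`, Lipschitz maps between hyperplane and graph compare it with
Hausdorff measure in both directions, so no area formula is involved. The lower bound on a component
of the normal prepares the trace inequality. -/
theorem exists_boundaryMeasure_of_mem_frontier (hΩ : IsLipschitzDomain Ω) {x₀ : E n}
    (hx₀ : x₀ ∈ frontier Ω) : ∃ r > 0, ∃ m N, BoundaryMeasure Ω (Metric.ball x₀ r) m N ∧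
      ∃ v : E n, ∃ c > (0 : ℝ), ∀ᵐ x ∂m, c ≤ inner ℝ (N x) v := by
  obtain ⟨e, γ, K, r, he, hγ, hr, hg⟩ := hΩ.graph x₀ hx₀
  change ∀ y ∈ Metric.ball x₀ r, (y ∈ Ω ↔ γ (perp e y) < inner ℝ e y) at hg
  set B := Metric.ball x₀ r
  have hB : MeasurableSet B := measurableSet_ball
  set G : Hyper e → E n := fun y => lineMap e (y, γ y)
  have hGc : Continuous G :=
    continuous_lineMap.comp (continuous_id.prodMk (hγ.continuous.comp continuous_subtype_val))
  have hGt : ∀ y, toHyper he (G y) = y := fun y => toHyper_lineMap he _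
  have hGe : MeasurableEmbedding G := hGc.measurableEmbedding fun a b h => by
    rw [← hGt a, h, hGt b]
  have htc : Continuous (toHyper he) := Continuous.subtype_mk (continuous_perp e) _
  have hΓ : LipschitzWith K (fun y : Hyper e => γ y) :=
    LipschitzWith.of_dist_le_mul fun a b => hγ.dist_le_mul a b
  set g := graphNormal e γ
  have hgm : Measurable g := measurable_graphNormal γ
  have hg1 : ∀ y, 1 ≤ ‖g y‖ := one_le_norm_graphNormal he γ
  have hgK : ∀ y, ‖g y‖ ≤ K + 1 := norm_graphNormal_le he hγ
  set D : Hyper e → ℝ≥0 := fun y => ‖g y‖₊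
  have hDm : Measurable D := hgm.nnnorm
  set m : Measure (E n) := ((volume.withDensity fun y => (D y : ℝ≥0∞)).map G).restrict B
  set N : E n → E n := fun x => ‖g (toHyper he x)‖⁻¹ • g (toHyper he x)
  have hNm : Measurable N := by
    have := hgm.comp htc.measurable
    exact this.norm.inv.smul this
  have hmA : ∀ A, MeasurableSet A → m A = ∫⁻ y in G ⁻¹' (A ∩ B), D y := by
    intro A hA
    rw [Measure.restrict_apply hA, Measure.map_apply hGc.measurable (hA.inter hB),
      withDensity_apply _ (hGc.measurable (hA.inter hB))]
  have hmle : ∀ A, MeasurableSet A → m A ≤ (K + 1) * volume (G ⁻¹' (A ∩ B)) := by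
    intro A hA
    rw [hmA A hA, ← setLIntegral_const]
    refine lintegral_mono fun y => ?_
    have : D y ≤ K + 1 := hgK y
    exact (ENNReal.coe_le_coe.2 this).trans_eq (by simp)
  have hlem : ∀ A, MeasurableSet A → volume (G ⁻¹' (A ∩ B)) ≤ m A := by
    intro A hA
    rw [hmA A hA, ← setLIntegral_one]
    refine lintegral_mono fun y => ?_
    have : 1 ≤ D y := hg1 y
    exact ENNReal.one_le_coe_iff.2 this
  -- Inside the chart the frontier is the graph: a point `x` on the graph is the limit of `x + s •
  -- e` as `s ↓ 0`, and these points lie in `Ω`.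
  have hfr : ∀ x ∈ B, x ∈ frontier Ω ↔ G (toHyper he x) = x := by
    intro x hx
    have hGx : G (toHyper he x) = x ↔ γ (perp e x) = inner ℝ e x := by
      have e1 : G (toHyper he x) = perp e x + γ (perp e x) • e := rfl
      constructor
      · intro h
        have := inner_lineMap he (toHyper he x, γ (toHyper he x))
        change inner ℝ e (G (toHyper he x)) = _ at this
        rw [h] at this
        exact this.symm
      · intro h
        rw [e1, h, perp, sub_add_cancel]
    rw [hGx, hΩ.isOpen.frontier_eq]
    constructor
    · rintro ⟨h1, h2⟩
      refine le_antisymm (le_inner_of_mem_closure hγ.continuous hg h1 hx) ?_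
      rw [hg x hx, not_lt] at h2
      exact h2
    · intro h
      refine ⟨?_, fun h2 => absurd ((hg x hx).1 h2) (by rw [h]; exact lt_irrefl _)⟩
      have hc : Tendsto (fun s : ℝ => x + s • e) (𝓝[>] 0) (𝓝 x) := by
        have : Continuous fun s : ℝ => x + s • e := by fun_prop
        have := this.tendsto 0
        rw [zero_smul, add_zero] at this
        exact this.mono_left nhdsWithin_le_nhds
      refine mem_closure_of_tendsto hc ?_
      filter_upwards [hc.eventually (Metric.isOpen_ball.mem_nhds hx), self_mem_nhdsWithin] with s hs h0
      rw [hg _ hs, perp_add, perp_smul, perp_self he, smul_zero, add_zero, h, inner_add_right,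
        inner_smul_right, real_inner_self_eq_norm_sq, he]
      simpa using h0
  obtain ⟨c, hc0, hvol⟩ := exists_volume_hyper_eq he
  have hfin : IsFiniteMeasure m := ⟨by
    refine (hmle univ MeasurableSet.univ).trans_lt (ENNReal.mul_lt_top (by simp) ?_)
    refine lt_of_le_of_lt (measure_mono ?_) (measure_closedBall_lt_top (x := (0 : Hyper e))
      (r := ‖x₀‖ + r))
    intro y hy
    have h1 : dist (G y) x₀ < r := hy.2
    rw [dist_eq_norm] at h1
    rw [mem_closedBall_zero_iff]
    have h2 : ‖y‖ ≤ ‖G y‖ := norm_coe_hyper_le he (y, γ y)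
    have h3 : ‖G y‖ ≤ ‖G y - x₀‖ + ‖x₀‖ := by
      simpa using norm_add_le (G y - x₀) x₀
    linarith⟩
  have hd0 : (0 : ℝ) ≤ (n : ℝ) - 1 := by
    have : 1 ≤ n := by
      rcases Nat.eq_zero_or_pos n with h | h
      · subst h
        have : e = 0 := Subsingleton.elim _ _
        rw [this] at he; simp at he
      · exact h
    have : (1 : ℝ) ≤ n := by exact_mod_cast this
    linarith
  have hint : ∀ f : E n → ℝ, ∫ x, f x ∂m = ∫ y in G ⁻¹' B, ‖g y‖ * f (G y) := by
    intro f
    change ∫ x in B, f x ∂_ = _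
    rw [hGe.setIntegral_map, setIntegral_withDensity_eq_setIntegral_smul hDm _
      (hGc.measurable hB)]
    rfl
  have hdiff : ∀ᵐ x ∂m, x ∈ B ∧ ∃ y, x = G y ∧ DifferentiableAt ℝ (fun y : Hyper e => γ y) y := by
    have h1 : ∀ᵐ x ∂((volume.withDensity fun y => (D y : ℝ≥0∞)).map G),
        ∃ y, x = G y ∧ DifferentiableAt ℝ (fun y : Hyper e => γ y) y := by
      rw [hGe.ae_map_iff]
      refine (withDensity_absolutelyContinuous _ _).ae_le ?_
      filter_upwards [hΓ.ae_differentiableAt] with y hy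
      exact ⟨y, rfl, hy⟩
    filter_upwards [ae_restrict_of_ae h1, ae_restrict_mem hB] with x h2 h3
    exact ⟨h3, h2⟩
  -- The transversal direction is `-e`, for which `⟪N, -e⟫ = ‖g‖⁻¹ ≥ (K + 1)⁻¹`.
  refine ⟨r, hr, m, N, ⟨hfin, ?_, ?_, hNm.aestronglyMeasurable, ?_, ?_⟩, -e, (K + 1 : ℝ)⁻¹,
    by positivity, ?_⟩
  -- The projection to the hyperplane is 1-Lipschitz, and the image of the frontier part covers the
  -- chart preimage.
  · refine ⟨(K + 1) * c, Measure.le_iff.2 fun A hA => (hmle A hA).trans ?_⟩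
    have h1 : volume (G ⁻¹' (A ∩ B)) ≤ c * surf (frontier Ω) A := by
      rw [hvol, surf, Measure.restrict_apply hA]
      change (c : ℝ≥0∞) * _ ≤ _
      gcongr
      have h2 : G ⁻¹' (A ∩ B) ⊆ toHyper he '' (A ∩ frontier Ω) := by
        intro y hy
        refine ⟨G y, ⟨hy.1, (hfr _ hy.2).2 (by rw [hGt])⟩, hGt y⟩
      refine (measure_mono h2).trans ?_
      have hl : LipschitzWith 1 (toHyper he) := LipschitzWith.of_dist_le_mul fun a b => by
        rw [dist_eq_norm, dist_eq_norm, NNReal.coe_one, one_mul]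
        have : toHyper he a - toHyper he b = toHyper he (a - b) := by
          apply Subtype.ext
          change perp e a - perp e b = perp e (a - b)
          rw [sub_eq_add_neg a b, ← neg_one_smul ℝ b, perp_add, perp_smul]
          simp [sub_eq_add_neg]
        rw [this]
        exact norm_perp_le he _
      have := hl.hausdorffMeasure_image_le hd0 (A ∩ frontier Ω)
      simpa using this
    calc ((K : ℝ≥0∞) + 1) * volume (G ⁻¹' (A ∩ B)) ≤ (K + 1) * (c * surf (frontier Ω) A) := by gcongr
      _ = _ := by
        rw [← mul_assoc]
        simp [Measure.smul_apply, ENNReal.smul_def]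
  -- Conversely the graph map `G` is `(1 + K)`-Lipschitz and covers the frontier in `B`.
  · refine ⟨((1 + K) ^ ((n : ℝ) - 1)) * c⁻¹, Measure.le_iff.2 fun A hA => ?_⟩
    rw [surf, Measure.restrict_restrict hB, Measure.restrict_apply hA]
    have h2 : A ∩ (B ∩ frontier Ω) ⊆ G '' (G ⁻¹' (A ∩ B)) := by
      rintro x ⟨h1, h2, h3⟩
      have := (hfr x h2).1 h3
      exact ⟨toHyper he x, by rw [mem_preimage, this]; exact ⟨h1, h2⟩, this⟩
    have hl : LipschitzWith (1 + K) G := LipschitzWith.of_dist_le_mul fun a b => by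
      rw [dist_eq_norm]
      have : G a - G b = ((a - b : Hyper e) : E n) + (γ a - γ b) • e := by
        simp only [G, lineMap, Submodule.coe_sub, sub_smul]; abel
      rw [this]
      refine (norm_add_le _ _).trans ?_
      rw [norm_smul, he, mul_one, NNReal.coe_add, NNReal.coe_one, add_mul, one_mul]
      gcongr
      · exact (dist_eq_norm a b).ge
      · exact hΓ.dist_le_mul a b
    refine (measure_mono h2).trans ((hl.hausdorffMeasure_image_le hd0 _).trans ?_)
    have h3 : (Measure.hausdorffMeasure ((n : ℝ) - 1) : Measure (Hyper e)) (G ⁻¹' (A ∩ B))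
        = (c⁻¹ : ℝ≥0) * volume (G ⁻¹' (A ∩ B)) := by
      rw [hvol]
      change _ = _ * ((c : ℝ≥0∞) * _)
      rw [← mul_assoc, ← ENNReal.coe_mul, inv_mul_cancel₀ hc0, ENNReal.coe_one, one_mul]
      rfl
    rw [h3, ← mul_assoc, Measure.smul_apply, ENNReal.smul_def, ENNReal.coe_mul, smul_eq_mul,
      ENNReal.coe_rpow_of_nonneg _ hd0]
    gcongr
    exact hlem A hA
  · filter_upwards [hdiff] with x hx
    obtain ⟨hxB, y, rfl, hy⟩ := hx
    have := isOuterNormal_graph he hg hy hxB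
    simp only [N, hGt]
    exact this
  · intro w hw hwc hws v
    have hw0 : ∀ x, x ∉ B → w x = 0 := fun x hx =>
      image_eq_zero_of_notMem_tsupport fun h => hx (hws h)
    have hw0' : ∀ x, x ∉ B → fderiv ℝ w x v = 0 := fun x hx =>
      image_eq_zero_of_notMem_tsupport (f := fun x => fderiv ℝ w x v) fun h =>
        hx (hws (tsupport_fderiv_apply_subset ℝ v h))
    have hUm : MeasurableSet {z : E n | γ (perp e z) < inner ℝ e z} :=
      measurableSet_lt (hγ.continuous.measurable.comp (continuous_perp e).measurable)
        (by fun_prop)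
    have e1 : ∫ x in Ω, fderiv ℝ w x v
        = ∫ z in {z | γ (perp e z) < inner ℝ e z}, fderiv ℝ w z v := by
      rw [← integral_indicator hΩ.isOpen.measurableSet, ← integral_indicator hUm]
      congr 1
      funext x
      by_cases hx : x ∈ B
      · by_cases h : x ∈ Ω
        · rw [indicator_of_mem h, indicator_of_mem]
          exact (hg x hx).1 h
        · rw [indicator_of_notMem h, indicator_of_notMem]
          exact fun h' => h ((hg x hx).2 h')
      · simp [indicator, hw0' x hx]
    rw [e1, integral_fderiv_epigraph he hγ hw hwc v, hint,
      setIntegral_eq_integral_of_forall_compl_eq_zero]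
    · refine integral_congr_ae (ae_of_all _ fun y => ?_)
      change w (G y) * _ = ‖g y‖ * (w (G y) * inner ℝ (N (G y)) v)
      simp only [N, hGt]
      rw [← inner_graphNormal he, real_inner_smul_left]
      have : ‖g y‖ ≠ 0 := (one_pos.trans_le (hg1 y)).ne'
      change _ * inner ℝ (g y) v = _
      field_simp
    · intro y hy
      rw [hw0 _ hy]; simp
  · filter_upwards [hdiff] with x hx
    obtain ⟨hxB, y, rfl, hy⟩ := hx
    simp only [N, hGt]
    rw [real_inner_smul_left, inner_graphNormal he, inner_neg_right, real_inner_self_eq_norm_sq, he]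
    have : toHyper he (-e) = 0 := Subtype.ext (by
      change perp e (-e) = 0
      rw [← neg_one_smul ℝ e, perp_smul, perp_self he, smul_zero])
    rw [this, map_zero]
    simp only [one_pow, sub_neg_eq_add, zero_add, mul_one]
    exact inv_anti₀ (one_pos.trans_le (hg1 y)) (hgK y)

/-- A ball inside `Ω` meets no boundary, so the zero measure serves. -/
theorem exists_boundaryMeasure_of_mem (hΩ : IsOpen Ω) {x₀ : E n} (hx₀ : x₀ ∈ Ω) :
    ∃ r > 0, ∃ m N, BoundaryMeasure Ω (Metric.ball x₀ r) m N ∧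
      ∃ v : E n, ∃ c > (0 : ℝ), ∀ᵐ x ∂m, c ≤ inner ℝ (N x) v := by
  obtain ⟨r, hr, hb⟩ := Metric.isOpen_iff.1 hΩ x₀ hx₀
  refine ⟨r, hr, 0, 0, ⟨inferInstance, ⟨0, by simp⟩, ⟨0, ?_⟩, aestronglyMeasurable_zero_measure _,
    by simp, ?_⟩, 0, 1, one_pos, by simp⟩
  · rw [surf, Measure.restrict_restrict measurableSet_ball]
    have : Metric.ball x₀ r ∩ frontier Ω = ∅ := by
      rw [hΩ.frontier_eq]
      ext x; simp only [mem_inter_iff, Set.mem_sdiff, mem_empty_iff_false, iff_false]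
      rintro ⟨h1, h2, h3⟩
      exact h3 (hb h1)
    simp [this]
  · intro w hw hwc hws v
    rw [setIntegral_eq_integral_of_forall_compl_eq_zero,
      integral_fderiv_eq_zero_of_hasCompactSupport hw hwc]
    · simp
    · exact fun x hx => image_eq_zero_of_notMem_tsupport (f := fun x => fderiv ℝ w x v) fun h =>
        hx (hb (hws (tsupport_fderiv_apply_subset ℝ v h)))

end BoundaryMeasure

/-! ### The global boundary measure and the outer normal field. -/

section GlobalBoundary

variable {Ω : Set (E n)}

/-- Along `d = ν' - ν` one moves strictly into the half space of `ν` and strictly out of that of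
`ν'`, so points near `x` would be both in `Ω` and outside. Uniqueness lets the normals of
overlapping charts be read as a single field. -/
theorem IsOuterNormal.unique {x ν ν' : E n} (h : IsOuterNormal Ω x ν) (h' : IsOuterNormal Ω x ν') :
    ν = ν' := by
  by_contra hne
  have h1 : inner ℝ ν ν' < (1 : ℝ) := (inner_lt_one_iff_real_of_norm_eq_one h.1 h'.1).2 hne
  set a : ℝ := 1 - inner ℝ ν ν'
  have ha : 0 < a := by simp only [a]; linarith
  set d := ν' - ν
  have hd1 : inner ℝ d ν = -a := by
    simp only [d, a, inner_sub_left, real_inner_self_eq_norm_sq, h.1, real_inner_comm ν ν']; ring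
  have hd2 : inner ℝ d ν' = a := by
    simp only [d, a, inner_sub_left, real_inner_self_eq_norm_sq, h'.1]; ring
  -- The products of `d` with the two normals are `-a` and `a`; this `ε` makes `ε * ‖d‖` smaller
  -- than `a`.
  set ε : ℝ := a / (2 * (‖d‖ + 1))
  have hε : 0 < ε := by positivity
  have hεd : ε * ‖d‖ < a := by
    have : ε * (2 * (‖d‖ + 1)) = a := div_mul_cancel₀ _ (by positivity)
    nlinarith [norm_nonneg d]
  have hc : Tendsto (fun t : ℝ => x + t • d) (𝓝[>] 0) (𝓝 x) := by
    have : Continuous fun s : ℝ => x + s • d := by fun_prop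
    have := this.tendsto 0
    rw [zero_smul, add_zero] at this
    exact this.mono_left nhdsWithin_le_nhds
  have hev := (hc.eventually (h.2 ε hε)).and ((hc.eventually (h'.2 ε hε)).and self_mem_nhdsWithin)
  obtain ⟨t, h1, h2, h3⟩ := hev.exists
  have ht : (0 : ℝ) < t := h3
  simp only [add_sub_cancel_left, real_inner_smul_left, hd1, hd2, norm_smul,
    Real.norm_of_nonneg ht.le] at h1 h2
  exact h2.2 (by nlinarith) (h1.1 (by nlinarith))

open Classical in
/-- The outer normal of `Ω` at `x`, or zero where there is none. -/
def outerNormal (Ω : Set (E n)) (x : E n) : E n :=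
  if h : ∃ ν, IsOuterNormal Ω x ν then h.choose else 0

theorem IsOuterNormal.eq {x ν : E n} (h : IsOuterNormal Ω x ν) : outerNormal Ω x = ν := by
  have h' : ∃ ν, IsOuterNormal Ω x ν := ⟨ν, h⟩
  rw [outerNormal, dif_pos h']
  exact h'.choose_spec.unique h

theorem norm_outerNormal_le (x : E n) : ‖outerNormal Ω x‖ ≤ 1 := by
  unfold outerNormal
  split_ifs with h
  · exact h.choose_spec.1.le
  · simp

theorem norm_clm_le_sum (L : E n →L[ℝ] ℝ) : ‖L‖ ≤ ∑ i, |L (unitVec i)| := by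
  refine L.opNorm_le_bound (Finset.sum_nonneg fun i _ => abs_nonneg _) fun x => ?_
  have hx : L x = ∑ i, x i * L (unitVec i) := by
    conv_lhs => rw [← (EuclideanSpace.basisFun (Fin n) ℝ).sum_repr x]
    simp [map_sum]
  rw [hx, Finset.sum_mul]
  refine (norm_sum_le _ _).trans (Finset.sum_le_sum fun i _ => ?_)
  rw [norm_mul, mul_comm, Real.norm_eq_abs]
  exact mul_le_mul_of_nonneg_left (PiLp.norm_apply_le x i) (abs_nonneg _)

theorem IsLipschitzDomain.isCompact_closure (hΩ : IsLipschitzDomain Ω) : IsCompact (closure Ω) :=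
  hΩ.isBounded.isCompact_closure

theorem IsLipschitzDomain.integrableOn_continuous {F : Type*} [NormedAddCommGroup F]
    (hΩ : IsLipschitzDomain Ω) {f : E n → F} (hf : Continuous f) : IntegrableOn f Ω :=
  (hf.continuousOn.integrableOn_compact hΩ.isCompact_closure).mono_set subset_closure

/-- The local measures are weighted with a partition of unity on `closure Ω` and added, and the
Gauss-Green formula for `w` is the sum of the local ones for `χ i * w`. The trace inequality is the
local formula for `χ i * s ^ 2` in the direction `v i`: there the normal component is at least `c
i`, and the volume integral is estimated by Young's inequality. -/
theorem exists_boundaryMeasure (hΩ : IsLipschitzDomain Ω) :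
    ∃ μ, BoundaryMeasure Ω univ μ (outerNormal Ω) ∧ ∃ C : ℝ, 0 ≤ C ∧ ∀ s : E n → ℝ,
      ContDiff ℝ 1 s → Integrable (fun x => s x ^ 2) μ ∧
        ∫ x, s x ^ 2 ∂μ ≤ C * ∫ x in Ω, (s x ^ 2 + ‖fderiv ℝ s x‖ ^ 2) := by
  have h : ∀ x₀ ∈ closure Ω, ∃ r > 0, ∃ m N, BoundaryMeasure Ω (Metric.ball x₀ r) m N ∧
      ∃ v : E n, ∃ c > (0 : ℝ), ∀ᵐ x ∂m, c ≤ inner ℝ (N x) v := by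
    intro x₀ hx₀
    by_cases hin : x₀ ∈ Ω
    · exact exists_boundaryMeasure_of_mem hΩ.isOpen hin
    · exact exists_boundaryMeasure_of_mem_frontier hΩ (by
        rw [hΩ.isOpen.frontier_eq]; exact ⟨hx₀, hin⟩)
  choose! r hr m N hm v c hc hv using h
  obtain ⟨s, χ, hs, hχ, hsum⟩ := exists_partition hΩ.isCompact_closure hr
  set d : E n → E n → ℝ≥0 := fun i x => (χ i x).toNNReal
  have hdm : ∀ i ∈ s, Measurable (d i) := fun i hi =>
    (hχ i hi).1.continuous.measurable.real_toNNReal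
  have hdχ : ∀ i ∈ s, ∀ x, (d i x : ℝ) = χ i x := fun i hi x =>
    Real.coe_toNNReal _ ((hχ i hi).2.2.2 x).1
  set μi : E n → Measure (E n) := fun i => (m i).withDensity fun x => (d i x : ℝ≥0∞)
  set μ : Measure (E n) := ∑ i ∈ s, μi i
  have hmi : ∀ i ∈ s, μi i ≤ m i := by
    intro i hi
    have : μi i ≤ (m i).withDensity 1 := withDensity_mono (ae_of_all _ fun x => by
      have : d i x ≤ 1 := by
        rw [← NNReal.coe_le_coe, hdχ i hi, NNReal.coe_one]; exact ((hχ i hi).2.2.2 x).2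
      exact ENNReal.coe_le_one_iff.2 this)
    rwa [withDensity_one] at this
  have hmfin : ∀ i ∈ s, IsFiniteMeasure (m i) := fun i hi => (hm i (hs i hi)).finite
  have hμifin : ∀ i ∈ s, IsFiniteMeasure (μi i) := fun i hi => by
    have := hmfin i hi
    exact isFiniteMeasure_of_le (m i) (hmi i hi)
  have hμle : ∀ i ∈ s, μi i ≤ μ := fun i hi => Finset.single_le_sum (f := μi)
    (fun j _ => Measure.zero_le _) hi
  have hNi : ∀ i ∈ s, ∀ᵐ x ∂(m i), outerNormal Ω x = N i x := fun i hi => by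
    filter_upwards [(hm i (hs i hi)).normal] with x hx using hx.eq
  have hNm : ∀ i ∈ s, AEStronglyMeasurable (outerNormal Ω) (m i) := fun i hi =>
    (hm i (hs i hi)).measurable.congr ((hNi i hi).mono fun x hx => hx.symm)
  have hμfin : IsFiniteMeasure μ := ⟨by
    simp only [μ, Measure.finsetSum_apply]
    exact ENNReal.sum_lt_top.2 fun i hi => (hμifin i hi).measure_univ_lt_top⟩
  have hsupp : ∀ i ∈ s, ∀ x, x ∉ Metric.ball i (r i) → χ i x = 0 := fun i hi x hx =>
    image_eq_zero_of_notMem_tsupport fun h => hx ((hχ i hi).2.2.1 h)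
  have hle : ∃ C : ℝ≥0, μ ≤ C • surf (frontier Ω) := by
    have h1 : ∀ i, ∃ C : ℝ≥0, i ∈ s → μi i ≤ C • surf (frontier Ω) := fun i => by
      by_cases hi : i ∈ s
      · obtain ⟨C, hC⟩ := (hm i (hs i hi)).le_surf
        exact ⟨C, fun _ => (hmi i hi).trans hC⟩
      · exact ⟨0, fun h => (hi h).elim⟩
    choose C hC using h1
    refine ⟨∑ i ∈ s, C i, ?_⟩
    rw [Finset.sum_smul]
    exact Finset.sum_le_sum fun i hi => hC i hi
  have hge : ∃ C : ℝ≥0, (surf (frontier Ω)).restrict univ ≤ C • μ := by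
    have h1 : ∀ i, ∃ C : ℝ≥0, i ∈ s → ∀ A, MeasurableSet A →
        ∫⁻ x in A, d i x ∂(surf (frontier Ω)) ≤ C * μi i A := fun i => by
      by_cases hi : i ∈ s
      · obtain ⟨C, hC⟩ := (hm i (hs i hi)).surf_le
        refine ⟨C, fun _ A hA => ?_⟩
        have e1 : ∫⁻ x in A, d i x ∂(surf (frontier Ω))
            = ∫⁻ x in A, d i x ∂((surf (frontier Ω)).restrict (Metric.ball i (r i))) := by
          rw [← lintegral_indicator hA, ← lintegral_indicator hA,
            setLIntegral_eq_of_support_subset]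
          intro x hx
          by_contra h
          apply hx
          have : d i x = 0 := by simp [d, hsupp i hi x h]
          simp [indicator, this]
        rw [e1, withDensity_apply _ hA]
        refine (lintegral_mono' (Measure.restrict_mono_measure hC A) le_rfl).trans ?_
        rw [Measure.restrict_smul, lintegral_smul_measure]
        rfl
      · exact ⟨0, fun h => (hi h).elim⟩
    choose C hC using h1
    refine ⟨∑ i ∈ s, C i, Measure.le_iff.2 fun A hA => ?_⟩
    rw [Measure.restrict_univ]
    have e1 : surf (frontier Ω) A = ∑ i ∈ s, ∫⁻ x in A, d i x ∂(surf (frontier Ω)) := by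
      rw [← lintegral_finsetSum' _ fun i hi => (hdm i hi).coe_nnreal_ennreal.aemeasurable,
        ← setLIntegral_one]
      refine lintegral_congr_ae ?_
      have : ∀ᵐ x ∂(surf (frontier Ω)), x ∈ frontier Ω :=
        ae_restrict_mem isClosed_frontier.measurableSet
      filter_upwards [ae_restrict_of_ae this] with x hx
      have h2 := hsum x (frontier_subset_closure hx)
      have h3 : ∑ i ∈ s, d i x = 1 := by
        rw [← NNReal.coe_inj, NNReal.coe_sum, NNReal.coe_one, ← h2]
        exact Finset.sum_congr rfl fun i hi => hdχ i hi x
      rw [← ENNReal.ofNNReal_finsetSum, h3, ENNReal.coe_one]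
    rw [e1, Measure.smul_apply, ENNReal.smul_def, smul_eq_mul, ENNReal.ofNNReal_finsetSum,
      Finset.sum_mul]
    refine Finset.sum_le_sum fun i hi => (hC i hi A hA).trans ?_
    gcongr
    exact hμle i hi
  have hchange : ∀ i ∈ s, ∀ f : E n → ℝ, ∫ x, f x ∂(μi i) = ∫ x, χ i x * f x ∂(m i) := by
    intro i hi f
    rw [integral_withDensity_eq_integral_smul (hdm i hi)]
    refine integral_congr_ae (ae_of_all _ fun x => ?_)
    change (d i x : ℝ) * f x = _
    rw [hdχ i hi]
  have hχint : ∀ i ∈ s, ∀ f : E n → ℝ, Continuous f → Integrable f (μi i) := by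
    intro i hi f hf
    have := hmfin i hi
    rw [integrable_withDensity_iff_integrable_smul (hdm i hi)]
    have h1 : Continuous fun x => χ i x * f x := (hχ i hi).1.continuous.mul hf
    obtain ⟨b, hb⟩ := ((hχ i hi).2.1.mul_right (f' := f)).exists_bound_of_continuous h1
    refine (Integrable.of_bound h1.aestronglyMeasurable b (ae_of_all _ hb)).congr
      (ae_of_all _ fun x => ?_)
    change _ = (d i x : ℝ) * f x
    rw [hdχ i hi]
  have hNmμ : AEStronglyMeasurable (outerNormal Ω) μ := by
    have key : ∀ t : Finset (E n), (∀ i ∈ t, AEStronglyMeasurable (outerNormal Ω) (μi i)) →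
        AEStronglyMeasurable (outerNormal Ω) (∑ i ∈ t, μi i) := by
      classical
      intro t
      induction t using Finset.induction_on with
      | empty => intro _; simp
      | insert a t ha ih =>
        intro h
        rw [Finset.sum_insert ha, aestronglyMeasurable_add_measure_iff]
        exact ⟨h a (Finset.mem_insert_self a t),
          ih fun i hi => h i (Finset.mem_insert_of_mem hi)⟩
    exact key s fun i hi => (hNm i hi).mono_measure (hmi i hi)
  refine ⟨μ, ⟨hμfin, hle, hge, hNmμ, ?_, ?_⟩, ?_⟩
  · simp only [μ]
    rw [ae_finsetSum_measure_iff]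
    intro i hi
    have h1 : ∀ᵐ x ∂(m i), IsOuterNormal Ω x (outerNormal Ω x) := by
      filter_upwards [(hm i (hs i hi)).normal, hNi i hi] with x h1 h2
      rw [h2]; exact h1
    exact (withDensity_absolutelyContinuous _ _).ae_le h1
  · intro w hw hwc _ v'
    have e1 : ∀ x ∈ Ω, fderiv ℝ w x v' = ∑ i ∈ s, fderiv ℝ (fun x => χ i x * w x) x v' := by
      intro x hx
      have h1 : (fun x => ∑ i ∈ s, χ i x * w x) =ᶠ[𝓝 x] w := by
        filter_upwards [hΩ.isOpen.mem_nhds hx] with y hy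
        rw [← Finset.sum_mul, hsum y (subset_closure hy), one_mul]
      have hd : ∀ i ∈ s, DifferentiableAt ℝ (fun x => χ i x * w x) x := fun i hi =>
        (((hχ i hi).1.differentiable (by simp)) x).mul ((hw.differentiable (by simp)) x)
      rw [← h1.fderiv_eq, fderiv_fun_sum hd]
      simp
    have hwχ : ∀ i ∈ s, ContDiff ℝ 1 fun x => χ i x * w x := fun i hi =>
      ((hχ i hi).1.of_le (by simp)).mul hw
    have h2 : ∀ i ∈ s, Integrable (fun x => w x * inner ℝ (outerNormal Ω x) v') (μi i) := by
      intro i hi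
      refine (hχint i hi w hw.continuous).mul_bdd (c := ‖v'‖) ?_ ?_
      · exact ((hNm i hi).mono_measure (hmi i hi)).inner aestronglyMeasurable_const
      · refine ae_of_all _ fun x => (norm_inner_le_norm _ _).trans ?_
        nlinarith [norm_outerNormal_le (Ω := Ω) x, norm_nonneg v']
    rw [setIntegral_congr_fun hΩ.isOpen.measurableSet e1, integral_finsetSum]
    · simp only [μ]
      rw [integral_finsetSum_measure h2]
      refine Finset.sum_congr rfl fun i hi => ?_
      rw [(hm i (hs i hi)).gauss_green _ (hwχ i hi) (hχ i hi).2.1.mul_right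
        ((tsupport_mul_subset_left).trans (hχ i hi).2.2.1) v', hchange i hi]
      refine integral_congr_ae ?_
      filter_upwards [hNi i hi] with x hx
      rw [hx, mul_assoc]
    · intro i hi
      exact hΩ.integrableOn_continuous (((hwχ i hi).continuous_fderiv (by simp)).clm_apply
        continuous_const)
  · have hb : ∀ i, ∃ L : ℝ, 0 ≤ L ∧ (i ∈ s → ∀ x, |fderiv ℝ (χ i) x (v i)| ≤ L) := by
      intro i
      by_cases hi : i ∈ s
      · obtain ⟨L, hL⟩ := ((hχ i hi).2.1.fderiv_apply ℝ (v i)).exists_bound_of_continuous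
          (((hχ i hi).1.continuous_fderiv (by simp)).clm_apply continuous_const)
        exact ⟨L, (norm_nonneg _).trans (hL 0), fun _ => hL⟩
      · exact ⟨0, le_rfl, fun h => (hi h).elim⟩
    choose L hL0 hL using hb
    -- The derivative of `χ i` contributes `L i`, the bound of `2 f ∂f` by `f ^ 2 + ‖∇f‖ ^ 2 * ‖v i‖
    -- ^ 2` contributes the rest, and `(c i)⁻¹` undoes the lower bound on the normal component.
    refine ⟨∑ i ∈ s, (c i)⁻¹ * (L i + 1 + ‖v i‖ ^ 2), Finset.sum_nonneg fun i hi => ?_,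
      fun f hf => ⟨?_, ?_⟩⟩
    · have := hc i (hs i hi)
      have := hL0 i
      positivity
    · simp only [μ]
      rw [integrable_finsetSum_measure]
      exact fun i hi => hχint i hi _ (hf.continuous.pow 2)
    · simp only [μ]
      rw [integral_finsetSum_measure fun i hi => hχint i hi (fun x => f x ^ 2) (hf.continuous.pow 2),
        Finset.sum_mul]
      refine Finset.sum_le_sum fun i hi => ?_
      have hci := hc i (hs i hi)
      have hfin := hmfin i hi
      have hwχ : ContDiff ℝ 1 fun x => χ i x * f x ^ 2 :=
        ((hχ i hi).1.of_le (by simp)).mul (hf.pow 2)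
      have hwi : Integrable (fun x => χ i x * f x ^ 2) (m i) := by
        obtain ⟨b, hb⟩ := ((hχ i hi).2.1.mul_right (f' := fun x => f x ^ 2)).exists_bound_of_continuous
          hwχ.continuous
        exact Integrable.of_bound hwχ.continuous.aestronglyMeasurable b (ae_of_all _ hb)
      rw [hchange i hi, mul_assoc, inv_mul_eq_div, le_div_iff₀ hci]
      have gg := (hm i (hs i hi)).gauss_green _ hwχ (hχ i hi).2.1.mul_right
        ((tsupport_mul_subset_left).trans (hχ i hi).2.2.1) (v i)
      calc (∫ x, χ i x * f x ^ 2 ∂(m i)) * c i = ∫ x, χ i x * f x ^ 2 * c i ∂(m i) := by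
            rw [integral_mul_const]
        _ ≤ ∫ x, χ i x * f x ^ 2 * inner ℝ (N i x) (v i) ∂(m i) := by
            refine integral_mono_ae (hwi.mul_const _) ?_ ?_
            · refine hwi.mul_bdd (c := ‖v i‖) ?_ ?_
              · exact (hm i (hs i hi)).measurable.inner aestronglyMeasurable_const
              · filter_upwards [(hm i (hs i hi)).normal] with x hx
                refine (norm_inner_le_norm _ _).trans ?_
                rw [hx.1, one_mul]
            · filter_upwards [hv i (hs i hi)] with x hx
              exact mul_le_mul_of_nonneg_left hx
                (mul_nonneg ((hχ i hi).2.2.2 x).1 (sq_nonneg _))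
        _ = ∫ x in Ω, fderiv ℝ (fun x => χ i x * f x ^ 2) x (v i) := gg.symm
        _ ≤ ∫ x in Ω, (L i + 1 + ‖v i‖ ^ 2) * (f x ^ 2 + ‖fderiv ℝ f x‖ ^ 2) := by
            refine setIntegral_mono (hΩ.integrableOn_continuous
                ((hwχ.continuous_fderiv (by simp)).clm_apply continuous_const))
              (hΩ.integrableOn_continuous (continuous_const.mul ((hf.continuous.pow 2).add
                ((hf.continuous_fderiv (by simp)).norm.pow 2)))) fun x => ?_
            have hd := (hf.differentiable (by simp)) x
            have e2 : fderiv ℝ (fun x => χ i x * f x ^ 2) x (v i)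
                = χ i x * (2 * f x * fderiv ℝ f x (v i)) + f x ^ 2 * fderiv ℝ (χ i) x (v i) := by
              have hd2 : DifferentiableAt ℝ (fun x => f x ^ 2) x := hd.pow 2
              rw [fderiv_fun_mul (((hχ i hi).1.differentiable (by simp)) x) hd2,
                fderiv_fun_pow 2 hd]
              simp
            rw [e2]
            have h3 : |fderiv ℝ f x (v i)| ≤ ‖fderiv ℝ f x‖ * ‖v i‖ := (fderiv ℝ f x).le_opNorm _
            have h4 := (abs_le.1 (hL i hi x)).2
            have h5 := ((hχ i hi).2.2.2 x)
            have h6 : 2 * f x * fderiv ℝ f x (v i) ≤ f x ^ 2 + ‖fderiv ℝ f x‖ ^ 2 * ‖v i‖ ^ 2 := by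
              have : (fderiv ℝ f x (v i)) ^ 2 ≤ ‖fderiv ℝ f x‖ ^ 2 * ‖v i‖ ^ 2 := by
                rw [← mul_pow]; exact sq_le_sq' (abs_le.1 h3).1 (abs_le.1 h3).2
              nlinarith [sq_nonneg (f x - fderiv ℝ f x (v i))]
            have h7 : 0 ≤ f x ^ 2 + ‖fderiv ℝ f x‖ ^ 2 * ‖v i‖ ^ 2 := by positivity
            have h8 : χ i x * (2 * f x * fderiv ℝ f x (v i))
                ≤ f x ^ 2 + ‖fderiv ℝ f x‖ ^ 2 * ‖v i‖ ^ 2 := by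
              nlinarith
            have h9 := mul_le_mul_of_nonneg_left h4 (sq_nonneg (f x))
            have h10 : 0 ≤ L i * ‖fderiv ℝ f x‖ ^ 2 := mul_nonneg (hL0 i) (sq_nonneg _)
            nlinarith [sq_nonneg ‖fderiv ℝ f x‖, mul_nonneg (sq_nonneg (f x)) (sq_nonneg ‖v i‖)]
        _ = _ := by rw [integral_const_mul]

end GlobalBoundary

/-! ### Consequences for the surface measure, and the trace inequality. -/

section BoundaryToolkit

variable {Ω : Set (E n)} {μ : Measure (E n)} {N : E n → E n}

theorem exists_cutoff (Ω : Set (E n)) (hb : Bornology.IsBounded Ω) :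
    ∃ χ : E n → ℝ, ContDiff ℝ ∞ χ ∧ HasCompactSupport χ ∧ (∀ x, 0 ≤ χ x ∧ χ x ≤ 1) ∧
      ∀ x ∈ closure Ω, χ =ᶠ[𝓝 x] 1 := by
  obtain ⟨R, hR⟩ := hb.closure.subset_ball (0 : E n)
  have hR' : closure Ω ⊆ Metric.ball 0 (max R 1) :=
    hR.trans (Metric.ball_subset_ball (le_max_left _ _))
  let χ : ContDiffBump (0 : E n) := ⟨max R 1, max R 1 + 1, by positivity, by linarith⟩
  exact ⟨χ, χ.contDiff, χ.hasCompactSupport, fun x => ⟨χ.nonneg, χ.le_one⟩,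
    fun x hx => χ.eventuallyEq_one_of_mem_ball (hR' hx)⟩

theorem BoundaryMeasure.ae_mem_frontier {B : Set (E n)} (h : BoundaryMeasure Ω B μ N) :
    ∀ᵐ x ∂μ, x ∈ frontier Ω := by
  obtain ⟨C, hC⟩ := h.le_surf
  have h1 : ∀ᵐ x ∂(surf (frontier Ω)), x ∈ frontier Ω :=
    ae_restrict_mem isClosed_frontier.measurableSet
  exact (Measure.absolutelyContinuous_of_le_smul (c := (C : ℝ≥0∞)) hC).ae_le h1

/-- Together with `BoundaryMeasure.ae_of_surf`: the auxiliary measure and the surface measure have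
the same null sets, so pointwise boundary identities pass between them. -/
theorem BoundaryMeasure.ae_surf {P : E n → Prop} (h : BoundaryMeasure Ω univ μ N)
    (hP : ∀ᵐ x ∂μ, P x) : ∀ᵐ x ∂(surf (frontier Ω)), P x := by
  obtain ⟨C, hC⟩ := h.surf_le
  rw [Measure.restrict_univ] at hC
  exact (Measure.absolutelyContinuous_of_le_smul (c := (C : ℝ≥0∞)) hC).ae_le hP

theorem BoundaryMeasure.ae_of_surf {P : E n → Prop} {B : Set (E n)} (h : BoundaryMeasure Ω B μ N)
    (hP : ∀ᵐ x ∂(surf (frontier Ω)), P x) : ∀ᵐ x ∂μ, P x := by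
  obtain ⟨C, hC⟩ := h.le_surf
  exact (Measure.absolutelyContinuous_of_le_smul (c := (C : ℝ≥0∞)) hC).ae_le hP

theorem BoundaryMeasure.isFiniteMeasure_surf (h : BoundaryMeasure Ω univ μ N) :
    IsFiniteMeasure (surf (frontier Ω)) := by
  obtain ⟨C, hC⟩ := h.surf_le
  have := h.finite
  rw [Measure.restrict_univ] at hC
  exact isFiniteMeasure_of_le _ hC

/-- A cutoff that is one near `closure Ω` removes the requirement of compact support. -/
theorem BoundaryMeasure.integral_fderiv (hΩ : IsLipschitzDomain Ω)
    (h : BoundaryMeasure Ω univ μ N) {w : E n → ℝ} (hw : ContDiff ℝ 1 w) (v : E n) :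
    ∫ x in Ω, fderiv ℝ w x v = ∫ x, w x * inner ℝ (N x) v ∂μ := by
  obtain ⟨χ, h1, h2, -, h4⟩ := exists_cutoff Ω hΩ.isBounded
  have gg := h.gauss_green (fun x => χ x * w x) ((h1.of_le (by simp)).mul hw) h2.mul_right
    (subset_univ _) v
  have e1 : ∫ x in Ω, fderiv ℝ (fun x => χ x * w x) x v = ∫ x in Ω, fderiv ℝ w x v := by
    refine setIntegral_congr_fun hΩ.isOpen.measurableSet fun x hx => ?_
    have : (fun x => χ x * w x) =ᶠ[𝓝 x] w := by
      filter_upwards [h4 x (subset_closure hx)] with y hy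
      simp [hy]
    simp only [this.fderiv_eq]
  rw [← e1, gg]
  refine integral_congr_ae ?_
  filter_upwards [h.ae_mem_frontier] with x hx
  have := (h4 x (frontier_subset_closure hx)).eq_of_nhds
  simp [this]

theorem _root_.MeasureTheory.MemLp.eLpNorm_two_eq {α : Type*} [MeasurableSpace α] {P : Measure α}
    {f : α → ℝ} (hf : MemLp f 2 P) :
    eLpNorm f 2 P = ENNReal.ofReal (Real.sqrt (∫ x, f x ^ 2 ∂P)) := by
  rw [hf.eLpNorm_eq_integral_rpow_norm (by simp) (by simp), Real.sqrt_eq_rpow]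
  simp

theorem eLpNorm_two_le_of_integral_sq_le {α β : Type*} [MeasurableSpace α] [MeasurableSpace β]
    {P : Measure α} {Q : Measure β} {f : α → ℝ} {g k : β → ℝ} {C : ℝ} (hC : 0 ≤ C)
    (hf : MemLp f 2 P) (hg : MemLp g 2 Q) (hk : MemLp k 2 Q)
    (h : ∫ x, f x ^ 2 ∂P ≤ C * ∫ x, (g x ^ 2 + k x ^ 2) ∂Q) :
    eLpNorm f 2 P ≤ ENNReal.ofReal (Real.sqrt C) * (eLpNorm g 2 Q + eLpNorm k 2 Q) := by
  rw [hf.eLpNorm_two_eq, hg.eLpNorm_two_eq, hk.eLpNorm_two_eq, ← ENNReal.ofReal_add (Real.sqrt_nonneg _) (Real.sqrt_nonneg _),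
    ← ENNReal.ofReal_mul (Real.sqrt_nonneg _)]
  refine ENNReal.ofReal_le_ofReal ?_
  rw [integral_add hg.integrable_sq hk.integrable_sq] at h
  have hg0 : 0 ≤ ∫ x, g x ^ 2 ∂Q := integral_nonneg fun x => sq_nonneg _
  have hk0 : 0 ≤ ∫ x, k x ^ 2 ∂Q := integral_nonneg fun x => sq_nonneg _
  refine (Real.sqrt_le_sqrt h).trans ?_
  rw [Real.sqrt_mul hC]
  gcongr
  refine Real.sqrt_le_iff.2 ⟨by positivity, ?_⟩
  nlinarith [Real.sq_sqrt hg0, Real.sq_sqrt hk0, Real.sqrt_nonneg (∫ x, g x ^ 2 ∂Q),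
    Real.sqrt_nonneg (∫ x, k x ^ 2 ∂Q),
    mul_nonneg (Real.sqrt_nonneg (∫ x, g x ^ 2 ∂Q)) (Real.sqrt_nonneg (∫ x, k x ^ 2 ∂Q))]

theorem IsLipschitzDomain.memLp_continuous {F : Type*} [NormedAddCommGroup F]
    (hΩ : IsLipschitzDomain Ω) {f : E n → F} (hf : Continuous f) (q : ℝ≥0∞) :
    MemLp f q (volume.restrict Ω) := by
  obtain ⟨C, hC⟩ := hΩ.isCompact_closure.exists_bound_of_continuousOn hf.continuousOn
  have : IsFiniteMeasure (volume.restrict Ω) :=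
    ⟨by rw [Measure.restrict_apply_univ]; exact hΩ.isBounded.measure_lt_top⟩
  exact MemLp.of_bound hf.aestronglyMeasurable C
    (ae_restrict_of_forall_mem hΩ.isOpen.measurableSet fun x hx => hC x (subset_closure hx))

theorem BoundaryMeasure.memLp_surf {F : Type*} [NormedAddCommGroup F] (hΩ : IsLipschitzDomain Ω)
    (h : BoundaryMeasure Ω univ μ N) {f : E n → F} (hf : Continuous f) (q : ℝ≥0∞) :
    MemLp f q (surf (frontier Ω)) := by
  have := h.isFiniteMeasure_surf
  obtain ⟨C, hC⟩ := hΩ.isCompact_closure.exists_bound_of_continuousOn hf.continuousOn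
  have h1 : ∀ᵐ x ∂(surf (frontier Ω)), x ∈ frontier Ω :=
    ae_restrict_mem isClosed_frontier.measurableSet
  exact MemLp.of_bound hf.aestronglyMeasurable C
    (h1.mono fun x hx => hC x (frontier_subset_closure hx))

/-- The trace inequality for functions that are `C¹` up to the boundary. -/
theorem exists_trace_bound (hΩ : IsLipschitzDomain Ω) : ∃ C : ℝ≥0, ∀ s : E n → ℝ, ContDiff ℝ 1 s →
    eLpNorm s 2 (surf (frontier Ω)) ≤ C * (eLpNorm s 2 (volume.restrict Ω)
      + ∑ i, eLpNorm (fun x => fderiv ℝ s x (unitVec i)) 2 (volume.restrict Ω)) := by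
  obtain ⟨μ, hμ, C, hC, h⟩ := exists_boundaryMeasure hΩ
  obtain ⟨A, hA⟩ := hμ.surf_le
  rw [Measure.restrict_univ] at hA
  refine ⟨A ^ (1 / 2 : ℝ≥0∞).toReal * (Real.sqrt C).toNNReal, fun s hs => ?_⟩
  have hs2 : MemLp s 2 μ := (memLp_two_iff_integrable_sq hs.continuous.aestronglyMeasurable).2 (h s hs).1
  have hd : Continuous (fun x => fderiv ℝ s x) := hs.continuous_fderiv (by simp)
  have h1 := eLpNorm_two_le_of_integral_sq_le hC hs2
    (hΩ.memLp_continuous hs.continuous 2) (hΩ.memLp_continuous hd.norm 2) (h s hs).2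
  have h2 : eLpNorm (fun x => ‖fderiv ℝ s x‖) 2 (volume.restrict Ω)
      ≤ ∑ i, eLpNorm (fun x => fderiv ℝ s x (unitVec i)) 2 (volume.restrict Ω) := by
    refine (eLpNorm_mono_real (g := ∑ i, fun x => |fderiv ℝ s x (unitVec i)|) fun x => ?_).trans
      ((eLpNorm_sum_le (fun i _ => (hd.clm_apply continuous_const).abs.aestronglyMeasurable)
        (by simp)).trans (Finset.sum_le_sum fun i _ => ?_))
    · rw [norm_norm, Finset.sum_apply]; exact norm_clm_le_sum _
    · simp only [← Real.norm_eq_abs, eLpNorm_norm, le_refl]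
  have h3 : eLpNorm s 2 (surf (frontier Ω)) ≤ ((A ^ (1 / 2 : ℝ≥0∞).toReal : ℝ≥0) : ℝ≥0∞) * eLpNorm s 2 μ := by
    have h4 := eLpNorm_smul_measure_le (A : ℝ≥0∞) s 2 μ
    rw [← ENNReal.coe_rpow_of_nonneg A ENNReal.toReal_nonneg] at h4
    exact (eLpNorm_mono_measure s hA).trans h4
  refine h3.trans ?_
  rw [ENNReal.coe_mul, mul_assoc]
  exact mul_le_mul_right (h1.trans (mul_le_mul_right (add_le_add_right h2 _) _)) _

end BoundaryToolkit

/-! ### One-sided mollification and density of smooth functions. -/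

section OneSided

open Convolution ContinuousLinearMap

variable {Ω : Set (E n)}

/-- A partition of unity on `closure Ω` together with mollifying kernels that, on the support of the
respective function of the partition, only use values inside `Ω`. -/
structure Mollifier (Ω : Set (E n)) where
  s : Finset (E n)
  χ : E n → E n → ℝ
  ρ : ℕ → E n → E n → ℝ
  r : ℕ → ℝ
  smooth_χ : ∀ i ∈ s, ContDiff ℝ ∞ (χ i)
  compact_χ : ∀ i ∈ s, HasCompactSupport (χ i)
  nonneg_χ : ∀ i ∈ s, ∀ x, 0 ≤ χ i x
  sum_χ : ∀ x ∈ closure Ω, ∑ i ∈ s, χ i x = 1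
  smooth_ρ : ∀ k, ∀ i ∈ s, ContDiff ℝ ∞ (ρ k i)
  compact_ρ : ∀ k, ∀ i ∈ s, HasCompactSupport (ρ k i)
  nonneg_ρ : ∀ k, ∀ i ∈ s, ∀ x, 0 ≤ ρ k i x
  integral_ρ : ∀ k, ∀ i ∈ s, ∫ x, ρ k i x = 1
  tsupport_ρ : ∀ k, ∀ i ∈ s, tsupport (ρ k i) ⊆ Metric.closedBall 0 (r k)
  tendsto_r : Tendsto r atTop (𝓝 0)
  isTest : ∀ k, ∀ i ∈ s, ∀ x ∈ closure Ω, x ∈ tsupport (χ i) → IsTest Ω fun y => ρ k i (x - y)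

/-- A finite cover by neighbourhoods with a cone condition gives the partition of unity. In each of
them the kernels are shifted along the cone, so that they look only into `Ω`, even from boundary
points. -/
theorem exists_mollifier (hΩ : IsLipschitzDomain Ω) : Nonempty (Mollifier Ω) := by
  have h : ∀ x₀ ∈ closure Ω, ∃ ρ, 0 < ρ ∧ ∃ v₀ c, HasCone Ω x₀ ρ v₀ c := fun x₀ hx₀ => by
    obtain ⟨ρ, v₀, c, h⟩ := exists_cone hΩ hx₀
    exact ⟨ρ, h.radius_pos, v₀, c, h⟩
  choose! R hR v₀ c hcone using h
  obtain ⟨s, χ, hs, hχ, hsum⟩ := exists_partition hΩ.isCompact_closure hR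
  set τ : ℕ → ℝ := fun k => 1 / ((k : ℝ) + 1)
  have hτ : ∀ k, 0 < τ k := fun k => by positivity
  have hτ1 : ∀ k, τ k ≤ 1 := fun k => by
    rw [div_le_one (by positivity)]; linarith [(Nat.cast_nonneg k : (0 : ℝ) ≤ k)]
  have hτ0 : Tendsto τ atTop (𝓝 0) := tendsto_one_div_add_atTop_nhds_zero_nat
  -- The bump sits at `-(τ k • v₀ i)` with radius `τ k * c i`: if `x - y` is in its support, then
  -- `y` is `x` plus `τ k` times a vector of the cone ball.
  let B : (k : ℕ) → (i : E n) → i ∈ s → ContDiffBump (-(τ k • v₀ i)) := fun k i hi =>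
    ⟨τ k * c i / 2, τ k * c i, by have := (hcone i (hs i hi)).aperture_pos; have := hτ k; positivity,
      by have := mul_pos (hτ k) (hcone i (hs i hi)).aperture_pos; linarith⟩
  classical
  let ρ : ℕ → E n → E n → ℝ := fun k i => if hi : i ∈ s then (B k i hi).normed volume else 0
  have hρ : ∀ k i (hi : i ∈ s), ρ k i = (B k i hi).normed volume := fun k i hi => dif_pos hi
  have hts : ∀ k i (hi : i ∈ s), tsupport (ρ k i) = Metric.closedBall (-(τ k • v₀ i)) (τ k * c i) := by
    intro k i hi
    rw [hρ k i hi, (B k i hi).tsupport_normed_eq]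
  refine ⟨⟨s, χ, ρ, fun k => τ k * ∑ i ∈ s, (‖v₀ i‖ + |c i|), fun i hi => (hχ i hi).1,
    fun i hi => (hχ i hi).2.1, fun i hi x => ((hχ i hi).2.2.2 x).1, hsum, ?_, ?_, ?_, ?_, ?_, ?_, ?_⟩⟩
  · intro k i hi; rw [hρ k i hi]; exact (B k i hi).contDiff_normed
  · intro k i hi; rw [hρ k i hi]; exact (B k i hi).hasCompactSupport_normed
  · intro k i hi x; rw [hρ k i hi]; exact (B k i hi).nonneg_normed x
  · intro k i hi; rw [hρ k i hi]; exact (B k i hi).integral_normed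
  · intro k i hi
    rw [hts k i hi]
    refine Metric.closedBall_subset_closedBall' ?_
    have h1 : ‖v₀ i‖ + |c i| ≤ ∑ i ∈ s, (‖v₀ i‖ + |c i|) :=
      Finset.single_le_sum (f := fun i => ‖v₀ i‖ + |c i|) (fun j _ => by positivity) hi
    have h2 := mul_le_mul_of_nonneg_left h1 (hτ k).le
    rw [dist_zero_right, norm_neg, norm_smul, Real.norm_of_nonneg (hτ k).le]
    have h3 := mul_le_mul_of_nonneg_left (le_abs_self (c i)) (hτ k).le
    linarith
  · simpa using hτ0.mul_const (∑ i ∈ s, (‖v₀ i‖ + |c i|))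
  · intro k i hi x hx hxs
    have hsub : ∀ y, x - y ∈ tsupport (ρ k i) → y ∈ Ω := by
      intro y hy
      rw [hts k i hi, mem_closedBall_iff_norm] at hy
      have h1 := (hcone i (hs i hi)).mem x hx ((hχ i hi).2.2.1 hxs) (τ k) ⟨hτ k, hτ1 k⟩
        ((τ k)⁻¹ • (y - x)) (by
          rw [mem_closedBall_iff_norm]
          have e1 : (τ k)⁻¹ • (y - x) - v₀ i = -(τ k)⁻¹ • (x - y - -(τ k • v₀ i)) := by
            rw [sub_neg_eq_add, smul_add, smul_smul, neg_mul, inv_mul_cancel₀ (hτ k).ne', neg_smul,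
              neg_smul, one_smul, ← smul_neg, neg_sub, sub_eq_add_neg]
          rw [e1, norm_smul, norm_neg, norm_inv, Real.norm_of_nonneg (hτ k).le,
            inv_mul_le_iff₀ (hτ k)]
          exact hy)
      rwa [smul_smul, mul_inv_cancel₀ (hτ k).ne', one_smul, add_sub_cancel] at h1
    have hsm : ContDiff ℝ ∞ fun y => ρ k i (x - y) := by
      rw [hρ k i hi]
      exact (B k i hi).contDiff_normed.comp (contDiff_const.sub contDiff_id)
    have hco : HasCompactSupport (ρ k i) := by
      rw [hρ k i hi]; exact (B k i hi).hasCompactSupport_normed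
    refine ⟨hsm, hco.comp_homeomorph (Homeomorph.subLeft x), fun y hy => hsub y ?_⟩
    exact (tsupport_comp_subset_preimage (ρ k i) (Homeomorph.subLeft x).continuous) hy

namespace Mollifier

variable (M : Mollifier Ω)

/-- `∑ i, a_i (ρ_i ⋆ w)`, where `w` is extended by zero outside `Ω`. -/
def op (k : ℕ) (a : E n → E n → ℝ) (w : E n → ℝ) (x : E n) : ℝ :=
  ∑ i ∈ M.s, a i x * (M.ρ k i ⋆[lsmul ℝ ℝ, volume] (Ω.indicator w)) x

/-- Partial derivatives of the functions of the partition of unity. -/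
def dχ (v : E n) (i x : E n) : ℝ := fderiv ℝ (M.χ i) x v

theorem smooth_dχ (v : E n) : ∀ i ∈ M.s, ContDiff ℝ ∞ (M.dχ v i) := by
  intro i hi
  have h : ContDiff ℝ ∞ (fderiv ℝ (M.χ i)) := (M.smooth_χ i hi).fderiv_right (by simp)
  change ContDiff ℝ ∞ fun x => fderiv ℝ (M.χ i) x v
  exact h.clm_apply contDiff_const

theorem compact_dχ (v : E n) : ∀ i ∈ M.s, HasCompactSupport (M.dχ v i) := fun i hi =>
  (M.compact_χ i hi).fderiv_apply ℝ v

/-- Because of this the commutator terms produced by the localization disappear in the limit. -/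
theorem sum_dχ (hΩ : IsOpen Ω) (v : E n) {x : E n} (hx : x ∈ Ω) : ∑ i ∈ M.s, M.dχ v i x = 0 := by
  have h1 : (fun x => ∑ i ∈ M.s, M.χ i x) =ᶠ[𝓝 x] fun _ => 1 := by
    filter_upwards [hΩ.mem_nhds hx] with y hy using M.sum_χ y (subset_closure hy)
  have h2 := h1.fderiv_eq (𝕜 := ℝ)
  rw [fderiv_fun_sum fun i hi => ((M.smooth_χ i hi).differentiable (by simp)) x] at h2
  have h3 := congrArg (fun L : E n →L[ℝ] ℝ => L v) h2
  simpa [dχ] using h3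

variable {M}

theorem contDiff_conv (hΩ : MeasurableSet Ω) {w : E n → ℝ} (hw : IntegrableOn w Ω) (k : ℕ) {i : E n}
    (hi : i ∈ M.s) : ContDiff ℝ ∞ (M.ρ k i ⋆[lsmul ℝ ℝ, volume] (Ω.indicator w)) :=
  (M.compact_ρ k i hi).contDiff_convolution_left _ (M.smooth_ρ k i hi)
    ((integrable_indicator_iff hΩ).2 hw).locallyIntegrable

theorem contDiff_op (hΩ : MeasurableSet Ω) {w : E n → ℝ} (hw : IntegrableOn w Ω) (k : ℕ)
    {a : E n → E n → ℝ} (ha : ∀ i ∈ M.s, ContDiff ℝ ∞ (a i)) : ContDiff ℝ ∞ (M.op k a w) :=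
  ContDiff.sum fun i hi => (ha i hi).mul (contDiff_conv hΩ hw k hi)

/-- The weights are arbitrary because two kinds occur: `M.χ`, which reproduces `w` in the limit, and
`M.dχ v`, for which the limit is zero in `Ω`. -/
theorem tendsto_op (hΩ : MeasurableSet Ω) {q : ℝ≥0∞} [Fact (1 ≤ q)] (hq : q ≠ ⊤) {w : E n → ℝ}
    (hw : MemLp w q (volume.restrict Ω)) (hwi : IntegrableOn w Ω) {a : E n → E n → ℝ}
    (ha : ∀ i ∈ M.s, ContDiff ℝ ∞ (a i)) (hac : ∀ i ∈ M.s, HasCompactSupport (a i)) :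
    Tendsto (fun k => eLpNorm (fun x => M.op k a w x - (∑ i ∈ M.s, a i x) * w x) q
      (volume.restrict Ω)) atTop (𝓝 0) := by
  have hb : ∀ i, ∃ L : ℝ≥0, i ∈ M.s → ∀ x, ‖a i x‖ ≤ L := by
    intro i
    by_cases hi : i ∈ M.s
    · obtain ⟨L, hL⟩ := (hac i hi).exists_bound_of_continuous (ha i hi).continuous
      exact ⟨L.toNNReal, fun _ x => (hL x).trans (Real.le_coe_toNNReal L)⟩
    · exact ⟨0, fun h => (hi h).elim⟩
  choose L hL using hb
  have hw' : MemLp (Ω.indicator w) q := (memLp_indicator_iff_restrict hΩ).2 hw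
  have h1 : ∀ i ∈ M.s, Tendsto (fun k => (L i : ℝ≥0∞) * eLpNorm (fun x =>
      (M.ρ k i ⋆[lsmul ℝ ℝ, volume] (Ω.indicator w)) x - Ω.indicator w x) q) atTop (𝓝 0) := by
    intro i hi
    have := tendsto_eLpNorm_convolution_sub hq hw' (fun k => (M.smooth_ρ k i hi).continuous)
      (fun k => M.compact_ρ k i hi) (fun k => M.nonneg_ρ k i hi) (fun k => M.integral_ρ k i hi)
      (fun k => M.tsupport_ρ k i hi) M.tendsto_r
    simpa using ENNReal.Tendsto.const_mul this (Or.inr (ENNReal.coe_ne_top (r := L i)))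
  have h2 := tendsto_finsetSum M.s h1
  rw [Finset.sum_const_zero] at h2
  refine tendsto_of_tendsto_of_tendsto_of_le_of_le tendsto_const_nhds h2 (fun _ => zero_le) fun k => ?_
  set g : E n → E n → ℝ := fun i x =>
    (M.ρ k i ⋆[lsmul ℝ ℝ, volume] (Ω.indicator w)) x - Ω.indicator w x
  have hgm : ∀ i ∈ M.s, AEStronglyMeasurable (g i) volume := fun i hi =>
    (contDiff_conv hΩ hwi k hi).continuous.aestronglyMeasurable.sub hw'.1
  have e1 : ∀ᵐ x ∂(volume.restrict Ω), M.op k a w x - (∑ i ∈ M.s, a i x) * w x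
      = (∑ i ∈ M.s, fun x => a i x * g i x) x := by
    refine ae_restrict_of_forall_mem hΩ fun x hx => ?_
    rw [Finset.sum_apply, op, Finset.sum_mul, ← Finset.sum_sub_distrib]
    refine Finset.sum_congr rfl fun i _ => ?_
    simp only [g, indicator_of_mem hx]
    ring
  simp only []
  rw [eLpNorm_congr_ae e1]
  refine (eLpNorm_mono_measure _ Measure.restrict_le_self).trans ((eLpNorm_sum_le (fun i hi =>
    (ha i hi).continuous.aestronglyMeasurable.mul (hgm i hi)) Fact.out).trans
    (Finset.sum_le_sum fun i hi => ?_))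
  refine (eLpNorm_le_nnreal_smul_eLpNorm_of_ae_le_mul (c := L i) (g := g i)
    (ae_of_all _ fun x => ?_) q).trans (le_of_eq (ENNReal.smul_def _ _))
  rw [← NNReal.coe_le_coe]
  simpa using mul_le_mul_of_nonneg_right (hL i hi x) (norm_nonneg (g i x))

theorem fderiv_op (hΩ : MeasurableSet Ω) {w : E n → ℝ} (hw : IntegrableOn w Ω) (k : ℕ) (x v : E n) :
    fderiv ℝ (M.op k M.χ w) x v = M.op k (M.dχ v) w x
      + ∑ i ∈ M.s, M.χ i x * ∫ y in Ω, fderiv ℝ (M.ρ k i) (x - y) v * w y := by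
  have hd : ∀ i ∈ M.s, DifferentiableAt ℝ (fun x =>
      M.χ i x * (M.ρ k i ⋆[lsmul ℝ ℝ, volume] (Ω.indicator w)) x) x := fun i hi =>
    ((M.smooth_χ i hi).differentiable (by simp) x).mul
      ((contDiff_conv hΩ hw k hi).differentiable (by simp) x)
  unfold op
  rw [fderiv_fun_sum hd, ← Finset.sum_add_distrib]
  simp only [FunLike.coe_sum, Finset.sum_apply]
  refine Finset.sum_congr rfl fun i hi => ?_
  rw [fderiv_fun_mul ((M.smooth_χ i hi).differentiable (by simp) x)
      ((contDiff_conv hΩ hw k hi).differentiable (by simp) x)]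
  simp only [_root_.add_apply, _root_.smul_apply, smul_eq_mul]
  rw [fderiv_convolution_apply ((integrable_indicator_iff hΩ).2 hw).locallyIntegrable
    (M.smooth_ρ k i hi) (M.compact_ρ k i hi), ← integral_indicator hΩ]
  have : ∀ y, fderiv ℝ (M.ρ k i) (x - y) v * Ω.indicator w y
      = Ω.indicator (fun y => fderiv ℝ (M.ρ k i) (x - y) v * w y) y := fun y => by
    by_cases hy : y ∈ Ω <;> simp [hy]
  simp only [this, dχ]
  ring

theorem conv_eq (hΩ : MeasurableSet Ω) (w : E n → ℝ) (k : ℕ) (i x : E n) :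
    (M.ρ k i ⋆[lsmul ℝ ℝ, volume] (Ω.indicator w)) x = ∫ y in Ω, M.ρ k i (x - y) * w y := by
  rw [convolution_eq_swap, ← integral_indicator hΩ]
  refine integral_congr_ae (ae_of_all _ fun y => ?_)
  by_cases hy : y ∈ Ω <;> simp [hy]

theorem fderiv_reflect (k : ℕ) {i : E n} (hi : i ∈ M.s) (x y v : E n) :
    fderiv ℝ (fun y => M.ρ k i (x - y)) y v = -fderiv ℝ (M.ρ k i) (x - y) v := by
  have h1 : HasFDerivAt (fun y : E n => x - y) (-ContinuousLinearMap.id ℝ (E n)) y :=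
    (hasFDerivAt_id y).const_sub x
  have h2 := ((M.smooth_ρ k i hi).differentiable (by simp) (x - y)).hasFDerivAt.comp y h1
  rw [show (fun y => M.ρ k i (x - y)) = M.ρ k i ∘ fun y => x - y from rfl, h2.fderiv]
  simp

/-- For every `x` in `closure Ω`, boundary points included, `y ↦ ρ (x - y)` is a test function in
`Ω`, so the weak derivative enters without a boundary term. -/
theorem fderiv_op_of_isWeakPartial (hΩ : MeasurableSet Ω) {j : Fin n} {w d : E n → ℝ}
    (hw : IntegrableOn w Ω) (h : IsWeakPartial Ω j w d) (k : ℕ) {x : E n} (hx : x ∈ closure Ω) :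
    fderiv ℝ (M.op k M.χ w) x (unitVec j)
      = M.op k M.χ d x + M.op k (M.dχ (unitVec j)) w x := by
  rw [fderiv_op hΩ hw, add_comm]
  congr 1
  refine Finset.sum_congr rfl fun i hi => ?_
  by_cases hxs : x ∈ tsupport (M.χ i)
  · have h1 := h.2.2 _ (M.isTest k i hi x hx hxs)
    simp only [fderiv_reflect k hi, smul_eq_mul, neg_mul, integral_neg, neg_inj] at h1
    rw [conv_eq hΩ, ← h1]
  · rw [image_eq_zero_of_notMem_tsupport hxs, zero_mul, zero_mul]

/-- Only the divergence of `V` is available, not its single derivatives. Therefore the derivatives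
are left on the kernel and summed over `j` before the weak formula is used. -/
theorem sum_fderiv_op_of_isWeakDiv (hΩ : MeasurableSet Ω) {V : E n → E n} {d : E n → ℝ}
    (hV : IntegrableOn V Ω) (h : IsWeakDiv Ω V d) (k : ℕ) {x : E n} (hx : x ∈ closure Ω) :
    ∑ j, fderiv ℝ (M.op k M.χ fun x => V x j) x (unitVec j)
      = M.op k M.χ d x + ∑ j, M.op k (M.dχ (unitVec j)) (fun x => V x j) x := by
  have hVj : ∀ j, IntegrableOn (fun x => V x j) Ω := fun j =>
    (EuclideanSpace.proj (𝕜 := ℝ) j).integrable_comp hV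
  rw [Finset.sum_congr rfl fun j _ => fderiv_op hΩ (hVj j) k x (unitVec j),
    Finset.sum_add_distrib, add_comm]
  congr 1
  rw [Finset.sum_comm]
  refine Finset.sum_congr rfl fun i hi => ?_
  rw [← Finset.mul_sum]
  by_cases hxs : x ∈ tsupport (M.χ i)
  · have ht := M.isTest k i hi x hx hxs
    have h1 := h.2.2 _ ht
    simp only [fderiv_reflect k hi, integral_neg, neg_inj] at h1
    rw [conv_eq hΩ, ← h1, ← integral_finsetSum]
    · congr 1
      refine integral_congr_ae (ae_of_all _ fun y => ?_)
      have e : V y = ∑ j, V y j • unitVec j := by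
        conv_lhs => rw [← (EuclideanSpace.basisFun (Fin n) ℝ).sum_repr (V y)]
        simp
      change _ = fderiv ℝ (M.ρ k i) (x - y) (V y)
      rw [congrArg (fderiv ℝ (M.ρ k i) (x - y)) e]
      simp [map_sum, mul_comm]
    · intro j _
      have hc : Continuous fun y => fderiv ℝ (M.ρ k i) (x - y) (unitVec j) :=
        (((M.smooth_ρ k i hi).continuous_fderiv (by simp)).comp (by fun_prop)).clm_apply
          continuous_const
      obtain ⟨L, hL⟩ := ((M.compact_ρ k i hi).fderiv_apply ℝ (unitVec j)).exists_bound_of_continuous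
        (((M.smooth_ρ k i hi).continuous_fderiv (by simp)).clm_apply continuous_const)
      exact (hVj j).bdd_mul (c := L) hc.aestronglyMeasurable (ae_of_all _ fun y => hL (x - y))
  · rw [image_eq_zero_of_notMem_tsupport hxs, zero_mul, zero_mul]

/-- The kernels have integral one, see only points of `Ω` and have shrinking support, so the error
is the oscillation of `w'` on small balls. Uniformity up to the boundary is what lets boundary
integrals pass to the limit. -/
theorem tendstoUniformlyOn_op (hΩ : IsOpen Ω) (hb : Bornology.IsBounded Ω) {w w' : E n → ℝ}
    (hw : IntegrableOn w Ω) (hww : ∀ᵐ x ∂(volume.restrict Ω), w x = w' x)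
    (hc : ContinuousOn w' (closure Ω)) :
    TendstoUniformlyOn (fun k => M.op k M.χ w) w' atTop (closure Ω) := by
  have hu : UniformContinuousOn w' (closure Ω) :=
    hb.isCompact_closure.uniformContinuousOn_of_continuous hc
  rw [Metric.tendstoUniformlyOn_iff]
  intro ε hε
  obtain ⟨δ, hδ, hu⟩ := Metric.uniformContinuousOn_iff.1 hu (ε / 2) (by positivity)
  filter_upwards [M.tendsto_r.eventually (gt_mem_nhds hδ)] with k hk x hx
  have key : ∀ i ∈ M.s, x ∈ tsupport (M.χ i) →
      ‖(M.ρ k i ⋆[lsmul ℝ ℝ, volume] (Ω.indicator w)) x - w' x‖ ≤ ε / 2 := by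
    intro i hi hxs
    have ht := M.isTest k i hi x hx hxs
    have hsub : ∀ y, M.ρ k i (x - y) ≠ 0 → y ∈ Ω ∧ dist y x < δ := by
      intro y hy
      refine ⟨ht.2.2 (subset_tsupport _ hy), ?_⟩
      have := M.tsupport_ρ k i hi (subset_tsupport _ hy)
      rw [mem_closedBall_zero_iff] at this
      rw [dist_comm, dist_eq_norm]
      exact this.trans_lt hk
    have hρi : Integrable fun y => M.ρ k i (x - y) :=
      ht.1.continuous.integrable_of_hasCompactSupport ht.2.1
    have h1 : ∫ y, M.ρ k i (x - y) = 1 := by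
      rw [integral_sub_left_eq_self (M.ρ k i) volume x]; exact M.integral_ρ k i hi
    have h2 : ∫ y in Ω, M.ρ k i (x - y) = 1 := by
      rw [setIntegral_eq_integral_of_forall_compl_eq_zero, h1]
      intro y hy
      by_contra h
      exact hy (hsub y h).1
    have hwi : IntegrableOn (fun y => M.ρ k i (x - y) * w y) Ω := by
      obtain ⟨L, hL⟩ := (M.compact_ρ k i hi).exists_bound_of_continuous (M.smooth_ρ k i hi).continuous
      exact hw.bdd_mul (c := L) ht.1.continuous.aestronglyMeasurable
        (ae_of_all _ fun y => hL (x - y))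
    have h3 : (M.ρ k i ⋆[lsmul ℝ ℝ, volume] (Ω.indicator w)) x - w' x
        = ∫ y in Ω, M.ρ k i (x - y) * (w y - w' x) := by
      simp only [mul_sub]
      rw [conv_eq hΩ.measurableSet, integral_sub hwi (hρi.integrableOn.mul_const _),
        integral_mul_const, h2, one_mul]
    rw [h3]
    calc _ ≤ ∫ y in Ω, M.ρ k i (x - y) * (ε / 2) := by
          refine norm_integral_le_of_norm_le (hρi.integrableOn.mul_const _) ?_
          filter_upwards [hww, ae_restrict_mem hΩ.measurableSet] with y hy hyΩ
          rw [norm_mul, Real.norm_of_nonneg (M.nonneg_ρ k i hi _)]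
          by_cases h : M.ρ k i (x - y) = 0
          · simp [h]
          · refine mul_le_mul_of_nonneg_left ?_ (M.nonneg_ρ k i hi _)
            rw [hy, ← dist_eq_norm]
            exact (hu y (subset_closure hyΩ) x hx (hsub y h).2).le
      _ = ε / 2 := by rw [integral_mul_const, h2, one_mul]
  have e1 : M.op k M.χ w x - w' x = ∑ i ∈ M.s, M.χ i x *
      ((M.ρ k i ⋆[lsmul ℝ ℝ, volume] (Ω.indicator w)) x - w' x) := by
    simp only [mul_sub]
    rw [Finset.sum_sub_distrib, ← Finset.sum_mul, M.sum_χ x hx, one_mul, op]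
  rw [dist_comm, dist_eq_norm, e1]
  refine (norm_sum_le _ _).trans_lt ?_
  calc _ ≤ ∑ i ∈ M.s, M.χ i x * (ε / 2) := by
        refine Finset.sum_le_sum fun i hi => ?_
        rw [norm_mul, Real.norm_of_nonneg (M.nonneg_χ i hi x)]
        by_cases hxs : x ∈ tsupport (M.χ i)
        · exact mul_le_mul_of_nonneg_left (key i hi hxs) (M.nonneg_χ i hi x)
        · rw [image_eq_zero_of_notMem_tsupport hxs, zero_mul, zero_mul]
    _ = ε / 2 := by rw [← Finset.sum_mul, M.sum_χ x hx, one_mul]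
    _ < ε := by linarith

end Mollifier

/-- Density of smooth functions in `W^{1,q}(Ω)`. -/
theorem IsSobolev.exists_smooth (hΩ : IsLipschitzDomain Ω) {q : ℝ≥0∞} [Fact (1 ≤ q)] (hq : q ≠ ⊤)
    {w : E n → ℝ} {D : Fin n → E n → ℝ} (h : IsSobolev Ω q w D) :
    ∃ s : ℕ → E n → ℝ, (∀ k, ContDiff ℝ ∞ (s k)) ∧
      Tendsto (fun k => eLpNorm (fun x => s k x - w x) q (volume.restrict Ω)) atTop (𝓝 0) ∧
      ∀ i, Tendsto (fun k => eLpNorm (fun x => fderiv ℝ (s k) x (unitVec i) - D i x) q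
        (volume.restrict Ω)) atTop (𝓝 0) := by
  obtain ⟨M⟩ := exists_mollifier hΩ
  have hm := hΩ.isOpen.measurableSet
  have : IsFiniteMeasure (volume.restrict Ω) :=
    ⟨by rw [Measure.restrict_apply_univ]; exact hΩ.isBounded.measure_lt_top⟩
  have hint : ∀ {f : E n → ℝ}, MemLp f q (volume.restrict Ω) → IntegrableOn f Ω := fun hf =>
    hf.integrable Fact.out
  have hwi := hint h.1
  refine ⟨fun k => M.op k M.χ w, fun k => M.contDiff_op hm hwi k M.smooth_χ, ?_, fun j => ?_⟩
  · refine (M.tendsto_op hm hq h.1 hwi M.smooth_χ M.compact_χ).congr fun k => ?_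
    refine eLpNorm_congr_ae (ae_restrict_of_forall_mem hm fun x hx => ?_)
    simp only [M.sum_χ x (subset_closure hx), one_mul]
  · have hD := h.2 j
    have h1 := M.tendsto_op hm hq hD.1 (hint hD.1) M.smooth_χ M.compact_χ
    -- The weights `dχ` sum to zero in `Ω`, so this commutator term tends to zero.
    have h2 := M.tendsto_op hm hq h.1 hwi (M.smooth_dχ (unitVec j)) (M.compact_dχ (unitVec j))
    have h3 := h1.add h2
    rw [add_zero] at h3
    refine tendsto_of_tendsto_of_tendsto_of_le_of_le tendsto_const_nhds h3 (fun _ => zero_le)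
      fun k => ?_
    refine le_of_eq_of_le (eLpNorm_congr_ae ?_) (eLpNorm_add_le ?_ ?_ Fact.out)
    · refine ae_restrict_of_forall_mem hm fun x hx => ?_
      simp only [M.fderiv_op_of_isWeakPartial hm hwi hD.2 k (subset_closure hx), Pi.add_apply,
        M.sum_χ x (subset_closure hx), M.sum_dχ hΩ.isOpen _ hx]
      ring
    · refine (M.contDiff_op hm (hint hD.1) k M.smooth_χ).continuous.aestronglyMeasurable.sub ?_
      exact (Continuous.aestronglyMeasurable (continuous_finsetSum _ fun i hi =>
        (M.smooth_χ i hi).continuous)).mul hD.1.1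
    · refine (M.contDiff_op hm hwi k (M.smooth_dχ _)).continuous.aestronglyMeasurable.sub ?_
      exact (Continuous.aestronglyMeasurable (continuous_finsetSum _ fun i hi =>
        (M.smooth_dχ _ i hi).continuous)).mul h.1.1

end OneSided

/-! ### Morrey's inequality. -/

section Morrey

variable {Ω : Set (E n)}

/-- The integrand is the derivative of `-((1 - τ) * s (x + τ • v))`. The weight removes the value at
the far end, leaving `s x` as an integral that can be averaged over directions. -/
theorem eq_integral_along_segment {s : E n → ℝ} (hs : ContDiff ℝ 1 s) (x v : E n) :
    s x = ∫ τ in (0 : ℝ)..1, (s (x + τ • v) - (1 - τ) * fderiv ℝ s (x + τ • v) v) := by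
  have h1 : ∀ τ : ℝ, HasDerivAt (fun τ : ℝ => -((1 - τ) * s (x + τ • v)))
      (s (x + τ • v) - (1 - τ) * fderiv ℝ s (x + τ • v) v) τ := by
    intro τ
    have h2 : HasDerivAt (fun τ : ℝ => x + τ • v) v τ := by
      simpa using ((hasDerivAt_id τ).smul_const v).const_add x
    have h3 := ((hs.differentiable (by simp) (x + τ • v)).hasFDerivAt.comp_hasDerivAt τ h2)
    have h4 := (((hasDerivAt_id τ).const_sub 1).mul h3).neg
    refine h4.congr_deriv ?_
    simp
    ring
  have hc : Continuous fun τ : ℝ => s (x + τ • v) - (1 - τ) * fderiv ℝ s (x + τ • v) v := by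
    have h5 : Continuous fun τ : ℝ => x + τ • v := by fun_prop
    exact (hs.continuous.comp h5).sub ((continuous_const.sub continuous_id).mul
      (((hs.continuous_fderiv one_ne_zero).comp h5).clm_apply continuous_const))
  rw [intervalIntegral.integral_eq_sub_of_hasDerivAt (fun τ _ => h1 τ) (hc.intervalIntegrable _ _)]
  simp

/-- Substitution of `y = x + τ • v`, whose Jacobian is `τ ^ n`. -/
theorem setIntegral_comp_smul_le (hΩ : IsLipschitzDomain Ω) {G : E n → ℝ} (hG : Continuous G)
    (hG0 : ∀ y, 0 ≤ G y) {x : E n} {B : Set (E n)} {τ : ℝ} (hτ : 0 < τ)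
    (hB : ∀ v ∈ B, x + τ • v ∈ Ω) :
    ∫ v in B, G (x + τ • v) ≤ (τ ^ n)⁻¹ * ∫ y in Ω, G y := by
  have h1 := Measure.setIntegral_comp_smul_of_pos (volume : Measure (E n)) (fun y => G (x + y)) B hτ
  simp only [finrank_euclideanSpace, Fintype.card_fin, smul_eq_mul] at h1
  rw [h1]
  refine mul_le_mul_of_nonneg_left ?_ (by positivity)
  have h2 := (measurePreserving_add_left (volume : Measure (E n)) x).setIntegral_preimage_emb
    (measurableEmbedding_addLeft x) G Ω
  rw [← h2]
  refine setIntegral_mono_set ?_ (ae_of_all _ fun y => hG0 _) ?_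
  · have := (hΩ.integrableOn_continuous hG)
    exact ((measurePreserving_add_left (volume : Measure (E n)) x).integrableOn_comp_preimage
      (measurableEmbedding_addLeft x)).2 this
  · refine LE.le.eventuallyLE ?_
    rintro _ ⟨v, hv, rfl⟩
    exact hB v hv

/-- The formula along segments is averaged over the ball `B` of cone directions. Hölder's inequality
in `v` and scaling bound the slice at `τ` by `τ ^ (-(n / p))` times the norm in `W^{1,p}`, and `p >
n` makes this power integrable at zero. -/
theorem HasCone.exists_sup_bound (hΩ : IsLipschitzDomain Ω) {x₀ v₀ : E n} {r c : ℝ}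
    (h : HasCone Ω x₀ r v₀ c) {p : ℝ} (hp1 : 1 < p) (hp : (n : ℝ) < p) :
    ∃ A : ℝ, 0 ≤ A ∧ ∀ s : E n → ℝ, ContDiff ℝ 1 s → ∀ x ∈ closure Ω, x ∈ Metric.ball x₀ r →
      |s x| ≤ A * (∫ y in Ω, (|s y| + ‖fderiv ℝ s y‖) ^ p) ^ (1 / p) := by
  set B := Metric.closedBall v₀ c
  set R := ‖v₀‖ + c + 1
  have hR : 1 ≤ R := by have := h.aperture_pos; have := norm_nonneg v₀; simp only [R]; linarith
  have hBR : ∀ v ∈ B, ‖v‖ ≤ R := by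
    intro v hv
    have : ‖v‖ ≤ ‖v₀‖ + ‖v - v₀‖ := by
      simpa using norm_add_le v₀ (v - v₀)
    rw [mem_closedBall_iff_norm] at hv
    simp only [R]; linarith
  have hBpos : 0 < (volume B).toReal :=
    ENNReal.toReal_pos (Metric.measure_closedBall_pos volume v₀ h.aperture_pos).ne'
      (isCompact_closedBall v₀ c).measure_lt_top.ne
  have hBfin : IsFiniteMeasure (volume.restrict B) :=
    ⟨by rw [Measure.restrict_apply_univ]; exact (isCompact_closedBall v₀ c).measure_lt_top⟩
  set q := p.conjExponent
  have hpq : p.HolderConjugate q := Real.HolderConjugate.conjExponent hp1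
  have hp0 : 0 < p := by linarith
  have hnp : -1 < -((n : ℝ) / p) := by
    rw [neg_lt_neg_iff, div_lt_one hp0]; exact hp
  set I := ∫ τ in Ioc (0 : ℝ) 1, τ ^ (-((n : ℝ) / p))
  have hI : IntegrableOn (fun τ : ℝ => τ ^ (-((n : ℝ) / p))) (Ioc 0 1) :=
    (intervalIntegrable_iff_integrableOn_Ioc_of_le zero_le_one).1
      (intervalIntegral.intervalIntegrable_rpow' hnp)
  have hI0 : 0 ≤ I := setIntegral_nonneg measurableSet_Ioc fun τ hτ => Real.rpow_nonneg hτ.1.le _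
  refine ⟨(volume B).toReal⁻¹ * (I * (volume B).toReal ^ (1 / q) * R), by positivity,
    fun s hs x hx hxr => ?_⟩
  set H : E n → ℝ := fun y => |s y| + ‖fderiv ℝ s y‖
  have hH : Continuous H := by
    have := hs.continuous_fderiv one_ne_zero
    have := hs.continuous
    fun_prop
  have hH0 : ∀ y, 0 ≤ H y := fun y => by positivity
  set K := ∫ y in Ω, H y ^ p
  have hK0 : 0 ≤ K := integral_nonneg fun y => Real.rpow_nonneg (hH0 y) _
  have hline : Continuous fun q : E n × ℝ => H (x + q.2 • q.1) := by fun_prop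
  have h1 : ∀ v ∈ B, |s x| ≤ R * ∫ τ in Ioc (0 : ℝ) 1, H (x + τ • v) := by
    intro v hv
    rw [eq_integral_along_segment hs x v, intervalIntegral.integral_of_le zero_le_one,
      ← integral_const_mul, ← Real.norm_eq_abs]
    refine norm_integral_le_of_norm_le ?_ ?_
    · exact (((hline.comp (Continuous.prodMk_right v)).integrableOn_Icc).mono_set
        Ioc_subset_Icc_self).const_mul R
    · refine ae_restrict_of_forall_mem measurableSet_Ioc fun τ hτ => ?_
      have h2 : ‖fderiv ℝ s (x + τ • v) v‖ ≤ ‖fderiv ℝ s (x + τ • v)‖ * R :=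
        ((fderiv ℝ s (x + τ • v)).le_opNorm v).trans
          (mul_le_mul_of_nonneg_left (hBR v hv) (norm_nonneg _))
      have h3 : ‖1 - τ‖ ≤ 1 := by rw [Real.norm_eq_abs, abs_le]; constructor <;> linarith [hτ.1, hτ.2]
      calc _ ≤ ‖s (x + τ • v)‖ + ‖1 - τ‖ * ‖fderiv ℝ s (x + τ • v) v‖ := by
            rw [← norm_mul]; exact norm_sub_le _ _
        _ ≤ ‖s (x + τ • v)‖ + 1 * (‖fderiv ℝ s (x + τ • v)‖ * R) := by gcongr
        _ ≤ R * H (x + τ • v) := by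
            simp only [H, Real.norm_eq_abs]
            nlinarith [abs_nonneg (s (x + τ • v)), norm_nonneg (fderiv ℝ s (x + τ • v))]
  have hprod : Integrable (fun q : E n × ℝ => H (x + q.2 • q.1))
      ((volume.restrict B).prod (volume.restrict (Ioc (0 : ℝ) 1))) := by
    rw [Measure.prod_restrict]
    exact (hline.continuousOn.integrableOn_compact
      ((isCompact_closedBall v₀ c).prod (isCompact_Icc (a := (0 : ℝ)) (b := 1)))).mono_set
      (prod_mono le_rfl Ioc_subset_Icc_self)
  have h2 : ∀ τ ∈ Ioc (0 : ℝ) 1, ∫ v in B, H (x + τ • v)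
      ≤ τ ^ (-((n : ℝ) / p)) * (K ^ (1 / p) * (volume B).toReal ^ (1 / q)) := by
    intro τ hτ
    have hcont : Continuous fun v => H (x + τ • v) := by fun_prop
    have hHp : Continuous fun y => H y ^ p := hH.rpow_const fun y => Or.inr hp0.le
    obtain ⟨b, hb⟩ := (isCompact_closedBall v₀ c).exists_bound_of_continuousOn hcont.continuousOn
    have h3 := integral_mul_le_Lp_mul_Lq_of_nonneg (μ := volume.restrict B) hpq
      (f := fun v => H (x + τ • v)) (g := fun _ => 1) (ae_of_all _ fun v => hH0 _)
      (ae_of_all _ fun v => zero_le_one)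
      (MemLp.of_bound hcont.aestronglyMeasurable b
        (ae_restrict_of_forall_mem Metric.isClosed_closedBall.measurableSet hb))
      (memLp_const _)
    simp only [mul_one, Real.one_rpow, integral_const, smul_eq_mul, measureReal_def,
      Measure.restrict_apply_univ] at h3
    refine h3.trans ?_
    have h4 := setIntegral_comp_smul_le hΩ hHp (fun y => Real.rpow_nonneg (hH0 y) _) (x := x)
      (B := B) hτ.1 fun v hv => h.mem x hx hxr τ hτ v hv
    have h5 : (∫ v in B, H (x + τ • v) ^ p) ^ (1 / p) ≤ τ ^ (-((n : ℝ) / p)) * K ^ (1 / p) := by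
      refine (Real.rpow_le_rpow (integral_nonneg fun v => Real.rpow_nonneg (hH0 _) _) h4
        (by positivity)).trans (le_of_eq ?_)
      have hτn : 0 ≤ (τ ^ n)⁻¹ := inv_nonneg.2 (pow_nonneg hτ.1.le n)
      rw [Real.mul_rpow hτn hK0, ← Real.rpow_natCast, ← Real.rpow_neg hτ.1.le,
        ← Real.rpow_mul hτ.1.le]
      congr 2
      ring
    rw [← mul_assoc]
    exact mul_le_mul_of_nonneg_right h5 (by positivity)
  have h6 : (volume B).toReal * |s x| ≤ R * (I * (K ^ (1 / p) * (volume B).toReal ^ (1 / q))) := by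
    calc (volume B).toReal * |s x| = ∫ v in B, |s x| := by
          rw [integral_const, measureReal_def, Measure.restrict_apply_univ, smul_eq_mul]
      _ ≤ ∫ v in B, R * ∫ τ in Ioc (0 : ℝ) 1, H (x + τ • v) :=
          setIntegral_mono_on (integrable_const _) (hprod.integral_prod_left.const_mul R)
            Metric.isClosed_closedBall.measurableSet h1
      _ = R * ∫ τ in Ioc (0 : ℝ) 1, ∫ v in B, H (x + τ • v) := by
          rw [integral_const_mul, integral_integral_swap hprod]
      _ ≤ R * ∫ τ in Ioc (0 : ℝ) 1,
            τ ^ (-((n : ℝ) / p)) * (K ^ (1 / p) * (volume B).toReal ^ (1 / q)) := by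
          refine mul_le_mul_of_nonneg_left ?_ (by linarith)
          exact setIntegral_mono_on hprod.integral_prod_right (hI.mul_const _) measurableSet_Ioc h2
      _ = _ := by rw [integral_mul_const]
  rw [mul_assoc, inv_mul_eq_div, le_div_iff₀ hBpos]
  linarith

/-- Morrey's bound for functions that are `C¹` up to the boundary. -/
theorem exists_sup_bound (hΩ : IsLipschitzDomain Ω) {p : ℝ} (hp1 : 1 < p) (hp : (n : ℝ) < p) :
    ∃ A : ℝ≥0, ∀ s : E n → ℝ, ContDiff ℝ 1 s → ∀ x ∈ closure Ω,
      ‖s x‖ₑ ≤ A * (eLpNorm s (ENNReal.ofReal p) (volume.restrict Ω)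
        + ∑ i, eLpNorm (fun x => fderiv ℝ s x (unitVec i)) (ENNReal.ofReal p) (volume.restrict Ω)) := by
  have h : ∀ x₀ ∈ closure Ω, ∃ r, 0 < r ∧ ∃ A : ℝ, 0 ≤ A ∧ ∀ s : E n → ℝ, ContDiff ℝ 1 s →
      ∀ x ∈ closure Ω, x ∈ Metric.ball x₀ r →
      |s x| ≤ A * (∫ y in Ω, (|s y| + ‖fderiv ℝ s y‖) ^ p) ^ (1 / p) := fun x₀ hx₀ => by
    obtain ⟨r, v₀, c, h⟩ := exists_cone hΩ hx₀
    exact ⟨r, h.radius_pos, h.exists_sup_bound hΩ hp1 hp⟩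
  choose! r hr A hA0 hA using h
  obtain ⟨t, ht, hcov⟩ := hΩ.isCompact_closure.elim_nhds_subcover (fun x => Metric.ball x (r x))
    fun x hx => Metric.ball_mem_nhds x (hr x hx)
  refine ⟨(∑ i ∈ t, A i).toNNReal, fun s hs x hx => ?_⟩
  obtain ⟨i, hi, hxi⟩ := mem_iUnion₂.1 (hcov hx)
  have hd : Continuous (fun x => fderiv ℝ s x) := hs.continuous_fderiv one_ne_zero
  set H : E n → ℝ := fun y => |s y| + ‖fderiv ℝ s y‖
  have hH : Continuous H := hs.continuous.abs.add hd.norm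
  have hp0 : 0 < p := by linarith
  have hone : 1 ≤ ENNReal.ofReal p := by rw [ENNReal.one_le_ofReal]; exact hp1.le
  have h1 : |s x| ≤ (∑ i ∈ t, A i) * (∫ y in Ω, H y ^ p) ^ (1 / p) := by
    refine (hA i (ht i hi) s hs x hx hxi).trans (mul_le_mul_of_nonneg_right
      (Finset.single_le_sum (fun j hj => hA0 j (ht j hj)) hi) (Real.rpow_nonneg ?_ _))
    exact integral_nonneg fun y => Real.rpow_nonneg (by positivity) _
  have h2 : eLpNorm H (ENNReal.ofReal p) (volume.restrict Ω)
      = ENNReal.ofReal ((∫ y in Ω, H y ^ p) ^ (1 / p)) := by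
    rw [(hΩ.memLp_continuous hH _).eLpNorm_eq_integral_rpow_norm (by simpa using hp0) (by simp),
      ENNReal.toReal_ofReal hp0.le, one_div]
    have e : ∀ y, ‖H y‖ = H y := fun y => Real.norm_of_nonneg (by positivity)
    simp only [e]
  have h3 : ‖s x‖ₑ ≤ (∑ i ∈ t, A i).toNNReal
      * eLpNorm H (ENNReal.ofReal p) (volume.restrict Ω) := by
    rw [h2, Real.enorm_eq_ofReal_abs]
    refine (ENNReal.ofReal_le_ofReal h1).trans ?_
    rw [ENNReal.ofReal_mul (Finset.sum_nonneg fun j hj => hA0 j (ht j hj))]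
    rfl
  refine h3.trans (mul_le_mul_right ((eLpNorm_add_le (f := fun y => |s y|)
    (g := fun y => ‖fderiv ℝ s y‖) hs.continuous.abs.aestronglyMeasurable
    hd.norm.aestronglyMeasurable hone).trans (add_le_add ?_ ?_)) _)
  · simp only [← Real.norm_eq_abs, eLpNorm_norm, le_refl]
  · refine (eLpNorm_mono_real (g := ∑ i, fun x => |fderiv ℝ s x (unitVec i)|) fun x => ?_).trans
      ((eLpNorm_sum_le (fun i _ => (hd.clm_apply continuous_const).abs.aestronglyMeasurable)
        hone).trans (Finset.sum_le_sum fun i _ => ?_))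
    · rw [norm_norm, Finset.sum_apply]; exact norm_clm_le_sum _
    · simp only [← Real.norm_eq_abs, eLpNorm_norm, le_refl]

end Morrey

/-! ### Convergence in Sobolev spaces and uniform limits. -/

section SobolevTools

variable {Ω : Set (E n)} {F : Type*} [NormedAddCommGroup F] {q : ℝ≥0∞}

/-- The sum of the `L^q(Ω)` norms of a function and of its derivatives. -/
def wNorm (Ω : Set (E n)) (q : ℝ≥0∞) (w : E n → F) (D : Fin n → E n → F) : ℝ≥0∞ :=
  eLpNorm w q (volume.restrict Ω) + ∑ i, eLpNorm (D i) q (volume.restrict Ω)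

theorem wNorm_sub_comm (w w' : E n → F) (D D' : Fin n → E n → F) :
    wNorm Ω q (fun x => w x - w' x) (fun i x => D i x - D' i x)
      = wNorm Ω q (fun x => w' x - w x) (fun i x => D' i x - D i x) := by
  unfold wNorm
  congr 1
  · exact eLpNorm_sub_comm _ _ _ _
  · exact Finset.sum_congr rfl fun i _ => eLpNorm_sub_comm _ _ _ _

/-- `s k → w` in `W^{1,q}(Ω)`, with `D` the derivatives of `w`. -/
def TendstoW (Ω : Set (E n)) (q : ℝ≥0∞) (s : ℕ → E n → F) (Ds : ℕ → Fin n → E n → F) (w : E n → F)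
    (D : Fin n → E n → F) : Prop :=
  Tendsto (fun k => wNorm Ω q (fun x => s k x - w x) (fun i x => Ds k i x - D i x)) atTop (𝓝 0)

theorem tendstoW_iff {s : ℕ → E n → F} {Ds : ℕ → Fin n → E n → F} {w : E n → F}
    {D : Fin n → E n → F} : TendstoW Ω q s Ds w D ↔
      Tendsto (fun k => eLpNorm (fun x => s k x - w x) q (volume.restrict Ω)) atTop (𝓝 0) ∧
      ∀ i, Tendsto (fun k => eLpNorm (fun x => Ds k i x - D i x) q (volume.restrict Ω))
        atTop (𝓝 0) := by
  constructor
  · intro h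
    refine ⟨tendsto_of_tendsto_of_tendsto_of_le_of_le tendsto_const_nhds h (fun _ => zero_le)
      fun k => le_self_add, fun i => tendsto_of_tendsto_of_tendsto_of_le_of_le tendsto_const_nhds h
      (fun _ => zero_le) fun k => ?_⟩
    exact (Finset.single_le_sum (f := fun i => eLpNorm (fun x => Ds k i x - D i x) q
      (volume.restrict Ω)) (fun _ _ => zero_le) (Finset.mem_univ i)).trans le_add_self
  · rintro ⟨h1, h2⟩
    have h3 := h1.add (tendsto_finsetSum Finset.univ fun i _ => h2 i)
    simpa [TendstoW, wNorm] using h3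

theorem eLpNorm_one_le_of_isFinite {μ : Measure (E n)} [IsFiniteMeasure μ] (hq : 1 ≤ q) {f : E n → F}
    (hf : AEStronglyMeasurable f μ) :
    eLpNorm f 1 μ ≤ eLpNorm f q μ * μ univ ^ (1 - 1 / q.toReal) := by
  simpa using eLpNorm_le_eLpNorm_mul_rpow_measure_univ hq hf

theorem tendsto_eLpNorm_one {μ : Measure (E n)} [IsFiniteMeasure μ] (hq : 1 ≤ q)
    {f : ℕ → E n → F} (hf : ∀ k, AEStronglyMeasurable (f k) μ)
    (h : Tendsto (fun k => eLpNorm (f k) q μ) atTop (𝓝 0)) :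
    Tendsto (fun k => eLpNorm (f k) 1 μ) atTop (𝓝 0) := by
  have hc : μ univ ^ (1 - 1 / q.toReal) ≠ ⊤ := by
    refine ENNReal.rpow_ne_top_of_nonneg ?_ (measure_ne_top μ univ)
    rcases eq_or_ne q ⊤ with rfl | hq'
    · simp
    · have : 1 ≤ q.toReal := by
        rw [← ENNReal.toReal_one]; exact ENNReal.toReal_mono hq' hq
      rw [sub_nonneg, div_le_one (by linarith)]; exact this
  have h1 := ENNReal.Tendsto.mul_const h (Or.inr hc)
  rw [zero_mul] at h1
  exact tendsto_of_tendsto_of_tendsto_of_le_of_le tendsto_const_nhds h1 (fun _ => zero_le)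
    fun k => eLpNorm_one_le_of_isFinite hq (hf k)

variable [NormedSpace ℝ F]

/-- Classical partial derivatives. -/
def pd (s : E n → F) (i : Fin n) (x : E n) : F := fderiv ℝ s x (unitVec i)

theorem continuous_pd {s : E n → F} (hs : ContDiff ℝ 1 s) (i : Fin n) : Continuous (pd s i) :=
  (hs.continuous_fderiv one_ne_zero).clm_apply continuous_const

theorem isFiniteMeasure_restrict (hΩ : IsLipschitzDomain Ω) : IsFiniteMeasure (volume.restrict Ω) :=
  ⟨by rw [Measure.restrict_apply_univ]; exact hΩ.isBounded.measure_lt_top⟩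

theorem isSobolev_of_contDiff [CompleteSpace F] (hΩ : IsLipschitzDomain Ω) {s : E n → F}
    (hs : ContDiff ℝ 1 s) : IsSobolev Ω q s (pd s) :=
  ⟨hΩ.memLp_continuous hs.continuous q, fun i => ⟨hΩ.memLp_continuous (continuous_pd hs i) q,
    isWeakPartial_of_contDiff hs⟩⟩

theorem IsSobolev.neg {w : E n → F} {D : Fin n → E n → F} (h : IsSobolev Ω q w D) :
    IsSobolev Ω q (fun x => -w x) (fun i x => -D i x) := by
  refine ⟨h.1.neg, fun i => ⟨(h.2 i).1.neg, (h.2 i).2.1.neg, (h.2 i).2.2.1.neg, fun φ hφ => ?_⟩⟩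
  have := (h.2 i).2.2.2 φ hφ
  simp only [smul_neg, integral_neg, this]

theorem IsSobolev.add [CompleteSpace F] {w w' : E n → F} {D D' : Fin n → E n → F}
    (h : IsSobolev Ω q w D) (h' : IsSobolev Ω q w' D') :
    IsSobolev Ω q (fun x => w x + w' x) (fun i x => D i x + D' i x) :=
  ⟨h.1.add h'.1, fun i => ⟨(h.2 i).1.add (h'.2 i).1, (h.2 i).2.add (h'.2 i).2⟩⟩

theorem IsSobolev.sub [CompleteSpace F] {w w' : E n → F} {D D' : Fin n → E n → F}
    (h : IsSobolev Ω q w D) (h' : IsSobolev Ω q w' D') :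
    IsSobolev Ω q (fun x => w x - w' x) (fun i x => D i x - D' i x) := by
  simpa only [sub_eq_add_neg] using h.add h'.neg

theorem IsSobolev.wNorm_ne_top {w : E n → F} {D : Fin n → E n → F} (h : IsSobolev Ω q w D) :
    wNorm Ω q w D ≠ ⊤ :=
  ENNReal.add_ne_top.2 ⟨h.1.eLpNorm_ne_top, ENNReal.sum_ne_top.2 fun i _ => (h.2 i).1.eLpNorm_ne_top⟩

theorem wNorm_add_le (hq : 1 ≤ q) {w w' : E n → F} {D D' : Fin n → E n → F}
    (h : IsSobolev Ω q w D) (h' : IsSobolev Ω q w' D') :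
    wNorm Ω q (fun x => w x + w' x) (fun i x => D i x + D' i x)
      ≤ wNorm Ω q w D + wNorm Ω q w' D' := by
  unfold wNorm
  rw [add_add_add_comm, ← Finset.sum_add_distrib]
  exact add_le_add (eLpNorm_add_le h.1.1 h'.1.1 hq) (Finset.sum_le_sum fun i _ =>
    eLpNorm_add_le (h.2 i).1.1 (h'.2 i).1.1 hq)

theorem exists_tendstoW (hΩ : IsLipschitzDomain Ω) (hq1 : 1 ≤ q) (hq : q ≠ ⊤)
    {w : E n → ℝ} {D : Fin n → E n → ℝ} (h : IsSobolev Ω q w D) :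
    ∃ s : ℕ → E n → ℝ, (∀ k, ContDiff ℝ ∞ (s k)) ∧ TendstoW Ω q s (fun k => pd (s k)) w D := by
  have : Fact (1 ≤ q) := ⟨hq1⟩
  obtain ⟨s, h1, h2, h3⟩ := h.exists_smooth hΩ hq
  exact ⟨s, h1, tendstoW_iff.2 ⟨h2, h3⟩⟩

theorem TendstoW.sub_le [CompleteSpace F] (hq1 : 1 ≤ q) {s : ℕ → E n → F} {Ds : ℕ → Fin n → E n → F}
    {w : E n → F} {D : Fin n → E n → F} (hs : ∀ k, IsSobolev Ω q (s k) (Ds k))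
    (hw : IsSobolev Ω q w D) (k l : ℕ) :
    wNorm Ω q (fun x => s k x - s l x) (fun i x => Ds k i x - Ds l i x)
      ≤ wNorm Ω q (fun x => s k x - w x) (fun i x => Ds k i x - D i x)
        + wNorm Ω q (fun x => s l x - w x) (fun i x => Ds l i x - D i x) := by
  rw [wNorm_sub_comm (s l)]
  refine le_of_eq_of_le ?_ (wNorm_add_le hq1 ((hs k).sub hw) (hw.sub (hs l)))
  simp

theorem pd_sub {s s' : E n → F} (hs : ContDiff ℝ ∞ s) (hs' : ContDiff ℝ ∞ s') (i : Fin n) (x : E n) :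
    pd (fun x => s x - s' x) i x = pd s i x - pd s' i x := by
  unfold pd
  rw [fderiv_fun_sub (hs.differentiable (by simp) x) (hs'.differentiable (by simp) x)]
  rfl

/-- Smooth functions that converge in `W^{1,p}(Ω)`, `p > n`, converge uniformly on `closure Ω`. -/
theorem exists_uniform_limit (hΩ : IsLipschitzDomain Ω) {p : ℝ} (hp1 : 1 < p) (hp : (n : ℝ) < p) :
    ∃ A : ℝ≥0, ∀ (w : E n → ℝ) (D : Fin n → E n → ℝ) (s : ℕ → E n → ℝ),
      IsSobolev Ω (ENNReal.ofReal p) w D → (∀ k, ContDiff ℝ ∞ (s k)) →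
      TendstoW Ω (ENNReal.ofReal p) s (fun k => pd (s k)) w D →
      ∃ w' : E n → ℝ, ContinuousOn w' (closure Ω) ∧ (∀ᵐ x ∂(volume.restrict Ω), w x = w' x) ∧
        TendstoUniformlyOn s w' atTop (closure Ω) ∧
        ∀ x ∈ closure Ω, ‖w' x‖ₑ ≤ A * wNorm Ω (ENNReal.ofReal p) w D := by
  obtain ⟨A, hA⟩ := exists_sup_bound hΩ hp1 hp
  refine ⟨A, fun w D s hw hs h => ?_⟩
  have hone : 1 ≤ ENNReal.ofReal p := by rw [ENNReal.one_le_ofReal]; exact hp1.le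
  have hsob : ∀ k, IsSobolev Ω (ENNReal.ofReal p) (s k) (pd (s k)) := fun k =>
    isSobolev_of_contDiff hΩ ((hs k).of_le (by simp))
  set a : ℕ → ℝ≥0∞ := fun k =>
    wNorm Ω (ENNReal.ofReal p) (fun x => s k x - w x) (fun i x => pd (s k) i x - D i x)
  have hcau : ∀ k l, ∀ x ∈ closure Ω, ‖s k x - s l x‖ₑ ≤ A * (a k + a l) := by
    intro k l x hx
    have h1 := hA (fun x => s k x - s l x) (((hs k).sub (hs l)).of_le (by simp)) x hx
    refine h1.trans (mul_le_mul_right (le_of_eq_of_le ?_ (TendstoW.sub_le hone hsob hw k l)) _)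
    unfold wNorm
    congr 1
    refine Finset.sum_congr rfl fun i _ => ?_
    congr 1
    ext y
    exact pd_sub (hs k) (hs l) i y
  have hunif : UniformCauchySeqOn s atTop (closure Ω) := by
    rw [Metric.uniformCauchySeqOn_iff]
    intro ε hε
    have h1 : Tendsto (fun kl : ℕ × ℕ => (A : ℝ≥0∞) * (a kl.1 + a kl.2)) atTop (𝓝 0) := by
      rw [← prod_atTop_atTop_eq]
      have h2 := ENNReal.Tendsto.const_mul ((h.comp tendsto_fst).add (h.comp tendsto_snd))
        (Or.inr (ENNReal.coe_ne_top (r := A)))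
      simpa using h2
    obtain ⟨N, hN⟩ := eventually_atTop_prod_self.1
      (h1.eventually (gt_mem_nhds (ENNReal.ofReal_pos.2 hε)))
    refine ⟨N, fun k hk l hl x hx => ?_⟩
    have h2 := (hcau k l x hx).trans_lt (hN k l hk hl)
    rwa [Real.enorm_eq_ofReal_abs, ENNReal.ofReal_lt_ofReal_iff hε, ← Real.dist_eq] at h2
  have hlim : ∀ x ∈ closure Ω, ∃ y, Tendsto (fun k => s k x) atTop (𝓝 y) := fun x hx =>
    cauchySeq_tendsto_of_complete (hunif.cauchySeq hx)
  choose! w' hw' using hlim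
  have hu : TendstoUniformlyOn s w' atTop (closure Ω) := hunif.tendstoUniformlyOn_of_tendsto hw'
  refine ⟨w', hu.continuousOn (Eventually.of_forall fun k => (hs k).continuous.continuousOn).frequently,
    ?_, hu, fun x hx => ?_⟩
  -- A subsequence converges to `w` almost everywhere, which identifies the uniform limit.
  · have h1 := tendstoInMeasure_of_tendsto_eLpNorm (p := ENNReal.ofReal p) (by simp; linarith)
      (fun k => (hs k).continuous.aestronglyMeasurable) hw.1.1 (tendstoW_iff.1 h).1
    obtain ⟨ns, hns, h2⟩ := h1.exists_seq_tendsto_ae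
    filter_upwards [h2, ae_restrict_mem hΩ.isOpen.measurableSet] with x hx hxΩ
    exact tendsto_nhds_unique hx ((hw' x (subset_closure hxΩ)).comp hns.tendsto_atTop)
  · have h1 : ∀ k, ‖s k x‖ₑ ≤ A * (a k + wNorm Ω (ENNReal.ofReal p) w D) := by
      intro k
      refine (hA (s k) ((hs k).of_le (by simp)) x hx).trans (mul_le_mul_right
        (le_of_eq_of_le ?_ (wNorm_add_le hone ((hsob k).sub hw) hw)) _)
      simp [wNorm, pd]
    have h2 : Tendsto (fun k => (A : ℝ≥0∞) * (a k + wNorm Ω (ENNReal.ofReal p) w D)) atTop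
        (𝓝 (A * (0 + wNorm Ω (ENNReal.ofReal p) w D))) :=
      ENNReal.Tendsto.const_mul (h.add tendsto_const_nhds) (Or.inr ENNReal.coe_ne_top)
    rw [zero_add] at h2
    exact le_of_tendsto_of_tendsto' (hw' x hx).enorm h2 h1

end SobolevTools

/-! ### Traces of functions in `H¹` and in `W^{1,p}`. -/

section Traces

variable {Ω : Set (E n)} {F : Type*} [NormedAddCommGroup F] {q : ℝ≥0∞}

theorem eLpNorm_le_of_forall_le {μ : Measure (E n)} [IsFiniteMeasure μ] {f : E n → F} {c : ℝ≥0}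
    (hq : 1 ≤ q) (h : ∀ᵐ x ∂μ, ‖f x‖₊ ≤ c) :
    eLpNorm f q μ ≤ c * (μ univ + 1) := by
  have h1 := eLpNorm_le_of_ae_nnnorm_bound (p := q) h
  refine h1.trans ?_
  rw [ENNReal.smul_def, smul_eq_mul]
  refine mul_le_mul_right ?_ _
  have h3 : q.toReal⁻¹ ≤ 1 := by
    rcases eq_or_ne q ⊤ with rfl | hq'
    · simp
    · refine inv_le_one_of_one_le₀ ?_
      rw [← ENNReal.toReal_one]; exact ENNReal.toReal_mono hq' hq
  have h2 : μ univ ^ q.toReal⁻¹ ≤ (μ univ + 1) ^ q.toReal⁻¹ :=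
    ENNReal.rpow_le_rpow le_self_add (by positivity)
  exact h2.trans ((ENNReal.rpow_le_rpow_of_exponent_le le_add_self h3).trans
    (ENNReal.rpow_one _).le)

theorem tendsto_eLpNorm_of_tendstoUniformlyOn {μ : Measure (E n)} [IsFiniteMeasure μ] (hq : 1 ≤ q)
    {K : Set (E n)} (hK : ∀ᵐ x ∂μ, x ∈ K) {s : ℕ → E n → F} {w : E n → F}
    (h : TendstoUniformlyOn s w atTop K) :
    Tendsto (fun k => eLpNorm (fun x => s k x - w x) q μ) atTop (𝓝 0) := by
  rw [ENNReal.tendsto_nhds_zero]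
  intro ε hε
  obtain ⟨c, hc0, hc⟩ : ∃ c : ℝ≥0, 0 < c ∧ (c : ℝ≥0∞) * (μ univ + 1) ≤ ε := by
    rcases eq_or_ne ε ⊤ with rfl | hε'
    · exact ⟨1, one_pos, le_top⟩
    · lift ε to ℝ≥0 using hε'
      have h0 : 0 < ε := by exact_mod_cast hε
      lift μ univ to ℝ≥0 using measure_ne_top μ univ with m
      refine ⟨ε / (m + 1), by positivity, ?_⟩
      norm_cast
      rw [div_mul_cancel₀ _ (by positivity)]
  filter_upwards [Metric.tendstoUniformlyOn_iff.1 h c (by exact_mod_cast hc0)] with k hk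
  refine (eLpNorm_le_of_forall_le (c := c) hq ?_).trans hc
  filter_upwards [hK] with x hx
  have := hk x hx
  rw [dist_comm, dist_eq_norm] at this
  exact_mod_cast this.le

variable [NormedSpace ℝ F]

theorem hasTrace_of_contDiff [CompleteSpace F] (hΩ : IsLipschitzDomain Ω) {s : E n → F}
    (hs : ContDiff ℝ ∞ s) : HasTrace Ω q s s := by
  obtain ⟨μ, hμ, -⟩ := exists_boundaryMeasure hΩ
  exact ⟨hμ.memLp_surf hΩ hs.continuous q, pd s, isSobolev_of_contDiff hΩ (hs.of_le (by simp)),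
    fun _ => s, fun _ => hs, by simp, fun i => by simp [pd], by simp⟩

theorem HasTrace.clm_comp {G : Type*} [NormedAddCommGroup G] [NormedSpace ℝ G] [CompleteSpace F]
    [CompleteSpace G] (L : F →L[ℝ] G) {w g : E n → F} (h : HasTrace Ω q w g) :
    HasTrace Ω q (fun x => L (w x)) (fun x => L (g x)) := by
  obtain ⟨hg, D, hD, s, hs, h1, h2, h3⟩ := h
  have key : ∀ {μ : Measure (E n)} {f : ℕ → E n → F}, Tendsto (fun k => eLpNorm (f k) q μ) atTop (𝓝 0) →
      Tendsto (fun k => eLpNorm (fun x => L (f k x)) q μ) atTop (𝓝 0) := by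
    intro μ f hf
    have hc := ENNReal.Tendsto.const_mul hf (Or.inr (ENNReal.coe_ne_top (r := ‖L‖₊)))
    rw [mul_zero] at hc
    refine tendsto_of_tendsto_of_tendsto_of_le_of_le tendsto_const_nhds hc (fun _ => zero_le)
      fun k => ?_
    exact (eLpNorm_le_nnreal_smul_eLpNorm_of_ae_le_mul (ae_of_all _ fun x => L.le_opNNNorm _) q).trans
      (le_of_eq (ENNReal.smul_def _ _))
  refine ⟨L.comp_memLp' hg, fun i x => L (D i x), hD.clm_comp L, fun k x => L (s k x),
    fun k => L.contDiff.comp (hs k), ?_, fun i => ?_, ?_⟩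
  · simpa only [map_sub] using key h1
  · have h4 : ∀ k x, fderiv ℝ (fun x => L (s k x)) x (EuclideanSpace.single i 1) - L (D i x)
        = L (fderiv ℝ (s k) x (EuclideanSpace.single i 1) - D i x) := by
      intro k x
      have h5 := L.hasFDerivAt.comp x ((hs k).differentiable (by simp) x).hasFDerivAt
      rw [show (fun x => L (s k x)) = L ∘ s k from rfl, h5.fderiv, map_sub]
      rfl
    simp only [h4]
    exact key (h2 i)
  · simpa only [map_sub] using key h3

/-- Every function in `H¹(Ω)` has a trace. -/
theorem IsSobolev.exists_hasTrace (hΩ : IsLipschitzDomain Ω) {w : E n → ℝ} {D : Fin n → E n → ℝ}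
    (h : IsSobolev Ω 2 w D) : ∃ g, HasTrace Ω 2 w g := by
  obtain ⟨s, hs, hsw⟩ := exists_tendstoW hΩ (by norm_num) (by simp) h
  obtain ⟨C, hC⟩ := exists_trace_bound hΩ
  obtain ⟨μ, hμ, -⟩ := exists_boundaryMeasure hΩ
  have hm : ∀ k, MemLp (s k) 2 (surf (frontier Ω)) := fun k => hμ.memLp_surf hΩ (hs k).continuous 2
  have hsob : ∀ k, IsSobolev Ω 2 (s k) (pd (s k)) := fun k =>
    isSobolev_of_contDiff hΩ ((hs k).of_le (by simp))
  set a : ℕ → ℝ≥0∞ := fun k => wNorm Ω 2 (fun x => s k x - w x) (fun i x => pd (s k) i x - D i x)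
  -- The trace inequality, applied to differences, makes the boundary values a Cauchy sequence; its
  -- limit is the trace.
  have hcau : ∀ k l, eLpNorm (fun x => s k x - s l x) 2 (surf (frontier Ω)) ≤ C * (a k + a l) := by
    intro k l
    have h1 := hC (fun x => s k x - s l x) (((hs k).sub (hs l)).of_le (by simp))
    refine h1.trans (mul_le_mul_right (le_of_eq_of_le ?_
      (TendstoW.sub_le (by norm_num) hsob h k l)) _)
    unfold wNorm
    congr 1
    refine Finset.sum_congr rfl fun i _ => ?_
    congr 1
    ext y
    exact pd_sub (hs k) (hs l) i y
  have hc : CauchySeq fun k => (hm k).toLp (s k) := by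
    rw [EMetric.cauchySeq_iff]
    intro ε hε
    have h1 : Tendsto (fun kl : ℕ × ℕ => (C : ℝ≥0∞) * (a kl.1 + a kl.2)) atTop (𝓝 0) := by
      rw [← prod_atTop_atTop_eq]
      have h2 := ENNReal.Tendsto.const_mul ((hsw.comp tendsto_fst).add (hsw.comp tendsto_snd))
        (Or.inr (ENNReal.coe_ne_top (r := C)))
      simpa using h2
    obtain ⟨N, hN⟩ := eventually_atTop_prod_self.1 (h1.eventually (gt_mem_nhds hε))
    refine ⟨N, fun k hk l hl => ?_⟩
    rw [Lp.edist_toLp_toLp]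
    exact (hcau k l).trans_lt (hN k l hk hl)
  obtain ⟨g, hg⟩ := cauchySeq_tendsto_of_complete hc
  refine ⟨g, Lp.memLp g, D, h, s, hs, (tendstoW_iff.1 hsw).1, (tendstoW_iff.1 hsw).2, ?_⟩
  rw [Lp.tendsto_Lp_iff_tendsto_eLpNorm'] at hg
  refine hg.congr fun k => eLpNorm_congr_ae ?_
  filter_upwards [(hm k).coeFn_toLp] with x hx
  simp [hx]

/-- A trace, in the sense of `W^{1,p}(Ω)` with `p > n`, is the restriction of the continuous
representative. -/
theorem HasTrace.exists_continuous (hΩ : IsLipschitzDomain Ω) {p : ℝ} (hp1 : 1 < p)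
    (hp : (n : ℝ) < p) {w g : E n → ℝ} (h : HasTrace Ω (ENNReal.ofReal p) w g) :
    ∃ w' : E n → ℝ, ContinuousOn w' (closure Ω) ∧ (∀ᵐ x ∂(volume.restrict Ω), w x = w' x) ∧
      ∀ᵐ x ∂(surf (frontier Ω)), g x = w' x := by
  obtain ⟨hg, D, hD, s, hs, h1, h2, h3⟩ := h
  obtain ⟨A, hA⟩ := exists_uniform_limit hΩ hp1 hp
  obtain ⟨w', hc, hae, hu, -⟩ := hA w D s hD hs (tendstoW_iff.2 ⟨h1, h2⟩)
  refine ⟨w', hc, hae, ?_⟩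
  have h4 := tendstoInMeasure_of_tendsto_eLpNorm (p := ENNReal.ofReal p) (by simp; linarith)
    (fun k => (hs k).continuous.aestronglyMeasurable) hg.1 h3
  obtain ⟨ns, hns, h5⟩ := h4.exists_seq_tendsto_ae
  have h6 : ∀ᵐ x ∂(surf (frontier Ω)), x ∈ frontier Ω :=
    ae_restrict_mem isClosed_frontier.measurableSet
  filter_upwards [h5, h6] with x hx hxΩ
  exact tendsto_nhds_unique hx
    ((hu.tendsto_at (frontier_subset_closure hxΩ)).comp hns.tendsto_atTop)

/-- Uniform convergence on `closure Ω` implies convergence in `L^p` of the boundary, whose surface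
measure is finite. -/
theorem IsSobolev.exists_continuous_trace (hΩ : IsLipschitzDomain Ω) {p : ℝ} (hp1 : 1 < p)
    (hp : (n : ℝ) < p) {w : E n → ℝ} {D : Fin n → E n → ℝ}
    (h : IsSobolev Ω (ENNReal.ofReal p) w D) :
    ∃ w' : E n → ℝ, ContinuousOn w' (closure Ω) ∧ (∀ᵐ x ∂(volume.restrict Ω), w x = w' x) ∧
      HasTrace Ω (ENNReal.ofReal p) w w' := by
  have hone : 1 ≤ ENNReal.ofReal p := by rw [ENNReal.one_le_ofReal]; exact hp1.le
  obtain ⟨s, hs, hsw⟩ := exists_tendstoW hΩ hone (by simp) h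
  obtain ⟨A, hA⟩ := exists_uniform_limit hΩ hp1 hp
  obtain ⟨w', hc, hae, hu, -⟩ := hA w D s h hs hsw
  obtain ⟨μ, hμ, -⟩ := exists_boundaryMeasure hΩ
  have := hμ.isFiniteMeasure_surf
  have h6 : ∀ᵐ x ∂(surf (frontier Ω)), x ∈ frontier Ω :=
    ae_restrict_mem isClosed_frontier.measurableSet
  refine ⟨w', hc, hae, ⟨?_, D, h, s, hs, (tendstoW_iff.1 hsw).1, (tendstoW_iff.1 hsw).2,
    tendsto_eLpNorm_of_tendstoUniformlyOn hone (h6.mono fun x hx => frontier_subset_closure hx) hu⟩⟩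
  obtain ⟨b, hb⟩ := hΩ.isCompact_closure.exists_bound_of_continuousOn hc
  have hms : AEStronglyMeasurable w' (surf (frontier Ω)) :=
    (hc.mono frontier_subset_closure).aestronglyMeasurable isClosed_frontier.measurableSet
  exact MemLp.of_bound hms b (h6.mono fun x hx => hb x (frontier_subset_closure hx))

end Traces

/-! ### Integration by parts with traces. -/

section GaussGreen

variable {Ω : Set (E n)} {μ : Measure (E n)} {N : E n → E n}

/-- Continuity of the inner product of `L²`. -/
theorem tendsto_integral_mul_of_tendsto_eLpNorm {α : Type*} [MeasurableSpace α] {P : Measure α}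
    {a b : ℕ → α → ℝ} {a' b' : α → ℝ} (ha : ∀ k, MemLp (a k) 2 P) (hb : ∀ k, MemLp (b k) 2 P)
    (ha' : MemLp a' 2 P) (hb' : MemLp b' 2 P)
    (h1 : Tendsto (fun k => eLpNorm (fun x => a k x - a' x) 2 P) atTop (𝓝 0))
    (h2 : Tendsto (fun k => eLpNorm (fun x => b k x - b' x) 2 P) atTop (𝓝 0)) :
    Tendsto (fun k => ∫ x, a k x * b k x ∂P) atTop (𝓝 (∫ x, a' x * b' x ∂P)) := by
  have h3 := (Lp.tendsto_Lp_iff_tendsto_eLpNorm'' a ha a' ha').2 h1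
  have h4 := (Lp.tendsto_Lp_iff_tendsto_eLpNorm'' b hb b' hb').2 h2
  have h5 := h3.inner h4 (𝕜 := ℝ)
  have key : ∀ {f g : α → ℝ} (hf : MemLp f 2 P) (hg : MemLp g 2 P),
      inner ℝ (hf.toLp f) (hg.toLp g) = ∫ x, f x * g x ∂P := by
    intro f g hf hg
    rw [L2.inner_def]
    refine integral_congr_ae ?_
    filter_upwards [hf.coeFn_toLp, hg.coeFn_toLp] with x h6 h7
    rw [h6, h7]
    simp [mul_comm]
  simpa only [key] using h5

theorem BoundaryMeasure.memLp_of_surf {q : ℝ≥0∞} {B : Set (E n)} (h : BoundaryMeasure Ω B μ N)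
    {f : E n → ℝ} (hf : MemLp f q (surf (frontier Ω))) : MemLp f q μ := by
  obtain ⟨C, hC⟩ := h.le_surf
  have := hf.smul_measure (c := (C : ℝ≥0∞)) ENNReal.coe_ne_top
  exact this.mono_measure hC

theorem BoundaryMeasure.tendsto_of_surf {q : ℝ≥0∞} {B : Set (E n)}
    (h : BoundaryMeasure Ω B μ N) {f : ℕ → E n → ℝ}
    (hf : Tendsto (fun k => eLpNorm (f k) q (surf (frontier Ω))) atTop (𝓝 0)) :
    Tendsto (fun k => eLpNorm (f k) q μ) atTop (𝓝 0) := by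
  obtain ⟨C, hC⟩ := h.le_surf
  have hc : (C : ℝ≥0∞) ^ (1 / q).toReal ≠ ⊤ :=
    ENNReal.rpow_ne_top_of_nonneg ENNReal.toReal_nonneg ENNReal.coe_ne_top
  have h1 := ENNReal.Tendsto.const_mul hf (Or.inr hc)
  rw [mul_zero] at h1
  refine tendsto_of_tendsto_of_tendsto_of_le_of_le tendsto_const_nhds h1 (fun _ => zero_le) fun k => ?_
  exact (eLpNorm_mono_measure (f k) hC).trans (eLpNorm_smul_measure_le (C : ℝ≥0∞) (f k) q _)

/-- Integration by parts in `H¹(Ω)`. -/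
theorem BoundaryMeasure.integral_by_parts (hΩ : IsLipschitzDomain Ω) (h : BoundaryMeasure Ω univ μ N)
    {w ζ g γ : E n → ℝ} (hw : HasTrace Ω 2 w g) (hζ : HasTrace Ω 2 ζ γ) (j : Fin n)
    {d δ : E n → ℝ} (hd : IsWeakPartial Ω j w d) (hδ : IsWeakPartial Ω j ζ δ) :
    ∫ x in Ω, (d x * ζ x + w x * δ x) = ∫ x, g x * γ x * N x j ∂μ := by
  obtain ⟨hg, D, hD, s, hs, h1, h2, h3⟩ := hw
  obtain ⟨hγ, D', hD', s', hs', h1', h2', h3'⟩ := hζ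
  have hN : AEStronglyMeasurable (fun x => N x j) μ :=
    (EuclideanSpace.proj (𝕜 := ℝ) j).continuous.comp_aestronglyMeasurable h.measurable
  have hN1 : ∀ᵐ x ∂μ, ‖N x j‖ ≤ 1 := by
    filter_upwards [h.normal] with x hx
    rw [← hx.1]; exact PiLp.norm_apply_le _ _
  have hNb : ∀ {f : E n → ℝ}, MemLp f 2 μ → MemLp (fun x => f x * N x j) 2 μ := fun hf =>
    hf.mono (hf.1.mul hN) (hN1.mono fun x hx => by
      rw [norm_mul]; exact mul_le_of_le_one_right (norm_nonneg _) hx)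
  have hfin := h.finite
  have hml : ∀ {f : E n → ℝ}, Continuous f → MemLp f 2 (volume.restrict Ω) := fun hf =>
    hΩ.memLp_continuous hf 2
  have hpd : ∀ k, Continuous (pd (s k) j) := fun k => continuous_pd ((hs k).of_le (by simp)) j
  have hpd' : ∀ k, Continuous (pd (s' k) j) := fun k => continuous_pd ((hs' k).of_le (by simp)) j
  have e1 : ∀ k, (∫ x in Ω, pd (s k) j x * s' k x) + (∫ x in Ω, s k x * pd (s' k) j x)
      = ∫ x, s k x * (s' k x * N x j) ∂μ := by
    intro k
    have gg := h.integral_fderiv hΩ (((hs k).mul (hs' k)).of_le (by simp)) (unitVec j)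
      (w := fun x => s k x * s' k x)
    have i1 : IntegrableOn (fun x => pd (s k) j x * s' k x) Ω :=
      hΩ.integrableOn_continuous ((hpd k).mul (hs' k).continuous)
    have i2 : IntegrableOn (fun x => s k x * pd (s' k) j x) Ω :=
      hΩ.integrableOn_continuous ((hs k).continuous.mul (hpd' k))
    rw [← integral_add i1 i2]
    refine Eq.trans (integral_congr_ae (ae_of_all _ fun x => ?_)) (gg.trans
      (integral_congr_ae (ae_of_all _ fun x => ?_)))
    · simp only [fderiv_fun_mul ((hs k).differentiable (by simp) x)
        ((hs' k).differentiable (by simp) x), pd]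
      simp
      ring
    · simp [unitVec, mul_assoc, EuclideanSpace.inner_single_right]
  -- The derivatives hidden in the two traces agree with the prescribed ones by uniqueness.
  have hDd : D j =ᵐ[volume.restrict Ω] d :=
    (hD.2 j).2.ae_unique hΩ.isOpen hd (ae_eq_refl w)
  have hDδ : D' j =ᵐ[volume.restrict Ω] δ :=
    (hD'.2 j).2.ae_unique hΩ.isOpen hδ (ae_eq_refl ζ)
  have l1 := tendsto_integral_mul_of_tendsto_eLpNorm (fun k => hml (hpd k))
    (fun k => hml (hs' k).continuous) (hD.2 j).1 hD'.1 (h2 j) h1'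
  have l2 := tendsto_integral_mul_of_tendsto_eLpNorm (fun k => hml (hs k).continuous)
    (fun k => hml (hpd' k)) hD.1 (hD'.2 j).1 h1 (h2' j)
  have l3 := tendsto_integral_mul_of_tendsto_eLpNorm
    (fun k => h.memLp_of_surf (h.memLp_surf hΩ (hs k).continuous 2))
    (fun k => hNb (h.memLp_of_surf (h.memLp_surf hΩ (hs' k).continuous 2)))
    (h.memLp_of_surf hg) (hNb (h.memLp_of_surf hγ)) (h.tendsto_of_surf h3) (by
      refine tendsto_of_tendsto_of_tendsto_of_le_of_le tendsto_const_nhds (h.tendsto_of_surf h3')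
        (fun _ => zero_le) fun k => eLpNorm_mono_ae ?_
      filter_upwards [hN1] with x hx
      rw [← sub_mul, norm_mul]
      exact mul_le_of_le_one_right (norm_nonneg _) hx)
  have l4 := tendsto_nhds_unique (l1.add l2) (l3.congr fun k => (e1 k).symm)
  have i1 : Integrable (fun x => D j x * ζ x) (volume.restrict Ω) := (hD.2 j).1.integrable_mul hD'.1
  have i2 : Integrable (fun x => w x * D' j x) (volume.restrict Ω) := hD.1.integrable_mul (hD'.2 j).1
  rw [← integral_add i1 i2] at l4
  rw [← integral_congr_ae (f := fun x => D j x * ζ x + w x * D' j x), l4]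
  · simp only [mul_assoc]
  · filter_upwards [hDd, hDδ] with x h5 h6
    rw [h5, h6]

end GaussGreen

/-! ### Product and chain rules in Sobolev spaces. -/

section Products

variable {Ω : Set (E n)} {q : ℝ≥0∞}

theorem tendsto_eLpNorm_bdd_mul {α : Type*} [MeasurableSpace α] {P : Measure α} {M : ℝ≥0}
    {a f : ℕ → α → ℝ} (ha : ∀ k, ∀ᵐ x ∂P, ‖a k x‖₊ ≤ M)
    (hf : Tendsto (fun k => eLpNorm (f k) q P) atTop (𝓝 0)) :
    Tendsto (fun k => eLpNorm (fun x => a k x * f k x) q P) atTop (𝓝 0) := by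
  have h1 := ENNReal.Tendsto.const_mul hf (Or.inr (ENNReal.coe_ne_top (r := M)))
  rw [mul_zero] at h1
  refine tendsto_of_tendsto_of_tendsto_of_le_of_le tendsto_const_nhds h1 (fun _ => zero_le) fun k => ?_
  refine (eLpNorm_le_nnreal_smul_eLpNorm_of_ae_le_mul (c := M) (g := f k) ?_ q).trans
    (le_of_eq (ENNReal.smul_def _ _))
  filter_upwards [ha k] with x hx
  rw [nnnorm_mul]
  gcongr

theorem tendsto_eLpNorm_sub_add {α : Type*} [MeasurableSpace α] {P : Measure α} (hq : 1 ≤ q)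
    {f g : ℕ → α → ℝ} {f' g' : α → ℝ} (hf : ∀ k, AEStronglyMeasurable (fun x => f k x - f' x) P)
    (hg : ∀ k, AEStronglyMeasurable (fun x => g k x - g' x) P)
    (h1 : Tendsto (fun k => eLpNorm (fun x => f k x - f' x) q P) atTop (𝓝 0))
    (h2 : Tendsto (fun k => eLpNorm (fun x => g k x - g' x) q P) atTop (𝓝 0)) :
    Tendsto (fun k => eLpNorm (fun x => (f k x + g k x) - (f' x + g' x)) q P) atTop (𝓝 0) := by
  have h3 := h1.add h2
  rw [add_zero] at h3
  refine tendsto_of_tendsto_of_tendsto_of_le_of_le tendsto_const_nhds h3 (fun _ => zero_le) fun k => ?_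
  simp only [add_sub_add_comm]
  exact eLpNorm_add_le (hf k) (hg k) hq

/-- The product of a function in `H¹(Ω)` and a bounded function with bounded derivatives. -/
theorem IsSobolev.mul_bounded (hΩ : IsLipschitzDomain Ω) {v : E n → ℝ} {D : Fin n → E n → ℝ}
    (h : IsSobolev Ω 2 v D) {w : E n → ℝ} {Dw : Fin n → E n → ℝ} (hw : IsSobolev Ω 2 w Dw)
    {M : ℝ≥0} (hwM : ∀ᵐ x ∂(volume.restrict Ω), ‖w x‖₊ ≤ M)
    (hDM : ∀ i, ∀ᵐ x ∂(volume.restrict Ω), ‖Dw i x‖₊ ≤ M) :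
    IsSobolev Ω 2 (fun x => w x * v x) (fun i x => w x * D i x + Dw i x * v x) := by
  have hfin := isFiniteMeasure_restrict hΩ
  have hml : ∀ {a f : E n → ℝ}, AEStronglyMeasurable a (volume.restrict Ω) →
      (∀ᵐ x ∂(volume.restrict Ω), ‖a x‖₊ ≤ M) → MemLp f 2 (volume.restrict Ω) →
      MemLp (fun x => a x * f x) 2 (volume.restrict Ω) := by
    intro a f ha hM hf
    refine hf.of_le_mul (c := M) (ha.mul hf.1) (hM.mono fun x hx => ?_)
    rw [norm_mul]
    gcongr
    exact_mod_cast hx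
  refine ⟨hml hw.1.1 hwM h.1, fun i => ⟨(hml hw.1.1 hwM (h.2 i).1).add
    (hml (hw.2 i).1.1 (hDM i) h.1), ?_⟩⟩
  obtain ⟨s, hs, hsv⟩ := exists_tendstoW hΩ (by norm_num) (by simp) h
  obtain ⟨h1, h2⟩ := tendstoW_iff.1 hsv
  have hsm : ∀ k, MemLp (s k) 2 (volume.restrict Ω) := fun k =>
    hΩ.memLp_continuous (hs k).continuous 2
  have hdm : ∀ k, MemLp (pd (s k) i) 2 (volume.restrict Ω) := fun k =>
    hΩ.memLp_continuous (continuous_pd ((hs k).of_le (by simp)) i) 2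
  have hint : ∀ {f : E n → ℝ}, MemLp f 2 (volume.restrict Ω) → IntegrableOn f Ω := fun hf =>
    hf.integrable (by norm_num)
  have c1 := tendsto_eLpNorm_one (by norm_num) (fun k => (hsm k).1.sub h.1.1) h1
  have c2 := tendsto_eLpNorm_one (by norm_num) (fun k => (hdm k).1.sub (h.2 i).1.1) (h2 i)
  -- The smooth approximation of `v` acts as multiplier of the Sobolev function `w`; the bounds on
  -- `w` and its derivatives then allow the limit in `L¹`.
  have hk : ∀ k, IsWeakPartial Ω i (fun x => w x * s k x)
      (fun x => w x * pd (s k) i x + Dw i x * s k x) := by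
    intro k
    refine ((hw.2 i).2.smooth_smul hΩ.isOpen (hs k)).congr ?_ ?_
    · exact ae_of_all _ fun x => by simp [mul_comm]
    · exact ae_of_all _ fun x => by simp only [smul_eq_mul, pd]; ring
  refine IsWeakPartial.of_tendsto hk (fun k => hint (hml hw.1.1 hwM (hsm k)))
    (hint (hml hw.1.1 hwM h.1))
    (fun k => hint ((hml hw.1.1 hwM (hdm k)).add (hml (hw.2 i).1.1 (hDM i) (hsm k))))
    (hint ((hml hw.1.1 hwM (h.2 i).1).add (hml (hw.2 i).1.1 (hDM i) h.1))) ?_ ?_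
  · simp only [← mul_sub]
    exact tendsto_eLpNorm_bdd_mul (fun _ => hwM) c1
  · refine tendsto_eLpNorm_sub_add le_rfl (fun k => ?_) (fun k => ?_) ?_ ?_
    · exact (hw.1.1.mul (hdm k).1).sub (hw.1.1.mul (h.2 i).1.1)
    · exact ((hw.2 i).1.1.mul (hsm k).1).sub ((hw.2 i).1.1.mul h.1.1)
    · simp only [← mul_sub]
      exact tendsto_eLpNorm_bdd_mul (fun _ => hwM) c2
    · simp only [← mul_sub]
      exact tendsto_eLpNorm_bdd_mul (fun _ => hDM i) c1

/-- Chain rule for a `C¹` function of an element of `W^{1,p}(Ω)`, `p > n`, with bounded derivatives. -/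
theorem IsSobolev.comp_contDiff (hΩ : IsLipschitzDomain Ω) {p : ℝ} (hp1 : 1 < p) (hp : (n : ℝ) < p)
    {w : E n → ℝ} {D : Fin n → E n → ℝ} (h : IsSobolev Ω (ENNReal.ofReal p) w D) {M : ℝ≥0}
    (hD : ∀ i, ∀ᵐ x ∂(volume.restrict Ω), ‖D i x‖₊ ≤ M) {H : ℝ → ℝ} (hH : ContDiff ℝ 1 H) :
    ∃ M' : ℝ≥0, (∀ᵐ x ∂(volume.restrict Ω), ‖H (w x)‖₊ ≤ M') ∧
      (∀ i, ∀ᵐ x ∂(volume.restrict Ω), ‖deriv H (w x) * D i x‖₊ ≤ M') ∧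
      IsSobolev Ω 2 (fun x => H (w x)) (fun i x => deriv H (w x) * D i x) := by
  have hfin := isFiniteMeasure_restrict hΩ
  have hone : 1 ≤ ENNReal.ofReal p := by rw [ENNReal.one_le_ofReal]; exact hp1.le
  obtain ⟨s, hs, hsw⟩ := exists_tendstoW hΩ hone (by simp) h
  obtain ⟨A, hA⟩ := exists_uniform_limit hΩ hp1 hp
  obtain ⟨w', hc, hae, hu, -⟩ := hA w D s h hs hsw
  obtain ⟨R, hR⟩ := hΩ.isCompact_closure.exists_bound_of_continuousOn hc
  have hH' : Continuous (deriv H) := hH.continuous_deriv le_rfl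
  -- The margin of one leaves room for all approximations from some index `k₀` on, so that `H` and
  -- its derivative are only evaluated on one compact set.
  set K := Metric.closedBall (0 : ℝ) (R + 1)
  have hK : IsCompact K := isCompact_closedBall _ _
  have hwK : ∀ x ∈ closure Ω, w' x ∈ K := fun x hx => by
    rw [mem_closedBall_zero_iff]; linarith [hR x hx]
  have hsK : ∀ᶠ k in atTop, ∀ x ∈ closure Ω, s k x ∈ K := by
    filter_upwards [Metric.tendstoUniformlyOn_iff.1 hu 1 one_pos] with k hk x hx
    have h1 := hk x hx
    rw [dist_comm, dist_eq_norm] at h1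
    rw [mem_closedBall_zero_iff]
    have h2 := norm_add_le (w' x) (s k x - w' x)
    rw [add_sub_cancel] at h2
    linarith [hR x hx]
  obtain ⟨k₀, hk₀⟩ := eventually_atTop.1 hsK
  have hunif : ∀ {g : ℝ → ℝ}, Continuous g →
      TendstoUniformlyOn (fun k x => g (s (k + k₀) x)) (fun x => g (w' x)) atTop (closure Ω) := by
    intro g hg
    rw [Metric.tendstoUniformlyOn_iff]
    intro ε hε
    obtain ⟨δ, hδ, h1⟩ := Metric.uniformContinuousOn_iff.1
      (hK.uniformContinuousOn_of_continuous hg.continuousOn) ε hε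
    have h2 := (tendsto_add_atTop_nat k₀).eventually (Metric.tendstoUniformlyOn_iff.1 hu δ hδ)
    filter_upwards [h2] with k hk x hx
    exact h1 _ (hwK x hx) _ (hk₀ _ le_add_self x hx) (hk x hx)
  obtain ⟨B, hB⟩ := hK.exists_bound_of_continuousOn hH.continuous.continuousOn
  obtain ⟨B', hB'⟩ := hK.exists_bound_of_continuousOn hH'.continuousOn
  have hΩcl : ∀ᵐ x ∂(volume.restrict Ω), x ∈ closure Ω :=
    ae_restrict_of_forall_mem hΩ.isOpen.measurableSet fun x hx => subset_closure hx
  have hnn : ∀ {y b : ℝ}, ‖y‖ ≤ b → ‖y‖₊ ≤ b.toNNReal := fun h => by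
    rw [← NNReal.coe_le_coe]; exact h.trans (Real.le_coe_toNNReal _)
  set M' := max B.toNNReal (B'.toNNReal * M)
  have hHM : ∀ᵐ x ∂(volume.restrict Ω), ‖H (w x)‖₊ ≤ M' := by
    filter_upwards [hae, hΩcl] with x h1 h2
    rw [h1]; exact (hnn (hB _ (hwK x h2))).trans (le_max_left _ _)
  have hHD : ∀ i, ∀ᵐ x ∂(volume.restrict Ω), ‖deriv H (w x) * D i x‖₊ ≤ M' := by
    intro i
    filter_upwards [hae, hΩcl, hD i] with x h1 h2 h3
    rw [nnnorm_mul, h1]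
    exact (mul_le_mul' (hnn (hB' _ (hwK x h2))) h3).trans (le_max_right _ _)
  have hHm : AEStronglyMeasurable (fun x => H (w x)) (volume.restrict Ω) :=
    hH.continuous.comp_aestronglyMeasurable h.1.1
  have hHm' : AEStronglyMeasurable (fun x => deriv H (w x)) (volume.restrict Ω) :=
    hH'.comp_aestronglyMeasurable h.1.1
  have hb1 : MemLp (fun x => H (w x)) 2 (volume.restrict Ω) :=
    MemLp.of_bound hHm M' (hHM.mono fun x hx => by exact_mod_cast hx)
  have hb2 : ∀ i, MemLp (fun x => deriv H (w x) * D i x) 2 (volume.restrict Ω) := fun i =>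
    MemLp.of_bound (hHm'.mul (h.2 i).1.1) M' ((hHD i).mono fun x hx => by exact_mod_cast hx)
  refine ⟨M', hHM, hHD, hb1, fun i => ⟨hb2 i, ?_⟩⟩
  have hds : ∀ k, ContDiff ℝ 1 fun x => H (s (k + k₀) x) := fun k => hH.comp ((hs _).of_le (by simp))
  have hpd : ∀ k x, pd (fun x => H (s (k + k₀) x)) i x
      = deriv H (s (k + k₀) x) * pd (s (k + k₀)) i x := by
    intro k x
    have h1 := ((hH.differentiable one_ne_zero (s (k + k₀) x)).hasDerivAt).comp_hasFDerivAt x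
      ((hs (k + k₀)).differentiable (by simp) x).hasFDerivAt
    unfold pd
    rw [show (fun x => H (s (k + k₀) x)) = H ∘ s (k + k₀) from rfl, h1.fderiv]
    simp
  have hk : ∀ k, IsWeakPartial Ω i (fun x => H (s (k + k₀) x))
      (fun x => deriv H (s (k + k₀) x) * pd (s (k + k₀)) i x) := fun k =>
    (isWeakPartial_of_contDiff (hds k)).congr (ae_eq_refl _) (ae_of_all _ fun x => hpd k x)
  have hpc : ∀ k, Continuous (pd (s (k + k₀)) i) := fun k => continuous_pd ((hs _).of_le (by simp)) i
  have hDint : IntegrableOn (D i) Ω := (h.2 i).1.integrable hone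
  have hgk : ∀ k, Continuous fun x => deriv H (s (k + k₀) x) * pd (s (k + k₀)) i x := fun k =>
    (hH'.comp (hs _).continuous).mul (hpc k)
  refine IsWeakPartial.of_tendsto hk (fun k => hΩ.integrableOn_continuous (hds k).continuous)
    (hb1.integrable (by norm_num)) (fun k => hΩ.integrableOn_continuous (hgk k))
    ((hb2 i).integrable (by norm_num)) ?_ ?_
  · refine (tendsto_eLpNorm_of_tendstoUniformlyOn le_rfl hΩcl (hunif hH.continuous)).congr fun k =>
      eLpNorm_congr_ae ?_
    filter_upwards [hae] with x hx
    rw [hx]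
  -- The error is split into a bounded factor times the error of the derivatives, and the bounded
  -- derivative `D i` times a uniformly small factor.
  · have c1 : Tendsto (fun k => eLpNorm (fun x => deriv H (s (k + k₀) x)
        * (pd (s (k + k₀)) i x - D i x)) 1 (volume.restrict Ω)) atTop (𝓝 0) := by
      refine tendsto_eLpNorm_bdd_mul (M := B'.toNNReal) (fun k => ?_) ?_
      · filter_upwards [hΩcl] with x hx
        exact hnn (hB' _ (hk₀ _ le_add_self x hx))
      · have := tendsto_eLpNorm_one hone (fun k => ((continuous_pd ((hs k).of_le (by simp))
          i).aestronglyMeasurable.sub (h.2 i).1.1)) ((tendstoW_iff.1 hsw).2 i)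
        exact this.comp (tendsto_add_atTop_nat k₀)
    have c2 : Tendsto (fun k => eLpNorm (fun x => D i x *
        (deriv H (s (k + k₀) x) - deriv H (w x))) 1 (volume.restrict Ω)) atTop (𝓝 0) := by
      refine tendsto_eLpNorm_bdd_mul (M := M) (fun k => hD i) ?_
      refine (tendsto_eLpNorm_of_tendstoUniformlyOn le_rfl hΩcl (hunif hH')).congr fun k =>
        eLpNorm_congr_ae ?_
      filter_upwards [hae] with x hx
      rw [hx]
    have c3 := c1.add c2
    rw [add_zero] at c3
    refine tendsto_of_tendsto_of_tendsto_of_le_of_le tendsto_const_nhds c3 (fun _ => zero_le)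
      fun k => ?_
    refine le_of_eq_of_le (eLpNorm_congr_ae (ae_of_all _ fun x => ?_)) (eLpNorm_add_le ?_ ?_ le_rfl)
    · simp only [Pi.add_apply]; ring
    · exact (hH'.comp (hs _).continuous).aestronglyMeasurable.mul
        ((hpc k).aestronglyMeasurable.sub (h.2 i).1.1)
    · exact (h.2 i).1.1.mul ((hH'.comp (hs _).continuous).aestronglyMeasurable.sub hHm')

end Products

/-! ### Gauss-Green for continuous fields with integrable divergence. -/

section Flux

variable {Ω : Set (E n)} {μ : Measure (E n)} {N : E n → E n}

theorem tendsto_integral_of_tendsto_eLpNorm_one {α : Type*} [MeasurableSpace α] {P : Measure α}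
    {f : ℕ → α → ℝ} {f' : α → ℝ} (hf : ∀ k, Integrable (f k) P) (hf' : Integrable f' P)
    (h : Tendsto (fun k => eLpNorm (fun x => f k x - f' x) 1 P) atTop (𝓝 0)) :
    Tendsto (fun k => ∫ x, f k x ∂P) atTop (𝓝 (∫ x, f' x ∂P)) := by
  refine tendsto_integral_of_L1 f' hf'.1 (Eventually.of_forall hf) ?_
  simpa only [eLpNorm_one_eq_lintegral_enorm] using h

theorem inner_gradVec (a : E n) (D : Fin n → ℝ) : inner ℝ a (gradVec D) = ∑ j, a j * D j := by
  simp [gradVec, PiLp.inner_apply, mul_comm]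

theorem norm_gradVec_le (D : Fin n → ℝ) : ‖gradVec D‖ ≤ ∑ j, |D j| := by
  have h : gradVec D = ∑ j, D j • unitVec j := by
    conv_lhs => rw [← (EuclideanSpace.basisFun (Fin n) ℝ).sum_repr (gradVec D)]
    simp [gradVec]
  rw [h]
  refine (norm_sum_le _ _).trans (Finset.sum_le_sum fun j _ => ?_)
  simp [norm_smul, unitVec]

/-- The Gauss-Green formula for a continuous vector field with integrable divergence. -/
theorem BoundaryMeasure.integral_flux (hΩ : IsLipschitzDomain Ω) (h : BoundaryMeasure Ω univ μ N)
    {V V' : E n → E n} {d : E n → ℝ} (hV : IsWeakDiv Ω V d) (hd : IntegrableOn d Ω)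
    (hVV : ∀ᵐ x ∂(volume.restrict Ω), V x = V' x) (hc : ContinuousOn V' (closure Ω))
    {ζ : E n → ℝ} (hζ : ContDiff ℝ 1 ζ) :
    ∫ x in Ω, (inner ℝ (V x) (gradVec fun j => pd ζ j x) + d x * ζ x)
      = ∫ x, ζ x * inner ℝ (N x) (V' x) ∂μ := by
  obtain ⟨M⟩ := exists_mollifier hΩ
  have hm := hΩ.isOpen.measurableSet
  have hfin := isFiniteMeasure_restrict hΩ
  have hμfin := h.finite
  have hone : Fact ((1 : ℝ≥0∞) ≤ 1) := ⟨le_rfl⟩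
  obtain ⟨b, hb⟩ := hΩ.isCompact_closure.exists_bound_of_continuousOn hc
  have hVi : IntegrableOn V Ω := by
    refine Integrable.congr (f := V') ?_ (hVV.mono fun x hx => hx.symm)
    exact (hc.integrableOn_compact hΩ.isCompact_closure).mono_set subset_closure
  have hVj : ∀ j, IntegrableOn (fun x => V x j) Ω := fun j =>
    (EuclideanSpace.proj (𝕜 := ℝ) j).integrable_comp hVi
  -- The components are mollified from inside, which gives fields that are smooth up to the boundary
  -- and whose divergence is expressed by `d` and commutators.
  set Vk : ℕ → Fin n → E n → ℝ := fun k j => M.op k M.χ fun x => V x j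
  have hVk : ∀ k j, ContDiff ℝ ∞ (Vk k j) := fun k j => M.contDiff_op hm (hVj j) k M.smooth_χ
  have hbd : ∀ {f : E n → ℝ}, Continuous f → ∃ L : ℝ≥0, ∀ᵐ x ∂(volume.restrict Ω), ‖f x‖₊ ≤ L := by
    intro f hf
    obtain ⟨L, hL⟩ := hΩ.isCompact_closure.exists_bound_of_continuousOn hf.continuousOn
    refine ⟨L.toNNReal, ae_restrict_of_forall_mem hm fun x hx => ?_⟩
    rw [← NNReal.coe_le_coe]
    exact (hL x (subset_closure hx)).trans (Real.le_coe_toNNReal _)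
  have hop : ∀ {a : E n → E n → ℝ} {w : E n → ℝ}, (∀ i ∈ M.s, ContDiff ℝ ∞ (a i)) →
      (∀ i ∈ M.s, HasCompactSupport (a i)) → IntegrableOn w Ω →
      ∀ {f : E n → ℝ}, Continuous f → Tendsto (fun k => ∫ x in Ω, f x * M.op k a w x) atTop
        (𝓝 (∫ x in Ω, f x * ((∑ i ∈ M.s, a i x) * w x))) := by
    intro a w ha hac hw f hf
    obtain ⟨L, hL⟩ := hbd hf
    obtain ⟨L', hL'⟩ := hbd (continuous_finsetSum M.s fun i hi => (ha i hi).continuous)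
    refine tendsto_integral_of_tendsto_eLpNorm_one (fun k => hΩ.integrableOn_continuous
      (hf.mul (M.contDiff_op hm hw k ha).continuous)) ?_ ?_
    · refine Integrable.bdd_mul (c := L) (Integrable.bdd_mul (c := L') hw
        (continuous_finsetSum M.s fun i hi => (ha i hi).continuous).aestronglyMeasurable
        (hL'.mono fun x hx => by exact_mod_cast hx)) hf.aestronglyMeasurable
        (hL.mono fun x hx => by exact_mod_cast hx)
    · simp only [← mul_sub]
      exact tendsto_eLpNorm_bdd_mul (fun _ => hL)
        (M.tendsto_op hm (by simp) (memLp_one_iff_integrable.2 hw) hw ha hac)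
  have e1 : ∀ k, (∑ j, ∫ x in Ω, pd ζ j x * Vk k j x) + ((∫ x in Ω, ζ x * M.op k M.χ d x)
        + ∑ j, ∫ x in Ω, ζ x * M.op k (M.dχ (unitVec j)) (fun x => V x j) x)
      = ∑ j, ∫ x, ζ x * N x j * Vk k j x ∂μ := by
    intro k
    have i1 : ∀ j, IntegrableOn (fun x => pd ζ j x * Vk k j x) Ω := fun j =>
      hΩ.integrableOn_continuous ((continuous_pd hζ j).mul (hVk k j).continuous)
    have i2 : ∀ j, IntegrableOn (fun x => ζ x * pd (Vk k j) j x) Ω := fun j =>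
      hΩ.integrableOn_continuous (hζ.continuous.mul (continuous_pd ((hVk k j).of_le (by simp)) j))
    have i3 : ∀ j, IntegrableOn (fun x => ζ x * M.op k (M.dχ (unitVec j)) (fun x => V x j) x) Ω :=
      fun j => hΩ.integrableOn_continuous (hζ.continuous.mul
        (M.contDiff_op hm (hVj j) k (M.smooth_dχ _)).continuous)
    have i4 : IntegrableOn (fun x => ζ x * M.op k M.χ d x) Ω :=
      hΩ.integrableOn_continuous (hζ.continuous.mul (M.contDiff_op hm hd k M.smooth_χ).continuous)
    have e2 : (∫ x in Ω, ζ x * M.op k M.χ d x)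
        + ∑ j, ∫ x in Ω, ζ x * M.op k (M.dχ (unitVec j)) (fun x => V x j) x
        = ∑ j, ∫ x in Ω, ζ x * pd (Vk k j) j x := by
      rw [← integral_finsetSum _ fun j _ => i2 j, ← integral_finsetSum _ fun j _ => i3 j,
        ← integral_add i4 (integrable_finsetSum _ fun j _ => i3 j)]
      refine setIntegral_congr_fun hm fun x hx => ?_
      have := M.sum_fderiv_op_of_isWeakDiv hm hVi hV k (subset_closure hx)
      simp only [← Finset.mul_sum, ← mul_add]
      rw [← this]
      rfl
    rw [e2, ← Finset.sum_add_distrib]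
    refine Finset.sum_congr rfl fun j _ => ?_
    rw [← integral_add (i1 j) (i2 j)]
    have gg := h.integral_fderiv hΩ (hζ.mul ((hVk k j).of_le (by simp))) (unitVec j)
      (w := fun x => ζ x * Vk k j x)
    refine Eq.trans (integral_congr_ae (ae_of_all _ fun x => ?_)) (gg.trans
      (integral_congr_ae (ae_of_all _ fun x => ?_)))
    · simp only [fderiv_fun_mul (hζ.differentiable (by simp) x)
        ((hVk k j).differentiable (by simp) x), pd]
      simp
      ring
    · simp only [unitVec, EuclideanSpace.inner_single_right]
      simp
      ring
  have l1 : ∀ j, Tendsto (fun k => ∫ x in Ω, pd ζ j x * Vk k j x) atTop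
      (𝓝 (∫ x in Ω, pd ζ j x * V x j)) := fun j => by
    refine (hop M.smooth_χ M.compact_χ (hVj j) (continuous_pd hζ j)).trans (le_of_eq ?_)
    congr 1
    refine setIntegral_congr_fun hm fun x hx => ?_
    simp only [M.sum_χ x (subset_closure hx), one_mul]
  have l2 : Tendsto (fun k => ∫ x in Ω, ζ x * M.op k M.χ d x) atTop
      (𝓝 (∫ x in Ω, ζ x * d x)) := by
    refine (hop M.smooth_χ M.compact_χ hd hζ.continuous).trans (le_of_eq ?_)
    congr 1
    refine setIntegral_congr_fun hm fun x hx => ?_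
    simp only [M.sum_χ x (subset_closure hx), one_mul]
  -- The commutators vanish in the limit because the derivatives of the partition sum to zero.
  have l3 : ∀ j, Tendsto (fun k => ∫ x in Ω, ζ x * M.op k (M.dχ (unitVec j)) (fun x => V x j) x)
      atTop (𝓝 0) := fun j => by
    refine (hop (M.smooth_dχ _) (M.compact_dχ _) (hVj j) hζ.continuous).trans (le_of_eq ?_)
    congr 1
    rw [setIntegral_congr_fun hm (g := fun _ => 0)]
    · simp
    · intro x hx
      simp only [M.sum_dχ hΩ.isOpen _ hx, zero_mul, mul_zero]
  have hcl : ∀ᵐ x ∂μ, x ∈ closure Ω := h.ae_mem_frontier.mono fun x hx => frontier_subset_closure hx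
  have hVc : ∀ j, ContinuousOn (fun x => V' x j) (closure Ω) := fun j =>
    (EuclideanSpace.proj (𝕜 := ℝ) j).continuous.comp_continuousOn hc
  have hN : ∀ j, AEStronglyMeasurable (fun x => N x j) μ := fun j =>
    (EuclideanSpace.proj (𝕜 := ℝ) j).continuous.comp_aestronglyMeasurable h.measurable
  obtain ⟨L, hL⟩ := hΩ.isCompact_closure.exists_bound_of_continuousOn hζ.continuous.continuousOn
  have hζN : ∀ j, ∀ᵐ x ∂μ, ‖ζ x * N x j‖₊ ≤ L.toNNReal := fun j => by
    filter_upwards [h.normal, hcl] with x hx hxc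
    rw [← NNReal.coe_le_coe, coe_nnnorm, norm_mul]
    refine (mul_le_of_le_one_right (norm_nonneg _) ?_).trans ((hL x hxc).trans
      (Real.le_coe_toNNReal _))
    rw [← hx.1]; exact PiLp.norm_apply_le _ _
  have hrestr : ∀ {f : E n → ℝ}, ContinuousOn f (closure Ω) → Integrable f μ := by
    intro f hf
    have h1 := (hf.mono frontier_subset_closure).integrableOn_compact (μ := μ)
      (hΩ.isCompact_closure.of_isClosed_subset isClosed_frontier frontier_subset_closure)
    rwa [IntegrableOn, Measure.restrict_eq_self_of_ae_mem h.ae_mem_frontier] at h1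
  have hVμ : ∀ {f : E n → ℝ}, ContinuousOn f (closure Ω) → ∀ j,
      Integrable (fun x => ζ x * N x j * f x) μ := fun hf j =>
    (hrestr hf).bdd_mul (c := L.toNNReal) (hζ.continuous.aestronglyMeasurable.mul (hN j))
      ((hζN j).mono fun x hx => by exact_mod_cast hx)
  have l4 : ∀ j, Tendsto (fun k => ∫ x, ζ x * N x j * Vk k j x ∂μ) atTop
      (𝓝 (∫ x, ζ x * N x j * V' x j ∂μ)) := fun j => by
    refine tendsto_integral_of_tendsto_eLpNorm_one
      (fun k => hVμ (hVk k j).continuous.continuousOn j) (hVμ (hVc j) j) ?_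
    simp only [← mul_sub]
    refine tendsto_eLpNorm_bdd_mul (fun _ => hζN j)
      (tendsto_eLpNorm_of_tendstoUniformlyOn le_rfl hcl ?_)
    -- On the boundary, convergence rests on the continuous representative `V'`; the field has no
    -- derivatives that would give a trace.
    exact M.tendstoUniformlyOn_op hΩ.isOpen hΩ.isBounded (hVj j)
      (hVV.mono fun x hx => by rw [hx]) (hVc j)
  have l5 := tendsto_nhds_unique ((tendsto_finsetSum Finset.univ fun j _ => l1 j).add
    (l2.add (tendsto_finsetSum Finset.univ fun j _ => l3 j)))
    ((tendsto_finsetSum Finset.univ fun j _ => l4 j).congr fun k => (e1 k).symm)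
  have j1 : ∀ j, IntegrableOn (fun x => pd ζ j x * V x j) Ω := fun j => by
    obtain ⟨L, hL⟩ := hbd (continuous_pd hζ j)
    exact (hVj j).bdd_mul (c := L) (continuous_pd hζ j).aestronglyMeasurable
      (hL.mono fun x hx => by exact_mod_cast hx)
  have j2 : IntegrableOn (fun x => ζ x * d x) Ω := by
    obtain ⟨L, hL⟩ := hbd hζ.continuous
    exact hd.bdd_mul (c := L) hζ.continuous.aestronglyMeasurable
      (hL.mono fun x hx => by exact_mod_cast hx)
  rw [Finset.sum_const_zero, add_zero, ← integral_finsetSum _ fun j _ => j1 j,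
    ← integral_add (integrable_finsetSum _ fun j _ => j1 j) j2,
    ← integral_finsetSum _ fun j _ => hVμ (hVc j) j] at l5
  refine Eq.trans (integral_congr_ae (ae_of_all _ fun x => ?_)) (l5.trans
    (integral_congr_ae (ae_of_all _ fun x => ?_)))
  · simp only [inner_gradVec, mul_comm]
  · simp only [PiLp.inner_apply, Finset.mul_sum]
    refine Finset.sum_congr rfl fun j _ => ?_
    simp
    ring

end Flux

/-! ### Almost everywhere statements on product spaces. -/

section ProductMeasure

variable {α β F : Type*} [MeasurableSpace α] [MeasurableSpace β] [NormedAddCommGroup F]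
  {P : Measure α} {Q : Measure β}

theorem ae_ae_swap_of_ae_prod [SFinite P] [SFinite Q] {p : α × β → Prop} (h : ∀ᵐ y ∂(P.prod Q), p y) :
    ∀ᵐ b ∂Q, ∀ᵐ a ∂P, p (a, b) := by
  have h1 : ∀ᵐ y ∂(Q.prod P), p y.swap :=
    Measure.measurePreserving_swap.quasiMeasurePreserving.ae h
  exact Measure.ae_ae_of_ae_prod h1

/-- Tonelli for the norm of the difference. Joint measurability is essential here, since null slices
alone do not make a null set. -/
theorem ae_prod_eq_of_ae_ae [SFinite Q] {f g : α → β → F}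
    (hf : AEStronglyMeasurable (fun y : α × β => f y.1 y.2) (P.prod Q))
    (hg : AEStronglyMeasurable (fun y : α × β => g y.1 y.2) (P.prod Q))
    (h : ∀ᵐ a ∂P, ∀ᵐ b ∂Q, f a b = g a b) : ∀ᵐ y ∂(P.prod Q), f y.1 y.2 = g y.1 y.2 := by
  have hm : AEMeasurable (fun y : α × β => ‖f y.1 y.2 - g y.1 y.2‖ₑ) (P.prod Q) := (hf.sub hg).enorm
  have h1 : ∫⁻ y, ‖f y.1 y.2 - g y.1 y.2‖ₑ ∂(P.prod Q) = 0 := by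
    rw [lintegral_prod _ hm, lintegral_eq_zero_of_ae_eq_zero]
    filter_upwards [h] with a ha
    refine lintegral_eq_zero_of_ae_eq_zero ?_
    filter_upwards [ha] with b hb
    simp [hb]
  filter_upwards [(lintegral_eq_zero_iff' hm).1 h1] with y hy
  simpa [sub_eq_zero] using hy

/-- The inequality is the equality `max f g = g`. -/
theorem ae_prod_le_of_ae_ae [SFinite Q] {f g : α → β → ℝ}
    (hf : AEStronglyMeasurable (fun y : α × β => f y.1 y.2) (P.prod Q))
    (hg : AEStronglyMeasurable (fun y : α × β => g y.1 y.2) (P.prod Q))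
    (h : ∀ᵐ a ∂P, ∀ᵐ b ∂Q, f a b ≤ g a b) : ∀ᵐ y ∂(P.prod Q), f y.1 y.2 ≤ g y.1 y.2 := by
  have h1 := ae_prod_eq_of_ae_ae (f := fun a b => max (f a b) (g a b)) (g := g) (hf.sup hg) hg
    (h.mono fun a ha => ha.mono fun b hb => max_eq_right hb)
  exact h1.mono fun y hy => max_eq_right_iff.1 hy

end ProductMeasure

/-! ### Calculus in time for space-time functions. -/

section TimeCalculus

variable {F : Type*} [NormedAddCommGroup F] {T : ℝ} {α : Type*} [MeasurableSpace α]
  {μ : Measure α}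

theorem ae_integrableOn_section [SFinite μ] {g : ℝ → α → F}
    (hg : Integrable (fun y : ℝ × α => g y.1 y.2) ((volume.restrict (Ioo 0 T)).prod μ)) :
    ∀ᵐ x ∂μ, IntegrableOn (fun s => g s x) (Ioo 0 T) :=
  (integrable_prod_iff' hg.1).1 hg |>.1

variable [NormedSpace ℝ F]

theorem integral_zero_eq_setIntegral_Ioo {k : ℝ → F} {t : ℝ} (ht : 0 ≤ t) :
    ∫ s in (0 : ℝ)..t, k s = ∫ s in Ioo 0 t, k s := by
  rw [intervalIntegral.integral_of_le ht, integral_Ioc_eq_integral_Ioo]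

theorem restrict_Ioo_prod_le [SFinite μ] {t : ℝ} (ht : t ≤ T) :
    (volume.restrict (Ioo 0 t)).prod μ ≤ (volume.restrict (Ioo 0 T)).prod μ :=
  Measure.prod_mono (Measure.restrict_mono (Ioo_subset_Ioo_right ht) le_rfl) le_rfl

/-- Fubini for primitives in time. -/
theorem integral_primitive [SFinite μ] {g : ℝ → α → F}
    (hg : Integrable (fun y : ℝ × α => g y.1 y.2) ((volume.restrict (Ioo 0 T)).prod μ)) {t : ℝ}
    (ht : t ∈ Icc 0 T) :
    Integrable (fun x => ∫ s in (0 : ℝ)..t, g s x) μ ∧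
      ∫ x, (∫ s in (0 : ℝ)..t, g s x) ∂μ = ∫ s in (0 : ℝ)..t, ∫ x, g s x ∂μ := by
  have h1 := hg.mono_measure (restrict_Ioo_prod_le (μ := μ) ht.2)
  simp only [integral_zero_eq_setIntegral_Ioo ht.1]
  exact ⟨h1.integral_prod_right, (integral_integral_swap h1).symm⟩

/-- A strongly measurable version is integrated in `s` over the measurable set `0 < s < t`. For
almost every `x` the two versions agree at almost every time, so their primitives are equal. -/
theorem aestronglyMeasurable_primitive [SFinite μ] {g : ℝ → α → F}
    (hg : AEStronglyMeasurable (fun y : ℝ × α => g y.1 y.2) ((volume.restrict (Ioo 0 T)).prod μ)) :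
    AEStronglyMeasurable (fun y : ℝ × α => ∫ s in (0 : ℝ)..y.1, g s y.2)
      ((volume.restrict (Ioo 0 T)).prod μ) := by
  set g' := hg.mk
  have hg' : StronglyMeasurable g' := hg.stronglyMeasurable_mk
  have h1 : StronglyMeasurable fun y : (ℝ × α) × ℝ =>
      {y : (ℝ × α) × ℝ | 0 < y.2 ∧ y.2 < y.1.1}.indicator (fun y => g' (y.2, y.1.2)) y := by
    refine (hg'.comp_measurable (by fun_prop)).indicator ?_
    exact (measurableSet_lt measurable_const measurable_snd).inter
      (measurableSet_lt measurable_snd (measurable_fst.comp measurable_fst))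
  have h2 := h1.integral_prod_right' (ν := volume.restrict (Ioo 0 T))
  refine ⟨_, h2, ?_⟩
  have h3 := ae_ae_swap_of_ae_prod hg.ae_eq_mk
  have h4 : ∀ᵐ y ∂((volume.restrict (Ioo 0 T)).prod μ), ∀ᵐ s ∂(volume.restrict (Ioo 0 T)),
      g s y.2 = g' (s, y.2) :=
    Measure.quasiMeasurePreserving_snd.ae h3
  have h5 : ∀ᵐ y ∂((volume.restrict (Ioo 0 T)).prod μ), y.1 ∈ Ioo 0 T :=
    Measure.quasiMeasurePreserving_fst.ae (ae_restrict_mem measurableSet_Ioo)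
  filter_upwards [h4, h5] with y hy hyT
  have e1 : ∀ s, {y : (ℝ × α) × ℝ | 0 < y.2 ∧ y.2 < y.1.1}.indicator (fun y => g' (y.2, y.1.2)) (y, s)
      = (Ioo 0 y.1).indicator (fun s => g' (s, y.2)) s := fun s => by
    simp only [indicator, mem_ofPred_eq, mem_Ioo]
  simp only [e1]
  rw [integral_indicator measurableSet_Ioo, Measure.restrict_restrict measurableSet_Ioo,
    inter_eq_self_of_subset_left (Ioo_subset_Ioo_right hyT.2.le),
    integral_zero_eq_setIntegral_Ioo hyT.1.le]
  exact integral_congr_ae (ae_restrict_of_ae_restrict_of_subset (Ioo_subset_Ioo_right hyT.2.le) hy)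

/-- `w` is a primitive in time of `wt`. -/
def IsTimePrimitive (μ : Measure α) (T : ℝ) (w wt : ℝ → α → F) : Prop :=
  ∀ t ∈ Icc 0 T, ∀ᵐ x ∂μ, w t x = w 0 x + ∫ s in (0 : ℝ)..t, wt s x

/-- The exceptional set of points in the definition depends on the time. In this form the identity
can be read for almost every point along almost all times, as the one-dimensional chain rule
requires. -/
theorem IsTimePrimitive.ae_eq [SFinite μ] {w wt : ℝ → α → F} (h : IsTimePrimitive μ T w wt)
    (hw : AEStronglyMeasurable (fun y : ℝ × α => w y.1 y.2) ((volume.restrict (Ioo 0 T)).prod μ))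
    (hw0 : AEStronglyMeasurable (w 0) μ)
    (hwt : AEStronglyMeasurable (fun y : ℝ × α => wt y.1 y.2) ((volume.restrict (Ioo 0 T)).prod μ)) :
    ∀ᵐ y ∂((volume.restrict (Ioo 0 T)).prod μ),
      w y.1 y.2 = w 0 y.2 + ∫ s in (0 : ℝ)..y.1, wt s y.2 := by
  refine ae_prod_eq_of_ae_ae (g := fun t x => w 0 x + ∫ s in (0 : ℝ)..t, wt s x) hw
    ((hw0.comp_quasiMeasurePreserving Measure.quasiMeasurePreserving_snd).add
      (aestronglyMeasurable_primitive hwt)) ?_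
  filter_upwards [ae_restrict_mem measurableSet_Ioo] with t ht
  exact h t (Ioo_subset_Icc_self ht)

/-- The energy identity for a composition with a `C¹` function. -/
theorem IsTimePrimitive.integral_comp [SFinite μ] [FiniteDimensional ℝ F] {w wt : ℝ → α → F}
    (h : IsTimePrimitive μ T w wt)
    (hw : AEStronglyMeasurable (fun y : ℝ × α => w y.1 y.2) ((volume.restrict (Ioo 0 T)).prod μ))
    (hw0 : AEStronglyMeasurable (w 0) μ)
    (hwt : Integrable (fun y : ℝ × α => wt y.1 y.2) ((volume.restrict (Ioo 0 T)).prod μ))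
    {Ψ : F → ℝ} (hΨ : ContDiff ℝ 1 Ψ) (hΨ0 : Integrable (fun x => Ψ (w 0 x)) μ)
    (hd : Integrable (fun y : ℝ × α => fderiv ℝ Ψ (w y.1 y.2) (wt y.1 y.2))
      ((volume.restrict (Ioo 0 T)).prod μ)) {t : ℝ} (ht : t ∈ Icc 0 T) :
    Integrable (fun x => Ψ (w t x)) μ ∧
      ∫ x, Ψ (w t x) ∂μ = (∫ x, Ψ (w 0 x) ∂μ)
        + ∫ s in (0 : ℝ)..t, ∫ x, fderiv ℝ Ψ (w s x) (wt s x) ∂μ := by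
  have key : ∀ᵐ x ∂μ, Ψ (w t x)
      = Ψ (w 0 x) + ∫ s in (0 : ℝ)..t, fderiv ℝ Ψ (w s x) (wt s x) := by
    filter_upwards [h t ht, ae_integrableOn_section hwt,
      ae_ae_swap_of_ae_prod (h.ae_eq hw hw0 hwt.1)] with x h1 h2 h3
    rw [h1, comp_primitive_eq_add_integral hΨ (w 0 x) h2 ht]
    congr 1
    rw [integral_zero_eq_setIntegral_Ioo ht.1, integral_zero_eq_setIntegral_Ioo ht.1]
    refine integral_congr_ae (ae_restrict_of_ae_restrict_of_subset (Ioo_subset_Ioo_right ht.2) ?_)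
    filter_upwards [h3] with s hs
    rw [hs]
  obtain ⟨i1, e1⟩ := integral_primitive (g := fun s x => fderiv ℝ Ψ (w s x) (wt s x)) hd ht
  refine ⟨(hΨ0.add i1).congr (key.mono fun x hx => hx.symm), ?_⟩
  rw [integral_congr_ae key, integral_add hΨ0 i1, e1]

end TimeCalculus

/-! ### Curves in Sobolev spaces as primitives of their time derivatives. -/

section Curves

variable {F : Type*} [NormedAddCommGroup F] {T : ℝ} {Ω : Set (E n)} {q : ℝ≥0∞}

theorem isFiniteMeasure_cyl (hΩ : IsLipschitzDomain Ω) (t : ℝ) : IsFiniteMeasure (cyl Ω t) := by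
  have := isFiniteMeasure_restrict hΩ
  have : IsFiniteMeasure ((volume : Measure ℝ).restrict (Ioo 0 t)) :=
    ⟨by rw [Measure.restrict_apply_univ]; simp⟩
  unfold cyl
  infer_instance

theorem MemLpT.integrable (hΩ : IsLipschitzDomain Ω) (hq : 1 ≤ q) {w : ℝ → E n → F}
    (h : MemLpT Ω T q w) : Integrable (fun y : ℝ × E n => w y.1 y.2) (cyl Ω T) := by
  have := isFiniteMeasure_cyl hΩ T
  exact MemLp.integrable hq h

variable [NormedSpace ℝ F] [CompleteSpace F]

/-- Integrated over a measurable set, the curve becomes a continuous function of time with an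
integrable weak derivative, hence a primitive of it. A function whose integral over every measurable
set vanishes is zero almost everywhere. -/
theorem isTimePrimitive_of_isTimeDeriv (hΩ : IsLipschitzDomain Ω) (hT : 0 < T) (hq : 1 ≤ q)
    {w wt : ℝ → E n → F} (hc : ContinuousInLp Ω T q w) (hw : MemLpT Ω T q w)
    (hwt : MemLpT Ω T q wt) (h : IsTimeDeriv Ω T w wt) :
    IsTimePrimitive (volume.restrict Ω) T w wt := by
  have hfin := isFiniteMeasure_restrict hΩ
  have hwi := hw.integrable hΩ hq
  have hwti := hwt.integrable hΩ hq
  have hint : ∀ t ∈ Icc 0 T, IntegrableOn (w t) Ω := fun t ht => (hc t ht).1.integrable hq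
  intro t ht
  obtain ⟨hpi, -⟩ := integral_primitive hwti ht
  have hzero : ∀ A, MeasurableSet A →
      ∫ x in A, (w t x - w 0 x - ∫ s in (0 : ℝ)..t, wt s x) ∂(volume.restrict Ω) = 0 := by
    intro A hA
    set ν := (volume.restrict Ω).restrict A
    have hν : ν ≤ volume.restrict Ω := Measure.restrict_le_self
    have hprod : (volume.restrict (Ioo 0 T)).prod ν ≤ cyl Ω T := Measure.prod_mono le_rfl hν
    have i1 := hwi.mono_measure hprod
    have i2 := hwti.mono_measure hprod
    have hg : ContinuousOn (fun t => ∫ x, w t x ∂ν) (Icc 0 T) := by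
      intro r hr
      refine tendsto_integral_of_L1' _ (Integrable.mono_measure (hint r hr) hν).1 ?_ ?_
      · filter_upwards [self_mem_nhdsWithin] with s hs using Integrable.mono_measure (hint s hs) hν
      · have hcst : (volume.restrict Ω) univ ^ (1 - 1 / q.toReal) ≠ ⊤ := by
          refine ENNReal.rpow_ne_top_of_nonneg ?_ (measure_ne_top _ univ)
          rcases eq_or_ne q ⊤ with rfl | hq'
          · simp
          · have : 1 ≤ q.toReal := by
              rw [← ENNReal.toReal_one]; exact ENNReal.toReal_mono hq' hq
            rw [sub_nonneg, div_le_one (by linarith)]; exact this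
        have h1 := ENNReal.Tendsto.mul_const (hc r hr).2 (Or.inr hcst)
        rw [zero_mul] at h1
        refine tendsto_of_tendsto_of_tendsto_of_le_of_le' tendsto_const_nhds h1
          (Eventually.of_forall fun _ => zero_le) ?_
        filter_upwards [self_mem_nhdsWithin] with s hs
        exact (eLpNorm_mono_measure _ hν).trans
          (eLpNorm_one_le_of_isFinite hq ((hc s hs).1.1.sub (hc r hr).1.1))
    have hk : IntegrableOn (fun t => ∫ x, wt t x ∂ν) (Ioo 0 T) := i2.integral_prod_left
    have hweak : ∀ φ : ℝ → ℝ, IsTest (Ioo 0 T) φ → ∫ t in Ioo 0 T, deriv φ t • ∫ x, w t x ∂ν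
        = -∫ t in Ioo 0 T, φ t • ∫ x, wt t x ∂ν := by
      intro φ hφ
      have hdc : Continuous (deriv φ) := hφ.1.continuous_deriv (by simp)
      obtain ⟨c, hc1⟩ := hφ.2.1.deriv.exists_bound_of_continuous hdc
      obtain ⟨c', hc2⟩ := hφ.2.1.exists_bound_of_continuous hφ.1.continuous
      have j1 : Integrable (fun y : ℝ × E n => deriv φ y.1 • w y.1 y.2)
          ((volume.restrict (Ioo 0 T)).prod ν) :=
        i1.bdd_smul c (hdc.comp continuous_fst).aestronglyMeasurable
          (ae_of_all _ fun y => hc1 y.1)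
      have j2 : Integrable (fun y : ℝ × E n => φ y.1 • wt y.1 y.2)
          ((volume.restrict (Ioo 0 T)).prod ν) :=
        i2.bdd_smul c' (hφ.1.continuous.comp continuous_fst).aestronglyMeasurable
          (ae_of_all _ fun y => hc2 y.1)
      simp only [← integral_smul]
      rw [integral_integral_swap (f := fun t x => deriv φ t • w t x) j1,
        integral_integral_swap (f := fun t x => φ t • wt t x) j2, ← integral_neg]
      exact integral_congr_ae (ae_restrict_of_ae (h φ hφ))
    have h1 := eq_add_integral_of_weak_deriv hT hg hk hweak t ht
    obtain ⟨hpν, e1⟩ := integral_primitive i2 ht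
    have h0 : (0 : ℝ) ∈ Icc 0 T := ⟨le_rfl, hT.le⟩
    have j1 := Integrable.mono_measure (hint t ht) hν
    have j2 := Integrable.mono_measure (hint 0 h0) hν
    have j3 : Integrable (fun x => w t x - w 0 x) ν := j1.sub j2
    rw [integral_sub j3 hpν, integral_sub j1 j2, e1, h1]
    abel
  have hI : Integrable (fun x => w t x - w 0 x - ∫ s in (0 : ℝ)..t, wt s x) (volume.restrict Ω) :=
    ((hint t ht).sub (hint 0 ⟨le_rfl, hT.le⟩)).sub hpi
  have h2 := hI.ae_eq_zero_of_forall_setIntegral_eq_zero fun A hA _ => hzero A hA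
  filter_upwards [h2] with x hx
  rw [sub_sub] at hx
  exact sub_eq_zero.1 hx

theorem Curve.primitive_val (hΩ : IsLipschitzDomain Ω) (hT : 0 < T) (hq : 1 ≤ q)
    (w : Curve Ω T q F) : IsTimePrimitive (volume.restrict Ω) T w.val w.dt :=
  isTimePrimitive_of_isTimeDeriv hΩ hT hq w.continuous_val w.memLp_val w.memLp_dt w.timeDeriv_val

/-- By Fubini the primitive of `dt` has the primitive of `dtdx i` as its weak partial derivative,
and weak derivatives are unique. So the time regularity of spatial derivatives is a consequence and
no part of the definition. -/
theorem Curve.primitive_dx (hΩ : IsLipschitzDomain Ω) (hT : 0 < T) (hq : 1 ≤ q)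
    (w : Curve Ω T q F) (i : Fin n) :
    IsTimePrimitive (volume.restrict Ω) T (w.dx i) (w.dtdx i) := by
  have hfin := isFiniteMeasure_restrict hΩ
  intro t ht
  have h0 : (0 : ℝ) ∈ Icc 0 T := ⟨le_rfl, hT.le⟩
  have i1 := w.memLp_dt.integrable hΩ hq
  have i2 := (w.memLp_dtdx i).integrable hΩ hq
  have hp1 := (integral_primitive i1 ht).1
  have hp2 := (integral_primitive i2 ht).1
  have hm1 := restrict_Ioo_prod_le (μ := volume.restrict Ω) ht.2
  have hweak : IsWeakPartial Ω i (fun x => ∫ s in (0 : ℝ)..t, w.dt s x)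
      (fun x => ∫ s in (0 : ℝ)..t, w.dtdx i s x) := by
    refine ⟨IntegrableOn.locallyIntegrableOn hp1, IntegrableOn.locallyIntegrableOn hp2,
      fun φ hφ => ?_⟩
    have hdc : Continuous fun x => fderiv ℝ φ x (EuclideanSpace.single i 1) :=
      (hφ.1.continuous_fderiv (by simp)).clm_apply continuous_const
    obtain ⟨c, hc1⟩ := (hφ.2.1.fderiv_apply ℝ (EuclideanSpace.single i 1)).exists_bound_of_continuous hdc
    obtain ⟨c', hc2⟩ := hφ.2.1.exists_bound_of_continuous hφ.1.continuous
    have j1 : Integrable (fun y : ℝ × E n => fderiv ℝ φ y.2 (EuclideanSpace.single i 1) • w.dt y.1 y.2)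
        (cyl Ω T) :=
      i1.bdd_smul c (hdc.comp continuous_snd).aestronglyMeasurable (ae_of_all _ fun y => hc1 y.2)
    have j2 : Integrable (fun y : ℝ × E n => φ y.2 • w.dtdx i y.1 y.2) (cyl Ω T) :=
      i2.bdd_smul c' (hφ.1.continuous.comp continuous_snd).aestronglyMeasurable
        (ae_of_all _ fun y => hc2 y.2)
    simp only [← intervalIntegral.integral_smul]
    rw [(integral_primitive (g := fun s x => fderiv ℝ φ x (EuclideanSpace.single i 1) • w.dt s x)
        j1 ht).2,
      (integral_primitive (g := fun s x => φ x • w.dtdx i s x) j2 ht).2,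
      ← intervalIntegral.integral_neg, integral_zero_eq_setIntegral_Ioo ht.1,
      integral_zero_eq_setIntegral_Ioo ht.1]
    refine integral_congr_ae
      (ae_restrict_of_ae_restrict_of_subset (Ioo_subset_Ioo_right ht.2) ?_)
    filter_upwards [w.sobolev_dt] with s hs
    exact (hs.2 i).2.2.2 φ hφ
  have h1 := (((w.sobolev_val 0 h0).2 i).2.add hweak).congr
    ((w.primitive_val hΩ hT hq t ht).mono fun x hx => hx.symm) (ae_eq_refl _)
  exact ((w.sobolev_val t ht).2 i).2.ae_unique hΩ.isOpen h1 (ae_eq_refl _)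

end Curves

/-! ### Extension of the coefficients from the unit interval. -/

section Extension

/-- The one-sided derivative is continued by its end values and integrated. The chain rules need
`C¹` functions on the whole line, while the coefficients are only controlled on `[0, 1]`. -/
theorem exists_contDiff_extension {h : ℝ → ℝ} (hh : ContDiffOn ℝ 1 h (Icc 0 1)) :
    ∃ H : ℝ → ℝ, ContDiff ℝ 1 H ∧
      ∀ y ∈ Icc (0 : ℝ) 1, H y = h y ∧ deriv H y = derivWithin h (Icc 0 1) y := by
  set k : ℝ → ℝ := fun s => derivWithin h (Icc 0 1) (projIcc 0 1 zero_le_one s)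
  have hu : UniqueDiffOn ℝ (Icc (0 : ℝ) 1) := uniqueDiffOn_Icc zero_lt_one
  have hk : Continuous k := (hh.continuousOn_derivWithin hu le_rfl).comp_continuous
    (continuous_subtype_val.comp continuous_projIcc) fun s => (projIcc 0 1 zero_le_one s).2
  set H : ℝ → ℝ := fun y => h 0 + ∫ s in (0 : ℝ)..y, k s
  have hH : ∀ y, HasDerivAt H (k y) y := fun y =>
    (intervalIntegral.integral_hasDerivAt_right (hk.intervalIntegrable _ _)
      hk.aestronglyMeasurable.stronglyMeasurableAtFilter hk.continuousAt).const_add _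
  have hkI : ∀ y ∈ Icc (0 : ℝ) 1, k y = derivWithin h (Icc 0 1) y := fun y hy => by
    simp only [k, projIcc_of_mem zero_le_one hy]
  have hdH : deriv H = k := funext fun y => (hH y).deriv
  refine ⟨H, contDiff_one_iff_deriv.2 ⟨fun y => (hH y).differentiableAt, hdH ▸ hk⟩,
    fun y hy => ⟨?_, by rw [hdH, hkI y hy]⟩⟩
  have hc := constant_of_derivWithin_zero (f := fun y => H y - h y) (a := 0) (b := 1)
    (fun y hy => ((hH y).differentiableAt.differentiableWithinAt).sub
      (hh.differentiableOn one_ne_zero y hy)) (fun y hy => by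
      have hy' : y ∈ Icc (0 : ℝ) 1 := Ico_subset_Icc_self hy
      rw [derivWithin_fun_sub (hH y).differentiableAt.differentiableWithinAt
        (hh.differentiableOn one_ne_zero y hy'), (hH y).hasDerivWithinAt.derivWithin (hu y hy'),
        hkI y hy', sub_self]) y hy
  simp only [H, intervalIntegral.integral_same, add_zero, sub_self] at hc
  exact sub_eq_zero.1 hc

end Extension

/-! ### Square bounds uniform in time. -/

section Bounds

variable {T : ℝ} {α : Type*} [MeasurableSpace α] {μ : Measure α} {F : Type*}
  [NormedAddCommGroup F] [NormedSpace ℝ F]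

/-- The integral of `(k - m) ^ 2` is nonnegative, where `m` is the mean of `k`. -/
theorem sq_setIntegral_Ioo_le (hT : 0 < T) {k : ℝ → ℝ} (hk : IntegrableOn k (Ioo 0 T))
    (hk2 : IntegrableOn (fun s => k s ^ 2) (Ioo 0 T)) :
    (∫ s in Ioo 0 T, k s) ^ 2 ≤ T * ∫ s in Ioo 0 T, k s ^ 2 := by
  set m := (∫ s in Ioo 0 T, k s) / T
  have hmT : m * T = ∫ s in Ioo 0 T, k s := div_mul_cancel₀ _ hT.ne'
  have hc : IntegrableOn (fun _ : ℝ => m ^ 2) (Ioo 0 T) := integrableOn_const (by simp)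
  have h1 : 0 ≤ ∫ s in Ioo 0 T, (k s ^ 2 - (2 * m) * k s + m ^ 2) :=
    integral_nonneg fun s => by
      change 0 ≤ k s ^ 2 - 2 * m * k s + m ^ 2
      nlinarith [sq_nonneg (k s - m)]
  have i1 : IntegrableOn (fun s => k s ^ 2 - (2 * m) * k s) (Ioo 0 T) := hk2.sub (hk.const_mul _)
  rw [integral_add i1 hc, integral_sub hk2 (hk.const_mul _), integral_const_mul,
    setIntegral_const, ← hmT] at h1
  simp only [measureReal_def, Real.volume_Ioo, sub_zero, ENNReal.toReal_ofReal hT.le,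
    smul_eq_mul] at h1
  rw [← hmT]
  nlinarith

/-- A bound in `L²` that is uniform in time. -/
theorem IsTimePrimitive.exists_sq_bound [SFinite μ] (hT : 0 < T) {w wt : ℝ → α → F}
    (h : IsTimePrimitive μ T w wt) (hw0 : MemLp (w 0) 2 μ)
    (hwi : Integrable (fun y : ℝ × α => wt y.1 y.2) ((volume.restrict (Ioo 0 T)).prod μ))
    (hwt : MemLp (fun y : ℝ × α => wt y.1 y.2) 2 ((volume.restrict (Ioo 0 T)).prod μ)) :
    ∃ G : α → ℝ, Integrable G μ ∧ ∀ t ∈ Icc 0 T, ∀ᵐ x ∂μ, ‖w t x‖ ^ 2 ≤ G x := by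
  have h2 := hwt.integrable_norm_pow (by norm_num)
  refine ⟨fun x => 2 * ‖w 0 x‖ ^ 2 + 2 * T * ∫ s in Ioo 0 T, ‖wt s x‖ ^ 2,
    ((hw0.integrable_norm_pow (by norm_num)).const_mul 2).add
      ((h2.integral_prod_right).const_mul _), fun t ht => ?_⟩
  filter_upwards [h t ht, ae_integrableOn_section hwi,
    ae_integrableOn_section (g := fun s x => ‖wt s x‖ ^ 2) h2] with x h3 h4 h5
  have h6 : ‖∫ s in (0 : ℝ)..t, wt s x‖ ≤ ∫ s in Ioo 0 T, ‖wt s x‖ := by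
    rw [integral_zero_eq_setIntegral_Ioo ht.1]
    exact (norm_integral_le_integral_norm _).trans (setIntegral_mono_set h4.norm
      (ae_of_all _ fun s => norm_nonneg _) (Ioo_subset_Ioo_right ht.2).eventuallyLE)
  have h7 := sq_setIntegral_Ioo_le hT h4.norm h5
  have h8 : ‖w t x‖ ≤ ‖w 0 x‖ + ∫ s in Ioo 0 T, ‖wt s x‖ := by
    rw [h3]; exact (norm_add_le _ _).trans (by gcongr)
  have h9 := pow_le_pow_left₀ (norm_nonneg _) h8 2
  nlinarith [sq_nonneg (‖w 0 x‖ - ∫ s in Ioo 0 T, ‖wt s x‖)]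

end Bounds

/-! ### Pairing the damage rate with functions that are only integrable. -/

section DampedRate

variable {T p : ℝ} {Ω : Set (E n)}

/-- The bound `I ^ (1 / p) ≤ 1 + I` replaces Hölder's inequality in the first variable, whose
measure is finite; the `p`-th powers are then treated by Tonelli. -/
theorem aemeasurable_eLpNorm_and_lintegral_lt_top {α β : Type*} [MeasurableSpace α] [MeasurableSpace β]
    {P : Measure α} {Q : Measure β} [IsFiniteMeasure P] [SFinite Q] (hp1 : 1 ≤ p)
    {g : α → β → ℝ}
    (hg : MemLp (fun y : α × β => g y.1 y.2) (ENNReal.ofReal p) (P.prod Q)) :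
    AEMeasurable (fun s => eLpNorm (g s) (ENNReal.ofReal p) Q) P ∧
      ∫⁻ s, eLpNorm (g s) (ENNReal.ofReal p) Q ∂P < ⊤ := by
  have hp0 : 0 < p := by linarith
  have h0 : ENNReal.ofReal p ≠ 0 := by simpa using hp0
  refine ⟨?_, ?_⟩
  · simp only [eLpNorm_eq_lintegral_rpow_enorm_toReal h0 ENNReal.ofReal_ne_top,
      ENNReal.toReal_ofReal hp0.le]
    exact ((hg.1.enorm.pow_const p).lintegral_prod_right').pow_const _
  have h1 : ∀ s, eLpNorm (g s) (ENNReal.ofReal p) Q ≤ 1 + ∫⁻ x, ‖g s x‖ₑ ^ p ∂Q := by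
    intro s
    rw [eLpNorm_eq_lintegral_rpow_enorm_toReal h0 (by simp), ENNReal.toReal_ofReal hp0.le]
    set I := ∫⁻ x, ‖g s x‖ₑ ^ p ∂Q
    have h2 : I ^ (1 / p) ≤ (1 + I) ^ (1 / p) := ENNReal.rpow_le_rpow le_add_self (by positivity)
    refine h2.trans ((ENNReal.rpow_le_rpow_of_exponent_le le_self_add
      (show 1 / p ≤ 1 by rw [div_le_one hp0]; exact hp1)).trans (ENNReal.rpow_one _).le)
  refine (lintegral_mono h1).trans_lt ?_
  rw [lintegral_add_left measurable_const, lintegral_const, one_mul]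
  refine ENNReal.add_lt_top.2 ⟨measure_lt_top P univ, ?_⟩
  have h2 := lintegral_rpow_enorm_lt_top_of_eLpNorm_lt_top h0 (by simp) hg.2
  rw [ENNReal.toReal_ofReal hp0.le] at h2
  rwa [lintegral_prod _ (hg.1.enorm.pow_const p)] at h2

/-- Functions in `W^{1,p}(Ω)`, `p > n`, are bounded. -/
theorem exists_ae_bound (hΩ : IsLipschitzDomain Ω) (hp1 : 1 < p) (hp : (n : ℝ) < p) :
    ∃ A : ℝ≥0, ∀ (w : E n → ℝ) (D : Fin n → E n → ℝ), IsSobolev Ω (ENNReal.ofReal p) w D →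
      ∀ᵐ x ∂(volume.restrict Ω), ‖w x‖ₑ ≤ A * wNorm Ω (ENNReal.ofReal p) w D := by
  have hone : 1 ≤ ENNReal.ofReal p := by rw [ENNReal.one_le_ofReal]; exact hp1.le
  obtain ⟨A, hA⟩ := exists_uniform_limit hΩ hp1 hp
  refine ⟨A, fun w D h => ?_⟩
  obtain ⟨s, hs, hsw⟩ := exists_tendstoW hΩ hone (by simp) h
  obtain ⟨w', -, hae, -, hb⟩ := hA w D s h hs hsw
  filter_upwards [hae, ae_restrict_mem hΩ.isOpen.measurableSet] with x h1 h2
  rw [h1]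
  exact hb x (subset_closure h2)

/-- For almost every time the rate is bounded in space by its norm in `W^{1,p}`, because `p > n`,
and this norm is integrable in time. A factor that is integrable in space and independent of time
can therefore be paired with it. This is how `C ε(u) : ε(u) ∂_t z` becomes integrable. -/
theorem Curve.integrable_mul_dt (hΩ : IsLipschitzDomain Ω) (hp1 : 1 < p) (hp : (n : ℝ) < p)
    (z : Curve Ω T (ENNReal.ofReal p) ℝ) {G : E n → ℝ} (hG : IntegrableOn G Ω) :
    Integrable (fun y : ℝ × E n => G y.2 * z.dt y.1 y.2) (cyl Ω T) := by
  have hfin := isFiniteMeasure_restrict hΩ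
  have hfinT : IsFiniteMeasure ((volume : Measure ℝ).restrict (Ioo 0 T)) :=
    ⟨by rw [Measure.restrict_apply_univ]; simp⟩
  obtain ⟨A, hA⟩ := exists_ae_bound hΩ hp1 hp
  have hm : AEStronglyMeasurable (fun y : ℝ × E n => G y.2 * z.dt y.1 y.2) (cyl Ω T) :=
    (hG.1.comp_quasiMeasurePreserving Measure.quasiMeasurePreserving_snd).mul z.memLp_dt.1
  refine ⟨hm, ?_⟩
  unfold HasFiniteIntegral cyl
  rw [lintegral_prod _ hm.enorm]
  have hN : ∫⁻ s, wNorm Ω (ENNReal.ofReal p) (z.dt s) (fun i => z.dtdx i s)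
      ∂(volume.restrict (Ioo 0 T)) < ⊤ := by
    unfold wNorm
    obtain ⟨h1, h2⟩ := aemeasurable_eLpNorm_and_lintegral_lt_top hp1.le z.memLp_dt
    have h3 := fun i => aemeasurable_eLpNorm_and_lintegral_lt_top hp1.le (z.memLp_dtdx i)
    rw [lintegral_add_left' h1, lintegral_finsetSum' _ fun i _ => (h3 i).1]
    exact ENNReal.add_lt_top.2 ⟨h2, ENNReal.sum_lt_top.2 fun i _ => (h3 i).2⟩
  calc _ ≤ ∫⁻ s, (∫⁻ x, ‖G x‖ₑ ∂(volume.restrict Ω))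
        * (A * wNorm Ω (ENNReal.ofReal p) (z.dt s) (fun i => z.dtdx i s))
        ∂(volume.restrict (Ioo 0 T)) := by
        refine lintegral_mono_ae ?_
        filter_upwards [z.sobolev_dt] with s hs
        rw [← lintegral_mul_const'' _ hG.1.enorm]
        refine lintegral_mono_ae ?_
        filter_upwards [hA _ _ hs] with x hx
        rw [enorm_mul]
        gcongr
    _ = (∫⁻ x, ‖G x‖ₑ ∂(volume.restrict Ω)) * (A *
        ∫⁻ s, wNorm Ω (ENNReal.ofReal p) (z.dt s) (fun i => z.dtdx i s)
        ∂(volume.restrict (Ioo 0 T))) := by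
        rw [lintegral_const_mul' _ _ hG.2.ne, lintegral_const_mul' _ _ ENNReal.coe_ne_top]
    _ < ⊤ := ENNReal.mul_lt_top hG.2 (ENNReal.mul_lt_top ENNReal.coe_lt_top hN)

end DampedRate

/-! ### Algebra of the elastic form. -/

section Tensor

variable {C : Tensor4 n}

theorem ddot_app_comm (hC : IsStiffness C) (a b : Matrix (Fin n) (Fin n) ℝ) :
    ddot (C.app a) b = ddot (C.app b) a := by
  simp only [ddot, Tensor4.app, Matrix.of_apply, Finset.sum_mul]
  have h1 : ∀ (a b : Matrix (Fin n) (Fin n) ℝ), ∑ i, ∑ j, ∑ l, ∑ k, C i j l k * a l k * b i j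
      = ∑ q : (Fin n × Fin n) × (Fin n × Fin n),
        C q.1.1 q.1.2 q.2.1 q.2.2 * a q.2.1 q.2.2 * b q.1.1 q.1.2 := by
    intro a b
    simp only [Fintype.sum_prod_type]
  rw [h1, h1, ← (Equiv.prodComm (Fin n × Fin n) (Fin n × Fin n)).sum_comp]
  refine Finset.sum_congr rfl fun q _ => ?_
  simp only [Equiv.prodComm_apply, Prod.fst_swap, Prod.snd_swap]
  rw [hC.major_symm q.2.1 q.2.2]
  ring

theorem app_symm (hC : IsStiffness C) (e : Matrix (Fin n) (Fin n) ℝ) (i j : Fin n) :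
    C.app e i j = C.app e j i := by
  simp only [Tensor4.app, Matrix.of_apply]
  exact Finset.sum_congr rfl fun l _ => Finset.sum_congr rfl fun k _ => by
    rw [hC.minor_symm]

/-- A symmetric matrix does not see the antisymmetric part of a gradient. So the stress may be
paired with full gradients, for which integration by parts is available. -/
theorem ddot_strain {a : Matrix (Fin n) (Fin n) ℝ} (ha : ∀ i j, a i j = a j i) (D : Fin n → E n) :
    ddot a (strain D) = ∑ i, ∑ j, a i j * D j i := by
  have h1 : ∑ i, ∑ j, a i j * D i j = ∑ i, ∑ j, a i j * D j i := by
    rw [Finset.sum_comm]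
    exact Finset.sum_congr rfl fun i _ => Finset.sum_congr rfl fun j _ => by rw [ha]
  have h2 : ddot a (strain D) = (∑ i, ∑ j, a i j * D j i + ∑ i, ∑ j, a i j * D i j) / 2 := by
    simp only [ddot, strain, Matrix.of_apply]
    rw [← Finset.sum_add_distrib, Finset.sum_div]
    refine Finset.sum_congr rfl fun i _ => ?_
    rw [← Finset.sum_add_distrib, Finset.sum_div]
    exact Finset.sum_congr rfl fun j _ => by ring
  rw [h2, h1]
  ring

/-- The bilinear form `C ε(D) : ε(D')`. -/
def elasticForm (C : Tensor4 n) (D D' : Fin n → E n) : ℝ := ddot (C.app (strain D)) (strain D')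

theorem elasticForm_add_left (D₁ D₂ D' : Fin n → E n) :
    elasticForm C (D₁ + D₂) D' = elasticForm C D₁ D' + elasticForm C D₂ D' := by
  simp only [elasticForm, ddot, Tensor4.app, strain, Matrix.of_apply, Pi.add_apply, PiLp.add_apply,
    ← Finset.sum_add_distrib, Finset.sum_mul]
  exact Finset.sum_congr rfl fun i _ => Finset.sum_congr rfl fun j _ =>
    Finset.sum_congr rfl fun l _ => Finset.sum_congr rfl fun k _ => by ring

theorem elasticForm_smul_left (r : ℝ) (D D' : Fin n → E n) :
    elasticForm C (r • D) D' = r * elasticForm C D D' := by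
  simp only [elasticForm, ddot, Tensor4.app, strain, Matrix.of_apply, Pi.smul_apply, PiLp.smul_apply,
    smul_eq_mul, Finset.sum_mul, Finset.mul_sum]
  exact Finset.sum_congr rfl fun i _ => Finset.sum_congr rfl fun j _ =>
    Finset.sum_congr rfl fun l _ => Finset.sum_congr rfl fun k _ => by ring

theorem elasticForm_comm (hC : IsStiffness C) (D D' : Fin n → E n) :
    elasticForm C D D' = elasticForm C D' D := ddot_app_comm hC _ _

theorem contDiff_elasticForm : ContDiff ℝ ∞ fun q : (Fin n → E n) × (Fin n → E n) =>
    elasticForm C q.1 q.2 := by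
  simp only [elasticForm, ddot, Tensor4.app, strain, Matrix.of_apply]
  refine ContDiff.sum fun i _ => ContDiff.sum fun j _ => ?_
  have h1 : ∀ i j, ContDiff ℝ ∞ fun q : (Fin n → E n) × (Fin n → E n) => q.1 i j := fun i j =>
    (EuclideanSpace.proj (𝕜 := ℝ) j).contDiff.comp
      ((ContinuousLinearMap.proj (R := ℝ) (φ := fun _ : Fin n => E n) i).contDiff.comp contDiff_fst)
  have h2 : ∀ i j, ContDiff ℝ ∞ fun q : (Fin n → E n) × (Fin n → E n) => q.2 i j := fun i j =>
    (EuclideanSpace.proj (𝕜 := ℝ) j).contDiff.comp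
      ((ContinuousLinearMap.proj (R := ℝ) (φ := fun _ : Fin n => E n) i).contDiff.comp contDiff_snd)
  refine ContDiff.mul (ContDiff.sum fun l _ => ContDiff.sum fun k _ => contDiff_const.mul ?_) ?_
  · exact ((h1 _ _).add (h1 _ _)).div_const _
  · exact ((h2 _ _).add (h2 _ _)).div_const _

theorem exists_elasticForm_bound (C : Tensor4 n) : ∃ K : ℝ, 0 ≤ K ∧ ∀ D D' : Fin n → E n,
    |elasticForm C D D'| ≤ K * ((∑ j, ‖D j‖) * ∑ j, ‖D' j‖) := by
  refine ⟨∑ i, ∑ j, ∑ l, ∑ k, |C i j l k|, by positivity, fun D D' => ?_⟩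
  have hs : ∀ (D : Fin n → E n) i j, |strain D i j| ≤ ∑ j, ‖D j‖ := by
    intro D i j
    have h1 : ∀ i j, |D i j| ≤ ∑ j, ‖D j‖ := fun i j => by
      have h2 : |D i j| ≤ ‖D i‖ := PiLp.norm_apply_le (D i) j
      exact h2.trans (Finset.single_le_sum (f := fun j => ‖D j‖) (fun _ _ => norm_nonneg _)
        (Finset.mem_univ i))
    simp only [strain, Matrix.of_apply]
    rw [abs_div, abs_two, div_le_iff₀ two_pos]
    refine (abs_add_le _ _).trans ?_
    linarith [h1 j i, h1 i j]
  have hP : ∀ i j l k, |strain D l k| * |strain D' i j| ≤ (∑ j, ‖D j‖) * ∑ j, ‖D' j‖ :=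
    fun i j l k => mul_le_mul (hs D l k) (hs D' i j) (abs_nonneg _) (by positivity)
  generalize (∑ j, ‖D j‖) * ∑ j, ‖D' j‖ = P at hP ⊢
  simp only [elasticForm, ddot, Tensor4.app, Matrix.of_apply, Finset.sum_mul]
  refine (Finset.abs_sum_le_sum_abs _ _).trans (Finset.sum_le_sum fun i _ =>
    (Finset.abs_sum_le_sum_abs _ _).trans (Finset.sum_le_sum fun j _ =>
    (Finset.abs_sum_le_sum_abs _ _).trans (Finset.sum_le_sum fun l _ =>
    (Finset.abs_sum_le_sum_abs _ _).trans (Finset.sum_le_sum fun k _ => ?_))))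
  rw [abs_mul, abs_mul, mul_assoc]
  exact mul_le_mul_of_nonneg_left (hP i j l k) (abs_nonneg _)

end Tensor

/-! ### Operations on primitives in time. -/

section PrimitiveConstructors

theorem intervalIntegrable_of_integrableOn_Ioo {F : Type*} [NormedAddCommGroup F] {T : ℝ} {k : ℝ → F}
    (hk : IntegrableOn k (Ioo 0 T)) {t : ℝ}
    (ht : t ∈ Icc 0 T) : IntervalIntegrable k volume 0 t := by
  rw [intervalIntegrable_iff_integrableOn_Ioo_of_le ht.1]
  exact hk.mono_set (Ioo_subset_Ioo_right ht.2)

variable {α : Type*} [MeasurableSpace α] {μ : Measure α} [SFinite μ] {T : ℝ}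
  {F G : Type*} [NormedAddCommGroup F] [NormedSpace ℝ F] [CompleteSpace F]
  [NormedAddCommGroup G] [NormedSpace ℝ G] [CompleteSpace G]

theorem IsTimePrimitive.clm_comp {w wt : ℝ → α → F} (h : IsTimePrimitive μ T w wt)
    (hwt : Integrable (fun y : ℝ × α => wt y.1 y.2) ((volume.restrict (Ioo 0 T)).prod μ))
    (L : F →L[ℝ] G) : IsTimePrimitive μ T (fun t x => L (w t x)) (fun t x => L (wt t x)) := by
  intro t ht
  filter_upwards [h t ht, ae_integrableOn_section hwt] with x h1 h2
  rw [h1, map_add, L.intervalIntegral_comp_comm (intervalIntegrable_of_integrableOn_Ioo h2 ht)]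

theorem IsTimePrimitive.pi {ι : Type*} [Fintype ι] {w wt : ι → ℝ → α → F}
    (h : ∀ i, IsTimePrimitive μ T (w i) (wt i))
    (hwt : ∀ i, Integrable (fun y : ℝ × α => wt i y.1 y.2) ((volume.restrict (Ioo 0 T)).prod μ)) :
    IsTimePrimitive μ T (fun t x i => w i t x) (fun t x i => wt i t x) := by
  intro t ht
  have h2 : ∀ᵐ x ∂μ, ∀ i, IntegrableOn (fun s => wt i s x) (Ioo 0 T) :=
    ae_all_iff.2 fun i => ae_integrableOn_section (hwt i)
  filter_upwards [ae_all_iff.2 fun i => h i t ht, h2] with x h1 h2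
  have h3 : IntegrableOn (fun s => fun i => wt i s x) (Ioo 0 T) := Integrable.of_eval h2
  funext i
  rw [h1 i, Pi.add_apply]
  congr 1
  exact (ContinuousLinearMap.proj (R := ℝ) (φ := fun _ : ι => F) i).intervalIntegral_comp_comm
    (intervalIntegrable_of_integrableOn_Ioo h3 ht)

theorem IsTimePrimitive.prodMk {w wt : ℝ → α → F} {v vt : ℝ → α → G} (h : IsTimePrimitive μ T w wt)
    (hv : IsTimePrimitive μ T v vt)
    (hwt : Integrable (fun y : ℝ × α => wt y.1 y.2) ((volume.restrict (Ioo 0 T)).prod μ))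
    (hvt : Integrable (fun y : ℝ × α => vt y.1 y.2) ((volume.restrict (Ioo 0 T)).prod μ)) :
    IsTimePrimitive μ T (fun t x => (w t x, v t x)) (fun t x => (wt t x, vt t x)) := by
  intro t ht
  filter_upwards [h t ht, hv t ht, ae_integrableOn_section hwt, ae_integrableOn_section hvt]
    with x h1 h2 h3 h4
  have h5 : IntegrableOn (fun s => (wt s x, vt s x)) (Ioo 0 T) := h3.prodMk h4
  have h6 := intervalIntegrable_of_integrableOn_Ioo h5 ht
  exact Prod.ext
    (h1.trans (congrArg (w 0 x + ·) ((ContinuousLinearMap.fst ℝ F G).intervalIntegral_comp_comm h6)))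
    (h2.trans (congrArg (v 0 x + ·) ((ContinuousLinearMap.snd ℝ F G).intervalIntegral_comp_comm h6)))

end PrimitiveConstructors

/-! ### The chain rule for the gradient energy. -/

section GradientEnergy

variable {Ω : Set (E n)} {T p : ℝ}

theorem inner_pFlux (p : ℝ) (a b : E n) : inner ℝ (pFlux p a) b = ‖a‖ ^ (p - 2) * inner ℝ a b := by
  rw [pFlux, real_inner_smul_left]

theorem contDiff_pEnergy (hp1 : 1 < p) : ContDiff ℝ 1 fun v : E n => 1 / p * ‖v‖ ^ p :=
  contDiff_const.mul (contDiff_norm_rpow hp1)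

theorem fderiv_pEnergy (hp1 : 1 < p) (v w : E n) :
    fderiv ℝ (fun v : E n => 1 / p * ‖v‖ ^ p) v w = inner ℝ (pFlux p v) w := by
  have hp0 : p ≠ 0 := by linarith
  rw [fderiv_const_mul (contDiff_norm_rpow hp1 |>.differentiable one_ne_zero v),
    fderiv_norm_rpow v hp1, inner_pFlux]
  simp only [_root_.smul_apply, innerSL_apply_apply, smul_eq_mul]
  field_simp

/-- For `p < 2` the factor `‖a‖ ^ (p - 2)` is unbounded near zero. Continuity follows because the
flux is the gradient of the `C¹` function `1 / p * ‖v‖ ^ p`. -/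
theorem continuous_pFlux (hp1 : 1 < p) : Continuous (pFlux p : E n → E n) := by
  have h1 := (contDiff_pEnergy (n := n) hp1).continuous_fderiv one_ne_zero
  have h2 : ∀ v : E n, pFlux p v = (InnerProductSpace.toDual ℝ (E n)).symm
      (fderiv ℝ (fun v : E n => 1 / p * ‖v‖ ^ p) v) := fun v => by
    refine ext_inner_right ℝ fun w => ?_
    rw [InnerProductSpace.toDual_symm_apply, fderiv_pEnergy hp1]
  exact ((InnerProductSpace.toDual ℝ (E n)).symm.continuous.comp h1).congr fun v => (h2 v).symm

/-- The product `‖a‖ ^ (p - 1) * ‖b‖` is at most the `p`-th power of the larger norm; this crude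
form of Young's inequality suffices for integrability. -/
theorem abs_inner_pFlux_le (hp1 : 1 < p) (a b : E n) :
    |inner ℝ (pFlux p a) b| ≤ ‖a‖ ^ p + ‖b‖ ^ p := by
  rw [inner_pFlux, abs_mul, abs_of_nonneg (by positivity)]
  have h0 : ‖a‖ ^ (p - 2) * |inner ℝ a b| ≤ ‖a‖ ^ (p - 1) * ‖b‖ := by
    rcases eq_or_ne a 0 with rfl | ha
    · simp only [inner_zero_left, abs_zero, mul_zero]; positivity
    have ha' : 0 < ‖a‖ := norm_pos_iff.2 ha
    calc ‖a‖ ^ (p - 2) * |inner ℝ a b| ≤ ‖a‖ ^ (p - 2) * (‖a‖ * ‖b‖) := by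
          gcongr; exact abs_real_inner_le_norm a b
      _ = ‖a‖ ^ (p - 1) * ‖b‖ := by
          rw [← mul_assoc, ← Real.rpow_add_one ha'.ne']; congr 2; ring
  refine h0.trans ?_
  have hpos : (0 : ℝ) < p - 1 := by linarith
  have hsplit : ∀ c : ℝ, 0 ≤ c → c ^ (p - 1) * c = c ^ p := fun c hc => by
    rcases hc.eq_or_lt with rfl | hc
    · rw [mul_zero, Real.zero_rpow (by linarith)]
    · rw [← Real.rpow_add_one hc.ne']; congr 1; ring
  rcases le_total ‖a‖ ‖b‖ with h | h
  · calc ‖a‖ ^ (p - 1) * ‖b‖ ≤ ‖b‖ ^ (p - 1) * ‖b‖ := by gcongr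
      _ = ‖b‖ ^ p := hsplit _ (norm_nonneg _)
      _ ≤ _ := le_add_of_nonneg_left (by positivity)
  · calc ‖a‖ ^ (p - 1) * ‖b‖ ≤ ‖a‖ ^ (p - 1) * ‖a‖ := by gcongr
      _ = ‖a‖ ^ p := hsplit _ (norm_nonneg _)
      _ ≤ _ := le_add_of_nonneg_right (by positivity)

theorem MemLp.gradVec {α : Type*} [MeasurableSpace α] {μ : Measure α} {q : ℝ≥0∞}
    {D : Fin n → α → ℝ} (h : ∀ j, MemLp (D j) q μ) : MemLp (fun x => gradVec fun j => D j x) q μ :=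
  MemLp.of_eval_piLp h

theorem integrable_pFlux (hp1 : 1 < p) {α : Type*} [MeasurableSpace α] {μ : Measure α}
    [IsFiniteMeasure μ] {a b : α → E n} (ha : MemLp a (ENNReal.ofReal p) μ)
    (hb : MemLp b (ENNReal.ofReal p) μ) : Integrable (fun x => inner ℝ (pFlux p (a x)) (b x)) μ := by
  have h0 : ENNReal.ofReal p ≠ 0 := by simp; linarith
  have ia := ha.integrable_norm_rpow h0 ENNReal.ofReal_ne_top
  have ib := hb.integrable_norm_rpow h0 ENNReal.ofReal_ne_top
  rw [ENNReal.toReal_ofReal (by linarith)] at ia ib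
  refine (ia.add ib).mono' (((continuous_pFlux hp1).comp_aestronglyMeasurable ha.1).inner hb.1) ?_
  exact .of_forall fun x => abs_inner_pFlux_le hp1 _ _

theorem one_le_ofReal (hp1 : 1 < p) : 1 ≤ ENNReal.ofReal p := by
  rw [ENNReal.one_le_ofReal]; exact hp1.le

theorem isTimePrimitive_grad (hΩ : IsLipschitzDomain Ω) (hT : 0 < T) (hp1 : 1 < p)
    (z : DamageVar Ω T p) : IsTimePrimitive (volume.restrict Ω) T z.grad
      (fun t x => gradVec fun j => z.dtdx j t x) := by
  have h1 := one_le_ofReal hp1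
  have hi := fun j => (z.memLp_dtdx j).integrable hΩ h1
  exact (IsTimePrimitive.pi (fun j => z.primitive_dx hΩ hT h1 j) hi).clm_comp
    (Integrable.of_eval hi) ((EuclideanSpace.equiv (Fin n) ℝ).symm : (Fin n → ℝ) →L[ℝ] E n)

/-- The chain rule for `1 / p * ‖v‖ ^ p` along `∇z`, a primitive in time of `∇∂_t z`. This is the
`p`-Laplacian tested with the rate. -/
theorem gradient_energy_identity (hΩ : IsLipschitzDomain Ω) (hT : 0 < T) (hp1 : 1 < p)
    (z : DamageVar Ω T p) :
    Integrable (fun y : ℝ × E n => inner ℝ (pFlux p (z.grad y.1 y.2))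
        (gradVec fun j => z.dtdx j y.1 y.2)) (cyl Ω T) ∧
      ∀ t ∈ Icc 0 T, IntegrableOn (fun x => 1 / p * ‖z.grad t x‖ ^ p) Ω ∧
        ∫ x in Ω, 1 / p * ‖z.grad t x‖ ^ p = (∫ x in Ω, 1 / p * ‖z.grad 0 x‖ ^ p)
          + ∫ s in (0 : ℝ)..t, ∫ x in Ω, inner ℝ (pFlux p (z.grad s x))
            (gradVec fun j => z.dtdx j s x) := by
  have h1 := one_le_ofReal hp1
  have hfin := isFiniteMeasure_restrict hΩ
  have hfinT := isFiniteMeasure_cyl hΩ T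
  have hg : MemLp (fun y : ℝ × E n => z.grad y.1 y.2) (ENNReal.ofReal p) (cyl Ω T) :=
    MemLp.gradVec z.memLp_dx
  have hgt : MemLp (fun y : ℝ × E n => gradVec fun j => z.dtdx j y.1 y.2) (ENNReal.ofReal p)
    (cyl Ω T) := MemLp.gradVec z.memLp_dtdx
  have hI := integrable_pFlux hp1 hg hgt
  refine ⟨hI, fun t ht => ?_⟩
  have h0 : MemLp (z.grad 0) (ENNReal.ofReal p) (volume.restrict Ω) :=
    MemLp.gradVec fun j => ((z.sobolev_val 0 ⟨le_rfl, hT.le⟩).2 j).1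
  have h0' : ENNReal.ofReal p ≠ 0 := by simp; linarith
  have i0 := h0.integrable_norm_rpow h0' ENNReal.ofReal_ne_top
  rw [ENNReal.toReal_ofReal (by linarith)] at i0
  have h2 := (isTimePrimitive_grad hΩ hT hp1 z).integral_comp hg.1 h0.1 (hgt.integrable h1)
    (contDiff_pEnergy hp1) (i0.const_mul _) (by simp only [fderiv_pEnergy hp1]; exact hI) ht
  simp only [fderiv_pEnergy hp1] at h2
  exact h2

end GradientEnergy

/-! ### The range of the damage variable and the chain rule for the elastic energy. -/

section ElasticEnergy

variable {Ω : Set (E n)} {T p : ℝ} {C : Tensor4 n} {h f : ℝ → ℝ}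

/-- At almost every point `z` is nonincreasing in time, hence below its initial value. Nonnegativity
is known at almost every time only; at a given `t` it is inherited from some later time, which is
why the end time is excluded. -/
theorem DamageVar.ae_mem_Icc (hΩ : IsLipschitzDomain Ω) (hT : 0 < T) (hp1 : 1 < p)
    {z : DamageVar Ω T p} (h0 : ∀ᵐ x ∂(volume.restrict Ω), z.val 0 x ≤ 1)
    (hz : ∀ᵐ y ∂(cyl Ω T), 0 ≤ z.val y.1 y.2) (hzt : ∀ᵐ y ∂(cyl Ω T), z.dt y.1 y.2 ≤ 0) :
    ∀ t ∈ Ico 0 T, ∀ᵐ x ∂(volume.restrict Ω), z.val t x ∈ Icc (0 : ℝ) 1 := by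
  have hq := one_le_ofReal hp1
  have hprim := z.primitive_val hΩ hT hq
  have hti := z.memLp_dt.integrable hΩ hq
  have hneg : ∀ᵐ x ∂(volume.restrict Ω), ∀ᵐ s ∂(volume.restrict (Ioo 0 T)), z.dt s x ≤ 0 :=
    ae_ae_swap_of_ae_prod hzt
  intro t ht
  have hpos : ∀ᵐ s ∂(volume.restrict (Ioo 0 T)), ∀ᵐ x ∂(volume.restrict Ω), 0 ≤ z.val s x :=
    Measure.ae_ae_of_ae_prod hz
  obtain ⟨s, hsm, hs⟩ : ∃ s ∈ Ioo t T, ∀ᵐ x ∂(volume.restrict Ω), 0 ≤ z.val s x := by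
    have h1 : ∀ᵐ s ∂(volume.restrict (Ioo t T)), ∀ᵐ x ∂(volume.restrict Ω), 0 ≤ z.val s x :=
      ae_mono (Measure.restrict_mono (Ioo_subset_Ioo_left ht.1) le_rfl) hpos
    have : (ae (volume.restrict (Ioo t T))).NeBot := by
      rw [ae_neBot, Ne, Measure.restrict_eq_zero, Real.volume_Ioo]; simpa using ht.2
    obtain ⟨s, h2, h3⟩ := (h1.and (ae_restrict_mem measurableSet_Ioo)).exists
    exact ⟨s, h3, h2⟩
  have ht' : t ∈ Icc 0 T := Ico_subset_Icc_self ht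
  have hs' : s ∈ Icc 0 T := ⟨ht.1.trans hsm.1.le, hsm.2.le⟩
  filter_upwards [hs, h0, hprim t ht', hprim s hs', hneg, ae_integrableOn_section hti]
    with x h1 h2 h3 h4 h5 h6
  have hle : ∀ a b, 0 ≤ a → a ≤ b → b ≤ T → ∫ r in a..b, z.dt r x ≤ 0 := by
    intro a b ha hab hb
    rw [intervalIntegral.integral_of_le hab, integral_Ioc_eq_integral_Ioo]
    exact integral_nonpos_of_ae
      (ae_mono (Measure.restrict_mono (Ioo_subset_Ioo ha hb) le_rfl) h5)
  have hadd := intervalIntegral.integral_interval_sub_left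
    (intervalIntegrable_of_integrableOn_Ioo h6 hs') (intervalIntegrable_of_integrableOn_Ioo h6 ht')
  have e1 := hle t s ht.1 hsm.1.le hsm.2.le
  have e2 := hle 0 t le_rfl ht.1 ht.2.le
  constructor <;> linarith

theorem DamageVar.ae_cyl_mem_Icc {z : DamageVar Ω T p}
    (hz : ∀ t ∈ Ico 0 T, ∀ᵐ x ∂(volume.restrict Ω), z.val t x ∈ Icc (0 : ℝ) 1) :
    ∀ᵐ y ∂(cyl Ω T), z.val y.1 y.2 ∈ Icc (0 : ℝ) 1 := by
  have hm := z.memLp_val.1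
  have h1 : ∀ᵐ y ∂(cyl Ω T), (0 : ℝ) ≤ z.val y.1 y.2 := by
    refine ae_prod_le_of_ae_ae (f := fun _ _ => 0) (g := z.val) aestronglyMeasurable_const hm ?_
    filter_upwards [ae_restrict_mem measurableSet_Ioo] with t ht
    exact (hz t (Ioo_subset_Ico_self ht)).mono fun x hx => hx.1
  have h2 : ∀ᵐ y ∂(cyl Ω T), z.val y.1 y.2 ≤ 1 := by
    refine ae_prod_le_of_ae_ae (g := fun _ _ => 1) (f := z.val) hm aestronglyMeasurable_const ?_
    filter_upwards [ae_restrict_mem measurableSet_Ioo] with t ht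
    exact (hz t (Ioo_subset_Ico_self ht)).mono fun x hx => hx.2
  filter_upwards [h1, h2] with y h1 h2 using ⟨h1, h2⟩

/-- A continuous coefficient evaluated at a function with values in `[0,1]`. -/
theorem Integrable.comp_mul {α : Type*} [MeasurableSpace α] {μ : Measure α} {k : ℝ → ℝ}
    (hk : Continuous k) {w g : α → ℝ} (hw : AEStronglyMeasurable w μ)
    (hw1 : ∀ᵐ x ∂μ, w x ∈ Icc (0 : ℝ) 1) (hg : Integrable g μ) :
    Integrable (fun x => k (w x) * g x) μ := by
  obtain ⟨M, hM⟩ := isCompact_Icc.exists_bound_of_continuousOn (hk.continuousOn (s := Icc (0 : ℝ) 1))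
  exact hg.bdd_mul (c := M) (hk.comp_aestronglyMeasurable hw) (hw1.mono fun x hx => hM _ hx)

theorem Integrable.norm_mul_of_memLp {α ι : Type*} [Fintype ι] [MeasurableSpace α] {μ : Measure α}
    {D D' : ι → α → E n} (hD : ∀ j, MemLp (D j) 2 μ) (hD' : ∀ j, MemLp (D' j) 2 μ) :
    Integrable (fun x => (∑ j, ‖D j x‖) * ∑ j, ‖D' j x‖) μ := by
  have h1 : MemLp (fun x => ∑ j, ‖D j x‖) 2 μ := memLp_finsetSum _ fun j _ => (hD j).norm
  have h2 : MemLp (fun x => ∑ j, ‖D' j x‖) 2 μ := memLp_finsetSum _ fun j _ => (hD' j).norm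
  exact h1.integrable_mul h2

theorem integrable_elasticForm {α : Type*} [MeasurableSpace α] {μ : Measure α}
    {D D' : Fin n → α → E n} (hD : ∀ j, MemLp (D j) 2 μ) (hD' : ∀ j, MemLp (D' j) 2 μ) :
    Integrable (fun x => elasticForm C (fun j => D j x) (fun j => D' j x)) μ := by
  obtain ⟨K, hK, hb⟩ := exists_elasticForm_bound C
  refine ((Integrable.norm_mul_of_memLp hD hD').const_mul K).mono' ?_ (.of_forall fun x => hb _ _)
  have hm : ∀ {D : Fin n → α → E n}, (∀ j, MemLp (D j) 2 μ) →
      AEStronglyMeasurable (fun x => fun j => D j x) μ := fun hD => (MemLp.of_eval hD).1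
  exact Continuous.comp_aestronglyMeasurable
    (g := fun q : (Fin n → E n) × (Fin n → E n) => elasticForm C q.1 q.2)
    (f := fun x => (fun j => D j x, fun j => D' j x))
    contDiff_elasticForm.continuous ((hm hD).prodMk (hm hD'))

theorem integrable_stress (hh : ContDiffOn ℝ 1 h (Icc 0 1)) (u : Displacement Ω T)
    {z : DamageVar Ω T p}
    (hz : ∀ t ∈ Ico 0 T, ∀ᵐ x ∂(volume.restrict Ω), z.val t x ∈ Icc (0 : ℝ) 1)
    {D : Fin n → ℝ → E n → E n} (hD : ∀ j, MemLpT Ω T 2 (D j)) :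
    Integrable (fun y : ℝ × E n => ddot (stress C h u z y.1 y.2) (strain fun j => D j y.1 y.2))
      (cyl Ω T) := by
  obtain ⟨H, hH, hHh⟩ := exists_contDiff_extension hh
  have hz' := DamageVar.ae_cyl_mem_Icc hz
  refine (Integrable.comp_mul hH.continuous z.memLp_val.1 hz'
    (integrable_elasticForm (C := C) u.memLp_dx hD)).congr ?_
  filter_upwards [hz'] with y hy
  simp only [(hHh _ hy).1, elasticForm, ddot, stress, energyDensity_e, Curve.eps,
    Matrix.smul_apply, smul_eq_mul, Finset.mul_sum, mul_assoc]

variable (C) in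
/-- The elastic and potential energy as a function of the displacement gradient and the damage. -/
def elasticPotential (H F : ℝ → ℝ) (q : (Fin n → E n) × ℝ) : ℝ :=
  1 / 2 * H q.2 * elasticForm C q.1 q.1 + F q.2

theorem contDiff_elasticPotential {H F : ℝ → ℝ} (hH : ContDiff ℝ 1 H) (hF : ContDiff ℝ 1 F) :
    ContDiff ℝ 1 (elasticPotential C H F) := by
  have h1 : ContDiff ℝ 1 fun q : (Fin n → E n) × ℝ => elasticForm C q.1 q.1 :=
    ContDiff.comp (g := fun q : (Fin n → E n) × (Fin n → E n) => elasticForm C q.1 q.2)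
      (f := fun q : (Fin n → E n) × ℝ => (q.1, q.1)) (contDiff_elasticForm.of_le (by simp))
      (contDiff_fst.prodMk contDiff_fst)
  exact ((contDiff_const.mul (hH.comp contDiff_snd)).mul h1).add (hF.comp contDiff_snd)

/-- Computed along a line, where the symmetric form is a quadratic polynomial. Along a solution the
three terms are `W_{,z} ∂_t z`, `f' ∂_t z` and the stress power. -/
theorem fderiv_elasticPotential (hC : IsStiffness C) {H F : ℝ → ℝ} (hH : ContDiff ℝ 1 H)
    (hF : ContDiff ℝ 1 F) (D D' : Fin n → E n) (y y' : ℝ) :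
    fderiv ℝ (elasticPotential C H F) (D, y) (D', y')
      = 1 / 2 * deriv H y * elasticForm C D D * y' + deriv F y * y' + H y * elasticForm C D D' := by
  have hd := (contDiff_elasticPotential (C := C) hH hF).differentiable one_ne_zero (D, y)
  have h1 := hd.hasFDerivAt.hasLineDerivAt (D', y')
  have hy : HasDerivAt (fun t : ℝ => y + t * y') y' 0 := by
    simpa using ((hasDerivAt_id (0 : ℝ)).mul_const y').const_add y
  have hH' : HasDerivAt (fun t : ℝ => H (y + t * y')) (deriv H y * y') 0 := by
    have := (hH.differentiable one_ne_zero y).hasDerivAt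
    exact HasDerivAt.comp (h₂ := H) (h := fun t : ℝ => y + t * y') 0 (by simpa using this) hy
  have hF' : HasDerivAt (fun t : ℝ => F (y + t * y')) (deriv F y * y') 0 := by
    have := (hF.differentiable one_ne_zero y).hasDerivAt
    exact HasDerivAt.comp (h₂ := F) (h := fun t : ℝ => y + t * y') 0 (by simpa using this) hy
  have he : HasDerivAt (fun t : ℝ => elasticForm C (D + t • D') (D + t • D'))
      (2 * elasticForm C D D') 0 := by
    have e1 : (fun t : ℝ => elasticForm C (D + t • D') (D + t • D'))
        = fun t => elasticForm C D D + t * (2 * elasticForm C D D') + t ^ 2 * elasticForm C D' D' := by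
      funext t
      simp only [elasticForm_add_left, elasticForm_smul_left]
      rw [elasticForm_comm hC D, elasticForm_comm hC D']
      simp only [elasticForm_add_left, elasticForm_smul_left]
      rw [elasticForm_comm hC D' D]
      ring
    rw [e1]
    have h2 := (((hasDerivAt_id (0 : ℝ)).mul_const (2 * elasticForm C D D')).const_add
      (elasticForm C D D)).add ((hasDerivAt_pow 2 (0 : ℝ)).mul_const (elasticForm C D' D'))
    refine (h2.congr_deriv (by simp)).congr_of_eventuallyEq (.of_forall fun t => by simp)
  have h3 := ((hH'.const_mul (1 / 2)).mul he).add hF'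
  have h4 := HasDerivAt.unique (h1 : HasDerivAt _ _ _) h3
  rw [h4]
  simp only [zero_mul, zero_smul, add_zero]
  ring

/-- The chain rule for `elasticPotential` along the pair of `∇u` and `z`, with the coefficients
extended to the line; the range of `z` makes the extension invisible. The delicate point is
integrability of the term with `W_{,z}`. -/
theorem elastic_energy_identity (hΩ : IsLipschitzDomain Ω) (hT : 0 < T) (hp1 : 1 < p)
    (hp : (n : ℝ) < p) (hC : IsStiffness C) (hh : ContDiffOn ℝ 1 h (Icc 0 1))
    (hf : ContDiffOn ℝ 1 f (Icc 0 1)) (u : Displacement Ω T) {z : DamageVar Ω T p}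
    (hz : ∀ t ∈ Ico 0 T, ∀ᵐ x ∂(volume.restrict Ω), z.val t x ∈ Icc (0 : ℝ) 1) :
    Integrable (fun y : ℝ × E n => energyDensity_z C h (u.eps y.1 y.2) (z.val y.1 y.2)
        * z.dt y.1 y.2) (cyl Ω T) ∧
      Integrable (fun y : ℝ × E n => derivWithin f (Icc 0 1) (z.val y.1 y.2) * z.dt y.1 y.2)
        (cyl Ω T) ∧
      ∀ t ∈ Ico 0 T,
        IntegrableOn (fun x => energyDensity C h (u.eps t x) (z.val t x) + f (z.val t x)) Ω ∧
        ∫ x in Ω, (energyDensity C h (u.eps t x) (z.val t x) + f (z.val t x))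
          = (∫ x in Ω, (energyDensity C h (u.eps 0 x) (z.val 0 x) + f (z.val 0 x)))
            + ∫ s in (0 : ℝ)..t, ∫ x in Ω,
              (energyDensity_z C h (u.eps s x) (z.val s x) * z.dt s x
                + derivWithin f (Icc 0 1) (z.val s x) * z.dt s x
                + ddot (stress C h u z s x) (u.epsDt s x)) := by
  have hq := one_le_ofReal hp1
  have hfin := isFiniteMeasure_restrict hΩ
  have hfinT := isFiniteMeasure_cyl hΩ T
  obtain ⟨H, hH, hHh⟩ := exists_contDiff_extension hh
  obtain ⟨F, hF, hFf⟩ := exists_contDiff_extension hf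
  have hz' := DamageVar.ae_cyl_mem_Icc hz
  have hD : MemLp (fun y : ℝ × E n => fun j => u.dx j y.1 y.2) 2 (cyl Ω T) := MemLp.of_eval u.memLp_dx
  have hDt : MemLp (fun y : ℝ × E n => fun j => u.dtdx j y.1 y.2) 2 (cyl Ω T) :=
    MemLp.of_eval u.memLp_dtdx
  have h0T : (0 : ℝ) ∈ Icc 0 T := ⟨le_rfl, hT.le⟩
  have hD0' : ∀ j, MemLp (u.dx j 0) 2 (volume.restrict Ω) := fun j => ((u.sobolev_val 0 h0T).2 j).1
  have hD0 : MemLp (fun x j => u.dx j 0 x) 2 (volume.restrict Ω) := MemLp.of_eval hD0'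
  have hzti := z.memLp_dt.integrable hΩ hq
  have hDti := fun j => (u.memLp_dtdx j).integrable hΩ (by norm_num)
  have primD := IsTimePrimitive.pi (fun j => u.primitive_dx hΩ hT (by norm_num) j) hDti
  -- The squared gradient is dominated, at all times, by one integrable function `G` of space, and
  -- `Curve.integrable_mul_dt` applies to `G`.
  have i1 : Integrable (fun y : ℝ × E n =>
      elasticForm C (fun j => u.dx j y.1 y.2) (fun j => u.dx j y.1 y.2) * z.dt y.1 y.2) (cyl Ω T) := by
    obtain ⟨K, hK, hb⟩ := exists_elasticForm_bound C
    obtain ⟨G, hG, hGb⟩ := primD.exists_sq_bound hT hD0 (Integrable.of_eval hDti) hDt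
    have hGcyl : ∀ᵐ y ∂(cyl Ω T), ‖fun j => u.dx j y.1 y.2‖ ^ 2 ≤ G y.2 := by
      refine ae_prod_le_of_ae_ae (f := fun t x => ‖fun j => u.dx j t x‖ ^ 2) (g := fun _ x => G x)
        (hD.1.norm.pow 2)
        (hG.1.comp_quasiMeasurePreserving Measure.quasiMeasurePreserving_snd) ?_
      filter_upwards [ae_restrict_mem measurableSet_Ioo] with t ht
      exact hGb t (Ioo_subset_Icc_self ht)
    refine (((z.integrable_mul_dt hΩ hp1 hp hG).norm).const_mul (K * n ^ 2)).mono' ?_ ?_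
    · exact (Continuous.comp_aestronglyMeasurable
        (g := fun q : (Fin n → E n) × (Fin n → E n) => elasticForm C q.1 q.2)
        (f := fun y : ℝ × E n => (fun j => u.dx j y.1 y.2, fun j => u.dx j y.1 y.2))
        contDiff_elasticForm.continuous (hD.1.prodMk hD.1)).mul z.memLp_dt.1
    filter_upwards [hGcyl] with y hy
    have hsum : ∑ j, ‖u.dx j y.1 y.2‖ ≤ n * ‖fun j => u.dx j y.1 y.2‖ := by
      have := Finset.sum_le_card_nsmul Finset.univ (fun j => ‖u.dx j y.1 y.2‖)
        ‖fun j => u.dx j y.1 y.2‖ fun j _ => norm_le_pi_norm (fun j => u.dx j y.1 y.2) j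
      simpa using this
    have hs0 : (0 : ℝ) ≤ ∑ j, ‖u.dx j y.1 y.2‖ := by positivity
    rw [norm_mul, norm_mul, Real.norm_eq_abs, Real.norm_eq_abs, Real.norm_eq_abs, ← mul_assoc]
    refine mul_le_mul_of_nonneg_right ((hb _ _).trans ?_) (abs_nonneg _)
    have h1 : (∑ j, ‖u.dx j y.1 y.2‖) * ∑ j, ‖u.dx j y.1 y.2‖ ≤ n ^ 2 * |G y.2| := by
      calc (∑ j, ‖u.dx j y.1 y.2‖) * ∑ j, ‖u.dx j y.1 y.2‖
          ≤ (n * ‖fun j => u.dx j y.1 y.2‖) * (n * ‖fun j => u.dx j y.1 y.2‖) := by gcongr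
        _ = n ^ 2 * ‖fun j => u.dx j y.1 y.2‖ ^ 2 := by ring
        _ ≤ n ^ 2 * |G y.2| := by gcongr; exact hy.trans (le_abs_self _)
    rw [mul_assoc]
    exact mul_le_mul_of_nonneg_left h1 hK
  have hcH : Continuous (deriv H) := hH.continuous_deriv le_rfl
  have hcF : Continuous (deriv F) := hF.continuous_deriv le_rfl
  have j1 := (Integrable.comp_mul hcH z.memLp_val.1 hz' i1).const_mul (1 / 2)
  have j2 := Integrable.comp_mul hcF z.memLp_val.1 hz' hzti
  have j3 := Integrable.comp_mul hH.continuous z.memLp_val.1 hz'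
    (integrable_elasticForm (C := C) u.memLp_dx u.memLp_dtdx)
  have e1 : ∀ y ∈ {y : ℝ × E n | z.val y.1 y.2 ∈ Icc (0 : ℝ) 1},
      1 / 2 * (deriv H (z.val y.1 y.2)
        * (elasticForm C (fun j => u.dx j y.1 y.2) (fun j => u.dx j y.1 y.2) * z.dt y.1 y.2))
      = energyDensity_z C h (u.eps y.1 y.2) (z.val y.1 y.2) * z.dt y.1 y.2 := fun y hy => by
    rw [(hHh _ hy).2, energyDensity_z, elasticForm, Curve.eps]; ring
  have e3 : ∀ y ∈ {y : ℝ × E n | z.val y.1 y.2 ∈ Icc (0 : ℝ) 1},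
      H (z.val y.1 y.2) * elasticForm C (fun j => u.dx j y.1 y.2) (fun j => u.dtdx j y.1 y.2)
      = ddot (stress C h u z y.1 y.2) (u.epsDt y.1 y.2) := fun y hy => by
    simp only [(hHh _ hy).1, elasticForm, ddot, stress, energyDensity_e, Curve.eps, Curve.epsDt,
      Matrix.smul_apply, smul_eq_mul, Finset.mul_sum, mul_assoc]
  refine ⟨j1.congr (hz'.mono e1), j2.congr (hz'.mono fun y hy => by
    simp only [(hFf _ hy).2]), ?_⟩
  intro t ht
  have hprim := primD.prodMk (z.primitive_val hΩ hT hq) (Integrable.of_eval hDti) hzti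
  have hΨ := contDiff_elasticPotential (C := C) hH hF
  have hΨe : ∀ t x, z.val t x ∈ Icc (0 : ℝ) 1 →
      elasticPotential C H F (fun j => u.dx j t x, z.val t x)
      = energyDensity C h (u.eps t x) (z.val t x) + f (z.val t x) := fun t x hx => by
    rw [elasticPotential, (hHh _ hx).1, (hFf _ hx).1, energyDensity, elasticForm, Curve.eps]
  have hz0 := hz 0 ⟨le_rfl, hT⟩
  have hΨ0 : Integrable (fun x => elasticPotential C H F (fun j => u.dx j 0 x, z.val 0 x))
      (volume.restrict Ω) := by
    have hzm := (z.sobolev_val 0 h0T).1.1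
    have k1 := (Integrable.comp_mul hH.continuous hzm hz0
      (integrable_elasticForm (C := C) hD0' hD0')).const_mul (1 / 2)
    have k2 := Integrable.comp_mul hF.continuous hzm hz0 (integrable_const (1 : ℝ))
    refine (k1.add k2).congr (.of_forall fun x => ?_)
    simp only [elasticPotential, Pi.add_apply]
    ring
  have key := hprim.integral_comp (hD.1.prodMk z.memLp_val.1)
    (hD0.1.prodMk (z.sobolev_val 0 h0T).1.1) ((Integrable.of_eval hDti).prodMk hzti) hΨ hΨ0
    (by
      simp only [fderiv_elasticPotential hC hH hF]
      refine ((j1.add j2).add j3).congr (.of_forall fun y => ?_)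
      simp only [Pi.add_apply]
      ring)
    (Ico_subset_Icc_self ht)
  have a1 : ∀ t ∈ Ico 0 T, (fun x => elasticPotential C H F (fun j => u.dx j t x, z.val t x))
      =ᵐ[volume.restrict Ω] fun x => energyDensity C h (u.eps t x) (z.val t x) + f (z.val t x) :=
    fun t ht => (hz t ht).mono fun x hx => hΨe t x hx
  refine ⟨key.1.congr (a1 t ht), ?_⟩
  rw [← integral_congr_ae (a1 t ht), ← integral_congr_ae (a1 0 ⟨le_rfl, hT⟩), key.2]
  congr 1
  rw [integral_zero_eq_setIntegral_Ioo ht.1, integral_zero_eq_setIntegral_Ioo ht.1]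
  refine setIntegral_congr_fun measurableSet_Ioo fun s hs => integral_congr_ae ?_
  filter_upwards [hz s ⟨hs.1.le, hs.2.trans ht.2⟩] with x hx
  rw [fderiv_elasticPotential hC hH hF, ← e1 (s, x) hx, ← e3 (s, x) hx, (hFf _ hx).2]
  ring

end ElasticEnergy

/-! ### The product rule in time and the kinetic energy. -/

section KineticEnergy

variable {Ω : Set (E n)} {T : ℝ}

theorem integrable_inner_cyl {v w : ℝ → E n → E n} (hv : MemLpT Ω T 2 v) (hw : MemLpT Ω T 2 w) :
    Integrable (fun y : ℝ × E n => inner ℝ (v y.1 y.2) (w y.1 y.2)) (cyl Ω T) :=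
  MemLp.integrable_inner_two hv hw

/-- Used with both factors equal to `∂_t u` for the kinetic energy, and with `∂_t u` and `∂_t b` for
the terms of the external work in which `b` is differentiated twice or evaluated at the end times.
-/
theorem inner_product_rule (hΩ : IsLipschitzDomain Ω) (hT : 0 < T)
    {v vt w wt : ℝ → E n → E n} (hv : IsSecondTime Ω T 2 v vt) (hw : IsSecondTime Ω T 2 w wt)
    (hvm : MemLpT Ω T 2 v) (hwm : MemLpT Ω T 2 w) {t : ℝ} (ht : t ∈ Icc 0 T) :
    (∫ x in Ω, inner ℝ (v t x) (w t x)) = (∫ x in Ω, inner ℝ (v 0 x) (w 0 x))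
      + ((∫ s in (0 : ℝ)..t, ∫ x in Ω, inner ℝ (vt s x) (w s x))
        + ∫ s in (0 : ℝ)..t, ∫ x in Ω, inner ℝ (v s x) (wt s x)) := by
  have h2 : (1 : ℝ≥0∞) ≤ 2 := by norm_num
  have h0T : (0 : ℝ) ∈ Icc 0 T := ⟨le_rfl, hT.le⟩
  have pv := isTimePrimitive_of_isTimeDeriv hΩ hT h2 hv.1 hvm hv.2.1 hv.2.2
  have pw := isTimePrimitive_of_isTimeDeriv hΩ hT h2 hw.1 hwm hw.2.1 hw.2.2
  have iv := hv.2.1.integrable hΩ h2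
  have iw := hw.2.1.integrable hΩ h2
  have hΨ : ContDiff ℝ 1 fun q : E n × E n => inner ℝ q.1 q.2 := contDiff_fst.inner ℝ contDiff_snd
  have hd : ∀ a b a' b' : E n, fderiv ℝ (fun q : E n × E n => inner ℝ q.1 q.2) (a, b) (a', b')
      = inner ℝ a' b + inner ℝ a b' := fun a b a' b' => by
    rw [fderiv_inner_apply ℝ differentiableAt_fst differentiableAt_snd]
    simp [fderiv_fst, fderiv_snd, add_comm]
  have i1 := integrable_inner_cyl hv.2.1 hwm
  have i2 := integrable_inner_cyl hvm hw.2.1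
  have key := (pv.prodMk pw iv iw).integral_comp (hvm.1.prodMk hwm.1)
    ((hv.1 0 h0T).1.1.prodMk (hw.1 0 h0T).1.1) (iv.prodMk iw) hΨ
    (MemLp.integrable_inner_two (hv.1 0 h0T).1 (hw.1 0 h0T).1)
    (by simp only [hd]; exact i1.add i2) ht
  rw [key.2]
  congr 1
  simp only [hd]
  have hm := restrict_Ioo_prod_le (μ := volume.restrict Ω) ht.2
  have k1 := (i1.mono_measure hm)
  have k2 := (i2.mono_measure hm)
  simp only [integral_zero_eq_setIntegral_Ioo ht.1]
  rw [← integral_add (f := fun s => ∫ x in Ω, inner ℝ (vt s x) (w s x))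
    (g := fun s => ∫ x in Ω, inner ℝ (v s x) (wt s x)) k1.integral_prod_left k2.integral_prod_left]
  refine integral_congr_ae ?_
  filter_upwards [k1.prod_right_ae, k2.prod_right_ae] with s h1 h2
  exact integral_add h1 h2

theorem kinetic_energy_identity (hΩ : IsLipschitzDomain Ω) (hT : 0 < T) (u : Displacement Ω T)
    {t : ℝ} (ht : t ∈ Icc 0 T) :
    kineticEnergy u t = kineticEnergy u 0
      + ∫ s in (0 : ℝ)..t, ∫ x in Ω, inner ℝ (u.dtt s x) (u.dt s x) := by
  have h1 := inner_product_rule hΩ hT u.second_time u.second_time u.memLp_dt u.memLp_dt ht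
  simp only [real_inner_self_eq_norm_sq] at h1
  simp only [kineticEnergy, integral_const_mul, h1]
  simp only [real_inner_comm (u.dtt _ _) (u.dt _ _)]
  ring

end KineticEnergy

/-! ### The momentum balance tested with the velocity. -/

section ForcePairing

variable {Ω ΓD : Set (E n)} {T p : ℝ} {C : Tensor4 n} {h : ℝ → ℝ}

theorem memLp_app_strain {α : Type*} [MeasurableSpace α] {μ : Measure α} {q : ℝ≥0∞}
    {D : Fin n → α → E n} (hD : ∀ j, MemLp (D j) q μ) (i j : Fin n) :
    MemLp (fun x => C.app (strain fun k => D k x) i j) q μ := by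
  have h1 : ∀ k l, MemLp (fun x => D k x l) q μ := fun k l =>
    (EuclideanSpace.proj (𝕜 := ℝ) l : E n →L[ℝ] ℝ).comp_memLp' (hD k)
  simp only [Tensor4.app, strain, Matrix.of_apply]
  refine memLp_finsetSum _ fun l _ => memLp_finsetSum _ fun k _ => MemLp.const_mul ?_ _
  simp only [div_eq_inv_mul]
  exact ((h1 k l).add (h1 l k)).const_mul _

theorem MemLp.comp_mul {α : Type*} [MeasurableSpace α] {μ : Measure α} {q : ℝ≥0∞} {k : ℝ → ℝ}
    (hk : Continuous k) {w g : α → ℝ} (hw : AEStronglyMeasurable w μ)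
    (hw1 : ∀ᵐ x ∂μ, w x ∈ Icc (0 : ℝ) 1) (hg : MemLp g q μ) :
    MemLp (fun x => k (w x) * g x) q μ := by
  obtain ⟨M, hM⟩ := isCompact_Icc.exists_bound_of_continuousOn (hk.continuousOn (s := Icc (0 : ℝ) 1))
  refine hg.of_le_mul (c := M) ((hk.comp_aestronglyMeasurable hw).mul hg.1) ?_
  filter_upwards [hw1] with x hx
  rw [norm_mul]
  exact mul_le_mul_of_nonneg_right (hM _ hx) (norm_nonneg _)

theorem MemLpT.ae_memLp {F : Type*} [NormedAddCommGroup F] {q : ℝ≥0∞} (hq0 : q ≠ 0) (hq : q ≠ ⊤)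
    {w : ℝ → E n → F} (hw : MemLpT Ω T q w) :
    ∀ᵐ t ∂(volume.restrict (Ioo 0 T)), MemLp (w t) q (volume.restrict Ω) :=
  MemLp_prod_section hq0 hq hw

theorem MemLpT.ae_memLp_two {F : Type*} [NormedAddCommGroup F] {w : ℝ → E n → F}
    (hw : MemLpT Ω T 2 w) :
    ∀ᵐ t ∂(volume.restrict (Ioo 0 T)), MemLp (w t) 2 (volume.restrict Ω) :=
  hw.ae_memLp two_ne_zero ENNReal.ofNat_ne_top

theorem stress_apply (u : Displacement Ω T) (z : DamageVar Ω T p) (t : ℝ) (x : E n) (i j : Fin n) :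
    stress C h u z t x i j = h (z.val t x) * C.app (strain fun k => u.dx k t x) i j := rfl

theorem memLp_stress (hh : ContDiffOn ℝ 1 h (Icc 0 1)) (u : Displacement Ω T)
    {z : DamageVar Ω T p}
    (hz : ∀ t ∈ Ico 0 T, ∀ᵐ x ∂(volume.restrict Ω), z.val t x ∈ Icc (0 : ℝ) 1) (i j : Fin n) :
    MemLpT Ω T 2 (fun t x => stress C h u z t x i j) := by
  obtain ⟨H, hH, hHh⟩ := exists_contDiff_extension hh
  have hz' := DamageVar.ae_cyl_mem_Icc hz
  have h1 := MemLp.comp_mul hH.continuous z.memLp_val.1 hz'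
    (memLp_app_strain (C := C) (D := fun k (y : ℝ × E n) => u.dx k y.1 y.2) u.memLp_dx i j)
  refine MemLp.ae_eq ?_ h1
  filter_upwards [hz'] with y hy
  rw [stress_apply, (hHh _ hy).1]

theorem stress_symm (hC : IsStiffness C) (u : Displacement Ω T) (z : DamageVar Ω T p) (t : ℝ)
    (x : E n) (i j : Fin n) : stress C h u z t x i j = stress C h u z t x j i := by
  rw [stress_apply, stress_apply, app_symm hC]

/-- A vector field together with its derivatives, as one Hilbert space valued function. -/
def jet (a : E n) (A : Fin n → E n) : PiLp 2 (fun _ : Option (Fin n) => E n) :=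
  WithLp.toLp 2 fun o => o.elim a A

theorem inner_jet (a b : E n) (A B : Fin n → E n) :
    inner ℝ (jet a A) (jet b B) = inner ℝ a b + ∑ j, inner ℝ (A j) (B j) := by
  rw [PiLp.inner_apply, Fintype.sum_option]
  rfl

theorem memLp_jet {α : Type*} [MeasurableSpace α] {μ : Measure α} {q : ℝ≥0∞} {a : α → E n}
    {A : Fin n → α → E n} (ha : MemLp a q μ) (hA : ∀ j, MemLp (A j) q μ) :
    MemLp (fun x => jet (a x) fun j => A j x) q μ := by
  refine MemLp.of_eval_piLp fun o => ?_
  cases o with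
  | none => exact ha
  | some j => exact hA j

theorem IsTimePrimitive.jet (hΩ : IsLipschitzDomain Ω) {w wt : ℝ → E n → E n}
    {D Dt : Fin n → ℝ → E n → E n}
    (h : IsTimePrimitive (volume.restrict Ω) T w wt)
    (hD : ∀ j, IsTimePrimitive (volume.restrict Ω) T (D j) (Dt j)) (hwt : MemLpT Ω T 2 wt)
    (hDt : ∀ j, MemLpT Ω T 2 (Dt j)) :
    IsTimePrimitive (volume.restrict Ω) T (fun t x => jet (w t x) fun j => D j t x)
      (fun t x => Damage.jet (wt t x) fun j => Dt j t x) := by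
  have h2 : (1 : ℝ≥0∞) ≤ 2 := by norm_num
  let W : Option (Fin n) → ℝ → E n → E n := fun o => o.elim w D
  let Wt : Option (Fin n) → ℝ → E n → E n := fun o => o.elim wt Dt
  have hW : ∀ o, IsTimePrimitive (volume.restrict Ω) T (W o) (Wt o) := fun o => by
    cases o with
    | none => exact h
    | some j => exact hD j
  have hWt : ∀ o, Integrable (fun y : ℝ × E n => Wt o y.1 y.2) (cyl Ω T) := fun o => by
    cases o with
    | none => exact hwt.integrable hΩ h2
    | some j => exact (hDt j).integrable hΩ h2
  have h3 := (IsTimePrimitive.pi hW hWt).clm_comp (Integrable.of_eval hWt)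
    ((PiLp.continuousLinearEquiv 2 ℝ (fun _ : Option (Fin n) => E n)).symm :
      (Option (Fin n) → E n) →L[ℝ] PiLp 2 (fun _ : Option (Fin n) => E n))
  have key : ∀ (a : ℝ → E n → E n) (A : Fin n → ℝ → E n → E n) t x,
      Damage.jet (a t x) (fun j => A j t x)
        = WithLp.toLp 2 (fun o : Option (Fin n) => (o.elim a A : ℝ → E n → E n) t x) := by
    intro a A t x
    unfold Damage.jet
    congr 1
    funext o
    cases o <;> rfl
  simp only [key]
  exact h3

variable (C h) in
/-- The linear functional of the momentum balance, as an element of the dual of jets. -/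
def forceJet (ℓ : ℝ → E n → E n) (u : Displacement Ω T) (z : DamageVar Ω T p) (t : ℝ) (x : E n) :
    PiLp 2 (fun _ : Option (Fin n) => E n) :=
  jet (u.dtt t x - ℓ t x) fun j => gradVec fun i => stress C h u z t x i j

theorem sum_inner_stress (hC : IsStiffness C) (u : Displacement Ω T) (z : DamageVar Ω T p) (t : ℝ)
    (x : E n) (D : Fin n → E n) :
    ∑ j, inner ℝ (gradVec fun i => stress C h u z t x i j) (D j)
      = ddot (stress C h u z t x) (strain D) := by
  rw [ddot_strain (stress_symm hC u z t x), Finset.sum_comm]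
  refine Finset.sum_congr rfl fun j _ => ?_
  simp [gradVec, PiLp.inner_apply, mul_comm]

variable {ℓ : ℝ → E n → E n}

theorem inner_forceJet (hC : IsStiffness C) (u : Displacement Ω T) (z : DamageVar Ω T p) (t : ℝ)
    (x : E n) (a : E n) (D : Fin n → E n) :
    inner ℝ (forceJet C h ℓ u z t x) (jet a D) = inner ℝ (u.dtt t x) a
      + ddot (stress C h u z t x) (strain D) - inner ℝ (ℓ t x) a := by
  rw [forceJet, inner_jet, sum_inner_stress hC, inner_sub_left]
  ring

theorem memLp_forceJet (hh : ContDiffOn ℝ 1 h (Icc 0 1)) (hℓ : MemLpT Ω T 2 ℓ)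
    (u : Displacement Ω T) {z : DamageVar Ω T p}
    (hz : ∀ t ∈ Ico 0 T, ∀ᵐ x ∂(volume.restrict Ω), z.val t x ∈ Icc (0 : ℝ) 1) :
    MemLpT Ω T 2 (forceJet C h ℓ u z) :=
  memLp_jet (u.second_time.2.1.sub hℓ) fun j => MemLp.gradVec fun i => memLp_stress hh u hz i j

/-- The residual of the momentum balance becomes a single `L²` pairing with a jet, as the exchange
lemmas require. The exceptional times depend only on integrability of the data, not on the test
field. -/
theorem ae_integral_forceJet (hC : IsStiffness C) (hh : ContDiffOn ℝ 1 h (Icc 0 1))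
    (hℓ : MemLpT Ω T 2 ℓ) (u : Displacement Ω T) {z : DamageVar Ω T p}
    (hz : ∀ t ∈ Ico 0 T, ∀ᵐ x ∂(volume.restrict Ω), z.val t x ∈ Icc (0 : ℝ) 1) :
    ∀ᵐ t ∂(volume.restrict (Ioo 0 T)), ∀ (ζ : E n → E n) (D : Fin n → E n → E n),
      MemLp ζ 2 (volume.restrict Ω) → (∀ j, MemLp (D j) 2 (volume.restrict Ω)) →
      ∫ x in Ω, inner ℝ (forceJet C h ℓ u z t x) (jet (ζ x) fun j => D j x)
        = (∫ x in Ω, inner ℝ (u.dtt t x) (ζ x))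
          + (∫ x in Ω, ddot (stress C h u z t x) (strain fun j => D j x))
          - ∫ x in Ω, inner ℝ (ℓ t x) (ζ x) := by
  filter_upwards [u.second_time.2.1.ae_memLp_two,
    hℓ.ae_memLp_two,
    ae_all_iff.2 fun i => ae_all_iff.2 fun j =>
      (memLp_stress (C := C) hh u hz i j).ae_memLp_two]
    with t h1 h2 h3 ζ D hζ hD
  have i1 := MemLp.integrable_inner_two h1 hζ
  have i2 := MemLp.integrable_inner_two h2 hζ
  have i3 : IntegrableOn (fun x => ddot (stress C h u z t x) (strain fun j => D j x)) Ω := by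
    simp only [← sum_inner_stress hC]
    exact integrable_finsetSum _ fun j _ =>
      MemLp.integrable_inner_two (MemLp.gradVec fun i => h3 i j) (hD j)
  simp only [inner_forceJet hC]
  have i4 : IntegrableOn (fun x => inner ℝ (u.dtt t x) (ζ x)
      + ddot (stress C h u z t x) (strain fun j => D j x)) Ω := i1.add i3
  rw [integral_sub i4 i2, integral_add i1 i3]

theorem VanishesOn.neg {w : E n → E n} (hw : VanishesOn Ω ΓD w) :
    VanishesOn Ω ΓD (fun x => -w x) := by
  obtain ⟨g, hg, h0⟩ := hw
  exact ⟨_, hg.clm_comp (-ContinuousLinearMap.id ℝ (E n)), h0.mono fun x hx => by simp [hx]⟩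

/-- The null set of times in the momentum balance can be chosen independently of the test field. -/
theorem ae_forall_force (hC : IsStiffness C) (hh : ContDiffOn ℝ 1 h (Icc 0 1))
    (hℓ : MemLpT Ω T 2 ℓ) (u : Displacement Ω T) {z : DamageVar Ω T p}
    (hz : ∀ t ∈ Ico 0 T, ∀ᵐ x ∂(volume.restrict Ω), z.val t x ∈ Icc (0 : ℝ) 1)
    (hF : ∀ (ζ : E n → E n) (Dζ : Fin n → E n → E n), IsSobolev Ω 2 ζ Dζ → VanishesOn Ω ΓD ζ →
      ∀ᵐ t ∂(volume.restrict (Ioo 0 T)),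
        (∫ x in Ω, inner ℝ (u.dtt t x) (ζ x))
          + (∫ x in Ω, ddot (stress C h u z t x) (strain fun j => Dζ j x))
          = ∫ x in Ω, inner ℝ (ℓ t x) (ζ x)) :
    ∀ᵐ t ∂(volume.restrict (Ioo 0 T)), ∀ (ζ : E n → E n) (Dζ : Fin n → E n → E n),
      IsSobolev Ω 2 ζ Dζ → VanishesOn Ω ΓD ζ →
        (∫ x in Ω, inner ℝ (u.dtt t x) (ζ x))
          + (∫ x in Ω, ddot (stress C h u z t x) (strain fun j => Dζ j x))
          = ∫ x in Ω, inner ℝ (ℓ t x) (ζ x) := by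
  let S : Set (E n → PiLp 2 (fun _ : Option (Fin n) => E n)) :=
    {Z | ∃ (ζ : E n → E n) (Dζ : Fin n → E n → E n), IsSobolev Ω 2 ζ Dζ ∧ VanishesOn Ω ΓD ζ ∧
      Z = fun x => jet (ζ x) fun j => Dζ j x}
  have hS : ∀ Z ∈ S, MemLp Z 2 (volume.restrict Ω) := by
    rintro Z ⟨ζ, Dζ, h1, -, rfl⟩
    exact memLp_jet h1.1 fun j => (h1.2 j).1
  have hform := ae_integral_forceJet hC hh hℓ u hz
  -- An inequality suffices because the admissible fields are closed under negation; it is used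
  -- below for `ζ` and for `-ζ`.
  have key := ae_forall_integral_inner_le (c := fun _ => 0)
    (memLp_forceJet (C := C) hh hℓ u hz) hS (by
      rintro Z ⟨ζ, Dζ, h1, h2, rfl⟩
      filter_upwards [hform, hF ζ Dζ h1 h2] with t ht h3
      rw [ht ζ Dζ h1.1 fun j => (h1.2 j).1]
      exact (sub_eq_zero.2 h3).le)
  filter_upwards [key, hform] with t h1 h2 ζ Dζ h3 h4
  have h5 := h1 _ ⟨ζ, Dζ, h3, h4, rfl⟩
  have h6 := h1 _ ⟨_, _, h3.neg, h4.neg, rfl⟩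
  have h7 : ∫ x in Ω, inner ℝ (forceJet C h ℓ u z t x) (jet (-ζ x) fun j => -Dζ j x)
      = -∫ x in Ω, inner ℝ (forceJet C h ℓ u z t x) (jet (ζ x) fun j => Dζ j x) := by
    rw [← integral_neg]
    refine integral_congr_ae (.of_forall fun x => ?_)
    simp only [forceJet, inner_jet, inner_neg_right, Finset.sum_neg_distrib]
    ring
  have h8 := h2 ζ Dζ h3.1 fun j => (h3.2 j).1
  rw [h7] at h6
  linarith

theorem IsTimePrimitive.sub {F : Type*} [NormedAddCommGroup F] [NormedSpace ℝ F] [CompleteSpace F]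
    {α : Type*} [MeasurableSpace α] {μ : Measure α} [SFinite μ] {w wt v vt : ℝ → α → F}
    (hw : IsTimePrimitive μ T w wt) (hv : IsTimePrimitive μ T v vt)
    (hwt : Integrable (fun y : ℝ × α => wt y.1 y.2) ((volume.restrict (Ioo 0 T)).prod μ))
    (hvt : Integrable (fun y : ℝ × α => vt y.1 y.2) ((volume.restrict (Ioo 0 T)).prod μ)) :
    IsTimePrimitive μ T (fun t x => w t x - v t x) (fun t x => wt t x - vt t x) :=
  (hw.prodMk hv hwt hvt).clm_comp (hwt.prodMk hvt)
    (ContinuousLinearMap.fst ℝ F F - ContinuousLinearMap.snd ℝ F F)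

/-- The momentum balance tested with the velocity relative to the boundary datum. -/
theorem ae_force_velocity (hΩ : IsLipschitzDomain Ω) (hT : 0 < T) (hC : IsStiffness C)
    (hh : ContDiffOn ℝ 1 h (Icc 0 1)) (hℓ : MemLpT Ω T 2 ℓ) (u : Displacement Ω T)
    (b : DirichletDatum Ω T) {z : DamageVar Ω T p}
    (hz : ∀ t ∈ Ico 0 T, ∀ᵐ x ∂(volume.restrict Ω), z.val t x ∈ Icc (0 : ℝ) 1)
    (hD : ∀ᵐ t ∂(volume.restrict (Ioo 0 T)), VanishesOn Ω ΓD (fun x => u.val t x - b.val t x))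
    (hF : ∀ᵐ t ∂(volume.restrict (Ioo 0 T)), ∀ (ζ : E n → E n) (Dζ : Fin n → E n → E n),
      IsSobolev Ω 2 ζ Dζ → VanishesOn Ω ΓD ζ →
        (∫ x in Ω, inner ℝ (u.dtt t x) (ζ x))
          + (∫ x in Ω, ddot (stress C h u z t x) (strain fun j => Dζ j x))
          = ∫ x in Ω, inner ℝ (ℓ t x) (ζ x)) :
    ∀ᵐ t ∂(volume.restrict (Ioo 0 T)),
      (∫ x in Ω, inner ℝ (u.dtt t x) (u.dt t x)) - (∫ x in Ω, inner ℝ (u.dtt t x) (b.dt t x))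
        + ((∫ x in Ω, ddot (stress C h u z t x) (u.epsDt t x))
          - ∫ x in Ω, ddot (stress C h u z t x) (b.epsDt t x))
        = ∫ x in Ω, inner ℝ (ℓ t x) (u.dt t x - b.dt t x) := by
  have h2 : (1 : ℝ≥0∞) ≤ 2 := by norm_num
  have hsub : ∀ t ∈ Icc 0 T, IsSobolev Ω 2 (fun x => u.val t x - b.val t x)
      (fun j x => u.dx j t x - b.dx j t x) := fun t ht => (u.sobolev_val t ht).sub (b.sobolev_val t ht)
  have hjet : ∀ t ∈ Icc 0 T, MemLp (fun x => jet (u.val t x - b.val t x)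
      fun j => u.dx j t x - b.dx j t x) 2 (volume.restrict Ω) := fun t ht =>
    memLp_jet (hsub t ht).1 fun j => ((hsub t ht).2 j).1
  have mt : MemLpT Ω T 2 (fun t x => u.dt t x - b.dt t x) := u.memLp_dt.sub b.memLp_dt
  have mD : ∀ j, MemLpT Ω T 2 (fun t x => u.dtdx j t x - b.dtdx j t x) := fun j =>
    (u.memLp_dtdx j).sub (b.memLp_dtdx j)
  have hprim := IsTimePrimitive.jet hΩ
    ((u.primitive_val hΩ hT h2).sub (b.primitive_val hΩ hT h2) (u.memLp_dt.integrable hΩ h2)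
      (b.memLp_dt.integrable hΩ h2))
    (fun j => (u.primitive_dx hΩ hT h2 j).sub (b.primitive_dx hΩ hT h2 j)
      ((u.memLp_dtdx j).integrable hΩ h2) ((b.memLp_dtdx j).integrable hΩ h2)) mt mD
  have h0T : (0 : ℝ) ∈ Icc 0 T := ⟨le_rfl, hT.le⟩
  have hform := ae_integral_forceJet hC hh hℓ u hz
  -- There is no need to show that `∂_t (u - b)` vanishes on `ΓD`. The residual at time `s`
  -- annihilates `u - b` at almost all times, hence also the time derivative of this curve, for
  -- almost every `s`.
  have key := ae_integral_inner_deriv_eq_zero hT (memLp_jet mt mD)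
    (memLp_forceJet (C := C) hh hℓ u hz) (hjet 0 h0T) hprim
    (fun t ht => (MemLp.sub (hjet t ht) (hjet 0 h0T)).ae_eq (by
      filter_upwards [hprim t ht] with x hx
      rw [Pi.sub_apply, hx, add_sub_cancel_left])) (by
      filter_upwards [hform, hF] with s h3 h4
      filter_upwards [hD, ae_restrict_mem measurableSet_Ioo] with t h5 ht
      have h6 := hsub t (Ioo_subset_Icc_self ht)
      rw [h3 _ _ h6.1 fun j => (h6.2 j).1, h4 _ _ h6 h5, sub_self])
  filter_upwards [key, hform, mt.ae_memLp_two,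
    ae_all_iff.2 fun j => (mD j).ae_memLp_two,
    (integrable_inner_cyl u.second_time.2.1 u.memLp_dt).prod_right_ae,
    (integrable_inner_cyl u.second_time.2.1 b.memLp_dt).prod_right_ae,
    (integrable_stress (C := C) hh u hz u.memLp_dtdx).prod_right_ae,
    (integrable_stress (C := C) hh u hz b.memLp_dtdx).prod_right_ae]
    with t k1 k2 k3 k4 i1 i2 i3 i4
  rw [k2 _ _ k3 k4] at k1
  have e1 : ∫ x in Ω, inner ℝ (u.dtt t x) (u.dt t x - b.dt t x)
      = (∫ x in Ω, inner ℝ (u.dtt t x) (u.dt t x)) - ∫ x in Ω, inner ℝ (u.dtt t x) (b.dt t x) := by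
    simp only [inner_sub_right]
    exact integral_sub i1 i2
  have e2 : ∫ x in Ω, ddot (stress C h u z t x) (strain fun j => u.dtdx j t x - b.dtdx j t x)
      = (∫ x in Ω, ddot (stress C h u z t x) (u.epsDt t x))
        - ∫ x in Ω, ddot (stress C h u z t x) (b.epsDt t x) := by
    refine Eq.trans ?_ (integral_sub i3 i4)
    refine integral_congr_ae (.of_forall fun x => ?_)
    simp only [← sum_inner_stress hC, Curve.epsDt, inner_sub_right, Finset.sum_sub_distrib]
  rw [e1, e2] at k1
  linarith

end ForcePairing

/-! ### Functionals on `W^{1,p}` and common null sets of times. -/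

section Pairing

variable {Ω : Set (E n)} {T p : ℝ}

theorem Curve.ae_isSobolev_dx {q : ℝ≥0∞} (hq0 : q ≠ 0) (hq : q ≠ ⊤) {F : Type*}
    [NormedAddCommGroup F] [NormedSpace ℝ F] (w : Curve Ω T q F)
    {dxx : Fin n → Fin n → ℝ → E n → F} (h : IsSecondSpace Ω T q w.dx dxx) :
    ∀ᵐ t ∂(volume.restrict (Ioo 0 T)), ∀ i, IsSobolev Ω q (w.dx i t) (fun j => dxx i j t) := by
  filter_upwards [ae_all_iff.2 fun i => (w.memLp_dx i).ae_memLp hq0 hq,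
    ae_all_iff.2 fun i => ae_all_iff.2 fun j => (h.1 i j).ae_memLp hq0 hq, h.2] with t h1 h2 h3 i
  exact ⟨h1 i, fun j => ⟨h2 i j, h3 i j⟩⟩

theorem IsSobolev.exists_bound (hΩ : IsLipschitzDomain Ω) (hp1 : 1 < p) (hp : (n : ℝ) < p)
    {w : E n → ℝ} {D : Fin n → E n → ℝ} (h : IsSobolev Ω (ENNReal.ofReal p) w D) :
    ∃ M : ℝ≥0, ∀ᵐ x ∂(volume.restrict Ω), ‖w x‖₊ ≤ M := by
  obtain ⟨A, hA⟩ := exists_ae_bound hΩ hp1 hp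
  refine ⟨A * (wNorm Ω (ENNReal.ofReal p) w D).toNNReal, ?_⟩
  filter_upwards [hA w D h] with x hx
  rw [← ENNReal.coe_le_coe, ENNReal.coe_mul, ENNReal.coe_toNNReal h.wNorm_ne_top]
  exact hx

theorem integrableOn_mul_of_isSobolev (hΩ : IsLipschitzDomain Ω) (hp1 : 1 < p) (hp : (n : ℝ) < p)
    {w : E n → ℝ} {D : Fin n → E n → ℝ} (h : IsSobolev Ω (ENNReal.ofReal p) w D) {a : E n → ℝ}
    (ha : IntegrableOn a Ω) : IntegrableOn (fun x => a x * w x) Ω := by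
  obtain ⟨M, hM⟩ := h.exists_bound hΩ hp1 hp
  exact ha.mul_bdd (c := M) h.1.1 (hM.mono fun x hx => hx)

/-- A functional on `W^{1,p}(Ω)` that vanishes on smooth functions vanishes. -/
theorem integral_pairing_eq_zero (hΩ : IsLipschitzDomain Ω) (hp1 : 1 < p) (hp : (n : ℝ) < p)
    {a : E n → ℝ} {B : E n → E n} (ha : IntegrableOn a Ω)
    (hB : AEStronglyMeasurable B (volume.restrict Ω)) {M : ℝ≥0}
    (hM : ∀ᵐ x ∂(volume.restrict Ω), ‖B x‖ ≤ M)
    (h : ∀ s : E n → ℝ, ContDiff ℝ ∞ s →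
      ∫ x in Ω, (a x * s x + inner ℝ (B x) (gradVec fun j => pd s j x)) = 0)
    {ζ : E n → ℝ} {D : Fin n → E n → ℝ} (hζ : IsSobolev Ω (ENNReal.ofReal p) ζ D) :
    ∫ x in Ω, (a x * ζ x + inner ℝ (B x) (gradVec fun j => D j x)) = 0 := by
  have hfin := isFiniteMeasure_restrict hΩ
  have hone := one_le_ofReal hp1
  obtain ⟨s, hs, hsw⟩ := exists_tendstoW hΩ hone (by simp) hζ
  obtain ⟨A, hA⟩ := exists_uniform_limit hΩ hp1 hp
  obtain ⟨ζ', hc, hae, hu, -⟩ := hA ζ D s hζ hs hsw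
  obtain ⟨R, hR⟩ := hΩ.isCompact_closure.exists_bound_of_continuousOn hc
  have hmem : ∀ᵐ x ∂(volume.restrict Ω), x ∈ closure Ω :=
    (ae_restrict_mem hΩ.isOpen.measurableSet).mono fun x hx => subset_closure hx
  have hB' : ∀ j, AEStronglyMeasurable (fun x => B x j) (volume.restrict Ω) := fun j =>
    (EuclideanSpace.proj (𝕜 := ℝ) j : E n →L[ℝ] ℝ).continuous.comp_aestronglyMeasurable hB
  have hBM : ∀ j, ∀ᵐ x ∂(volume.restrict Ω), ‖B x j‖ ≤ M := fun j =>
    hM.mono fun x hx => (PiLp.norm_apply_le (B x) j).trans hx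
  have hpd : ∀ k j, IntegrableOn (pd (s k) j) Ω := fun k j =>
    (hΩ.memLp_continuous (continuous_pd ((hs k).of_le (by simp)) j) 1).integrable le_rfl
  have hDi : ∀ j, IntegrableOn (D j) Ω := fun j => (hζ.2 j).1.integrable hone
  -- Since `a` is only integrable, a uniform bound on the approximations is needed for domination;
  -- it comes from `p > n`.
  have lim1 : Tendsto (fun k => ∫ x in Ω, a x * s k x) atTop (𝓝 (∫ x in Ω, a x * ζ x)) := by
    refine tendsto_integral_filter_of_dominated_convergence (fun x => |a x| * (R + 1))
      (.of_forall fun k => ha.1.mul (hs k).continuous.aestronglyMeasurable) ?_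
      (ha.norm.mul_const _) ?_
    · filter_upwards [Metric.tendstoUniformlyOn_iff.1 hu 1 one_pos] with k hk
      filter_upwards [hmem] with x hx
      rw [norm_mul]
      refine mul_le_mul_of_nonneg_left ?_ (norm_nonneg _)
      have h1 := hk x hx
      rw [dist_eq_norm'] at h1
      have h2 := norm_sub_norm_le (s k x) (ζ' x)
      linarith [hR x hx]
    · filter_upwards [hmem, hae] with x hx hx'
      rw [hx']
      exact (hu.tendsto_at hx).const_mul _
  have lim2 : ∀ j, Tendsto (fun k => ∫ x in Ω, B x j * pd (s k) j x) atTop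
      (𝓝 (∫ x in Ω, B x j * D j x)) := fun j => by
    refine tendsto_integral_of_tendsto_eLpNorm_one
      (fun k => (hpd k j).bdd_mul (hB' j) (hBM j)) ((hDi j).bdd_mul (hB' j) (hBM j)) ?_
    simp only [← mul_sub]
    exact tendsto_eLpNorm_bdd_mul (a := fun _ x => B x j) (M := M) (fun _ => hBM j)
      (tendsto_eLpNorm_one hone (fun k => (hpd k j).1.sub (hDi j).1) ((tendstoW_iff.1 hsw).2 j))
  have split : ∀ {w : E n → ℝ} {Dw : Fin n → E n → ℝ}, IntegrableOn (fun x => a x * w x) Ω →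
      (∀ j, IntegrableOn (Dw j) Ω) →
      ∫ x in Ω, (a x * w x + inner ℝ (B x) (gradVec fun j => Dw j x))
        = (∫ x in Ω, a x * w x) + ∑ j, ∫ x in Ω, B x j * Dw j x := by
    intro w Dw h1 h2
    simp only [inner_gradVec]
    have h3 : ∀ j, IntegrableOn (fun x => B x j * Dw j x) Ω := fun j =>
      (h2 j).bdd_mul (hB' j) (hBM j)
    rw [integral_add h1 (integrable_finsetSum _ fun j _ => h3 j),
      integral_finsetSum _ fun j _ => h3 j]
  have hsk : ∀ k, IntegrableOn (fun x => a x * s k x) Ω := fun k =>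
    integrableOn_mul_of_isSobolev hΩ hp1 hp (isSobolev_of_contDiff hΩ ((hs k).of_le (by simp))) ha
  rw [split (integrableOn_mul_of_isSobolev hΩ hp1 hp hζ ha) hDi]
  refine tendsto_nhds_unique (lim1.add (tendsto_finsetSum _ fun j _ => lim2 j)) ?_
  refine tendsto_const_nhds.congr fun k => ?_
  rw [← split (hsk k) (hpd k), h _ (hs k)]

/-- Null sets of times can be chosen independently of a smooth test function. -/
theorem ae_forall_pairing_eq_zero (hΩ : IsLipschitzDomain Ω) {ν : Measure ℝ} {a : ℝ → E n → ℝ}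
    {B : ℝ → E n → E n} (ha : ∀ᵐ t ∂ν, IntegrableOn (a t) Ω) (hB : ∀ᵐ t ∂ν, IntegrableOn (B t) Ω)
    (h : ∀ s : E n → ℝ, ContDiff ℝ ∞ s → ∀ᵐ t ∂ν,
      ∫ x in Ω, (a t x * s x + inner ℝ (B t x) (gradVec fun j => pd s j x)) = 0) :
    ∀ᵐ t ∂ν, ∀ s : E n → ℝ, ContDiff ℝ ∞ s →
      ∫ x in Ω, (a t x * s x + inner ℝ (B t x) (gradVec fun j => pd s j x)) = 0 := by
  have hK := hΩ.isCompact_closure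
  have : CompactSpace (closure Ω) := isCompact_iff_compactSpace.1 hK
  have hgc : ∀ s : E n → ℝ, ContDiff ℝ ∞ s → Continuous fun x => gradVec fun j => pd s j x :=
    fun s hs => (PiLp.continuous_toLp 2 _).comp
      (continuous_pi fun j => continuous_pd (hs.of_le (by simp)) j)
  -- With integrable coefficients there is no `L²` duality, so separability is taken from the
  -- continuous functions on a compact set. The pairing at a good time is Lipschitz for the distance
  -- of the images under `J`.
  let J : {s : E n → ℝ // ContDiff ℝ ∞ s} → C(closure Ω, ℝ × E n) := fun s =>
    ⟨fun x => (s.1 x, gradVec fun j => pd s.1 j x), (s.2.continuous.prodMk (hgc s.1 s.2)).comp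
      continuous_subtype_val⟩
  -- A smooth function is chosen for each element of the range; by the Lipschitz bound the pairing
  -- depends on the image only, so any choice serves.
  choose σ hσ using fun g : range J => g.2
  let L : ℝ → {s : E n → ℝ // ContDiff ℝ ∞ s} → ℝ := fun t s =>
    ∫ x in Ω, (a t x * s.1 x + inner ℝ (B t x) (gradVec fun j => pd s.1 j x))
  have hint : ∀ {t}, IntegrableOn (a t) Ω → IntegrableOn (B t) Ω →
      ∀ s : {s : E n → ℝ // ContDiff ℝ ∞ s},
      IntegrableOn (fun x => a t x * s.1 x + inner ℝ (B t x) (gradVec fun j => pd s.1 j x)) Ω := by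
    intro t h1 h2 s
    obtain ⟨R, hR⟩ := hK.exists_bound_of_continuousOn s.2.continuous.continuousOn
    obtain ⟨R', hR'⟩ := hK.exists_bound_of_continuousOn (hgc s.1 s.2).continuousOn
    have hmem : ∀ᵐ x ∂(volume.restrict Ω), x ∈ closure Ω :=
      (ae_restrict_mem hΩ.isOpen.measurableSet).mono fun x hx => subset_closure hx
    refine (h1.mul_bdd (c := R) s.2.continuous.aestronglyMeasurable (hmem.mono hR)).add ?_
    refine (h2.norm.mul_const R').mono' (h2.1.inner (hgc s.1 s.2).aestronglyMeasurable) ?_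
    filter_upwards [hmem] with x hx
    exact (norm_inner_le_norm _ _).trans (mul_le_mul_of_nonneg_left (hR' x hx) (norm_nonneg _))
  have hLip : ∀ {t}, IntegrableOn (a t) Ω → IntegrableOn (B t) Ω →
      ∀ s s', |L t s - L t s'| ≤ (∫ x in Ω, (|a t x| + ‖B t x‖)) * dist (J s) (J s') := by
    intro t h1 h2 s s'
    change |(∫ x in Ω, _) - ∫ x in Ω, _| ≤ _
    rw [← integral_sub (hint h1 h2 s) (hint h1 h2 s'), ← integral_mul_const]
    rw [← Real.norm_eq_abs]
    refine norm_integral_le_of_norm_le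
      (g := fun x => (|a t x| + ‖B t x‖) * dist (J s) (J s')) ((h1.norm.add h2.norm).mul_const _) ?_
    filter_upwards [ae_restrict_mem hΩ.isOpen.measurableSet] with x hx
    have hd := ContinuousMap.dist_apply_le_dist (f := J s) (g := J s') ⟨x, subset_closure hx⟩
    have hd1 := (Prod.dist_eq (x := J s ⟨x, subset_closure hx⟩)
      (y := J s' ⟨x, subset_closure hx⟩)) ▸ hd
    have e1 : |s.1 x - s'.1 x| ≤ dist (J s) (J s') := (le_max_left _ _).trans hd1
    have e2 : ‖(gradVec fun j => pd s.1 j x) - gradVec fun j => pd s'.1 j x‖ ≤ dist (J s) (J s') := by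
      rw [← dist_eq_norm]
      exact (le_max_right _ _).trans hd1
    have e3 : a t x * s.1 x + inner ℝ (B t x) (gradVec fun j => pd s.1 j x)
        - (a t x * s'.1 x + inner ℝ (B t x) (gradVec fun j => pd s'.1 j x))
        = a t x * (s.1 x - s'.1 x)
          + inner ℝ (B t x) ((gradVec fun j => pd s.1 j x) - gradVec fun j => pd s'.1 j x) := by
      rw [inner_sub_right]; ring
    rw [e3, Real.norm_eq_abs]
    refine (abs_add_le _ _).trans ?_
    rw [abs_mul, add_mul]
    exact add_le_add (mul_le_mul_of_nonneg_left e1 (abs_nonneg _))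
      ((abs_real_inner_le_norm _ _).trans (mul_le_mul_of_nonneg_left e2 (norm_nonneg _)))
  have key : ∀ᵐ t ∂ν, ∀ g : range J, L t (σ g) = 0 := by
    refine ae_forall_of_forall_ae ?_ fun g => h (σ g).1 (σ g).2
    filter_upwards [ha, hB] with t h1 h2
    have hc : Continuous fun g : range J => L t (σ g) := by
      refine (LipschitzWith.of_dist_le_mul (K := (∫ x in Ω, (|a t x| + ‖B t x‖)).toNNReal)
        fun g g' => ?_).continuous
      rw [Real.dist_eq, Real.coe_toNNReal _ (integral_nonneg fun x => by positivity)]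
      have := hLip h1 h2 (σ g) (σ g')
      rwa [hσ g, hσ g'] at this
    exact isClosed_eq hc continuous_const
  filter_upwards [key, ha, hB] with t h1 h2 h3 s hs
  have h4 := hLip h2 h3 ⟨s, hs⟩ (σ ⟨J ⟨s, hs⟩, mem_range_self _⟩)
  rw [hσ, dist_self, mul_zero, h1, sub_zero] at h4
  exact abs_eq_zero.1 (le_antisymm h4 (abs_nonneg _))

end Pairing

/-! ### The damage equation as a single pairing. -/

section DamagePairing

variable {Ω : Set (E n)} {T p : ℝ} {C : Tensor4 n} {h f : ℝ → ℝ}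

theorem integrable_energyDensity_z (hh : ContDiffOn ℝ 1 h (Icc 0 1)) (u : Displacement Ω T)
    {z : DamageVar Ω T p}
    (hz : ∀ t ∈ Ico 0 T, ∀ᵐ x ∂(volume.restrict Ω), z.val t x ∈ Icc (0 : ℝ) 1) :
    Integrable (fun y : ℝ × E n => energyDensity_z C h (u.eps y.1 y.2) (z.val y.1 y.2))
      (cyl Ω T) := by
  obtain ⟨H, hH, hHh⟩ := exists_contDiff_extension hh
  have hz' := DamageVar.ae_cyl_mem_Icc hz
  refine ((Integrable.comp_mul (hH.continuous_deriv le_rfl) z.memLp_val.1 hz'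
    (integrable_elasticForm (C := C) u.memLp_dx u.memLp_dx)).const_mul (1 / 2)).congr ?_
  filter_upwards [hz'] with y hy
  rw [(hHh _ hy).2, energyDensity_z, elasticForm, Curve.eps]
  ring

theorem integrable_potential_deriv (hΩ : IsLipschitzDomain Ω) (hf : ContDiffOn ℝ 1 f (Icc 0 1))
    {z : DamageVar Ω T p}
    (hz : ∀ t ∈ Ico 0 T, ∀ᵐ x ∂(volume.restrict Ω), z.val t x ∈ Icc (0 : ℝ) 1) :
    Integrable (fun y : ℝ × E n => derivWithin f (Icc 0 1) (z.val y.1 y.2)) (cyl Ω T) := by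
  have hfin := isFiniteMeasure_cyl hΩ T
  obtain ⟨F, hF, hFf⟩ := exists_contDiff_extension hf
  have hz' := DamageVar.ae_cyl_mem_Icc hz
  refine (Integrable.comp_mul (hF.continuous_deriv le_rfl) z.memLp_val.1 hz'
    (integrable_const (1 : ℝ))).congr ?_
  filter_upwards [hz'] with y hy
  rw [(hFf _ hy).2, mul_one]

variable (C h f) in
/-- The terms of the damage equation other than the `p`-Laplacian. -/
def damageSource (u : Displacement Ω T) (z : DamageVar Ω T p) (ξ φ : ℝ → E n → ℝ) (t : ℝ)
    (x : E n) : ℝ :=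
  z.dt t x + energyDensity_z C h (u.eps t x) (z.val t x) + derivWithin f (Icc 0 1) (z.val t x)
    + ξ t x + φ t x

variable {ξ φ : ℝ → E n → ℝ}

/-- Integrability of the terms of the damage equation at almost every time. -/
structure DamageRegularAt (C : Tensor4 n) (h f : ℝ → ℝ) (u : Displacement Ω T)
    (z : DamageVar Ω T p) (ξ φ : ℝ → E n → ℝ) (t : ℝ) : Prop where
  dt : IntegrableOn (z.dt t) Ω
  energy : IntegrableOn (fun x => energyDensity_z C h (u.eps t x) (z.val t x)) Ω
  potential : IntegrableOn (fun x => derivWithin f (Icc 0 1) (z.val t x)) Ω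
  xi : IntegrableOn (ξ t) Ω
  phi : IntegrableOn (φ t) Ω
  dx : ∀ i, IsSobolev Ω (ENNReal.ofReal p) (z.dx i t) (fun j => z.dxx i j t)

theorem ae_damageRegularAt (hΩ : IsLipschitzDomain Ω) (hp1 : 1 < p)
    (hh : ContDiffOn ℝ 1 h (Icc 0 1)) (hf : ContDiffOn ℝ 1 f (Icc 0 1)) (u : Displacement Ω T)
    {z : DamageVar Ω T p}
    (hz : ∀ t ∈ Ico 0 T, ∀ᵐ x ∂(volume.restrict Ω), z.val t x ∈ Icc (0 : ℝ) 1)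
    (hξ : MemLpT Ω T 2 ξ) (hφ : MemLpT Ω T 2 φ) :
    ∀ᵐ t ∂(volume.restrict (Ioo 0 T)), DamageRegularAt C h f u z ξ φ t := by
  have h2 : (1 : ℝ≥0∞) ≤ 2 := by norm_num
  have hq0 : ENNReal.ofReal p ≠ 0 := by simp; linarith
  filter_upwards [(z.memLp_dt.integrable hΩ (one_le_ofReal hp1)).prod_right_ae,
    (integrable_energyDensity_z (C := C) hh u hz).prod_right_ae,
    (integrable_potential_deriv hΩ hf hz).prod_right_ae, (hξ.integrable hΩ h2).prod_right_ae,
    (hφ.integrable hΩ h2).prod_right_ae,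
    z.ae_isSobolev_dx hq0 ENNReal.ofReal_ne_top z.second_space] with t h1 h2 h3 h4 h5 h6
  exact ⟨h1, h2, h3, h4, h5, h6⟩

namespace DamageRegularAt

variable {u : Displacement Ω T} {z : DamageVar Ω T p} {t : ℝ}

theorem source (H : DamageRegularAt C h f u z ξ φ t) :
    IntegrableOn (damageSource C h f u z ξ φ t) Ω :=
  (((H.dt.add H.energy).add H.potential).add H.xi).add H.phi

theorem memLp_grad (H : DamageRegularAt C h f u z ξ φ t) :
    MemLp (z.grad t) (ENNReal.ofReal p) (volume.restrict Ω) := MemLp.gradVec fun i => (H.dx i).1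

theorem aestronglyMeasurable_flux (hp1 : 1 < p) (H : DamageRegularAt C h f u z ξ φ t) :
    AEStronglyMeasurable (fun x => pFlux p (z.grad t x)) (volume.restrict Ω) :=
  (continuous_pFlux hp1).comp_aestronglyMeasurable H.memLp_grad.1

theorem exists_flux_bound (hΩ : IsLipschitzDomain Ω) (hp1 : 1 < p) (hp : (n : ℝ) < p)
    (H : DamageRegularAt C h f u z ξ φ t) :
    ∃ M : ℝ≥0, ∀ᵐ x ∂(volume.restrict Ω), ‖pFlux p (z.grad t x)‖ ≤ M := by
  choose M hM using fun i => (H.dx i).exists_bound hΩ hp1 hp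
  obtain ⟨R, hR⟩ := (isCompact_closedBall (0 : E n) (∑ i, M i)).exists_bound_of_continuousOn
    (continuous_pFlux hp1).continuousOn
  refine ⟨R.toNNReal, ?_⟩
  filter_upwards [ae_all_iff.2 hM] with x hx
  refine (hR _ ?_).trans (Real.le_coe_toNNReal R)
  rw [mem_closedBall_zero_iff]
  exact (norm_gradVec_le _).trans (Finset.sum_le_sum fun i _ => hx i)

theorem integrableOn_flux (hΩ : IsLipschitzDomain Ω) (hp1 : 1 < p) (hp : (n : ℝ) < p)
    (H : DamageRegularAt C h f u z ξ φ t) : IntegrableOn (fun x => pFlux p (z.grad t x)) Ω := by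
  have hfin := isFiniteMeasure_restrict hΩ
  obtain ⟨M, hM⟩ := H.exists_flux_bound hΩ hp1 hp
  exact Integrable.of_bound (H.aestronglyMeasurable_flux hp1) M hM

/-- The separate integrals may be collected because `ζ` is bounded, by `p > n`, and every
coefficient is integrable. -/
theorem pairing_eq (hΩ : IsLipschitzDomain Ω) (hp1 : 1 < p) (hp : (n : ℝ) < p)
    (H : DamageRegularAt C h f u z ξ φ t) {ζ : E n → ℝ} {D : Fin n → E n → ℝ}
    (hζ : IsSobolev Ω (ENNReal.ofReal p) ζ D) :
    (∫ x in Ω, (z.dt t x * ζ x + inner ℝ (pFlux p (z.grad t x)) (gradVec fun j => D j x)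
        + energyDensity_z C h (u.eps t x) (z.val t x) * ζ x
        + derivWithin f (Icc 0 1) (z.val t x) * ζ x))
      + (∫ x in Ω, ξ t x * ζ x) + ∫ x in Ω, φ t x * ζ x
    = ∫ x in Ω, (damageSource C h f u z ξ φ t x * ζ x
        + inner ℝ (pFlux p (z.grad t x)) (gradVec fun j => D j x)) := by
  have hfin := isFiniteMeasure_restrict hΩ
  have hm := fun {a : E n → ℝ} => integrableOn_mul_of_isSobolev (a := a) hΩ hp1 hp hζ
  have i0 := integrable_pFlux hp1 H.memLp_grad (MemLp.gradVec fun j => (hζ.2 j).1)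
  have i1 : IntegrableOn (fun x => z.dt t x * ζ x
      + inner ℝ (pFlux p (z.grad t x)) (gradVec fun j => D j x)
      + energyDensity_z C h (u.eps t x) (z.val t x) * ζ x
      + derivWithin f (Icc 0 1) (z.val t x) * ζ x) Ω :=
    (((hm H.dt).add i0).add (hm H.energy)).add (hm H.potential)
  rw [← integral_add i1 (hm H.xi)]
  refine (integral_add (i1.add (hm H.xi)) (hm H.phi)).symm.trans ?_
  refine integral_congr_ae (.of_forall fun x => ?_)
  simp only [damageSource, Pi.add_apply]
  ring

end DamageRegularAt

/-- The null set of times in the damage equation can be chosen independently of the test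
function. -/
theorem ae_forall_damage (hΩ : IsLipschitzDomain Ω) (hp1 : 1 < p) (hp : (n : ℝ) < p)
    {u : Displacement Ω T} {z : DamageVar Ω T p}
    (hreg : ∀ᵐ t ∂(volume.restrict (Ioo 0 T)), DamageRegularAt C h f u z ξ φ t)
    (hD : ∀ (ζ : E n → ℝ) (Dζ : Fin n → E n → ℝ), IsSobolev Ω (ENNReal.ofReal p) ζ Dζ →
      ∀ᵐ t ∂(volume.restrict (Ioo 0 T)),
        0 = (∫ x in Ω, (z.dt t x * ζ x
              + inner ℝ (pFlux p (z.grad t x)) (gradVec fun j => Dζ j x)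
              + energyDensity_z C h (u.eps t x) (z.val t x) * ζ x
              + derivWithin f (Icc 0 1) (z.val t x) * ζ x))
            + (∫ x in Ω, ξ t x * ζ x) + ∫ x in Ω, φ t x * ζ x) :
    ∀ᵐ t ∂(volume.restrict (Ioo 0 T)), ∀ s : E n → ℝ, ContDiff ℝ ∞ s →
      ∫ x in Ω, (damageSource C h f u z ξ φ t x * s x
        + inner ℝ (pFlux p (z.grad t x)) (gradVec fun j => pd s j x)) = 0 := by
  refine ae_forall_pairing_eq_zero hΩ (hreg.mono fun t H => H.source)
    (hreg.mono fun t H => H.integrableOn_flux hΩ hp1 hp) fun s hs => ?_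
  have hsob := isSobolev_of_contDiff (q := ENNReal.ofReal p) hΩ (hs.of_le (by simp) : ContDiff ℝ 1 s)
  filter_upwards [hreg, hD _ _ hsob] with t H h1
  rw [← H.pairing_eq hΩ hp1 hp hsob]
  exact h1.symm

end DamagePairing

/-! ### The energy relation satisfied by both kinds of solutions. -/

section EnergyRelation

variable {Ω ΓD : Set (E n)} {T p : ℝ} {C : Tensor4 n} {h f : ℝ → ℝ} {ξ φ : ℝ → E n → ℝ}
  {ℓ : ℝ → E n → E n}

/-- The momentum balance and the damage equation, tested with the velocity relative to the boundary
datum and with the damage rate, give the energy balance up to the power of `φ`. -/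
theorem energy_relation (hΩ : IsLipschitzDomain Ω) (hT : 0 < T) (hp1 : 1 < p) (hp : (n : ℝ) < p)
    (hC : IsStiffness C) (hh : ContDiffOn ℝ 1 h (Icc 0 1)) (hf : ContDiffOn ℝ 1 f (Icc 0 1))
    (hℓ : MemLpT Ω T 2 ℓ) (u : Displacement Ω T) (b : DirichletDatum Ω T) {z : DamageVar Ω T p}
    (hz : ∀ t ∈ Ico 0 T, ∀ᵐ x ∂(volume.restrict Ω), z.val t x ∈ Icc (0 : ℝ) 1)
    (hreg : ∀ᵐ t ∂(volume.restrict (Ioo 0 T)), DamageRegularAt C h f u z ξ φ t)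
    (hD : ∀ᵐ t ∂(volume.restrict (Ioo 0 T)), VanishesOn Ω ΓD (fun x => u.val t x - b.val t x))
    (hF : ∀ᵐ t ∂(volume.restrict (Ioo 0 T)), ∀ (ζ : E n → E n) (Dζ : Fin n → E n → E n),
      IsSobolev Ω 2 ζ Dζ → VanishesOn Ω ΓD ζ →
        (∫ x in Ω, inner ℝ (u.dtt t x) (ζ x))
          + (∫ x in Ω, ddot (stress C h u z t x) (strain fun j => Dζ j x))
          = ∫ x in Ω, inner ℝ (ℓ t x) (ζ x))
    (hdam : ∀ᵐ t ∂(volume.restrict (Ioo 0 T)), ∀ (ζ : E n → ℝ) (Dζ : Fin n → E n → ℝ),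
      IsSobolev Ω (ENNReal.ofReal p) ζ Dζ →
        ∫ x in Ω, (damageSource C h f u z ξ φ t x * ζ x
          + inner ℝ (pFlux p (z.grad t x)) (gradVec fun j => Dζ j x)) = 0)
    (hξz : ∀ᵐ y ∂(cyl Ω T), ξ y.1 y.2 * z.dt y.1 y.2 = 0) :
    (∀ᵐ t ∂(volume.restrict (Ioo 0 T)), IntegrableOn (fun x => |z.dt t x| ^ 2) Ω ∧
      IntegrableOn (fun x => φ t x * z.dt t x) Ω) ∧
    IntegrableOn (fun t => ∫ x in Ω, (|z.dt t x| ^ 2 + φ t x * z.dt t x)) (Ioo 0 T) ∧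
    ∀ t ∈ Ico 0 T, freeEnergy C h f u z t + kineticEnergy u t
        + (∫ s in (0 : ℝ)..t, ∫ x in Ω, (|z.dt s x| ^ 2 + φ s x * z.dt s x))
      = freeEnergy C h f u z 0 + kineticEnergy u 0 + externalWork C h ℓ b u z t := by
  obtain ⟨iG, hG⟩ := gradient_energy_identity hΩ hT hp1 z
  obtain ⟨iW, iP, hE⟩ := elastic_energy_identity hΩ hT hp1 hp hC hh hf u hz
  have iS := integrable_stress (C := C) hh u hz u.memLp_dtdx
  have iSb := integrable_stress (C := C) hh u hz b.memLp_dtdx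
  have ik := integrable_inner_cyl u.second_time.2.1 u.memLp_dt
  have ikb := integrable_inner_cyl u.second_time.2.1 b.memLp_dt
  have ie : Integrable (fun y : ℝ × E n => inner ℝ (ℓ y.1 y.2) (u.dt y.1 y.2 - b.dt y.1 y.2))
    (cyl Ω T) := MemLp.integrable_inner_two hℓ (u.memLp_dt.sub b.memLp_dt)
  have iE : Integrable (fun y : ℝ × E n => energyDensity_z C h (u.eps y.1 y.2) (z.val y.1 y.2)
      * z.dt y.1 y.2 + derivWithin f (Icc 0 1) (z.val y.1 y.2) * z.dt y.1 y.2
      + ddot (stress C h u z y.1 y.2) (u.epsDt y.1 y.2)) (cyl Ω T) := (iW.add iP).add iS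
  have mul_dt : ∀ᵐ t ∂(volume.restrict (Ioo 0 T)), ∀ a : E n → ℝ, IntegrableOn a Ω →
      IntegrableOn (fun x => a x * z.dt t x) Ω := by
    filter_upwards [z.sobolev_dt] with t ht a ha
    exact integrableOn_mul_of_isSobolev hΩ hp1 hp ht ha
  -- At almost every time the rate is bounded, so its square is integrable in space even if `p < 2`.
  -- Integrability in time of the sum with the power of `φ` is read off from the rate identity that
  -- follows.
  have hsec : ∀ᵐ t ∂(volume.restrict (Ioo 0 T)), IntegrableOn (fun x => |z.dt t x| ^ 2) Ω ∧
      IntegrableOn (fun x => φ t x * z.dt t x) Ω := by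
    filter_upwards [mul_dt, hreg] with t h1 h2
    refine ⟨(h1 _ h2.dt).congr (.of_forall fun x => ?_), h1 _ h2.phi⟩
    change z.dt t x * z.dt t x = |z.dt t x| ^ 2
    rw [sq_abs, sq]
  -- The two tested equations are added at a fixed time; the power of `ξ` is zero by `hξz`.
  have hrate : ∀ᵐ t ∂(volume.restrict (Ioo 0 T)),
      ∫ x in Ω, (|z.dt t x| ^ 2 + φ t x * z.dt t x)
      = -(∫ x in Ω, inner ℝ (pFlux p (z.grad t x)) (gradVec fun j => z.dtdx j t x))
        - (∫ x in Ω, (energyDensity_z C h (u.eps t x) (z.val t x) * z.dt t x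
            + derivWithin f (Icc 0 1) (z.val t x) * z.dt t x
            + ddot (stress C h u z t x) (u.epsDt t x)))
        - (∫ x in Ω, inner ℝ (u.dtt t x) (u.dt t x)) + (∫ x in Ω, inner ℝ (u.dtt t x) (b.dt t x))
        + (∫ x in Ω, ddot (stress C h u z t x) (b.epsDt t x))
        + ∫ x in Ω, inner ℝ (ℓ t x) (u.dt t x - b.dt t x) := by
    filter_upwards [ae_force_velocity hΩ hT hC hh hℓ u b hz hD hF, hdam, z.sobolev_dt, hsec, mul_dt,
      hreg, iG.prod_right_ae, iW.prod_right_ae, iP.prod_right_ae, iS.prod_right_ae, iE.prod_right_ae,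
      Measure.ae_ae_of_ae_prod hξz] with t h1 h2 h3 h4 h5 h6 j1 j2 j3 j4 j5 h7
    have e1 := h2 _ _ h3
    have e2 : ∫ x in Ω, (damageSource C h f u z ξ φ t x * z.dt t x
          + inner ℝ (pFlux p (z.grad t x)) (gradVec fun j => z.dtdx j t x))
        = ((∫ x in Ω, (|z.dt t x| ^ 2 + φ t x * z.dt t x))
          + ((∫ x in Ω, (energyDensity_z C h (u.eps t x) (z.val t x) * z.dt t x
            + derivWithin f (Icc 0 1) (z.val t x) * z.dt t x
            + ddot (stress C h u z t x) (u.epsDt t x)))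
            - ∫ x in Ω, ddot (stress C h u z t x) (u.epsDt t x)))
          + ∫ x in Ω, inner ℝ (pFlux p (z.grad t x)) (gradVec fun j => z.dtdx j t x) := by
      have k1 := integral_sub j5 j4
      have k2 := integral_add (h4.1.add h4.2) (j5.sub j4)
      have k3 := integral_add ((h4.1.add h4.2).add (j5.sub j4)) j1
      simp only [Pi.add_apply, Pi.sub_apply] at k1 k2 k3
      refine Eq.trans (integral_congr_ae ?_) (k3.trans ?_)
      · filter_upwards [h7] with x hx
        have hx' : ξ t x * z.dt t x = 0 := hx
        simp only [damageSource, sq_abs, Curve.epsDt]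
        linear_combination hx'
      · rw [k2]
        congr 2
    rw [e2] at e1
    linarith
  have qG := iG.integral_prod_left
  have qE := iE.integral_prod_left
  have qk := ik.integral_prod_left
  have qkb := ikb.integral_prod_left
  have qSb := iSb.integral_prod_left
  have qe := ie.integral_prod_left
  have q := ((((qG.neg.sub qE).sub qk).add qkb).add qSb).add qe
  refine ⟨hsec, q.congr (hrate.mono fun t ht => ht.symm), fun t ht => ?_⟩
  have htI : t ∈ Icc 0 T := Ico_subset_Icc_self ht
  have hmono : Ioo 0 t ⊆ Ioo 0 T := Ioo_subset_Ioo_right htI.2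
  have hint : (∫ s in (0 : ℝ)..t, ∫ x in Ω, (|z.dt s x| ^ 2 + φ s x * z.dt s x))
      = -(∫ s in (0 : ℝ)..t, ∫ x in Ω,
            inner ℝ (pFlux p (z.grad s x)) (gradVec fun j => z.dtdx j s x))
        - (∫ s in (0 : ℝ)..t, ∫ x in Ω, (energyDensity_z C h (u.eps s x) (z.val s x) * z.dt s x
            + derivWithin f (Icc 0 1) (z.val s x) * z.dt s x
            + ddot (stress C h u z s x) (u.epsDt s x)))
        - (∫ s in (0 : ℝ)..t, ∫ x in Ω, inner ℝ (u.dtt s x) (u.dt s x))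
        + (∫ s in (0 : ℝ)..t, ∫ x in Ω, inner ℝ (u.dtt s x) (b.dt s x))
        + (∫ s in (0 : ℝ)..t, ∫ x in Ω, ddot (stress C h u z s x) (b.epsDt s x))
        + ∫ s in (0 : ℝ)..t, ∫ x in Ω, inner ℝ (ℓ s x) (u.dt s x - b.dt s x) := by
    simp only [integral_zero_eq_setIntegral_Ioo ht.1]
    rw [integral_congr_ae (ae_mono (Measure.restrict_mono hmono le_rfl) hrate)]
    have m : ∀ {k : ℝ → ℝ}, IntegrableOn k (Ioo 0 T) → IntegrableOn k (Ioo 0 t) :=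
      fun hk => hk.mono_set hmono
    have s1 := (m qG).neg
    have s2 := s1.sub (m qE)
    have s3 := s2.sub (m qk)
    have s4 := s3.add (m qkb)
    have s5 := s4.add (m qSb)
    refine (integral_add s5 (m qe)).trans (congrArg₂ (· + ·) ?_ rfl)
    refine (integral_add s4 (m qSb)).trans (congrArg₂ (· + ·) ?_ rfl)
    refine (integral_add s3 (m qkb)).trans (congrArg₂ (· + ·) ?_ rfl)
    refine (integral_sub s2 (m qk)).trans (congrArg₂ (· - ·) ?_ rfl)
    refine (integral_sub s1 (m qE)).trans (congrArg₂ (· - ·) ?_ rfl)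
    exact integral_neg _
  have hsplit : ∀ t ∈ Ico 0 T, freeEnergy C h f u z t = (∫ x in Ω, 1 / p * ‖z.grad t x‖ ^ p)
      + ∫ x in Ω, (energyDensity C h (u.eps t x) (z.val t x) + f (z.val t x)) := fun t ht => by
    rw [← integral_add (hG t (Ico_subset_Icc_self ht)).1 (hE t ht).1, freeEnergy]
    exact integral_congr_ae (.of_forall fun x => add_assoc _ _ _)
  -- Integration by parts in time turns the pairing of `∂_tt u` with `∂_t b` into the end point
  -- terms and the pairing with `∂_tt b` in `externalWork`.
  have hprod := inner_product_rule hΩ hT u.second_time b.second_time u.memLp_dt b.memLp_dt htI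
  rw [hsplit t ht, hsplit 0 ⟨le_rfl, hT⟩, hint, (hG t htI).2, (hE t ht).2,
    kinetic_energy_identity hΩ hT u htI, externalWork, hprod]
  ring

end EnergyRelation

/-! ### Spatial regularity of the stress. -/

section StressRegularity

variable {Ω : Set (E n)} {T p : ℝ} {C : Tensor4 n} {h : ℝ → ℝ} {q : ℝ≥0∞}

theorem IsSobolev.congr {F : Type*} [NormedAddCommGroup F] [NormedSpace ℝ F] {w w' : E n → F}
    {D : Fin n → E n → F} (h : IsSobolev Ω q w D) (hw : w =ᵐ[volume.restrict Ω] w') :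
    IsSobolev Ω q w' D :=
  ⟨h.1.ae_eq hw, fun i => ⟨(h.2 i).1, (h.2 i).2.congr hw (ae_eq_refl _)⟩⟩

theorem MemW1.const_mul {w : E n → ℝ} (h : MemW1 Ω q w) (c : ℝ) : MemW1 Ω q fun x => c * w x := by
  obtain ⟨D, hD⟩ := h
  exact ⟨_, hD.clm_comp (c • ContinuousLinearMap.id ℝ ℝ)⟩

theorem MemW1.add {w v : E n → ℝ} (h : MemW1 Ω q w) (h' : MemW1 Ω q v) :
    MemW1 Ω q fun x => w x + v x := by
  obtain ⟨D, hD⟩ := h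
  obtain ⟨D', hD'⟩ := h'
  exact ⟨_, hD.add hD'⟩

theorem memW1_of_contDiff (hΩ : IsLipschitzDomain Ω) {s : E n → ℝ} (hs : ContDiff ℝ 1 s) :
    MemW1 Ω q s := ⟨_, isSobolev_of_contDiff hΩ hs⟩

theorem MemW1.sum (hΩ : IsLipschitzDomain Ω) {ι : Type*} {s : Finset ι} {w : ι → E n → ℝ}
    (h : ∀ i, MemW1 Ω q (w i)) : MemW1 Ω q fun x => ∑ i ∈ s, w i x := by
  classical
  induction s using Finset.induction_on with
  | empty => simpa using memW1_of_contDiff hΩ (contDiff_const (c := (0 : ℝ)))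
  | insert a s ha ih =>
    simp only [Finset.sum_insert ha]
    exact (h a).add ih

theorem memW1_app_strain (hΩ : IsLipschitzDomain Ω) {D : Fin n → E n → E n}
    (hD : ∀ k, MemW1 Ω q (D k)) (i j : Fin n) :
    MemW1 Ω q fun x => C.app (strain fun k => D k x) i j := by
  have h1 : ∀ k l, MemW1 Ω q fun x => D k x l := fun k l => by
    obtain ⟨D', hD'⟩ := hD k
    exact ⟨_, hD'.clm_comp (EuclideanSpace.proj l : E n →L[ℝ] ℝ)⟩
  simp only [Tensor4.app, strain, Matrix.of_apply]
  refine MemW1.sum hΩ fun l => MemW1.sum hΩ fun k => MemW1.const_mul ?_ _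
  simp only [div_eq_inv_mul]
  exact ((h1 k l).add (h1 l k)).const_mul _

/-- At almost every time the stress is in `H¹(Ω)`. -/
theorem ae_memW1_stress (hΩ : IsLipschitzDomain Ω) (hp1 : 1 < p) (hp : (n : ℝ) < p)
    (hh : ContDiffOn ℝ 1 h (Icc 0 1)) (u : Displacement Ω T) {z : DamageVar Ω T p}
    (hz : ∀ t ∈ Ico 0 T, ∀ᵐ x ∂(volume.restrict Ω), z.val t x ∈ Icc (0 : ℝ) 1) :
    ∀ᵐ t ∂(volume.restrict (Ioo 0 T)), ∀ i j, MemW1 Ω 2 fun x => stress C h u z t x i j := by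
  obtain ⟨H, hH, hHh⟩ := exists_contDiff_extension hh
  have hq0 : ENNReal.ofReal p ≠ 0 := by simp; linarith
  filter_upwards [u.ae_isSobolev_dx two_ne_zero ENNReal.ofNat_ne_top u.second_space,
    z.ae_isSobolev_dx hq0 ENNReal.ofReal_ne_top z.second_space, ae_restrict_mem measurableSet_Ioo]
    with t h1 h2 ht i j
  choose M hM using fun i => (h2 i).exists_bound hΩ hp1 hp
  have hMs : ∀ i, ∀ᵐ x ∂(volume.restrict Ω), ‖z.dx i t x‖₊ ≤ ∑ i, M i := fun i =>
    (hM i).mono fun x hx => hx.trans (Finset.single_le_sum (fun _ _ => zero_le) (Finset.mem_univ i))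
  -- At almost every time `∇z` is in `W^{1,p}`, hence bounded. So `h(z)` is bounded with bounded
  -- derivatives and may multiply a function in `H¹`.
  obtain ⟨M', hb, hb', hsob⟩ := (z.sobolev_val t (Ioo_subset_Icc_self ht)).comp_contDiff hΩ hp1 hp
    hMs hH
  obtain ⟨D, hD⟩ := memW1_app_strain (C := C) hΩ (fun k => ⟨_, h1 k⟩) i j
  refine ⟨_, (hD.mul_bounded hΩ hsob hb hb').congr ?_⟩
  filter_upwards [hz t (Ioo_subset_Ico_self ht)] with x hx
  rw [stress_apply, (hHh _ hx).1]

end StressRegularity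

/-! ### Green's formula for the stress. -/

section StressBoundary

variable {Ω ΓD ΓN : Set (E n)} {μ : Measure (E n)} {N : E n → E n}

/-- The interface is a null set, so conditions on the Dirichlet and the Neumann part decide boundary
integrals. -/
theorem IsBoundarySplit.ae_frontier (hΓ : IsBoundarySplit Ω ΓD ΓN) {P : E n → Prop}
    (hD : ∀ᵐ x ∂(surf ΓD), P x) (hN : ∀ᵐ x ∂(surf ΓN), P x) :
    ∀ᵐ x ∂(surf (frontier Ω)), P x := by
  have h0 : surf (frontier Ω \ (ΓD ∪ ΓN)) = 0 := Measure.measure_univ_eq_zero.1 hΓ.interface_null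
  have h1 : ∀ᵐ x ∂(surf (frontier Ω \ (ΓD ∪ ΓN))), P x := by rw [h0]; simp
  have h2 : ∀ᵐ x ∂(surf ((ΓD ∪ ΓN) ∪ (frontier Ω \ (ΓD ∪ ΓN)))), P x :=
    ae_restrict_union_iff _ _ P |>.2 ⟨ae_restrict_union_iff _ _ P |>.2 ⟨hD, hN⟩, h1⟩
  exact ae_mono (Measure.restrict_mono (by
    rw [union_sdiff_self]; exact subset_union_right) le_rfl) h2

theorem isWeakDiv_gradVec {V D : Fin n → E n → ℝ} (h : ∀ j, IsWeakPartial Ω j (V j) (D j)) :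
    IsWeakDiv Ω (fun x => gradVec fun j => V j x) (fun x => ∑ j, D j x) := by
  have hg : (fun x => gradVec fun j => V j x) = fun x => ∑ j, V j x • unitVec j := by
    funext x
    conv_lhs => rw [← (EuclideanSpace.basisFun (Fin n) ℝ).sum_repr (gradVec fun j => V j x)]
    simp [gradVec, unitVec]
  have hsum : ∀ {G : Type _} [NormedAddCommGroup G] {a : Fin n → E n → G},
      (∀ j, LocallyIntegrableOn (a j) Ω) → LocallyIntegrableOn (fun x => ∑ j, a j x) Ω := by
    intro G _ a ha
    have : ∀ s : Finset (Fin n), LocallyIntegrableOn (fun x => ∑ j ∈ s, a j x) Ω := by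
      intro s
      induction s using Finset.induction_on with
      | empty => simpa using (locallyIntegrable_zero (μ := volume)).locallyIntegrableOn Ω
      | insert i s hi ih =>
        simp only [Finset.sum_insert hi]
        exact (ha i).add ih
    exact this Finset.univ
  have hdiv := fun j => (h j).isWeakDiv
  refine ⟨?_, hsum fun j => (h j).2.1, fun φ hφ => ?_⟩
  · rw [hg]
    exact hsum fun j => (hdiv j).1
  · have e1 : ∀ x, fderiv ℝ φ x (gradVec fun j => V j x) = ∑ j, fderiv ℝ φ x (V j x • unitVec j) :=
      fun x => by rw [congrFun hg x, map_sum]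
    simp only [e1, Finset.mul_sum]
    rw [integral_finsetSum _ fun j _ => ?_, integral_finsetSum _ fun j _ => ?_,
      ← Finset.sum_neg_distrib]
    · exact Finset.sum_congr rfl fun j _ => (hdiv j).2.2 φ hφ
    · exact hφ.integrableOn_smul (h j).2.1
    · have := (hφ.fderiv (unitVec j)).integrableOn_smul (h j).1
      refine this.congr (.of_forall fun x => ?_)
      simp [mul_comm]

/-- Integration by parts for a matrix field with traces. -/
theorem BoundaryMeasure.integral_stress (hΩ : IsLipschitzDomain Ω)
    (hμ : BoundaryMeasure Ω univ μ N) {σ : E n → Matrix (Fin n) (Fin n) ℝ}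
    {g : Fin n → Fin n → E n → ℝ} {d : E n → E n}
    (hg : ∀ i j, HasTrace Ω 2 (fun x => σ x i j) (g i j))
    (hd : ∀ i, IsWeakDiv Ω (fun x => gradVec (σ x i)) (fun x => d x i))
    {ζ γ : E n → E n} {D : Fin n → E n → E n} (hζ : IsSobolev Ω 2 ζ D) (hγ : HasTrace Ω 2 ζ γ) :
    MemLp d 2 (volume.restrict Ω) ∧
    ∫ x in Ω, (inner ℝ (d x) (ζ x) + ∑ i, ∑ j, σ x i j * D j x i)
      = ∫ x, ∑ i, γ x i * ∑ j, g i j x * N x j ∂μ ∧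
    ∀ i, Integrable (fun x => ∑ j, g i j x * N x j) μ := by
  have hμfin := hμ.finite
  choose Dσ hσ using fun i j => (hg i j).2
  -- By uniqueness the given divergence is the sum of the partial derivatives of the components,
  -- hence square integrable.
  have hdiv : ∀ i, (fun x => d x i) =ᵐ[volume.restrict Ω] fun x => ∑ j, Dσ i j j x := fun i =>
    (hd i).ae_unique hΩ.isOpen (isWeakDiv_gradVec fun j => ((hσ i j).1.2 j).2) (ae_eq_refl _)
  have hd2 : ∀ i, MemLp (fun x => d x i) 2 (volume.restrict Ω) := fun i =>
    (memLp_finsetSum _ fun j _ => ((hσ i j).1.2 j).1).ae_eq (hdiv i).symm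
  have hgμ : ∀ i j, MemLp (g i j) 2 μ := fun i j => hμ.memLp_of_surf (hg i j).1
  have hγ' : ∀ i, HasTrace Ω 2 (fun x => ζ x i) (fun x => γ x i) := fun i =>
    hγ.clm_comp (EuclideanSpace.proj i : E n →L[ℝ] ℝ)
  have hζ' : ∀ i, IsSobolev Ω 2 (fun x => ζ x i) (fun j x => D j x i) := fun i =>
    hζ.clm_comp (EuclideanSpace.proj i : E n →L[ℝ] ℝ)
  have hNm : ∀ j, AEStronglyMeasurable (fun x => N x j) μ := fun j =>
    (EuclideanSpace.proj (𝕜 := ℝ) j).continuous.comp_aestronglyMeasurable hμ.measurable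
  have hN1 : ∀ j, ∀ᵐ x ∂μ, ‖N x j‖ ≤ 1 := fun j => by
    filter_upwards [hμ.normal] with x hx
    exact (PiLp.norm_apply_le (N x) j).trans hx.1.le
  have hgN : ∀ i j, MemLp (fun x => g i j x * N x j) 2 μ := fun i j => by
    refine (hgμ i j).of_le_mul (c := 1) ((hgμ i j).1.mul (hNm j)) ?_
    filter_upwards [hN1 j] with x hx
    rw [norm_mul, mul_comm]
    exact mul_le_mul_of_nonneg_right hx (norm_nonneg _)
  refine ⟨MemLp.of_eval_piLp hd2, ?_, fun i =>
    (memLp_finsetSum _ fun j _ => hgN i j).integrable (by norm_num)⟩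
  have hparts : ∀ i j, ∫ x in Ω, (Dσ i j j x * ζ x i + σ x i j * D j x i)
      = ∫ x, γ x i * (g i j x * N x j) ∂μ := fun i j => by
    rw [hμ.integral_by_parts hΩ (hg i j) (hγ' i) j ((hσ i j).1.2 j).2 ((hζ' i).2 j).2]
    exact integral_congr_ae (.of_forall fun x => by simp only; ring)
  have i1 : ∀ i j, IntegrableOn (fun x => Dσ i j j x * ζ x i + σ x i j * D j x i) Ω := fun i j =>
    (((hσ i j).1.2 j).1.integrable_mul (hζ' i).1).add ((hσ i j).1.1.integrable_mul ((hζ' i).2 j).1)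
  have i2 : ∀ i j, Integrable (fun x => γ x i * (g i j x * N x j)) μ := fun i j =>
    (hμ.memLp_of_surf (hγ' i).1).integrable_mul (hgN i j)
  have e1 : ∫ x in Ω, (inner ℝ (d x) (ζ x) + ∑ i, ∑ j, σ x i j * D j x i)
      = ∫ x in Ω, ∑ i, ∑ j, (Dσ i j j x * ζ x i + σ x i j * D j x i) := by
    refine integral_congr_ae ?_
    filter_upwards [ae_all_iff.2 hdiv] with x hx
    simp only [PiLp.inner_apply, hx, Finset.sum_add_distrib]
    congr 1
    refine Finset.sum_congr rfl fun i _ => ?_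
    simp [Finset.mul_sum, mul_comm]
  simp only [e1, Finset.mul_sum]
  rw [integral_finsetSum _ fun i _ => integrable_finsetSum _ fun j _ => i1 i j,
    integral_finsetSum _ fun i _ => integrable_finsetSum _ fun j _ => i2 i j]
  refine Finset.sum_congr rfl fun i _ => ?_
  rw [integral_finsetSum _ fun j _ => i1 i j, integral_finsetSum _ fun j _ => i2 i j]
  exact Finset.sum_congr rfl fun j _ => hparts i j

end StressBoundary

/-! ### The momentum balance at a fixed time. -/

section MomentumSlice

variable {Ω ΓD ΓN : Set (E n)} {σ : E n → Matrix (Fin n) (Fin n) ℝ} {a l : E n → E n}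

theorem integrableOn_ddot (hsym : ∀ x i j, σ x i j = σ x j i)
    (hσ : ∀ i j, MemLp (fun x => σ x i j) 2 (volume.restrict Ω)) {D : Fin n → E n → E n}
    (hD : ∀ j, MemLp (D j) 2 (volume.restrict Ω)) :
    IntegrableOn (fun x => ddot (σ x) (strain fun j => D j x)) Ω := by
  simp only [fun x => ddot_strain (hsym x)]
  exact integrable_finsetSum _ fun i _ => integrable_finsetSum _ fun j _ =>
    (hσ i j).integrable_mul ((EuclideanSpace.proj i : E n →L[ℝ] ℝ).comp_memLp' (hD j))

/-- In Green's formula the boundary integrand vanishes on `ΓD` by the trace of `ζ`, on `ΓN` by the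
traction condition, and the interface is null. -/
theorem momentum_weak_of_strong (hΩ : IsLipschitzDomain Ω) (hΓ : IsBoundarySplit Ω ΓD ΓN)
    (hsym : ∀ x i j, σ x i j = σ x j i) {d : E n → E n}
    (hd : ∀ i, IsWeakDiv Ω (fun x => gradVec (σ x i)) (fun x => d x i))
    (heq : ∀ᵐ x ∂(volume.restrict Ω), a x - d x = l x)
    (hl : MemLp l 2 (volume.restrict Ω)) {g : Fin n → Fin n → E n → ℝ}
    (hg : ∀ i j, HasTrace Ω 2 (fun x => σ x i j) (g i j))
    (hN : ∀ᵐ x ∂(surf ΓN), ∃ ν, IsOuterNormal Ω x ν ∧ ∀ i, ∑ j, g i j x * ν j = 0)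
    {ζ : E n → E n} {D : Fin n → E n → E n} (hζ : IsSobolev Ω 2 ζ D) (hv : VanishesOn Ω ΓD ζ) :
    (∫ x in Ω, inner ℝ (a x) (ζ x)) + (∫ x in Ω, ddot (σ x) (strain fun j => D j x))
      = ∫ x in Ω, inner ℝ (l x) (ζ x) := by
  obtain ⟨μ, hμ, -⟩ := exists_boundaryMeasure hΩ
  obtain ⟨γ, hγ, hγ0⟩ := hv
  obtain ⟨hd2, hparts, -⟩ := hμ.integral_stress hΩ hg hd hζ hγ
  have hb : ∀ᵐ x ∂(surf (frontier Ω)), ∑ i, γ x i * ∑ j, g i j x * outerNormal Ω x j = 0 := by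
    refine hΓ.ae_frontier ?_ ?_
    · filter_upwards [hγ0] with x hx
      simp [hx]
    · filter_upwards [hN] with x ⟨ν, h1, h2⟩
      simp [h1.eq, h2]
  rw [integral_congr_ae (g := fun _ => (0 : ℝ)) (hμ.ae_of_surf hb), integral_zero] at hparts
  have i1 := MemLp.integrable_inner_two hd2 hζ.1
  have i2 := integrableOn_ddot hsym (fun i j => (hg i j).2.choose_spec.1.1) fun j => (hζ.2 j).1
  have i3 := MemLp.integrable_inner_two hl hζ.1
  have e1 : ∫ x in Ω, inner ℝ (a x) (ζ x)
      = (∫ x in Ω, inner ℝ (d x) (ζ x)) + ∫ x in Ω, inner ℝ (l x) (ζ x) := by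
    rw [← integral_add i1 i3]
    refine integral_congr_ae (heq.mono fun x hx => ?_)
    simp only [← hx, inner_sub_left]
    ring
  simp only [← fun x => ddot_strain (hsym x)] at hparts
  rw [integral_add i1 i2] at hparts
  rw [e1]
  linarith

theorem vanishesOn_of_contDiff (hΩ : IsLipschitzDomain Ω) (hDm : MeasurableSet ΓD) {s : E n → E n}
    (hs : ContDiff ℝ ∞ s) (h0 : ∀ x ∈ ΓD, s x = 0) : VanishesOn Ω ΓD s :=
  ⟨s, hasTrace_of_contDiff hΩ hs, ae_restrict_of_forall_mem hDm h0⟩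

theorem IsBoundarySplit.measurableSet_D (hΓ : IsBoundarySplit Ω ΓD ΓN) : MeasurableSet ΓD := by
  obtain ⟨U, hU, rfl⟩ := hΓ.relOpen_D
  exact hU.measurableSet.inter isClosed_frontier.measurableSet

theorem inner_smul_unitVec (b : E n) (i : Fin n) (c : ℝ) : inner ℝ b (c • unitVec i) = b i * c := by
  rw [real_inner_smul_right, unitVec, EuclideanSpace.inner_single_right]
  simp [mul_comm]

theorem ddot_strain_pd_smul (hsym : ∀ x i j, σ x i j = σ x j i) {s : E n → ℝ} (hs : ContDiff ℝ 1 s)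
    (i : Fin n) (x : E n) :
    ddot (σ x) (strain fun j => pd (fun y => s y • unitVec i) j x) = ∑ j, σ x i j * pd s j x := by
  have hpd : ∀ j k, pd (fun y => s y • (unitVec i : E n)) j x k = if k = i then pd s j x else 0 := by
    intro j k
    have : pd (fun y => s y • (unitVec i : E n)) j x = pd s j x • unitVec i := by
      unfold pd
      rw [fderiv_smul_const (hs.differentiable one_ne_zero x)]
      rfl
    rw [this]
    simp [unitVec, PiLp.single_apply]
  rw [ddot_strain (hsym x)]
  simp only [hpd, mul_ite, mul_zero]
  rw [Finset.sum_eq_single i]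
  · simp
  · intro k _ hk
    simp [hk]
  · simp

/-- Test fields with support in `Ω` identify the divergence. As the stress is in `H¹` it has traces,
and Green's formula for smooth fields that vanish on `ΓD` leaves only the traction, tested with
enough functions to make it vanish on `ΓN`. -/
theorem momentum_strong_of_weak (hΩ : IsLipschitzDomain Ω) (hΓ : IsBoundarySplit Ω ΓD ΓN)
    (hsym : ∀ x i j, σ x i j = σ x j i) (hσ : ∀ i j, MemW1 Ω 2 fun x => σ x i j)
    (ha : MemLp a 2 (volume.restrict Ω)) (hl : MemLp l 2 (volume.restrict Ω))
    (hw : ∀ (ζ : E n → E n) (D : Fin n → E n → E n), IsSobolev Ω 2 ζ D → VanishesOn Ω ΓD ζ →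
      (∫ x in Ω, inner ℝ (a x) (ζ x)) + (∫ x in Ω, ddot (σ x) (strain fun j => D j x))
        = ∫ x in Ω, inner ℝ (l x) (ζ x)) :
    (∃ d : E n → E n, (∀ i, IsWeakDiv Ω (fun x => gradVec (σ x i)) (fun x => d x i)) ∧
      ∀ᵐ x ∂(volume.restrict Ω), a x - d x = l x) ∧
    ∃ g : Fin n → Fin n → E n → ℝ, (∀ i j, HasTrace Ω 2 (fun x => σ x i j) (g i j)) ∧
      ∀ᵐ x ∂(surf ΓN), ∃ ν, IsOuterNormal Ω x ν ∧ ∀ i, ∑ j, g i j x * ν j = 0 := by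
  have hfin := isFiniteMeasure_restrict hΩ
  have hDsub : ΓD ⊆ frontier Ω := by
    obtain ⟨U, -, rfl⟩ := hΓ.relOpen_D
    exact inter_subset_right
  have hσ2 : ∀ i j, MemLp (fun x => σ x i j) 2 (volume.restrict Ω) := fun i j =>
    (hσ i j).choose_spec.1
  have hd2 : MemLp (fun x => a x - l x) 2 (volume.restrict Ω) := ha.sub hl
  have key : ∀ i, ∀ s : E n → ℝ, ContDiff ℝ ∞ s → (∀ x ∈ ΓD, s x = 0) →
      (∫ x in Ω, (a x - l x) i * s x) + ∫ x in Ω, ∑ j, σ x i j * pd s j x = 0 := by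
    intro i s hs h0
    have hs' : ContDiff ℝ ∞ fun y => s y • (unitVec i : E n) := hs.smul contDiff_const
    have hsob := isSobolev_of_contDiff (q := 2) hΩ (hs'.of_le (by simp) : ContDiff ℝ 1 _)
    have h1 := hw _ _ hsob (vanishesOn_of_contDiff hΩ hΓ.measurableSet_D hs'
      fun x hx => by simp [h0 x hx])
    simp only [ddot_strain_pd_smul hsym (hs.of_le (by simp) : ContDiff ℝ 1 s)] at h1
    have e : ∀ (b : E n) x, inner ℝ b (s x • (unitVec i : E n)) = b i * s x := fun b x =>
      inner_smul_unitVec b i (s x)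
    have i1 := MemLp.integrable_inner_two ha hsob.1
    have i2 := MemLp.integrable_inner_two hl hsob.1
    simp only [e] at h1 i1 i2
    have h2 := integral_sub i1 i2
    simp only [← sub_mul] at h2
    change (∫ x in Ω, (a x i - l x i) * s x) + _ = 0
    linarith
  have hdiv : ∀ i, IsWeakDiv Ω (fun x => gradVec (σ x i)) (fun x => (a x - l x) i) := fun i => by
    refine ⟨?_, ?_, fun φ hφ => ?_⟩
    · have : MemLp (fun x => gradVec (σ x i)) 2 (volume.restrict Ω) := MemLp.gradVec (hσ2 i)
      exact IntegrableOn.locallyIntegrableOn (this.integrable (by norm_num))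
    · exact IntegrableOn.locallyIntegrableOn
        (((EuclideanSpace.proj i : E n →L[ℝ] ℝ).comp_memLp' hd2).integrable (by norm_num))
    · have h1 := key i φ hφ.1 fun x hx => image_eq_zero_of_notMem_tsupport fun hx' =>
        (hDsub hx).2 (by rw [hΩ.isOpen.interior_eq]; exact hφ.2.2 hx')
      have e1 : ∀ x, fderiv ℝ φ x (gradVec (σ x i)) = ∑ j, σ x i j * pd φ j x := fun x => by
        conv_lhs => rw [← (EuclideanSpace.basisFun (Fin n) ℝ).sum_repr (gradVec (σ x i))]
        simp [gradVec, unitVec, pd]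
      simp only [e1]
      rw [eq_neg_iff_add_eq_zero, add_comm, ← h1]
      congr 1
      exact integral_congr_ae (.of_forall fun x => mul_comm _ _)
  refine ⟨⟨fun x => a x - l x, hdiv, .of_forall fun x => sub_sub_cancel _ _⟩, ?_⟩
  obtain ⟨μ, hμ, -⟩ := exists_boundaryMeasure hΩ
  choose g hg using fun i j => (hσ i j).choose_spec.exists_hasTrace hΩ
  refine ⟨g, hg, ?_⟩
  obtain ⟨U, hU, hUN⟩ := hΓ.relOpen_N
  -- Here `ΓN` is the part of the frontier in the open set `U`. Functions supported in `U` vanish on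
  -- `ΓD` by disjointness, so the fundamental lemma is applied on `U`, with respect to the boundary
  -- measure.
  have hzero : ∀ i, ∀ᵐ x ∂μ, x ∈ U → ∑ j, g i j x * outerNormal Ω x j = 0 := fun i => by
    have hint := (hμ.integral_stress hΩ hg hdiv (isSobolev_of_contDiff hΩ
      (contDiff_const (c := (0 : E n)))) (hasTrace_of_contDiff hΩ contDiff_const)).2.2 i
    refine hU.ae_eq_zero_of_integral_contDiff_smul_eq_zero
      (hint.locallyIntegrable.locallyIntegrableOn U) fun s hs hsc hsU => ?_
    have hs' : ContDiff ℝ ∞ fun y => s y • (unitVec i : E n) := hs.smul contDiff_const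
    have hs0 : ∀ x ∈ ΓD, s x = 0 := fun x hx => image_eq_zero_of_notMem_tsupport fun hx' =>
      hΓ.disjoint.notMem_of_mem_left hx (by rw [hUN]; exact ⟨hsU hx', hDsub hx⟩)
    obtain ⟨-, h1, -⟩ := hμ.integral_stress hΩ hg hdiv
      (isSobolev_of_contDiff (q := 2) hΩ (hs'.of_le (by simp) : ContDiff ℝ 1 _))
      (hasTrace_of_contDiff hΩ hs')
    simp only [← fun x => ddot_strain (hsym x),
      ddot_strain_pd_smul hsym (hs.of_le (by simp) : ContDiff ℝ 1 s)] at h1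
    have e : ∀ (b : E n) x, inner ℝ b (s x • (unitVec i : E n)) = b i * s x := fun b x =>
      inner_smul_unitVec b i (s x)
    have h2 := key i s hs hs0
    have hsob := isSobolev_of_contDiff (q := 2) hΩ (hs'.of_le (by simp) : ContDiff ℝ 1 _)
    have i1 := MemLp.integrable_inner_two hd2 hsob.1
    have i2 := integrableOn_ddot hsym hσ2 fun j => (hsob.2 j).1
    simp only [e, ddot_strain_pd_smul hsym (hs.of_le (by simp) : ContDiff ℝ 1 s)] at h1 i1 i2
    rw [integral_add i1 i2, h2] at h1
    rw [h1]
    refine integral_congr_ae (.of_forall fun x => ?_)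
    refine ((Finset.sum_eq_single i (fun k _ hk => ?_) (by simp)).trans ?_).symm
    · simp [unitVec, hk]
    · simp [unitVec]
  have hall : ∀ᵐ x ∂(surf (frontier Ω)), x ∈ U → ∃ ν, IsOuterNormal Ω x ν ∧
      ∀ i, ∑ j, g i j x * ν j = 0 := by
    refine hμ.ae_surf ?_
    filter_upwards [ae_all_iff.2 hzero, hμ.normal] with x h1 h2 hx
    exact ⟨_, h2, fun i => h1 i hx⟩
  have hsub : ΓN ⊆ frontier Ω := by rw [hUN]; exact inter_subset_right
  have hNm : MeasurableSet ΓN := by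
    rw [hUN]; exact hU.measurableSet.inter isClosed_frontier.measurableSet
  have h3 : ∀ᵐ x ∂(surf ΓN), x ∈ ΓN := ae_restrict_mem hNm
  filter_upwards [h3, (ae_mono (Measure.restrict_mono hsub le_rfl) hall : ∀ᵐ x ∂(surf ΓN), _)]
    with x hx h4
  exact h4 (by rw [hUN] at hx; exact hx.1)

end MomentumSlice

/-! ### The damage equation at a fixed time. -/

section DamageSlice

variable {Ω : Set (E n)} {T p t : ℝ} {C : Tensor4 n} {h f : ℝ → ℝ} {ξ φ : ℝ → E n → ℝ}
  {u : Displacement Ω T} {z : DamageVar Ω T p}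

theorem continuousOn_gradVec {g : Fin n → E n → ℝ} {s : Set (E n)} (hg : ∀ j, ContinuousOn (g j) s) :
    ContinuousOn (fun x => gradVec fun j => g j x) s :=
  (PiLp.continuous_toLp 2 _).comp_continuousOn (continuousOn_pi.2 hg)

/-- The flux is continuous up to the boundary with integrable divergence, so
`BoundaryMeasure.integral_flux` applies to smooth test functions. Its normal component is a multiple
of that of `∇z`, hence zero. General test functions follow by density. -/
theorem DamageRegularAt.weak_of_strong (hΩ : IsLipschitzDomain Ω) (hp1 : 1 < p) (hp : (n : ℝ) < p)
    (H : DamageRegularAt C h f u z ξ φ t) {d : E n → ℝ}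
    (hd : IsWeakDiv Ω (fun x => pFlux p (z.grad t x)) d)
    (heq : ∀ᵐ x ∂(volume.restrict Ω), z.dt t x - d x + energyDensity_z C h (u.eps t x) (z.val t x)
      + derivWithin f (Icc 0 1) (z.val t x) + ξ t x + φ t x = 0)
    {g : Fin n → E n → ℝ} (hg : ∀ j, HasTrace Ω (ENNReal.ofReal p) (z.dx j t) (g j))
    (hN : ∀ᵐ x ∂(surf (frontier Ω)), ∃ ν, IsOuterNormal Ω x ν ∧ ∑ j, g j x * ν j = 0)
    {ζ : E n → ℝ} {D : Fin n → E n → ℝ} (hζ : IsSobolev Ω (ENNReal.ofReal p) ζ D) :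
    ∫ x in Ω, (damageSource C h f u z ξ φ t x * ζ x
      + inner ℝ (pFlux p (z.grad t x)) (gradVec fun j => D j x)) = 0 := by
  obtain ⟨μ, hμ, -⟩ := exists_boundaryMeasure hΩ
  obtain ⟨M, hM⟩ := H.exists_flux_bound hΩ hp1 hp
  choose w hwc hw hgw using fun j => (hg j).exists_continuous hΩ hp1 hp
  have hde : d =ᵐ[volume.restrict Ω] damageSource C h f u z ξ φ t := by
    filter_upwards [heq] with x hx
    simp only [damageSource]
    linarith
  have hdi : IntegrableOn d Ω := H.source.congr hde.symm
  refine integral_pairing_eq_zero hΩ hp1 hp H.source (H.aestronglyMeasurable_flux hp1) hM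
    (fun s hs => ?_) hζ
  have hV : ∀ᵐ x ∂(volume.restrict Ω), pFlux p (z.grad t x) = pFlux p (gradVec fun j => w j x) := by
    filter_upwards [ae_all_iff.2 hw] with x hx
    simp only [DamageVar.grad, hx]
  have h1 := hμ.integral_flux hΩ hd hdi hV
    ((continuous_pFlux hp1).comp_continuousOn (continuousOn_gradVec hwc)) (hs.of_le (by simp))
  have h2 : ∀ᵐ x ∂(surf (frontier Ω)),
      s x * inner ℝ (outerNormal Ω x) (pFlux p (gradVec fun j => w j x)) = 0 := by
    filter_upwards [hN, ae_all_iff.2 hgw] with x ⟨ν, h3, h4⟩ h5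
    rw [h3.eq, real_inner_comm, inner_pFlux, real_inner_comm, inner_gradVec]
    have : ∑ j, ν j * w j x = 0 := by
      rw [← h4]
      exact Finset.sum_congr rfl fun j _ => by rw [h5 j, mul_comm]
    rw [this, mul_zero, mul_zero]
  rw [integral_congr_ae (g := fun _ => (0 : ℝ)) (hμ.ae_of_surf h2), integral_zero] at h1
  rw [← h1]
  refine integral_congr_ae (hde.mono fun x hx => ?_)
  simp only [hx]
  ring

/-- Interior test functions show that the divergence of the flux is the source. The Gauss-Green
formula then leaves the normal flux, which is orthogonal to all smooth functions on the boundary and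
so vanishes, and with it the normal derivative of `z`. -/
theorem DamageRegularAt.strong_of_weak (hΩ : IsLipschitzDomain Ω) (hp1 : 1 < p) (hp : (n : ℝ) < p)
    (H : DamageRegularAt C h f u z ξ φ t)
    (hw : ∀ s : E n → ℝ, ContDiff ℝ ∞ s → ∫ x in Ω, (damageSource C h f u z ξ φ t x * s x
      + inner ℝ (pFlux p (z.grad t x)) (gradVec fun j => pd s j x)) = 0) :
    (∃ d : E n → ℝ, IsWeakDiv Ω (fun x => pFlux p (z.grad t x)) d ∧
      ∀ᵐ x ∂(volume.restrict Ω), z.dt t x - d x + energyDensity_z C h (u.eps t x) (z.val t x)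
        + derivWithin f (Icc 0 1) (z.val t x) + ξ t x + φ t x = 0) ∧
    ∃ g : Fin n → E n → ℝ, (∀ j, HasTrace Ω (ENNReal.ofReal p) (z.dx j t) (g j)) ∧
      ∀ᵐ x ∂(surf (frontier Ω)), ∃ ν, IsOuterNormal Ω x ν ∧ ∑ j, g j x * ν j = 0 := by
  have hflux := H.integrableOn_flux hΩ hp1 hp
  have hdiv : IsWeakDiv Ω (fun x => pFlux p (z.grad t x)) (damageSource C h f u z ξ φ t) := by
    refine ⟨hflux.locallyIntegrableOn, H.source.locallyIntegrableOn, fun φ' hφ => ?_⟩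
    have h1 := hw φ' hφ.1
    have i1 : IntegrableOn (fun x => damageSource C h f u z ξ φ t x * φ' x) Ω :=
      integrableOn_mul_of_isSobolev hΩ hp1 hp
        (isSobolev_of_contDiff hΩ (hφ.1.of_le (by simp) : ContDiff ℝ 1 φ')) H.source
    have hfin := isFiniteMeasure_restrict hΩ
    have i2 : IntegrableOn (fun x => inner ℝ (pFlux p (z.grad t x)) (gradVec fun j => pd φ' j x)) Ω :=
      integrable_pFlux hp1 H.memLp_grad (MemLp.gradVec fun j => hΩ.memLp_continuous
        (continuous_pd (hφ.1.of_le (by simp) : ContDiff ℝ 1 φ') j) _)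
    rw [integral_add i1 i2] at h1
    have e1 : ∀ v x, fderiv ℝ φ' x v = inner ℝ v (gradVec fun j => pd φ' j x) := fun v x => by
      rw [inner_gradVec]
      conv_lhs => rw [← (EuclideanSpace.basisFun (Fin n) ℝ).sum_repr v]
      simp [unitVec, pd]
    simp only [e1]
    have e2 : ∫ x in Ω, φ' x * damageSource C h f u z ξ φ t x
        = ∫ x in Ω, damageSource C h f u z ξ φ t x * φ' x :=
      integral_congr_ae (.of_forall fun x => mul_comm _ _)
    rw [e2]
    linarith
  refine ⟨⟨_, hdiv, .of_forall fun x => by simp only [damageSource]; ring⟩, ?_⟩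
  obtain ⟨μ, hμ, -⟩ := exists_boundaryMeasure hΩ
  have hμfin := hμ.finite
  choose w hwc hw' hgw using fun j => (H.dx j).exists_continuous_trace hΩ hp1 hp
  refine ⟨w, hgw, hμ.ae_surf ?_⟩
  have hc : ContinuousOn (fun x => pFlux p (gradVec fun j => w j x)) (closure Ω) :=
    (continuous_pFlux hp1).comp_continuousOn (continuousOn_gradVec hwc)
  have hV : ∀ᵐ x ∂(volume.restrict Ω), pFlux p (z.grad t x) = pFlux p (gradVec fun j => w j x) := by
    filter_upwards [ae_all_iff.2 hw'] with x hx
    simp only [DamageVar.grad, hx]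
  have hfr := hμ.ae_mem_frontier
  have hint : Integrable (fun x => inner ℝ (outerNormal Ω x) (pFlux p (gradVec fun j => w j x))) μ := by
    obtain ⟨R, hR⟩ := hΩ.isCompact_closure.exists_bound_of_continuousOn hc
    have hm : AEStronglyMeasurable (fun x => pFlux p (gradVec fun j => w j x)) μ := by
      have := (hc.mono frontier_subset_closure).aestronglyMeasurable (μ := μ)
        isClosed_frontier.measurableSet
      rwa [Measure.restrict_eq_self_of_ae_mem hfr] at this
    refine Integrable.of_bound (hμ.measurable.inner hm) R (hfr.mono fun x hx => ?_)
    refine (norm_inner_le_norm _ _).trans ?_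
    have h1 := norm_outerNormal_le (Ω := Ω) x
    have h2 := hR x (frontier_subset_closure hx)
    calc _ ≤ 1 * R := mul_le_mul h1 h2 (norm_nonneg _) zero_le_one
      _ = R := one_mul R
  have hzero := ae_eq_zero_of_integral_contDiff_smul_eq_zero hint.locallyIntegrable fun s hs _ => by
    have h1 := hμ.integral_flux hΩ hdiv H.source hV hc (hs.of_le (by simp) : ContDiff ℝ 1 s)
    simp only [smul_eq_mul]
    rw [← h1, ← hw s hs]
    exact integral_congr_ae (.of_forall fun x => add_comm _ _)
  filter_upwards [hzero, hμ.normal] with x h1 h2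
  refine ⟨_, h2, ?_⟩
  rw [real_inner_comm, inner_pFlux, real_inner_comm, inner_gradVec] at h1
  have e : ∑ j, w j x * outerNormal Ω x j = ∑ j, outerNormal Ω x j * w j x :=
    Finset.sum_congr rfl fun j _ => mul_comm _ _
  rw [e]
  -- If the scalar factor of the flux vanishes, the gradient itself does, since powers of positive
  -- numbers are positive.
  rcases mul_eq_zero.1 h1 with h3 | h3
  · have h4 : (gradVec fun j => w j x) = 0 := by
      by_contra hne
      exact (Real.rpow_pos_of_pos (norm_pos_iff.2 hne) _).ne' h3
    refine Finset.sum_eq_zero fun j _ => ?_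
    have : w j x = 0 := congrArg (fun v : E n => v j) h4
    rw [this, mul_zero]
  · exact h3

end DamageSlice

/-! ### Signs and complementarity from the variational inequalities. -/

section Inclusions

variable {Ω : Set (E n)} {T p : ℝ} {ξ φ : ℝ → E n → ℝ} {z : DamageVar Ω T p}

theorem ae_cyl_eq_of_ae_ae_swap {v w : ℝ → E n → ℝ}
    (hv : AEStronglyMeasurable (fun y : ℝ × E n => v y.1 y.2) (cyl Ω T))
    (hw : AEStronglyMeasurable (fun y : ℝ × E n => w y.1 y.2) (cyl Ω T))
    (h : ∀ᵐ x ∂(volume.restrict Ω), ∀ᵐ t ∂(volume.restrict (Ioo 0 T)), v t x = w t x) :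
    ∀ᵐ y ∂(cyl Ω T), v y.1 y.2 = w y.1 y.2 := by
  have h1 := ae_prod_eq_of_ae_ae (f := fun x t => v t x) (g := fun x t => w t x)
    (AEStronglyMeasurable.prod_swap hv) (AEStronglyMeasurable.prod_swap hw) h
  have h2 := Measure.measurePreserving_swap.quasiMeasurePreserving.ae
    (μa := (volume.restrict (Ioo 0 T)).prod (volume.restrict Ω)) h1
  exact h2

/-- A nonnegative function has vanishing time derivative almost everywhere on its zero set. -/
theorem DamageVar.mul_dt_eq_zero (hΩ : IsLipschitzDomain Ω) (hT : 0 < T) (hp1 : 1 < p)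
    (hz : ∀ᵐ y ∂(cyl Ω T), 0 ≤ z.val y.1 y.2) (hξ : MemLpT Ω T 2 ξ)
    (hξz : ∀ᵐ y ∂(cyl Ω T), ξ y.1 y.2 * z.val y.1 y.2 = 0) :
    ∀ᵐ y ∂(cyl Ω T), ξ y.1 y.2 * z.dt y.1 y.2 = 0 := by
  have hq := one_le_ofReal hp1
  have hprim := (z.primitive_val hΩ hT hq).ae_eq z.memLp_val.1
    (z.sobolev_val 0 ⟨le_rfl, hT.le⟩).1.1 z.memLp_dt.1
  refine ae_cyl_eq_of_ae_ae_swap (v := fun t x => ξ t x * z.dt t x) (w := fun _ _ => 0)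
    (hξ.1.mul z.memLp_dt.1) aestronglyMeasurable_const ?_
  have a1 : ∀ᵐ x ∂(volume.restrict Ω), ∀ᵐ t ∂(volume.restrict (Ioo 0 T)),
      z.val t x = z.val 0 x + ∫ s in (0 : ℝ)..t, z.dt s x := ae_ae_swap_of_ae_prod hprim
  have a2 : ∀ᵐ x ∂(volume.restrict Ω), ∀ᵐ t ∂(volume.restrict (Ioo 0 T)), 0 ≤ z.val t x :=
    ae_ae_swap_of_ae_prod hz
  have a3 : ∀ᵐ x ∂(volume.restrict Ω), ∀ᵐ t ∂(volume.restrict (Ioo 0 T)),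
      ξ t x * z.val t x = 0 := ae_ae_swap_of_ae_prod hξz
  filter_upwards [a1, a2, a3, ae_integrableOn_section (z.memLp_dt.integrable hΩ hq)] with x h1 h2 h3 h4
  have hc : ContinuousOn (fun t => z.val 0 x + ∫ s in (0 : ℝ)..t, z.dt s x) (Icc 0 T) :=
    continuousOn_const.add (continuousOn_primitive_Icc h4)
  -- Nonnegativity at almost every time extends to all times by continuity of the primitive: a
  -- negative value would persist on a nonempty open set, which is not null.
  have hpos : ∀ t ∈ Ioo 0 T, 0 ≤ z.val 0 x + ∫ s in (0 : ℝ)..t, z.dt s x := by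
    have hae : ∀ᵐ t ∂(volume.restrict (Ioo 0 T)), 0 ≤ z.val 0 x + ∫ s in (0 : ℝ)..t, z.dt s x := by
      filter_upwards [h1, h2] with t e1 e2
      rwa [← e1]
    intro t ht
    by_contra hneg
    have hct := (hc.mono Ioo_subset_Icc_self).continuousAt (isOpen_Ioo.mem_nhds ht)
    have hev : ∀ᶠ r in 𝓝 t, r ∈ Ioo 0 T ∧ z.val 0 x + ∫ s in (0 : ℝ)..r, z.dt s x < 0 :=
      (isOpen_Ioo.eventually_mem ht).and (hct.eventually_lt continuousAt_const (not_le.1 hneg))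
    obtain ⟨V, hVs, hVo, htV⟩ := eventually_nhds_iff.1 hev
    have hnull : volume V = 0 := by
      rw [ae_restrict_iff' measurableSet_Ioo] at hae
      refine measure_mono_null (fun r hr => ?_) (mem_ae_iff.1 hae)
      exact fun hh => not_le.2 (hVs r hr).2 (hh (hVs r hr).1)
    exact (hVo.measure_pos volume ⟨t, htV⟩).ne' hnull
  filter_upwards [h1, h3, ae_eq_zero_of_nonneg_primitive h4 hpos] with t e1 e2 e3
  rcases mul_eq_zero.1 e2 with h5 | h5
  · simp [h5]
  · rw [e3 (e1 ▸ h5), mul_zero]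

theorem memLp_two_of_isSobolev (hΩ : IsLipschitzDomain Ω) (hp1 : 1 < p) (hp : (n : ℝ) < p)
    {w : E n → ℝ} (h : MemW1 Ω (ENNReal.ofReal p) w) : MemLp w 2 (volume.restrict Ω) := by
  have hfin := isFiniteMeasure_restrict hΩ
  obtain ⟨D, hD⟩ := h
  obtain ⟨M, hM⟩ := hD.exists_bound hΩ hp1 hp
  exact MemLp.of_bound hD.1.1 M (hM.mono fun x hx => hx)

/-- Null sets of times can be chosen independently of the test function in a variational
inequality. -/
theorem ae_forall_integral_mul_le (hΩ : IsLipschitzDomain Ω) (hp1 : 1 < p) (hp : (n : ℝ) < p)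
    {a : ℝ → E n → ℝ} (ha : MemLpT Ω T 2 a) {c : ℝ → ℝ} {P : (E n → ℝ) → Prop}
    (h : ∀ ζ, MemW1 Ω (ENNReal.ofReal p) ζ → P ζ →
      ∀ᵐ t ∂(volume.restrict (Ioo 0 T)), ∫ x in Ω, a t x * ζ x ≤ c t) :
    ∀ᵐ t ∂(volume.restrict (Ioo 0 T)), ∀ ζ, MemW1 Ω (ENNReal.ofReal p) ζ → P ζ →
      ∫ x in Ω, a t x * ζ x ≤ c t := by
  have e : ∀ x y : ℝ, inner ℝ x y = x * y := fun x y => by simp [mul_comm]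
  have h1 := ae_forall_integral_inner_le (S := {ζ | MemW1 Ω (ENNReal.ofReal p) ζ ∧ P ζ}) (c := c)
    (μ := volume.restrict Ω) ha (fun ζ hζ => memLp_two_of_isSobolev hΩ hp1 hp hζ.1)
    (fun ζ hζ => by simpa only [e] using h ζ hζ.1 hζ.2)
  filter_upwards [h1] with t ht ζ h2 h3
  simpa only [e] using ht ζ ⟨h2, h3⟩

theorem ae_nonneg_of_setIntegral_mul_nonneg (hΩ : IsLipschitzDomain Ω) {a : E n → ℝ}
    (ha : IntegrableOn a Ω) (h : ∀ χ : E n → ℝ, ContDiff ℝ ∞ χ → (∀ x, 0 ≤ χ x) →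
      0 ≤ ∫ x in Ω, a x * χ x) : ∀ᵐ x ∂(volume.restrict Ω), 0 ≤ a x := by
  have hm := hΩ.isOpen.measurableSet
  have h1 := ae_nonneg_of_integral_mul_nonneg (ha.integrable_indicator hm) fun χ hχ _ h0 => by
    have e : ∀ x, χ x * Ω.indicator a x = Ω.indicator (fun x => a x * χ x) x := fun x => by
      by_cases hx : x ∈ Ω <;> simp [hx, mul_comm]
    simp only [e, integral_indicator hm]
    exact h χ hχ h0
  filter_upwards [ae_restrict_of_ae h1, ae_restrict_mem hm] with x hx hxm
  rwa [indicator_of_mem hxm] at hx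

/-- The inequality is tested with `-χ` for smooth `χ ≥ 0`, at times that do not depend on `χ`. -/
theorem ae_cyl_phi_nonneg (hΩ : IsLipschitzDomain Ω) (hp1 : 1 < p) (hp : (n : ℝ) < p)
    (hφ : MemLpT Ω T 2 φ)
    (h : ∀ ζ : E n → ℝ, MemW1 Ω (ENNReal.ofReal p) ζ → (∀ᵐ x ∂(volume.restrict Ω), ζ x ≤ 0) →
      ∀ᵐ t ∂(volume.restrict (Ioo 0 T)), ∫ x in Ω, φ t x * ζ x ≤ 0) :
    ∀ᵐ y ∂(cyl Ω T), 0 ≤ φ y.1 y.2 := by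
  refine ae_prod_le_of_ae_ae (f := fun _ _ => 0) (g := φ) aestronglyMeasurable_const hφ.1 ?_
  filter_upwards [ae_forall_integral_mul_le hΩ hp1 hp hφ h, (hφ.integrable hΩ
    (by norm_num)).prod_right_ae] with t h1 h2
  refine ae_nonneg_of_setIntegral_mul_nonneg hΩ h2 fun χ hχ h0 => ?_
  have h3 := h1 (fun x => -χ x) (memW1_of_contDiff hΩ (hχ.neg.of_le (by simp)))
    (.of_forall fun x => neg_nonpos.2 (h0 x))
  simp only [mul_neg, integral_neg] at h3
  linarith

/-- The test functions `z + χ` with `χ ≥ 0` give `ξ ≤ 0`. The test function zero gives `0 ≤ ∫ ξ z`,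
and as `ξ z ≤ 0` pointwise, this product vanishes. -/
theorem ae_cyl_xi_nonpos (hΩ : IsLipschitzDomain Ω) (hp1 : 1 < p) (hp : (n : ℝ) < p)
    (hξ : MemLpT Ω T 2 ξ) (hz : ∀ᵐ y ∂(cyl Ω T), 0 ≤ z.val y.1 y.2)
    (h : ∀ ζ : E n → ℝ, MemW1 Ω (ENNReal.ofReal p) ζ → (∀ᵐ x ∂(volume.restrict Ω), 0 ≤ ζ x) →
      ∀ᵐ t ∂(volume.restrict (Ioo 0 T)), ∫ x in Ω, ξ t x * (ζ x - z.val t x) ≤ 0) :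
    (∀ᵐ y ∂(cyl Ω T), ξ y.1 y.2 ≤ 0) ∧ ∀ᵐ y ∂(cyl Ω T), ξ y.1 y.2 * z.val y.1 y.2 = 0 := by
  have hzW : ∀ t ∈ Ioo 0 T, MemW1 Ω (ENNReal.ofReal p) (z.val t) := fun t ht =>
    ⟨_, z.sobolev_val t (Ioo_subset_Icc_self ht)⟩
  -- With the term in `z` moved to the right, the inequality is linear in `ζ` with a bound depending
  -- on time. The times become independent of `ζ`, so that `ζ = z(t) + χ` is allowed.
  have hall : ∀ᵐ t ∂(volume.restrict (Ioo 0 T)), ∀ ζ, MemW1 Ω (ENNReal.ofReal p) ζ →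
      (∀ᵐ x ∂(volume.restrict Ω), 0 ≤ ζ x) →
      ∫ x in Ω, ξ t x * ζ x ≤ ∫ x in Ω, ξ t x * z.val t x := by
    refine ae_forall_integral_mul_le hΩ hp1 hp hξ fun ζ hζ h0 => ?_
    filter_upwards [h ζ hζ h0, hξ.ae_memLp_two, ae_restrict_mem measurableSet_Ioo] with t h1 h2 ht
    have i1 := h2.integrable_mul (memLp_two_of_isSobolev hΩ hp1 hp hζ)
    have i2 := h2.integrable_mul (memLp_two_of_isSobolev hΩ hp1 hp (hzW t ht))
    simp only [mul_sub] at h1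
    have h3 := (integral_sub i1 i2).symm.trans_le h1
    exact sub_nonpos.1 h3
  have hslice : ∀ᵐ t ∂(volume.restrict (Ioo 0 T)),
      (∀ᵐ x ∂(volume.restrict Ω), ξ t x ≤ 0) ∧
      ∀ᵐ x ∂(volume.restrict Ω), ξ t x * z.val t x = 0 := by
    filter_upwards [hall, hξ.ae_memLp_two, ae_restrict_mem measurableSet_Ioo,
      Measure.ae_ae_of_ae_prod hz, (hξ.integrable hΩ (by norm_num)).prod_right_ae]
      with t h1 h2 ht h3 h4
    have hz2 := memLp_two_of_isSobolev hΩ hp1 hp (hzW t ht)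
    have i2 := h2.integrable_mul hz2
    have hneg : ∀ᵐ x ∂(volume.restrict Ω), ξ t x ≤ 0 := by
      have h5 := ae_nonneg_of_setIntegral_mul_nonneg hΩ h4.neg fun χ hχ h0 => by
        have hχW : MemW1 Ω (ENNReal.ofReal p) χ := memW1_of_contDiff hΩ (hχ.of_le (by simp))
        have h6 := h1 _ ((hzW t ht).add hχW) (h3.mono fun x hx => add_nonneg hx (h0 x))
        have i1 := h2.integrable_mul (memLp_two_of_isSobolev hΩ hp1 hp hχW)
        simp only [mul_add] at h6
        have h7 := (integral_add i2 i1).symm.trans_le h6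
        simp only [Pi.neg_apply, neg_mul, integral_neg]
        simp only [Pi.mul_apply] at h7
        linarith
      exact h5.mono fun x hx => neg_nonneg.1 hx
    refine ⟨hneg, ?_⟩
    have e1 := h1 (fun _ => 0) (memW1_of_contDiff hΩ contDiff_const) (.of_forall fun x => le_rfl)
    simp only [mul_zero, integral_zero] at e1
    have hle : ∀ᵐ x ∂(volume.restrict Ω), 0 ≤ -(ξ t x * z.val t x) := by
      filter_upwards [hneg, h3] with x h5 h6
      exact neg_nonneg.2 (mul_nonpos_of_nonpos_of_nonneg h5 h6)
    have e2 : ∫ x in Ω, -(ξ t x * z.val t x) = 0 := by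
      refine le_antisymm ?_ (integral_nonneg_of_ae hle)
      rw [integral_neg]
      linarith
    have h5 := (integral_eq_zero_iff_of_nonneg_ae hle i2.neg).1 e2
    exact h5.mono fun x hx => neg_eq_zero.1 hx
  exact ⟨ae_prod_le_of_ae_ae (f := ξ) (g := fun _ _ => 0) hξ.1 aestronglyMeasurable_const
      (hslice.mono fun t ht => ht.1),
    ae_prod_eq_of_ae_ae (f := fun t x => ξ t x * z.val t x) (g := fun _ _ => (0 : ℝ))
      (hξ.1.mul z.memLp_val.1) aestronglyMeasurable_const (hslice.mono fun t ht => ht.2)⟩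

end Inclusions

/-! ### Energy balance and complementarity of `φ`. -/

section EnergyBalance

variable {Ω : Set (E n)} {T p : ℝ} {C : Tensor4 n} {h f : ℝ → ℝ} {ξ φ : ℝ → E n → ℝ}
  {ℓ : ℝ → E n → E n} {b : DirichletDatum Ω T} {u : Displacement Ω T} {z : DamageVar Ω T p}

/-- Without the power of `φ` the rate in the relation is the dissipation rate. Its integrability in
time, contained in `hr`, gives the finiteness of the dissipation by Tonelli. -/
theorem balance_of_relation (hφz : ∀ᵐ y ∂(cyl Ω T), φ y.1 y.2 * z.dt y.1 y.2 = 0)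
    (hsec : ∀ᵐ t ∂(volume.restrict (Ioo 0 T)), IntegrableOn (fun x => |z.dt t x| ^ 2) Ω ∧
      IntegrableOn (fun x => φ t x * z.dt t x) Ω)
    (hr : IntegrableOn (fun t => ∫ x in Ω, (|z.dt t x| ^ 2 + φ t x * z.dt t x)) (Ioo 0 T))
    (hrel : ∀ t ∈ Ico 0 T, freeEnergy C h f u z t + kineticEnergy u t
        + (∫ s in (0 : ℝ)..t, ∫ x in Ω, (|z.dt s x| ^ 2 + φ s x * z.dt s x))
      = freeEnergy C h f u z 0 + kineticEnergy u 0 + externalWork C h ℓ b u z t) :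
    ∀ t ∈ Ioo 0 T, Integrable (fun y : ℝ × E n => |z.dt y.1 y.2| ^ 2) (cyl Ω t) ∧
      freeEnergy C h f u z t + kineticEnergy u t + dissipated z t
        = freeEnergy C h f u z 0 + kineticEnergy u 0 + externalWork C h ℓ b u z t := by
  have hrate : ∀ᵐ t ∂(volume.restrict (Ioo 0 T)),
      ∫ x in Ω, (|z.dt t x| ^ 2 + φ t x * z.dt t x) = ∫ x in Ω, |z.dt t x| ^ 2 := by
    filter_upwards [Measure.ae_ae_of_ae_prod hφz] with t ht
    refine integral_congr_ae (ht.mono fun x hx => ?_)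
    have hx' : φ t x * z.dt t x = 0 := hx
    simp only [hx', add_zero]
  have hm : AEStronglyMeasurable (fun y : ℝ × E n => |z.dt y.1 y.2| ^ 2) (cyl Ω T) :=
    z.memLp_dt.1.norm.pow 2
  have hint : Integrable (fun y : ℝ × E n => |z.dt y.1 y.2| ^ 2) (cyl Ω T) := by
    refine (integrable_prod_iff hm).2 ⟨hsec.mono fun t ht => ht.1, ?_⟩
    refine hr.congr (hrate.mono fun t ht => ht.trans ?_)
    exact integral_congr_ae (.of_forall fun x => by simp)
  intro t ht
  refine ⟨hint.mono_measure (restrict_Ioo_prod_le ht.2.le), ?_⟩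
  rw [← hrel t (Ioo_subset_Ico_self ht), dissipated]
  congr 1
  rw [integral_zero_eq_setIntegral_Ioo ht.1.le, integral_zero_eq_setIntegral_Ioo ht.1.le]
  exact (integral_congr_ae (ae_mono (Measure.restrict_mono
    (Ioo_subset_Ioo_right ht.2.le) le_rfl) hrate)).symm

/-- Exhaustion of `(0, T)` by intervals that end at times where `P` holds. The balance is available
at almost every time, not at `T`. -/
theorem ae_restrict_Ioo_of_forall (hT : 0 < T) {P Q : ℝ → Prop}
    (hP : ∀ᵐ t ∂(volume.restrict (Ioo 0 T)), P t)
    (h : ∀ t ∈ Ioo 0 T, P t → ∀ᵐ s ∂(volume.restrict (Ioo 0 t)), Q s) :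
    ∀ᵐ s ∂(volume.restrict (Ioo 0 T)), Q s := by
  have hex : ∀ a ∈ Ico 0 T, ∃ t ∈ Ioo a T, P t := by
    intro a ha
    have h1 : ∀ᵐ s ∂(volume.restrict (Ioo a T)), P s :=
      ae_mono (Measure.restrict_mono (Ioo_subset_Ioo_left ha.1) le_rfl) hP
    have : (ae (volume.restrict (Ioo a T))).NeBot := by
      rw [ae_neBot, Ne, Measure.restrict_eq_zero, Real.volume_Ioo]; simpa using ha.2
    obtain ⟨s, h2, h3⟩ := (h1.and (ae_restrict_mem measurableSet_Ioo)).exists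
    exact ⟨s, h3, h2⟩
  obtain ⟨a, -, haT, halim⟩ := exists_seq_strictMono_tendsto' hT
  choose t ht htP using fun k => hex (a k) (Ioo_subset_Ico_self (haT k))
  have h1 : ∀ᵐ s ∂(volume.restrict (⋃ k, Ioo 0 (t k))), Q s :=
    (ae_restrict_iUnion_iff _ _).2 fun k =>
      h (t k) ⟨(haT k).1.trans (ht k).1, (ht k).2⟩ (htP k)
  refine ae_mono (Measure.restrict_mono (fun s hs => ?_) le_rfl) h1
  obtain ⟨k, hk⟩ := (halim.eventually (lt_mem_nhds hs.2)).exists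
  exact mem_iUnion.2 ⟨k, hs.1, hk.trans (ht k).1⟩

/-- Subtracting the balance from the relation leaves the time integral of `∫ φ ∂_t z`, which is zero
up to almost every time. By the signs of `φ` and `∂_t z` the integrand is nonpositive, so it
vanishes almost everywhere. -/
theorem mul_dt_eq_zero_of_balance (hT : 0 < T) (hφ : MemLpT Ω T 2 φ)
    (hφ0 : ∀ᵐ y ∂(cyl Ω T), 0 ≤ φ y.1 y.2) (hzt : ∀ᵐ y ∂(cyl Ω T), z.dt y.1 y.2 ≤ 0)
    (hsec : ∀ᵐ t ∂(volume.restrict (Ioo 0 T)), IntegrableOn (fun x => |z.dt t x| ^ 2) Ω ∧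
      IntegrableOn (fun x => φ t x * z.dt t x) Ω)
    (hr : IntegrableOn (fun t => ∫ x in Ω, (|z.dt t x| ^ 2 + φ t x * z.dt t x)) (Ioo 0 T))
    (hrel : ∀ t ∈ Ico 0 T, freeEnergy C h f u z t + kineticEnergy u t
        + (∫ s in (0 : ℝ)..t, ∫ x in Ω, (|z.dt s x| ^ 2 + φ s x * z.dt s x))
      = freeEnergy C h f u z 0 + kineticEnergy u 0 + externalWork C h ℓ b u z t)
    (hbal : ∀ᵐ t ∂(volume.restrict (Ioo 0 T)),
      Integrable (fun y : ℝ × E n => |z.dt y.1 y.2| ^ 2) (cyl Ω t) ∧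
      freeEnergy C h f u z t + kineticEnergy u t + dissipated z t
        = freeEnergy C h f u z 0 + kineticEnergy u 0 + externalWork C h ℓ b u z t) :
    ∀ᵐ y ∂(cyl Ω T), φ y.1 y.2 * z.dt y.1 y.2 = 0 := by
  have hnonpos : ∀ᵐ s ∂(volume.restrict (Ioo 0 T)), ∀ᵐ x ∂(volume.restrict Ω),
      0 ≤ -(φ s x * z.dt s x) := by
    filter_upwards [Measure.ae_ae_of_ae_prod hφ0, Measure.ae_ae_of_ae_prod hzt] with s h1 h2
    filter_upwards [h1, h2] with x h3 h4
    exact neg_nonneg.2 (mul_nonpos_of_nonneg_of_nonpos h3 h4)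
  have hpow : ∀ᵐ s ∂(volume.restrict (Ioo 0 T)), ∫ x in Ω, -(φ s x * z.dt s x) = 0 := by
    refine ae_restrict_Ioo_of_forall hT hbal fun t ht hb => ?_
    have hsub : Ioo 0 t ⊆ Ioo 0 T := Ioo_subset_Ioo_right ht.2.le
    have hle := Measure.restrict_mono (μ := (volume : Measure ℝ)) hsub le_rfl
    have hd : IntegrableOn (fun s => ∫ x in Ω, |z.dt s x| ^ 2) (Ioo 0 t) := hb.1.integral_prod_left
    have hsplit : ∀ᵐ s ∂(volume.restrict (Ioo 0 t)),
        (∫ x in Ω, |z.dt s x| ^ 2) - (∫ x in Ω, (|z.dt s x| ^ 2 + φ s x * z.dt s x))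
          = ∫ x in Ω, -(φ s x * z.dt s x) := by
      filter_upwards [ae_mono hle hsec] with s hs
      rw [integral_add hs.1 hs.2, integral_neg]
      ring
    have hm := (hd.sub (hr.mono_set hsub)).congr hsplit
    have h0 : ∫ s in Ioo 0 t, ∫ x in Ω, -(φ s x * z.dt s x) = 0 := by
      rw [← integral_congr_ae hsplit, integral_sub hd (hr.mono_set hsub),
        ← integral_zero_eq_setIntegral_Ioo ht.1.le, ← integral_zero_eq_setIntegral_Ioo ht.1.le]
      have e1 := hrel t (Ioo_subset_Ico_self ht)
      have e2 := hb.2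
      rw [dissipated] at e2
      linarith
    have hnn : ∀ᵐ s ∂(volume.restrict (Ioo 0 t)), 0 ≤ ∫ x in Ω, -(φ s x * z.dt s x) :=
      by filter_upwards [ae_mono hle hnonpos] with s hs using integral_nonneg_of_ae hs
    exact (integral_eq_zero_iff_of_nonneg_ae hnn hm).1 h0
  refine ae_prod_eq_of_ae_ae (f := fun t x => φ t x * z.dt t x) (g := fun _ _ => (0 : ℝ))
    (hφ.1.mul z.memLp_dt.1) aestronglyMeasurable_const ?_
  filter_upwards [hpow, hnonpos, hsec] with s h1 h2 h3
  have h4 := (integral_eq_zero_iff_of_nonneg_ae h2 h3.2.neg).1 h1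
  exact h4.mono fun x hx => neg_eq_zero.1 hx

end EnergyBalance

/-! ### The two implications. -/

section Equivalence

variable {Ω ΓD ΓN : Set (E n)} {T p : ℝ} {C : Tensor4 n} {h f : ℝ → ℝ} {ξ φ : ℝ → E n → ℝ}
  {u0 v0 : E n → E n} {z0 : E n → ℝ}
  {ℓ : ℝ → E n → E n} {b : DirichletDatum Ω T} {u : Displacement Ω T} {z : DamageVar Ω T p}

/-- The inclusions are unpacked into signs and complementarity. These give the inequalities
pointwise, and since `φ ∂_t z = 0`, the energy relation is the energy balance. -/
theorem IsStrongSolution.isWeakSolution (hp1 : 1 < p) (hp : (n : ℝ) < p) (hT : 0 < T)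
    (hΩ : IsLipschitzDomain Ω) (hΓ : IsBoundarySplit Ω ΓD ΓN) (hC : IsStiffness C)
    (hf : ContDiffOn ℝ 1 f (Icc 0 1)) (hh : ContDiffOn ℝ 1 h (Icc 0 1))
    (hz01 : ∀ᵐ x ∂(volume.restrict Ω), 0 ≤ z0 x ∧ z0 x ≤ 1) (hℓ : MemLpT Ω T 2 ℓ)
    (hξ : MemLpT Ω T 2 ξ) (hφ : MemLpT Ω T 2 φ)
    (S : IsStrongSolution ΓD ΓN C h f u0 v0 z0 ℓ b u z ξ φ) :
    IsWeakSolution ΓD C h f u0 v0 z0 ℓ b u z ξ φ := by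
  have hzt : ∀ᵐ y ∂(cyl Ω T), z.dt y.1 y.2 ≤ 0 := S.incl_φ.mono fun y hy =>
    hy.elim (fun h => h.1.le) fun h => h.1.le
  have hφ0 : ∀ᵐ y ∂(cyl Ω T), 0 ≤ φ y.1 y.2 := S.incl_φ.mono fun y hy =>
    hy.elim (fun h => h.2.ge) fun h => h.2
  have hφz : ∀ᵐ y ∂(cyl Ω T), φ y.1 y.2 * z.dt y.1 y.2 = 0 := S.incl_φ.mono fun y hy =>
    hy.elim (fun h => by rw [h.2, zero_mul]) fun h => by rw [h.1, mul_zero]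
  have hz0 : ∀ᵐ y ∂(cyl Ω T), 0 ≤ z.val y.1 y.2 := S.incl_ξ.mono fun y hy =>
    hy.elim (fun h => h.1.le) fun h => h.1.ge
  have hξ0 : ∀ᵐ y ∂(cyl Ω T), ξ y.1 y.2 ≤ 0 := S.incl_ξ.mono fun y hy =>
    hy.elim (fun h => h.2.le) fun h => h.2
  have hξz : ∀ᵐ y ∂(cyl Ω T), ξ y.1 y.2 * z.val y.1 y.2 = 0 := S.incl_ξ.mono fun y hy =>
    hy.elim (fun h => by rw [h.2, zero_mul]) fun h => by rw [h.1, mul_zero]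
  have hz : ∀ t ∈ Ico 0 T, ∀ᵐ x ∂(volume.restrict Ω), z.val t x ∈ Icc (0 : ℝ) 1 := by
    refine DamageVar.ae_mem_Icc hΩ hT hp1 ?_ hz0 hzt
    filter_upwards [S.init_dirichlet.init_z, hz01] with x h1 h2
    rw [h1]
    exact h2.2
  have hreg := ae_damageRegularAt (C := C) hΩ hp1 hh hf u hz hξ hφ
  have hF : ∀ᵐ t ∂(volume.restrict (Ioo 0 T)), ∀ (ζ : E n → E n) (Dζ : Fin n → E n → E n),
      IsSobolev Ω 2 ζ Dζ → VanishesOn Ω ΓD ζ →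
        (∫ x in Ω, inner ℝ (u.dtt t x) (ζ x))
          + (∫ x in Ω, ddot (stress C h u z t x) (strain fun j => Dζ j x))
          = ∫ x in Ω, inner ℝ (ℓ t x) (ζ x) := by
    filter_upwards [S.force, S.neumann_u, hℓ.ae_memLp_two] with t ⟨d, hd, heq⟩ ⟨g, hg, hN⟩ h1 ζ Dζ h2 h3
    exact momentum_weak_of_strong hΩ hΓ (stress_symm hC u z t) hd heq h1 hg hN h2 h3
  have hdam : ∀ᵐ t ∂(volume.restrict (Ioo 0 T)), ∀ (ζ : E n → ℝ) (Dζ : Fin n → E n → ℝ),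
      IsSobolev Ω (ENNReal.ofReal p) ζ Dζ →
        ∫ x in Ω, (damageSource C h f u z ξ φ t x * ζ x
          + inner ℝ (pFlux p (z.grad t x)) (gradVec fun j => Dζ j x)) = 0 := by
    filter_upwards [S.damage, S.neumann_z, hreg] with t ⟨d, hd, heq⟩ ⟨g, hg, hN⟩ H ζ Dζ h1
    exact H.weak_of_strong hΩ hp1 hp hd heq hg hN h1
  obtain ⟨hsec, hr, hrel⟩ := energy_relation hΩ hT hp1 hp hC hh hf hℓ u b hz hreg
    S.init_dirichlet.dirichlet hF hdam (DamageVar.mul_dt_eq_zero hΩ hT hp1 hz0 hξ hξz)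
  refine
    { init_dirichlet := S.init_dirichlet
      force := fun ζ Dζ h1 h2 => hF.mono fun t ht => ht ζ Dζ h1 h2
      damage := fun ζ Dζ h1 => ?_
      ineq_φ := fun ζ _ h1 => ?_
      dt_nonpos := hzt
      ineq_ξ := fun ζ _ h1 => ?_
      nonneg := hz0
      balance := ?_ }
  · filter_upwards [hdam, hreg] with t h2 H
    rw [H.pairing_eq hΩ hp1 hp h1, h2 ζ Dζ h1]
  · filter_upwards [Measure.ae_ae_of_ae_prod hφ0] with t h2
    refine integral_nonpos_of_ae ?_
    filter_upwards [h1, h2] with x h3 h4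
    exact mul_nonpos_of_nonneg_of_nonpos h4 h3
  · filter_upwards [Measure.ae_ae_of_ae_prod hξ0, Measure.ae_ae_of_ae_prod hξz] with t h2 h3
    refine integral_nonpos_of_ae ?_
    filter_upwards [h1, h2, h3] with x h4 h5 h6
    have h6' : ξ t x * z.val t x = 0 := h6
    rw [mul_sub, h6', sub_zero]
    exact mul_nonpos_of_nonpos_of_nonneg h5 h4
  · filter_upwards [ae_restrict_mem measurableSet_Ioo] with t ht
    exact balance_of_relation hφz hsec hr hrel t ht

/-- Common null sets of times come first, so that the weak equations can be localized at one time
and tested with the rates. Complementarity for `ξ` is variational and makes the energy relation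
available; comparison with the assumed balance yields complementarity for `φ`. -/
theorem IsWeakSolution.isStrongSolution (hp1 : 1 < p) (hp : (n : ℝ) < p) (hT : 0 < T)
    (hΩ : IsLipschitzDomain Ω) (hΓ : IsBoundarySplit Ω ΓD ΓN) (hC : IsStiffness C)
    (hf : ContDiffOn ℝ 1 f (Icc 0 1)) (hh : ContDiffOn ℝ 1 h (Icc 0 1))
    (hz01 : ∀ᵐ x ∂(volume.restrict Ω), 0 ≤ z0 x ∧ z0 x ≤ 1) (hℓ : MemLpT Ω T 2 ℓ)
    (hξ : MemLpT Ω T 2 ξ) (hφ : MemLpT Ω T 2 φ)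
    (S : IsWeakSolution ΓD C h f u0 v0 z0 ℓ b u z ξ φ) :
    IsStrongSolution ΓD ΓN C h f u0 v0 z0 ℓ b u z ξ φ := by
  have hz : ∀ t ∈ Ico 0 T, ∀ᵐ x ∂(volume.restrict Ω), z.val t x ∈ Icc (0 : ℝ) 1 := by
    refine DamageVar.ae_mem_Icc hΩ hT hp1 ?_ S.nonneg S.dt_nonpos
    filter_upwards [S.init_dirichlet.init_z, hz01] with x h1 h2
    rw [h1]
    exact h2.2
  have hreg := ae_damageRegularAt (C := C) hΩ hp1 hh hf u hz hξ hφ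
  have hF := ae_forall_force hC hh hℓ u hz S.force
  have hdam := ae_forall_damage hΩ hp1 hp hreg S.damage
  obtain ⟨hξ0, hξz⟩ := ae_cyl_xi_nonpos hΩ hp1 hp hξ S.nonneg S.ineq_ξ
  have hφ0 := ae_cyl_phi_nonneg hΩ hp1 hp hφ S.ineq_φ
  have hdam' : ∀ᵐ t ∂(volume.restrict (Ioo 0 T)), ∀ (ζ : E n → ℝ) (Dζ : Fin n → E n → ℝ),
      IsSobolev Ω (ENNReal.ofReal p) ζ Dζ →
        ∫ x in Ω, (damageSource C h f u z ξ φ t x * ζ x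
          + inner ℝ (pFlux p (z.grad t x)) (gradVec fun j => Dζ j x)) = 0 := by
    filter_upwards [hdam, hreg] with t h1 H ζ Dζ h2
    obtain ⟨M, hM⟩ := H.exists_flux_bound hΩ hp1 hp
    exact integral_pairing_eq_zero hΩ hp1 hp H.source (H.aestronglyMeasurable_flux hp1) hM h1 h2
  obtain ⟨hsec, hr, hrel⟩ := energy_relation hΩ hT hp1 hp hC hh hf hℓ u b hz hreg
    S.init_dirichlet.dirichlet hF hdam' (DamageVar.mul_dt_eq_zero hΩ hT hp1 S.nonneg hξ hξz)
  have hφz := mul_dt_eq_zero_of_balance hT hφ hφ0 S.dt_nonpos hsec hr hrel S.balance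
  have hmom : ∀ᵐ t ∂(volume.restrict (Ioo 0 T)),
      (∃ d : E n → E n,
        (∀ i, IsWeakDiv Ω (fun x => gradVec (stress C h u z t x i)) (fun x => d x i)) ∧
        ∀ᵐ x ∂(volume.restrict Ω), u.dtt t x - d x = ℓ t x) ∧
      ∃ g : Fin n → Fin n → E n → ℝ,
        (∀ i j, HasTrace Ω 2 (fun x => stress C h u z t x i j) (g i j)) ∧
        ∀ᵐ x ∂(surf ΓN), ∃ ν, IsOuterNormal Ω x ν ∧ ∀ i, ∑ j, g i j x * ν j = 0 := by
    filter_upwards [hF, ae_memW1_stress (C := C) hΩ hp1 hp hh u hz, u.second_time.2.1.ae_memLp_two,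
      hℓ.ae_memLp_two] with t h1 h2 h3 h4
    exact momentum_strong_of_weak hΩ hΓ (stress_symm hC u z t) h2 h3 h4 h1
  have hdamS : ∀ᵐ t ∂(volume.restrict (Ioo 0 T)),
      (∃ d : E n → ℝ, IsWeakDiv Ω (fun x => pFlux p (z.grad t x)) d ∧
        ∀ᵐ x ∂(volume.restrict Ω), z.dt t x - d x
          + energyDensity_z C h (u.eps t x) (z.val t x)
          + derivWithin f (Icc 0 1) (z.val t x) + ξ t x + φ t x = 0) ∧
      ∃ g : Fin n → E n → ℝ, (∀ j, HasTrace Ω (ENNReal.ofReal p) (z.dx j t) (g j)) ∧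
        ∀ᵐ x ∂(surf (frontier Ω)), ∃ ν, IsOuterNormal Ω x ν ∧ ∑ j, g j x * ν j = 0 := by
    filter_upwards [hdam, hreg] with t h1 H
    exact H.strong_of_weak hΩ hp1 hp h1
  exact
    { init_dirichlet := S.init_dirichlet
      force := hmom.mono fun t ht => ht.1
      damage := hdamS.mono fun t ht => ht.1
      incl_ξ := by
        filter_upwards [S.nonneg, hξ0, hξz] with y h1 h2 h3
        rcases h1.lt_or_eq with h4 | h4
        · exact Or.inl ⟨h4, (mul_eq_zero.1 h3).resolve_right h4.ne'⟩
        · exact Or.inr ⟨h4.symm, h2⟩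
      incl_φ := by
        filter_upwards [S.dt_nonpos, hφ0, hφz] with y h1 h2 h3
        rcases h1.lt_or_eq with h4 | h4
        · exact Or.inl ⟨h4, (mul_eq_zero.1 h3).resolve_right h4.ne⟩
        · exact Or.inr ⟨h4, h2⟩
      neumann_u := hmom.mono fun t ht => ht.2
      neumann_z := hdamS.mono fun t ht => ht.2 }

end Equivalence

end Damage

end

theorem lemma3 {n : ℕ} (hn : 1 ≤ n) (hn3 : n ≤ 3) {p T η : ℝ} (hp : (n : ℝ) < p) (hT : 0 < T)
    {Ω ΓD ΓN : Set (Damage.E n)} (hΩ : Damage.IsLipschitzDomain Ω)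
    (hΓ : Damage.IsBoundarySplit Ω ΓD ΓN)
    (C : Damage.Tensor4 n) (hC : Damage.IsStiffness C)
    (f h : ℝ → ℝ) (hf : ContDiffOn ℝ 1 f (Set.Icc 0 1)) (hf0 : ∀ s ∈ Set.Icc (0 : ℝ) 1, 0 ≤ f s)
    (hh : ContDiffOn ℝ 1 h (Set.Icc 0 1)) (hη : 0 < η) (hhη : ∀ s ∈ Set.Icc (0 : ℝ) 1, η ≤ h s)
    (hh' : ∀ s ∈ Set.Icc (0 : ℝ) 1, 0 ≤ derivWithin h (Set.Icc 0 1) s)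
    (u0 v0 : Damage.E n → Damage.E n) (z0 : Damage.E n → ℝ)
    (hu0 : Damage.MemW1 Ω 2 u0)
    (hv0 : MeasureTheory.MemLp v0 2 (MeasureTheory.volume.restrict Ω))
    (hz0 : Damage.MemW1 Ω (ENNReal.ofReal p) z0)
    (hz01 : ∀ᵐ x ∂(MeasureTheory.volume.restrict Ω), 0 ≤ z0 x ∧ z0 x ≤ 1)
    (ℓ : ℝ → Damage.E n → Damage.E n) (hℓ : Damage.MemLpT Ω T 2 ℓ)
    (b : Damage.DirichletDatum Ω T) (u : Damage.Displacement Ω T) (z : Damage.DamageVar Ω T p)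
    (ξ φ : ℝ → Damage.E n → ℝ) (hξ : Damage.MemLpT Ω T 2 ξ) (hφ : Damage.MemLpT Ω T 2 φ) :
    Damage.IsStrongSolution ΓD ΓN C h f u0 v0 z0 ℓ b u z ξ φ ↔
      Damage.IsWeakSolution ΓD C h f u0 v0 z0 ℓ b u z ξ φ := by
  have hp1 : 1 < p := lt_of_le_of_lt (by exact_mod_cast hn) hp
  exact ⟨fun S => S.isWeakSolution hp1 hp hT hΩ hΓ hC hf hh hz01 hℓ hξ hφ,
    fun S => S.isStrongSolution hp1 hp hT hΩ hΓ hC hf hh hz01 hℓ hξ hφ⟩
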